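/- **Setting.** Let $(\mathcal M,g)$ be a smooth, time-oriented $n$-dimensional spacetime ($n\ge 2$, signature $(-,+,\dots,+)$, Hausdorff, second countable) satisfying the Einstein equations $\mathrm{Ric}-\tfrac12Rg+\Lambda g=8\pi G\,T$ ($G>0$, $\Lambda\in\mathbb R$). Let $\Delta\subset\mathcal M$ be a non-expanding horizon: the image of a smooth embedding of $B\times I$, where $B$ is a compact connected $(n-2)$-manifold and $I$ is an open interval; $\Delta$ is a null hypersurface whose null curves are the images of $\{x\}\times I$; and $q^{AB}\mathcal L_\ell q_{AB}=0$ for all null $\ell$ tangent to $\Delta$, where $q$ is the induced degenerate metric and $q_{AB}$ is the metric it induces on $T\Delta/L$, $L$ being the bundle of null directions. Assume the stronger energy condition (at points of $\Delta$, $-T^\mu{}_\nu\ell^\nu$ is causal and future oriented, possibly zero, for each future oriented null $\ell$ tangent to $\Delta$) and that the pullback of $T$ to $\Delta$ is Lie dragged by every null field tangent to $\Delta$. Let $\pi:\Delta\to B$ be the projection, $\hat q$ the metric on $B$ with $\pi^*\hat q=q$, and $D$ the connection on $\Delta$ induced by the Levi-Civita connection $\nabla$ of $g$. A *natural vector field*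 is a smooth null vector field $\ell$ tangent to $\Delta$, nonzero on an open dense subset, with $D_\ell\ell=\ell$ and $q^{AB}N_{AB}=0$, where (where $\ell\ne0$) the tensor $N$ is defined by $[\mathcal L_\ell,D_a]X^b=\ell^bN_{ac}X^c$. Assume $\Delta$ is *invariant-generic*: there is exactly one natural vector field $\ell$, the *invariant vector field*; and assume that $\ell$ vanishes nowhere on $\Delta$. Let $\omega$ be the one-form on $\Delta$ with $D_X\ell=\omega(X)\ell$. Let $v$ be a smooth function on $\Delta$ with $\ell(v)=1$ which is constant on the leaves of the invariant foliation by good cuts, i.e. for every local section $\sigma$ of $\pi$ lying in a level set of $v$, the one-form $\sigma^*\omega$ is $\hat q$-divergence free. *Invariant structures of a neighbourhood.* Let $U\supset\Delta$ be an open subset of $\mathcal M$ with the following smooth structures. (1) A vector field $\mathbf n$ with $\nabla_{\mathbf n}\mathbf n=0$ which, on $\Delta$, is null and satisfies $g(\mathbf n,X)=-dv(X)$ for all $X$ tangent to $\Delta$; every point of $U$ lies on an integral curve of $\mathbf n$ in $U$ that meets $\Delta$. (2) A vector field $\zeta$ with $[\mathbf n,\zeta]=0$ and $\zeta|_\Delta=\ell$.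 (3) A function $r$ with $\mathbf n(r)=-1$ and $r|_\Delta=0$. (4) An extension of $v$ to $U$ with $\zeta(v)=1$ and $\mathbf n(v)=0$. (5) An extension of $\pi$ to $U$ which is constant along $\mathbf n$ and $\zeta$. Any local coordinates $\hat x^A$ on $B$ give, through the extended $\pi$, functions $x^A$ on an open part of $U$, and $(x^A,r,v)$ are the invariant Bondi-like coordinates. An *infinitesimal symmetry* of $\Delta$ is a smooth vector field $X\not\equiv0$ on $\Delta$ with $\mathcal L_Xq=0$ and $[\mathcal L_X,D]=0$. **Theorem.** Let $K$ be a smooth Killing vector field of $(\mathcal M,g)$ tangent to $\Delta$. (i) If $K$ is null at every point of $\Delta$, then there is a constant $a_0\in\mathbb R$ with $K=a_0\zeta$ on $U$. (ii) If $K$ is not null everywhere on $\Delta$, then there is a constant $a_0\in\mathbb R$, and for any local coordinates $\hat x^A$ on $B$ there are smooth functions $\Phi^A$ of $(\hat x^B)$ alone, such that in the invariant Bondi-like coordinates $$K=a_0\,\zeta+\Phi^A(x^B)\,\partial_A,$$ and the restriction $k$ of $K$ to $\Delta$ is an infinitesimal symmetry of $\Delta$ which has, in the coordinates $(\hat x^A,v)$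 on $\Delta$, the form $k=a_0\,\ell+\Phi^A(\hat x^B)\,\partial_{\hat x^A}$. -/

import Mathlib

open scoped Manifold ContDiff Topology Bundle

noncomputable section

namespace NEH

/-! ### Vector fields and tensor fields -/

section Generic

variable {E : Type*} [NormedAddCommGroup E] [NormedSpace ℝ E]
  {H : Type*} [TopologicalSpace H] (I : ModelWithCorners ℝ E H)
  {M : Type*} [TopologicalSpace M] [ChartedSpace H M]

variable (M) in
/-- (Not necessarily smooth) vector fields on `M`. -/
abbrev VF := Π p : M, TangentSpace I p

variable (M) in
/-- (Not necessarily smooth) one-forms on `M`. -/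
abbrev OneForm := Π p : M, TangentSpace I p →L[ℝ] ℝ

variable (M) in
/-- (Not necessarily smooth) fields of bilinear forms, i.e. tensor fields of type `(0,2)`. -/
abbrev Bilin := Π p : M, TangentSpace I p →L[ℝ] TangentSpace I p →L[ℝ] ℝ

section Smooth

variable [IsManifold I 1 M]

/-- Smoothness of a vector field on a set. -/
def SmoothVFOn (X : VF I M) (U : Set M) : Prop :=
  ContMDiffOn I I.tangent ∞ (fun p => (⟨p, X p⟩ : TangentBundle I M)) U

/-- Smoothness of a vector field. -/
def SmoothVF (X : VF I M) : Prop :=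
  ContMDiff I I.tangent ∞ (fun p => (⟨p, X p⟩ : TangentBundle I M))

/-- Smoothness of a tensor field of type `(0,2)`. -/
def SmoothBilin (S : Bilin I M) : Prop :=
  ContMDiff I (I.prod 𝓘(ℝ, E →L[ℝ] E →L[ℝ] ℝ)) ∞
    (fun p => Bundle.TotalSpace.mk' (E →L[ℝ] E →L[ℝ] ℝ)
      (E := fun p : M => TangentSpace I p →L[ℝ] TangentSpace I p →L[ℝ] ℝ) p (S p))

/-- A smooth vector field taking the value `w` at `p`. -/
def smoothExtension (p : M) (w : TangentSpace I p) : VF I M :=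
  Classical.epsilon fun Z => SmoothVF I Z ∧ Z p = w

end Smooth

/-- The derivative `X(f)` of a function along a vector field. -/
def dir (X : VF I M) (f : M → ℝ) (p : M) : ℝ := mvfderiv I f p (X p)

/-- The function `S(X, Y)`. -/
def pair (S : Bilin I M) (X Y : VF I M) : M → ℝ := fun p => S p (X p) (Y p)

/-- The Lie derivative `(𝓛_X S)(Y, Z) = X(S(Y,Z)) - S([X,Y],Z) - S(Y,[X,Z])` of a tensor field of
type `(0,2)`. -/
def lieBilin (X : VF I M) (S : Bilin I M) (Y Z : VF I M) (p : M) : ℝ :=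
  dir I X (pair I S Y Z) p - pair I S (VectorField.mlieBracket I X Y) Z p
    - pair I S Y (VectorField.mlieBracket I X Z) p

/-- The right-hand side of the Koszul formula. -/
def koszul (g : Bilin I M) (X Y Z : VF I M) (p : M) : ℝ :=
  (1 / 2) * (dir I X (pair I g Y Z) p + dir I Y (pair I g X Z) p - dir I Z (pair I g X Y) p
    + pair I g (VectorField.mlieBracket I X Y) Z p
    - pair I g (VectorField.mlieBracket I X Z) Y p
    - pair I g (VectorField.mlieBracket I Y Z) X p)

variable [IsManifold I 1 M]

/-- The Levi-Civita derivative `∇_X Y` of a nondegenerate metric `g`: at each point it is the vector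
determined by the Koszul formula. -/
def nabla (g : Bilin I M) (X Y : VF I M) : VF I M := fun p =>
  Classical.epsilon fun w : TangentSpace I p =>
    ∀ Z : VF I M, SmoothVF I Z → g p w (Z p) = koszul I g X Y Z p

/-- The curvature `R(X,Y)Z = ∇_X ∇_Y Z - ∇_Y ∇_X Z - ∇_[X,Y] Z`. -/
def curvature (g : Bilin I M) (X Y Z : VF I M) : VF I M :=
  nabla I g X (nabla I g Y Z) - nabla I g Y (nabla I g X Z)
    - nabla I g (VectorField.mlieBracket I X Y) Z

variable [FiniteDimensional ℝ E]

/-- A basis of the tangent space at `p` (which is, by definition, the model space `E`). -/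
def tangentBasis (p : M) : Module.Basis (Fin (Module.finrank ℝ E)) ℝ (TangentSpace I p) :=
  Module.finBasis ℝ E

/-- The Ricci tensor, `Ric(y, z) = tr (x ↦ R(x, y) z)`. -/
def ricci (g : Bilin I M) (p : M) (y z : TangentSpace I p) : ℝ :=
  ∑ i, (tangentBasis I p).coord i
    (curvature I g (smoothExtension I p (tangentBasis I p i)) (smoothExtension I p y)
      (smoothExtension I p z) p)

/-- The scalar curvature `g^{ij} Ric_{ij}`. -/
def scalarCurvature (g : Bilin I M) (p : M) : ℝ :=
  ∑ i, ∑ j, (Matrix.of fun k l => g p (tangentBasis I p k) (tangentBasis I p l))⁻¹ i j *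
    ricci I g p (tangentBasis I p i) (tangentBasis I p j)

end Generic

section Maps

variable {E : Type*} [NormedAddCommGroup E] [NormedSpace ℝ E]
  {H : Type*} [TopologicalSpace H] (I : ModelWithCorners ℝ E H)
  {M : Type*} [TopologicalSpace M] [ChartedSpace H M]
  {E' : Type*} [NormedAddCommGroup E'] [NormedSpace ℝ E']
  {H' : Type*} [TopologicalSpace H'] (J : ModelWithCorners ℝ E' H')
  {N : Type*} [TopologicalSpace N] [ChartedSpace H' N]

/-- Pullback of a tensor field of type `(0,2)`. -/
def pullbackBilin (f : N → M) (S : Bilin I M) : Bilin J N := fun p =>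
  ContinuousLinearMap.bilinearComp (E := E) (F := E) (E' := E') (F' := E')
    (S (f p)) (mfderiv J I f p) (mfderiv J I f p)

lemma pullbackBilin_apply (f : N → M) (S : Bilin I M) (p : N) (X Y : TangentSpace J p) :
    pullbackBilin I J f S p X Y = S (f p) (mfderiv J I f p X) (mfderiv J I f p Y) := rfl

/-- Pullback of a one-form. -/
def pullbackForm (f : N → M) (α : OneForm I M) : OneForm J N := fun p =>
  (α (f p)).comp (mfderiv J I f p)

variable [IsManifold I 1 M]

/-- The covariant derivative induced on an embedded submanifold `e : N → M`, characterised by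
`e_* (D_X Y) = ∇_X̃ Ỹ`, where `X̃`, `Ỹ` are smooth fields on `M` that agree along the submanifold,
near the given point, with `e_* X`, `e_* Y`.  It makes sense if `∇` preserves tangency. -/
def inducedD (g : Bilin I M) (e : N → M) (X Y : VF J N) : VF J N := fun p =>
  Classical.epsilon fun w : TangentSpace J p =>
    ∀ X' Y' : VF I M, SmoothVF I X' → SmoothVF I Y' →
      (∀ᶠ p' in 𝓝 p, mfderiv J I e p' (X p') = X' (e p')) →
      (∀ᶠ p' in 𝓝 p, mfderiv J I e p' (Y p') = Y' (e p')) →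
      mfderiv J I e p w = nabla I g X' Y' (e p)

end Maps

/-! ### Spacetimes -/

/-- An `n`-dimensional time-oriented spacetime satisfying the Einstein equations with
energy-momentum tensor `T`, cosmological constant `cosm` and Newton constant `newton`. -/
structure Spacetime (n : ℕ) [NeZero n] (M : Type*) [TopologicalSpace M]
    [ChartedSpace (EuclideanSpace ℝ (Fin n)) M] [IsManifold (𝓡 n) ∞ M] where
  /-- the metric -/
  g : Bilin (𝓡 n) M
  g_smooth : SmoothBilin (𝓡 n) g
  /-- the signature is `(-,+,…,+)` -/
  g_lorentz : ∀ p, ∃ b : Module.Basis (Fin n) ℝ (TangentSpace (𝓡 n) p),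
    ∀ i j, g p (b i) (b j) = if i = j then (if i = 0 then -1 else 1) else 0
  /-- a future directed timelike vector field, fixing the time orientation -/
  future : VF (𝓡 n) M
  future_smooth : SmoothVF (𝓡 n) future
  future_timelike : ∀ p, g p (future p) (future p) < 0
  /-- the energy-momentum tensor -/
  T : Bilin (𝓡 n) M
  cosm : ℝ
  newton : ℝ
  newton_pos : 0 < newton
  einstein : ∀ (p : M) (y z : TangentSpace (𝓡 n) p),
    ricci (𝓡 n) g p y z - (1 / 2) * scalarCurvature (𝓡 n) g p * g p y z + cosm * g p y z =
      8 * Real.pi * newton * T p y z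

namespace Spacetime

variable {n : ℕ} [NeZero n] {M : Type*} [TopologicalSpace M]
  [ChartedSpace (EuclideanSpace ℝ (Fin n)) M] [IsManifold (𝓡 n) ∞ M] (S : Spacetime n M)

/-- The vector `X` is causal and future oriented; the zero vector is admitted. -/
def FutureCausal (p : M) (X : TangentSpace (𝓡 n) p) : Prop :=
  S.g p X X ≤ 0 ∧ S.g p X (S.future p) ≤ 0

/-- `K` is a (smooth) Killing vector field. -/
def IsKilling (K : VF (𝓡 n) M) : Prop :=
  SmoothVF (𝓡 n) K ∧ ∀ Y Z : VF (𝓡 n) M, SmoothVF (𝓡 n) Y → SmoothVF (𝓡 n) Z →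
    ∀ p, lieBilin (𝓡 n) K S.g Y Z p = 0

end Spacetime

/-! ### Non-expanding horizons -/

/-- The model with corners of the horizon `B × ℝ`. -/
abbrev modelH (m : ℕ) : ModelWithCorners ℝ (EuclideanSpace ℝ (Fin m) × ℝ)
    (ModelProd (EuclideanSpace ℝ (Fin m)) ℝ) := (𝓡 m).prod 𝓘(ℝ, ℝ)

section Horizon

variable {m : ℕ} {M : Type*} [TopologicalSpace M]
  [ChartedSpace (EuclideanSpace ℝ (Fin (m + 2))) M] [IsManifold (𝓡 (m + 2)) ∞ M]
  {B : Type*} [TopologicalSpace B] [ChartedSpace (EuclideanSpace ℝ (Fin m)) B]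
  [IsManifold (𝓡 m) ∞ B]

/-- The vectors `F i p` form an orthonormal system at `p` with respect to `q`. If `q` is the
degenerate metric of a null hypersurface, `q^{AB} S_{AB} = ∑ i, S (F i) (F i)` for each `S` that is
annihilated by null vectors. -/
def OrthonormalAt {E H : Type*} [NormedAddCommGroup E] [NormedSpace ℝ E] [TopologicalSpace H]
    (I : ModelWithCorners ℝ E H) {N : Type*} [TopologicalSpace N] [ChartedSpace H N]
    (q : Bilin I N) {m : ℕ} (F : Fin m → VF I N) (p : N) : Prop :=
  ∀ i j, q p (F i p) (F j p) = if i = j then 1 else 0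

/-- A non-expanding horizon with base `B`: a null hypersurface with vanishing expansion, given as
the image of a smooth embedding `e` of `B × ℝ` (every open interval being diffeomorphic to `ℝ`)
such that the null curves are the images of `{x} × ℝ`. Compactness and connectedness
of `B` are assumed where `B` is introduced. All tensors on the horizon are tensors on `B × ℝ`. -/
structure Horizon (S : Spacetime (m + 2) M) (B : Type*) [TopologicalSpace B]
    [ChartedSpace (EuclideanSpace ℝ (Fin m)) B] [IsManifold (𝓡 m) ∞ B] where
  e : B × ℝ → M
  e_smooth : ContMDiff (modelH m) (𝓡 (m + 2)) ∞ e
  e_embedding : Topology.IsEmbedding e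
  e_immersion : ∀ p, Function.Injective (mfderiv (modelH m) (𝓡 (m + 2)) e p)
  /-- the tangent to `{x} × ℝ` is orthogonal to the whole tangent space of the hypersurface, so that
  the hypersurface is null, with the curves `{x} × ℝ` as its null curves -/
  null : ∀ (p : B × ℝ) (Y : TangentSpace (modelH m) p),
    pullbackBilin (𝓡 (m + 2)) (modelH m) e S.g p
      ((0, 1) : EuclideanSpace ℝ (Fin m) × ℝ) Y = 0
  /-- `q^{AB} 𝓛_ℓ q_{AB} = 0` for null `ℓ` -/
  nonexpanding : ∀ ℓ : VF (modelH m) (B × ℝ), SmoothVF (modelH m) ℓ →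
    (∀ p, pullbackBilin (𝓡 (m + 2)) (modelH m) e S.g p (ℓ p) (ℓ p) = 0) →
    ∀ (F : Fin m → VF (modelH m) (B × ℝ)), (∀ i, SmoothVF (modelH m) (F i)) →
    ∀ p, OrthonormalAt (modelH m) (pullbackBilin (𝓡 (m + 2)) (modelH m) e S.g) F p →
      ∑ i, lieBilin (modelH m) ℓ (pullbackBilin (𝓡 (m + 2)) (modelH m) e S.g) (F i) (F i) p = 0

namespace Horizon

variable {S : Spacetime (m + 2) M} (Δ : Horizon S B)

/-- The degenerate metric `q_{ab}` induced on the horizon. -/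
def q : Bilin (modelH m) (B × ℝ) := pullbackBilin (𝓡 (m + 2)) (modelH m) Δ.e S.g

/-- The push-forward of tangent vectors of the horizon to tangent vectors of the spacetime. -/
def push (p : B × ℝ) :
    TangentSpace (modelH m) p →L[ℝ] TangentSpace (𝓡 (m + 2)) (Δ.e p) :=
  mfderiv (modelH m) (𝓡 (m + 2)) Δ.e p

/-- A vector field on the horizon is null. -/
def IsNull (X : VF (modelH m) (B × ℝ)) : Prop := ∀ p, Δ.q p (X p) (X p) = 0

/-- The induced covariant derivative `D_X Y`. -/
def D (X Y : VF (modelH m) (B × ℝ)) : VF (modelH m) (B × ℝ) :=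
  inducedD (𝓡 (m + 2)) (modelH m) S.g Δ.e X Y

/-- The Lie derivative of the connection,
`([𝓛_Z, D])(X, Y) = [Z, D_X Y] - D_{[Z,X]} Y - D_X [Z,Y]`. -/
def lieD (Z X Y : VF (modelH m) (B × ℝ)) : VF (modelH m) (B × ℝ) :=
  VectorField.mlieBracket (modelH m) Z (Δ.D X Y)
    - Δ.D (VectorField.mlieBracket (modelH m) Z X) Y
    - Δ.D X (VectorField.mlieBracket (modelH m) Z Y)

/-- The metric on the base, whose pullback to the horizon is `q`. (Since `q` is Lie dragged along
the null curves, any section of the horizon may be used to define it; here it is `x ↦ (x, 0)`.) -/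
def baseMetric : Bilin (𝓡 m) B :=
  pullbackBilin (modelH m) (𝓡 m) (fun x : B => (x, (0 : ℝ))) Δ.q

/-- The stronger energy condition: `-T^μ_ν ℓ^ν` is causal and future oriented for each future
oriented null vector `ℓ` tangent to the horizon. -/
def StrongerEnergyCondition : Prop :=
  ∀ (p : B × ℝ) (ℓ : TangentSpace (modelH m) p),
    Δ.q p ℓ ℓ = 0 → S.FutureCausal (Δ.e p) (Δ.push p ℓ) →
    ∀ w : TangentSpace (𝓡 (m + 2)) (Δ.e p),
      (∀ Y, S.g (Δ.e p) w Y = - S.T (Δ.e p) (Δ.push p ℓ) Y) → S.FutureCausal (Δ.e p) w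

/-- The pullback of the energy-momentum tensor is Lie dragged by every null vector field. -/
def MatterLieDragged : Prop :=
  ∀ ℓ : VF (modelH m) (B × ℝ), SmoothVF (modelH m) ℓ → Δ.IsNull ℓ →
    ∀ X Y : VF (modelH m) (B × ℝ), SmoothVF (modelH m) X → SmoothVF (modelH m) Y →
      ∀ p, lieBilin (modelH m) ℓ (pullbackBilin (𝓡 (m + 2)) (modelH m) Δ.e S.T) X Y p = 0

/-- A natural vector field: a null field `ℓ` on the horizon, nonvanishing on a dense (open) set,
with surface gravity `1` (i.e. `D_ℓ ℓ = ℓ`), such that the tensor `N_{ac}` defined, where `ℓ ≠ 0`,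
by `[𝓛_ℓ, D_a] X^b = ℓ^b N_{ac} X^c` satisfies `q^{AB} N_{AB} = 0`. -/
structure IsNatural (ℓ : VF (modelH m) (B × ℝ)) : Prop where
  smooth : SmoothVF (modelH m) ℓ
  null : Δ.IsNull ℓ
  dense : Dense {p | ℓ p ≠ 0}
  surface_gravity : ∀ p, Δ.D ℓ ℓ p = ℓ p
  trace_free : ∃ N : Bilin (modelH m) (B × ℝ),
    (∀ X Y : VF (modelH m) (B × ℝ), SmoothVF (modelH m) X → SmoothVF (modelH m) Y →
      ∀ p, ℓ p ≠ 0 → Δ.lieD ℓ X Y p = N p (X p) (Y p) • ℓ p) ∧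
    ∀ (F : Fin m → VF (modelH m) (B × ℝ)) (p : B × ℝ), ℓ p ≠ 0 →
      OrthonormalAt (modelH m) Δ.q F p → ∑ i, N p (F i p) (F i p) = 0

/-- The horizon is invariant-generic: it has exactly one natural vector field (the invariant vector
field). -/
def InvariantGeneric : Prop := ∃! ℓ : VF (modelH m) (B × ℝ), Δ.IsNatural ℓ

/-- `α` is the rotation one-form potential of the nowhere vanishing null field `ℓ`:
`D_X ℓ = α(X) ℓ`. -/
def IsRotationForm (ℓ : VF (modelH m) (B × ℝ)) (α : OneForm (modelH m) (B × ℝ)) : Prop :=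
  ∀ X : VF (modelH m) (B × ℝ), SmoothVF (modelH m) X → ∀ p, Δ.D X ℓ p = α p (X p) • ℓ p

/-- The divergence `q̂^{AB} D̂_A β_B` of a one-form on the base vanishes at `x`. -/
def DivFreeAt (β : OneForm (𝓡 m) B) (x : B) : Prop :=
  ∀ F : Fin m → VF (𝓡 m) B, (∀ i, SmoothVF (𝓡 m) (F i)) →
    OrthonormalAt (𝓡 m) Δ.baseMetric F x →
    ∑ i, (dir (𝓡 m) (F i) (fun y => β y (F i y)) x
      - β x (nabla (𝓡 m) Δ.baseMetric (F i) (F i) x)) = 0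

/-- `v` is a function with `ℓ(v) = 1` which is constant on the leaves of the foliation by good
cuts: for every local section `s` of `B × ℝ → B` contained in a level set of `v`, the pullback
`s^* α` of the rotation one-form potential of `ℓ` is divergence free. (The level sets need not be
global sections.) -/
structure IsGoodCutFunction (ℓ : VF (modelH m) (B × ℝ)) (v : B × ℝ → ℝ) : Prop where
  smooth : ContMDiff (modelH m) 𝓘(ℝ, ℝ) ∞ v
  normalized : ∀ p, dir (modelH m) ℓ v p = 1
  good_cuts : ∃ α : OneForm (modelH m) (B × ℝ), Δ.IsRotationForm ℓ α ∧
    ∀ (U : Set B) (s : B → B × ℝ) (c : ℝ), IsOpen U → ContMDiffOn (𝓡 m) (modelH m) ∞ s U →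
      (∀ x ∈ U, (s x).1 = x ∧ v (s x) = c) →
      ∀ x ∈ U, Δ.DivFreeAt (pullbackForm (modelH m) (𝓡 m) s α) x

/-- Infinitesimal symmetries of the horizon: nontrivial vector fields with `𝓛_X q = 0` and
`[𝓛_X, D] = 0`. -/
structure IsInfinitesimalSymmetry (X : VF (modelH m) (B × ℝ)) : Prop where
  smooth : SmoothVF (modelH m) X
  nontrivial : ∃ p, X p ≠ 0
  metric : ∀ Y Z : VF (modelH m) (B × ℝ), SmoothVF (modelH m) Y → SmoothVF (modelH m) Z →
    ∀ p, lieBilin (modelH m) X Δ.q Y Z p = 0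
  connection : ∀ Y Z : VF (modelH m) (B × ℝ), SmoothVF (modelH m) Y → SmoothVF (modelH m) Z →
    ∀ p, Δ.lieD X Y Z p = 0

end Horizon

/-- The Bondi-like structure in a neighbourhood `U` of the horizon, determined by a null field `ℓ`
on the horizon and a function `v₀` with `ℓ(v₀) = 1` (whose level sets form the foliation, and which
gives the covector `n_a = -dv₀`). -/
structure BondiNeighbourhood {S : Spacetime (m + 2) M} (Δ : Horizon S B)
    (ℓ : VF (modelH m) (B × ℝ)) (v₀ : B × ℝ → ℝ) where
  /-- the neighbourhood -/
  U : Set M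
  U_open : IsOpen U
  horizon_subset : ∀ p, Δ.e p ∈ U
  /-- the transversal null field `n^μ` -/
  n : VF (𝓡 (m + 2)) M
  n_smooth : SmoothVFOn (𝓡 (m + 2)) n U
  /-- at the horizon `n` is null and its covector pulls back to `-dv₀` -/
  n_null : ∀ p, S.g (Δ.e p) (n (Δ.e p)) (n (Δ.e p)) = 0
  n_horizon : ∀ (p : B × ℝ) (X : TangentSpace (modelH m) p),
    S.g (Δ.e p) (n (Δ.e p)) (Δ.push p X) = - mvfderiv (modelH m) v₀ p X
  n_geodesic : ∀ x ∈ U, nabla (𝓡 (m + 2)) S.g n n x = 0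
  /-- every point of `U` lies on an integral curve of `n` in `U` which meets the horizon; the
  function `r` below makes this curve unique, so that these geodesics foliate `U` -/
  swept : ∀ x ∈ U, ∃ (p : B × ℝ) (γ : ℝ → M) (a b s : ℝ),
    (0 : ℝ) ∈ Set.Ioo a b ∧ s ∈ Set.Ioo a b ∧ γ 0 = Δ.e p ∧ γ s = x ∧
      (∀ t ∈ Set.Ioo a b, γ t ∈ U) ∧ IsMIntegralCurveOn (I := 𝓡 (m + 2)) γ n (Set.Ioo a b)
  /-- the Bondi-like extension `ζ^μ` of `ℓ` -/
  ζ : VF (𝓡 (m + 2)) M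
  ζ_smooth : SmoothVFOn (𝓡 (m + 2)) ζ U
  ζ_horizon : ∀ p, ζ (Δ.e p) = Δ.push p (ℓ p)
  ζ_dragged : ∀ x ∈ U, VectorField.mlieBracket (𝓡 (m + 2)) n ζ x = 0
  /-- the radial coordinate -/
  r : M → ℝ
  r_smooth : ContMDiffOn (𝓡 (m + 2)) 𝓘(ℝ, ℝ) ∞ r U
  r_horizon : ∀ p, r (Δ.e p) = 0
  r_n : ∀ x ∈ U, dir (𝓡 (m + 2)) n r x = -1
  /-- the coordinate `v` -/
  v : M → ℝ
  v_smooth : ContMDiffOn (𝓡 (m + 2)) 𝓘(ℝ, ℝ) ∞ v U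
  v_horizon : ∀ p, v (Δ.e p) = v₀ p
  v_ζ : ∀ x ∈ U, dir (𝓡 (m + 2)) ζ v x = 1
  v_n : ∀ x ∈ U, dir (𝓡 (m + 2)) n v x = 0
  /-- the projection to the base, which extends coordinates `x̂^A` on `B` to `x^A = x̂^A ∘ proj` -/
  proj : M → B
  proj_smooth : ContMDiffOn (𝓡 (m + 2)) (𝓡 m) ∞ proj U
  proj_horizon : ∀ p, proj (Δ.e p) = p.1
  proj_ζ : ∀ x ∈ U, mfderiv (𝓡 (m + 2)) (𝓡 m) proj x (ζ x) = 0
  proj_n : ∀ x ∈ U, mfderiv (𝓡 (m + 2)) (𝓡 m) proj x (n x) = 0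

/-- The coordinates `(x̂^A, v₀)` on the horizon. -/
def horizonCoord (φ : OpenPartialHomeomorph B (EuclideanSpace ℝ (Fin m))) (v₀ : B × ℝ → ℝ) :
    B × ℝ → EuclideanSpace ℝ (Fin m) × ℝ :=
  fun p => (φ p.1, v₀ p)

/-- The coordinate vector field `∂/∂x̂^A` of the coordinates `(x̂^A, v₀)` on the horizon. -/
def horizonPartial (φ : OpenPartialHomeomorph B (EuclideanSpace ℝ (Fin m))) (v₀ : B × ℝ → ℝ)
    (A : Fin m) : VF (modelH m) (B × ℝ) := fun p =>
  (mfderiv (modelH m) 𝓘(ℝ, EuclideanSpace ℝ (Fin m) × ℝ) (horizonCoord φ v₀) p).inverse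
    ((EuclideanSpace.single A 1, 0) : EuclideanSpace ℝ (Fin m) × ℝ)

namespace BondiNeighbourhood

variable {S : Spacetime (m + 2) M} {Δ : Horizon S B} {ℓ : VF (modelH m) (B × ℝ)}
  {v₀ : B × ℝ → ℝ} (𝓑 : BondiNeighbourhood Δ ℓ v₀)

/-- The Bondi-like coordinates `(x^A, r, v)`. -/
def coord (φ : OpenPartialHomeomorph B (EuclideanSpace ℝ (Fin m))) :
    M → EuclideanSpace ℝ (Fin m) × ℝ × ℝ :=
  fun x => (φ (𝓑.proj x), 𝓑.r x, 𝓑.v x)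

/-- The coordinate vector field `∂/∂x^A` of the Bondi-like coordinates `(x^A, r, v)`. -/
def partialA (φ : OpenPartialHomeomorph B (EuclideanSpace ℝ (Fin m))) (A : Fin m) :
    VF (𝓡 (m + 2)) M := fun x =>
  (mfderiv (𝓡 (m + 2)) 𝓘(ℝ, EuclideanSpace ℝ (Fin m) × ℝ × ℝ) (𝓑.coord φ) x).inverse
    ((EuclideanSpace.single A 1, 0, 0) : EuclideanSpace ℝ (Fin m) × ℝ × ℝ)

end BondiNeighbourhood

end Horizon

end NEH

end

/-! Write k for the restriction of K to Δ, ω for the rotation one-form, and v for the good-cut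
function. The argument first works on Δ alone and then transports the result along the geodesics of
`n`.

Rigidity of Δ. The Raychaudhuri equation for the non-expanding ℓ reads Ric(ℓ,ℓ) = -¼|𝓛_ℓ q|²
(`ricci_null`), while the Einstein equations and the energy condition give Ric(ℓ,ℓ) ≥ 0. Hence 𝓛_ℓ q
= 0 (`lie_q_eq_zero`). This says that the second fundamental form vanishes, so the connection D on Δ
is well defined (`totallyGeodesic`), and k, being the restriction of a Killing field, preserves both
q and D.

Commutation with ℓ. Since k preserves the kernel of q, [k,ℓ] = fℓ. Applying k to D_ℓ ℓ = ℓ gives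
ℓ(f) = -f, and then (1+f)ℓ is again a natural vector field. Uniqueness forces f = 0
(`bracket_killing_natural`). Therefore k projects to a Killing field k̂ of the compact Riemannian
manifold B, and k(v) is the pullback of a function u on B.

The constant. Both ℓ and k drag ω, so ω = dv + π*β with 𝓛_k̂ β = -du. The good-cut condition says
that β is divergence free. A Killing field commutes with the divergence, so u is harmonic
(`laplacian_eq_zero`), hence constant by the strong maximum principle (`hopf`, `harmonic_const`).
This constant is a₀ (`dir_killing_const`).

Leaving Δ. On Δ the field `n` is determined by g and dv, both invariant under k, so [K,n] = 0 there.
For geodesic `n` the field Y = [K,n] satisfies [n,Y] = -2∇_Y n, a linear ODE along the integral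
curves, so [K,n] = 0 on all of U (`bracket_killing_n`). Consequently K(r), K(v) and the projection
of K to B are constant along `n` and take on U their values 0, a₀ and k̂ from Δ (`killing_coord`).
As proj, r and v separate tangent vectors (`eq_of_coord`), these values determine K; if K is null on
Δ, then k̂ = 0 and only a₀ζ is left. -/

set_option linter.unusedSectionVars false

namespace NEH

open VectorField Filter Set

/-! ### Derivatives of functions and the algebra of smooth vector fields. -/

section Calculus

variable {E : Type*} [NormedAddCommGroup E] [NormedSpace ℝ E]
  {H : Type*} [TopologicalSpace H] {I : ModelWithCorners ℝ E H}
  {M : Type*} [TopologicalSpace M] [ChartedSpace H M]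

variable (I) in
/-- Smooth real valued functions. -/
abbrev SmoothFn (f : M → ℝ) : Prop := ContMDiff I 𝓘(ℝ, ℝ) ∞ f

lemma SmoothFn.mdiff {f : M → ℝ} (hf : SmoothFn I f) (p : M) :
    MDifferentiableAt I 𝓘(ℝ, ℝ) f p := (hf p).mdifferentiableAt (by simp)

lemma SmoothFn.add {f g : M → ℝ} (hf : SmoothFn I f) (hg : SmoothFn I g) :
    SmoothFn I (fun p => f p + g p) := ContMDiff.add hf hg

lemma SmoothFn.sub {f g : M → ℝ} (hf : SmoothFn I f) (hg : SmoothFn I g) :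
    SmoothFn I (fun p => f p - g p) := ContMDiff.sub hf hg

lemma SmoothFn.mul {f g : M → ℝ} (hf : SmoothFn I f) (hg : SmoothFn I g) :
    SmoothFn I (fun p => f p * g p) := ContMDiff.mul hf hg

lemma SmoothFn.neg {f : M → ℝ} (hf : SmoothFn I f) : SmoothFn I (fun p => - f p) :=
  ContMDiff.neg hf

lemma SmoothFn.const (c : ℝ) : SmoothFn I (fun _ : M => c) := contMDiff_const

lemma SmoothFn.sum {ι : Type*} {s : Finset ι} {f : ι → M → ℝ} (hf : ∀ i ∈ s, SmoothFn I (f i)) :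
    SmoothFn I (fun p => ∑ i ∈ s, f i p) := by
  have := contMDiff_finsetSum' (I' := I) (t := s) (f := f) (n := ∞) hf
  convert this using 1
  ext p; simp

/-! ### Derivatives of functions along vector fields -/

lemma mvfderiv_congr {f g : M → ℝ} {p : M} (h : f =ᶠ[𝓝 p] g) :
    mvfderiv I f p = mvfderiv I g p := by
  unfold mvfderiv
  rw [h.mfderiv_eq]
  rw [h.eq_of_nhds]

lemma dir_congr_fun (X : VF I M) {f g : M → ℝ} {p : M} (h : f =ᶠ[𝓝 p] g) :
    dir I X f p = dir I X g p := by
  unfold dir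
  rw [mvfderiv_congr h]

lemma dir_congr_vec {X Y : VF I M} (f : M → ℝ) {p : M} (h : X p = Y p) :
    dir I X f p = dir I Y f p := by simp [dir, h]

lemma dir_fun_add (X : VF I M) {f g : M → ℝ} {p : M} (hf : MDifferentiableAt I 𝓘(ℝ, ℝ) f p)
    (hg : MDifferentiableAt I 𝓘(ℝ, ℝ) g p) :
    dir I X (fun x => f x + g x) p = dir I X f p + dir I X g p := by
  have := mvfderiv_add hf hg
  simp only [dir]
  change mvfderiv I (f + g) p (X p) = _
  rw [this]; rfl

lemma dir_fun_sub (X : VF I M) {f g : M → ℝ} {p : M} (hf : MDifferentiableAt I 𝓘(ℝ, ℝ) f p)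
    (hg : MDifferentiableAt I 𝓘(ℝ, ℝ) g p) :
    dir I X (fun x => f x - g x) p = dir I X f p - dir I X g p := by
  have := mvfderiv_sub hf hg
  simp only [dir]
  change mvfderiv I (f - g) p (X p) = _
  rw [this]; rfl

lemma dir_fun_neg (X : VF I M) {f : M → ℝ} {p : M} :
    dir I X (fun x => - f x) p = - dir I X f p := by
  have := mvfderiv_neg (I := I) (g := f) (x := p)
  simp only [dir]
  change mvfderiv I (- f) p (X p) = _
  rw [this]; rfl

lemma dir_fun_mul (X : VF I M) {f g : M → ℝ} {p : M} (hf : MDifferentiableAt I 𝓘(ℝ, ℝ) f p)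
    (hg : MDifferentiableAt I 𝓘(ℝ, ℝ) g p) :
    dir I X (fun x => f x * g x) p = f p * dir I X g p + g p * dir I X f p := by
  have := mvfderiv_mul hf hg
  simp only [dir]
  change mvfderiv I (f * g) p (X p) = _
  rw [this]; rfl

lemma dir_const (X : VF I M) (c : ℝ) (p : M) : dir I X (fun _ => c) p = 0 := by
  simp [dir, mvfderiv_const]

lemma dir_eq_zero_of_eventually_const (X : VF I M) {f : M → ℝ} {p : M} {c : ℝ}
    (h : ∀ᶠ x in 𝓝 p, f x = c) : dir I X f p = 0 := by
  rw [dir_congr_fun X (g := fun _ => c) h, dir_const]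

lemma dir_fun_sum (X : VF I M) {ι : Type*} {s : Finset ι} {f : ι → M → ℝ} {p : M}
    (hf : ∀ i ∈ s, MDifferentiableAt I 𝓘(ℝ, ℝ) (f i) p) :
    dir I X (fun x => ∑ i ∈ s, f i x) p = ∑ i ∈ s, dir I X (f i) p := by
  classical
  suffices H : MDifferentiableAt I 𝓘(ℝ, ℝ) (fun x => ∑ i ∈ s, f i x) p ∧
      dir I X (fun x => ∑ i ∈ s, f i x) p = ∑ i ∈ s, dir I X (f i) p from H.2
  induction s using Finset.induction_on with
  | empty => simpa using ⟨mdifferentiableAt_const, dir_const X 0 p⟩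
  | insert a s ha ih =>
    obtain ⟨h1, h2⟩ := ih (fun i hi => hf i (Finset.mem_insert_of_mem hi))
    simp only [Finset.sum_insert ha]
    have h3 := hf a (Finset.mem_insert_self _ _)
    exact ⟨h3.add h1, by rw [dir_fun_add X h3 h1, h2]⟩

lemma dir_add (X Y : VF I M) (f : M → ℝ) (p : M) :
    dir I (X + Y) f p = dir I X f p + dir I Y f p := by simp [dir]

lemma dir_smul (c : M → ℝ) (X : VF I M) (f : M → ℝ) (p : M) :
    dir I (c • X) f p = c p * dir I X f p := by simp [dir]

lemma dir_vec_sum {ι : Type*} (s : Finset ι) (X : VF I M) (Y : ι → VF I M) (f : M → ℝ) (p : M)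
    (c : ι → ℝ) (h : X p = ∑ i ∈ s, c i • Y i p) :
    dir I X f p = ∑ i ∈ s, c i * dir I (Y i) f p := by simp [dir, h]

variable [IsManifold I 1 M]

lemma SmoothVF.dir {X : VF I M} (hX : SmoothVF I X) {f : M → ℝ} (hf : SmoothFn I f) :
    SmoothFn I (dir I X f) := by
  have h1 := ContMDiff.contMDiff_tangentMap hf (m := ∞) (by simp)
  have h2 := (contMDiff_snd_tangentBundle_modelSpace (n := ∞) ℝ 𝓘(ℝ, ℝ)).comp (h1.comp hX)
  exact h2

/-! ### Algebra of smooth vector fields -/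

lemma SmoothVF.add {X Y : VF I M} (hX : SmoothVF I X) (hY : SmoothVF I Y) :
    SmoothVF I (X + Y) := ContMDiff.add_section hX hY

lemma SmoothVF.sub {X Y : VF I M} (hX : SmoothVF I X) (hY : SmoothVF I Y) :
    SmoothVF I (X - Y) := ContMDiff.sub_section hX hY

lemma SmoothVF.neg {X : VF I M} (hX : SmoothVF I X) : SmoothVF I (- X) :=
  ContMDiff.neg_section hX

lemma SmoothVF.smul {f : M → ℝ} {X : VF I M} (hf : SmoothFn I f) (hX : SmoothVF I X) :
    SmoothVF I (f • X) := ContMDiff.smul_section hf hX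

lemma SmoothVF.zero : SmoothVF I (0 : VF I M) := Bundle.contMDiff_zeroSection ℝ (TangentSpace I (M := M))

lemma SmoothVF.sum {ι : Type*} {s : Finset ι} {X : ι → VF I M} (hX : ∀ i ∈ s, SmoothVF I (X i)) :
    SmoothVF I (fun p => ∑ i ∈ s, X i p) := ContMDiff.sum_section hX

lemma SmoothVF.mdiff {X : VF I M} (hX : SmoothVF I X) (p : M) :
    MDifferentiableAt I I.tangent (fun p => (⟨p, X p⟩ : TangentBundle I M)) p :=
  (hX p).mdifferentiableAt (by simp)

end Calculus

/-! ### Lie brackets, cut-offs, local frames and tensoriality. -/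

section Smooth

variable {E : Type*} [NormedAddCommGroup E] [NormedSpace ℝ E] [FiniteDimensional ℝ E]
  {H : Type*} [TopologicalSpace H] {I : ModelWithCorners ℝ E H}
  {M : Type*} [TopologicalSpace M] [ChartedSpace H M] [IsManifold I ∞ M]

variable (I M) in
lemma isManifold_infty_add_one : IsManifold I (((⊤ : ℕ∞) : ℕ∞ω) + 1) M :=
  IsManifold.of_le (n := ∞) (by simp)

variable (I M) in
lemma isManifold_minSmoothness (k : ℕ) : IsManifold I (minSmoothness ℝ k) M := by
  rw [minSmoothness_of_isRCLikeNormedField]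
  exact IsManifold.of_le (n := ∞) (by exact_mod_cast le_top)

lemma SmoothVF.bracket {X Y : VF I M} (hX : SmoothVF I X) (hY : SmoothVF I Y) :
    SmoothVF I (mlieBracket I X Y) := by
  have := FiniteDimensional.complete ℝ E
  have := isManifold_infty_add_one I M
  have := isManifold_minSmoothness I M 2
  intro p
  exact ContMDiffAt.mlieBracket_vectorField (n := ⊤) (m := ⊤) (hX p) (hY p)
    (by rw [minSmoothness_of_isRCLikeNormedField]; simp)

lemma bracket_add_right {X Y Z : VF I M} (hY : SmoothVF I Y) (hZ : SmoothVF I Z) :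
    mlieBracket I X (Y + Z) = mlieBracket I X Y + mlieBracket I X Z := by
  have := FiniteDimensional.complete ℝ E
  ext1 p; exact mlieBracket_add_right (hY.mdiff p) (hZ.mdiff p)

lemma bracket_add_left {X Y Z : VF I M} (hX : SmoothVF I X) (hY : SmoothVF I Y) :
    mlieBracket I (X + Y) Z = mlieBracket I X Z + mlieBracket I Y Z := by
  have := FiniteDimensional.complete ℝ E
  ext1 p; exact mlieBracket_add_left (hX.mdiff p) (hY.mdiff p)

lemma bracket_smul_right {X Y : VF I M} {f : M → ℝ} (hf : SmoothFn I f) (hY : SmoothVF I Y) :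
    mlieBracket I X (f • Y) = dir I X f • Y + f • mlieBracket I X Y := by
  have := FiniteDimensional.complete ℝ E
  ext1 p; exact mlieBracket_smul_right (hf.mdiff p) (hY.mdiff p)

lemma bracket_smul_left {X Y : VF I M} {f : M → ℝ} (hf : SmoothFn I f) (hX : SmoothVF I X) :
    mlieBracket I (f • X) Y = - (dir I Y f • X) + f • mlieBracket I X Y := by
  have := FiniteDimensional.complete ℝ E
  ext1 p
  simpa [dir] using mlieBracket_smul_left (W := Y) (hf.mdiff p) (hX.mdiff p)

lemma bracket_swap (X Y : VF I M) : mlieBracket I X Y = - mlieBracket I Y X :=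
  mlieBracket_swap

lemma jacobi {X Y Z : VF I M} (hX : SmoothVF I X) (hY : SmoothVF I Y) (hZ : SmoothVF I Z) :
    mlieBracket I X (mlieBracket I Y Z) =
      mlieBracket I (mlieBracket I X Y) Z + mlieBracket I Y (mlieBracket I X Z) := by
  have := FiniteDimensional.complete ℝ E
  have := isManifold_minSmoothness I M 3
  have h2 : minSmoothness ℝ 2 ≤ (∞ : ℕ∞ω) := by
    rw [minSmoothness_of_isRCLikeNormedField]
    exact WithTop.coe_le_coe.2 (le_top : (2 : ℕ∞) ≤ ⊤)
  exact leibniz_identity_mlieBracket (ContMDiff.of_le hX h2) (ContMDiff.of_le hY h2)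
    (ContMDiff.of_le hZ h2)

/-! ### Cutting off and frames -/

section T2
variable [T2Space M]

variable (I) in
lemma exists_bump {p : M} {s : Set M} (hs : s ∈ 𝓝 p) :
    ∃ ψ : M → ℝ, SmoothFn I ψ ∧ (∀ᶠ x in 𝓝 p, ψ x = 1) ∧ tsupport ψ ⊆ s := by
  obtain ⟨f, hf, -⟩ := (SmoothBumpFunction.nhds_basis_support (I := I) hs).mem_iff.1 hs
  exact ⟨f, f.contMDiff, f.eventuallyEq_one, hf⟩

lemma smoothVF_bump_smul {X : VF I M} {u : Set M} (hu : IsOpen u) (hX : SmoothVFOn I X u)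
    {ψ : M → ℝ} (hψ : SmoothFn I ψ) (hs : tsupport ψ ⊆ u) : SmoothVF I (ψ • X) := by
  intro p
  by_cases hp : p ∈ u
  · exact ContMDiffAt.smul_section (hψ p) (hX.contMDiffAt (hu.mem_nhds hp))
  · have h0 : ∀ᶠ x in 𝓝 p, ψ x = 0 := by
      have : p ∉ tsupport ψ := fun h => hp (hs h)
      exact notMem_tsupport_iff_eventuallyEq.1 this
    refine (SmoothVF.zero (I := I) (M := M) p).congr_of_eventuallyEq ?_
    filter_upwards [h0] with x hx
    simp [hx]

lemma smoothFn_bump_mul {f : M → ℝ} {u : Set M} (hu : IsOpen u)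
    (hf : ContMDiffOn I 𝓘(ℝ, ℝ) ∞ f u)
    {ψ : M → ℝ} (hψ : SmoothFn I ψ) (hs : tsupport ψ ⊆ u) : SmoothFn I (fun x => ψ x * f x) := by
  intro p
  by_cases hp : p ∈ u
  · exact (hψ p).mul (hf.contMDiffAt (hu.mem_nhds hp))
  · have h0 : ∀ᶠ x in 𝓝 p, ψ x = 0 := by
      have : p ∉ tsupport ψ := fun h => hp (hs h)
      exact notMem_tsupport_iff_eventuallyEq.1 this
    refine (contMDiffAt_const (c := (0 : ℝ))).congr_of_eventuallyEq ?_
    filter_upwards [h0] with x hx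
    simp [hx]

lemma exists_smoothVF_eventuallyEq {X : VF I M} {u : Set M} (hu : IsOpen u)
    (hX : SmoothVFOn I X u) {p : M} (hp : p ∈ u) :
    ∃ X' : VF I M, SmoothVF I X' ∧ ∀ᶠ x in 𝓝 p, X' x = X x := by
  obtain ⟨ψ, h1, h2, h3⟩ := exists_bump I (hu.mem_nhds hp)
  exact ⟨ψ • X, smoothVF_bump_smul hu hX h1 h3, by filter_upwards [h2] with x hx; simp [hx]⟩

lemma exists_smoothFn_eventuallyEq {f : M → ℝ} {u : Set M} (hu : IsOpen u)
    (hf : ContMDiffOn I 𝓘(ℝ, ℝ) ∞ f u) {p : M} (hp : p ∈ u) :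
    ∃ f' : M → ℝ, SmoothFn I f' ∧ ∀ᶠ x in 𝓝 p, f' x = f x := by
  obtain ⟨ψ, h1, h2, h3⟩ := exists_bump I (hu.mem_nhds hp)
  exact ⟨fun x => ψ x * f x, smoothFn_bump_mul hu hf h1 h3, by
    filter_upwards [h2] with x hx; simp [hx]⟩

variable (I) in
/-- Near each point there is a frame of smooth vector fields with its coframe. -/
lemma exists_frame (p : M) :
    ∃ (b : Fin (Module.finrank ℝ E) → VF I M)
      (c : Fin (Module.finrank ℝ E) → Π x : M, TangentSpace I x →ₗ[ℝ] ℝ),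
      (∀ i, SmoothVF I (b i)) ∧
      (∀ i (X : VF I M), SmoothVF I X → SmoothFn I (fun x => c i x (X x))) ∧
      (∀ᶠ x in 𝓝 p, ∀ w : TangentSpace I x, w = ∑ i, c i x w • b i x) ∧
      (∀ᶠ x in 𝓝 p, ∀ i j, c i x (b j x) = if i = j then 1 else 0) := by
  let e := trivializationAt E (TangentSpace I : M → Type _) p
  have hp : p ∈ e.baseSet := FiberBundle.mem_baseSet_trivializationAt' p
  let B := Module.finBasis ℝ E
  obtain ⟨ψ, h1, h2, h3⟩ := exists_bump I (e.open_baseSet.mem_nhds hp)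
  -- Frame and coframe are both cut off to make them global, so completeness and duality hold only
  -- where ψ = 1, that is, near p.
  refine ⟨fun i => ψ • e.localFrame B i, fun i x => ψ x • e.localFrameCoeff I B i x, ?_, ?_, ?_, ?_⟩
  · intro i
    exact smoothVF_bump_smul e.open_baseSet (e.contMDiffOn_localFrame_baseSet (n := ∞) B i) h1 h3
  · intro i X hX
    have := contMDiffOn_baseSet_localFrameCoeff (e := e) (I := I) B (k := ∞)
      (s := X) (ContMDiff.contMDiffOn hX) i
    exact smoothFn_bump_mul e.open_baseSet this h1 h3
  · filter_upwards [h2, e.open_baseSet.mem_nhds hp] with x hx hx' w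
    have := e.eq_sum_localFrameCoeff_smul (I := I) (b := B) hx' (s := fun y => by
      classical exact if h : y = x then h ▸ w else 0)
    simpa [hx] using this
  · filter_upwards [h2, e.open_baseSet.mem_nhds hp] with x hx hx' i j
    have := Bundle.Trivialization.localFrameCoeff_apply_of_mem_baseSet (I := I) e B hx'
      (e.localFrame B j) i
    simp only [hx, one_smul, Pi.smul_apply']
    rw [this]
    simp [hx', Finsupp.single_apply, eq_comm]

variable (I) in
lemma exists_smoothVF_apply_eq (p : M) (w : TangentSpace I p) :
    ∃ X : VF I M, SmoothVF I X ∧ X p = w := by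
  obtain ⟨b, c, hb, -, hc, -⟩ := exists_frame I p
  refine ⟨fun x => ∑ i, c i p w • b i x, SmoothVF.sum (X := fun i => (fun _ => c i p w) • b i)
    fun i _ => SmoothVF.smul (SmoothFn.const _) (hb i), ?_⟩
  exact (hc.self_of_nhds w).symm

lemma smoothExtension_spec (p : M) (w : TangentSpace I p) :
    SmoothVF I (smoothExtension I p w) ∧ smoothExtension I p w p = w :=
  Classical.epsilon_spec (exists_smoothVF_apply_eq I p w)

/-- An operation on smooth vector fields which is linear over smooth functions at `p` depends on
the value at `p` only. -/
lemma tensorial_zero {A : Type*} [AddCommGroup A] [Module ℝ A] {p : M} (Φ : VF I M → A)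
    (hadd : ∀ X Y, SmoothVF I X → SmoothVF I Y → Φ (X + Y) = Φ X + Φ Y)
    (hsmul : ∀ f X, SmoothFn I f → SmoothVF I X → Φ (f • X) = f p • Φ X)
    {X : VF I M} (hX : SmoothVF I X) (h0 : X p = 0) : Φ X = 0 := by
  obtain ⟨b, c, hb, hcs, hc, -⟩ := exists_frame I p
  obtain ⟨ψ, h1, h2, h3⟩ := exists_bump I hc
  have hz : Φ 0 = 0 := by
    have := hadd 0 0 SmoothVF.zero SmoothVF.zero
    simpa using this
  have hsum : ∀ s : Finset (Fin (Module.finrank ℝ E)),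
      SmoothVF I (∑ i ∈ s, (fun x => ψ x * c i x (X x)) • b i) ∧
      Φ (∑ i ∈ s, (fun x => ψ x * c i x (X x)) • b i) = 0 := by
    classical
    intro s
    induction s using Finset.induction_on with
    | empty => simpa using ⟨SmoothVF.zero, hz⟩
    | insert a s ha ih =>
      have hf : SmoothFn I (fun x => ψ x * c a x (X x)) := h1.mul (hcs a X hX)
      rw [Finset.sum_insert ha]
      refine ⟨(SmoothVF.smul hf (hb a)).add ih.1, ?_⟩
      rw [hadd _ _ (SmoothVF.smul hf (hb a)) ih.1, ih.2, hsmul _ _ hf (hb a)]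
      simp [h0]
  -- Cutting off turns the local expansion of X into a global one, to which linearity applies; its
  -- coefficients vanish at p because X does.
  have key : ψ • X = ∑ i, (fun x => ψ x * c i x (X x)) • b i := by
    ext1 x
    by_cases hx : x ∈ tsupport ψ
    · have := h3 hx (X x)
      simp only [Pi.smul_apply', Finset.sum_apply, mul_smul]
      rw [← Finset.smul_sum, ← this]
    · have hx0 : ψ x = 0 := image_eq_zero_of_notMem_tsupport hx
      simp [hx0]
  have h5 : Φ (ψ • X) = Φ X := by
    rw [hsmul _ _ h1 hX, h2.self_of_nhds, one_smul]
  rw [← h5, key]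
  exact (hsum _).2

lemma tensorial_congr {A : Type*} [AddCommGroup A] [Module ℝ A] {p : M} (Φ : VF I M → A)
    (hadd : ∀ X Y, SmoothVF I X → SmoothVF I Y → Φ (X + Y) = Φ X + Φ Y)
    (hsmul : ∀ f X, SmoothFn I f → SmoothVF I X → Φ (f • X) = f p • Φ X)
    {X Y : VF I M} (hX : SmoothVF I X) (hY : SmoothVF I Y) (h : X p = Y p) : Φ X = Φ Y := by
  have h1 := tensorial_zero Φ hadd hsmul (hX.sub hY) (by simp [h])
  have h2 := hadd (X - Y) Y (hX.sub hY) hY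
  rw [sub_add_cancel, h1, zero_add] at h2
  exact h2

/-- The linear map defined by a tensorial operation. -/
lemma exists_linear_of_tensorial {A : Type*} [AddCommGroup A] [Module ℝ A] {p : M}
    (Φ : VF I M → A)
    (hadd : ∀ X Y, SmoothVF I X → SmoothVF I Y → Φ (X + Y) = Φ X + Φ Y)
    (hsmul : ∀ f X, SmoothFn I f → SmoothVF I X → Φ (f • X) = f p • Φ X) :
    ∃ L : TangentSpace I p →ₗ[ℝ] A, ∀ X, SmoothVF I X → Φ X = L (X p) := by
  have hs := fun w => smoothExtension_spec (I := I) p w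
  refine ⟨{ toFun := fun w => Φ (smoothExtension I p w), map_add' := ?_, map_smul' := ?_ }, ?_⟩
  · intro v w
    rw [← hadd _ _ (hs v).1 (hs w).1]
    exact tensorial_congr Φ hadd hsmul (hs _).1 ((hs v).1.add (hs w).1) (by simp [(hs _).2])
  · intro r v
    have := hsmul (fun _ => r) _ (SmoothFn.const r) (hs v).1
    simp only [RingHom.id_apply]
    rw [← this]
    exact tensorial_congr Φ hadd hsmul (hs _).1 (SmoothVF.smul (SmoothFn.const r) (hs v).1)
      (by simp [(hs _).2])
  · intro X hX
    exact tensorial_congr Φ hadd hsmul hX (hs _).1 (hs _).2.symm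

/-- The bracket acts on functions as the commutator. -/
lemma dir_bracket {X Y : VF I M} (hX : SmoothVF I X) (hY : SmoothVF I Y) {f : M → ℝ}
    (hf : SmoothFn I f) (p : M) :
    dir I (mlieBracket I X Y) f p = dir I X (dir I Y f) p - dir I Y (dir I X f) p := by
  -- The Jacobi identity for X, Y, fW, compared with f times the one for X, Y, W, leaves ([X,Y]f -
  -- X(Yf) + Y(Xf)) W = 0. This is conclusive if W is nonzero at p; a zero tangent space is treated
  -- separately.
  by_cases hE : ∀ w : TangentSpace I p, w = 0
  · simp [dir, hE (mlieBracket I X Y p), hE (X p), hE (Y p)]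
  push Not at hE
  obtain ⟨w, hw⟩ := hE
  obtain ⟨W, hW, hWp⟩ := exists_smoothVF_apply_eq I p w
  have hXf := hX.dir hf
  have hYf := hY.dir hf
  have hXW := hX.bracket hW
  have hYW := hY.bracket hW
  have h1 := congrFun (jacobi hX hY (SmoothVF.smul hf hW)) p
  have h2 := congrFun (jacobi hX hY hW) p
  rw [bracket_smul_right hf hW, bracket_smul_right hf hW, bracket_smul_right hf hW,
    bracket_add_right (SmoothVF.smul hYf hW) (SmoothVF.smul hf hYW),
    bracket_add_right (SmoothVF.smul hXf hW) (SmoothVF.smul hf hXW),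
    bracket_smul_right hYf hW, bracket_smul_right hXf hW, bracket_smul_right hf hYW,
    bracket_smul_right hf hXW] at h1
  simp only [Pi.add_apply, Pi.smul_apply', h2, hWp] at h1
  have h3 : (dir I (mlieBracket I X Y) f p - (dir I X (dir I Y f) p - dir I Y (dir I X f) p)) • w
      = 0 := by
    simp only [sub_smul]
    simp only [smul_add] at h1
    rw [← sub_eq_zero] at h1
    rw [← neg_eq_zero, ← h1]
    module
  have := (smul_eq_zero.1 h3).resolve_right hw
  linarith

end T2

end Smooth

end NEH

namespace NEH

open VectorField Filter Set

/-! ### Smooth dependence of solutions of linear systems. -/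

section LinearSolve

variable {E : Type*} [NormedAddCommGroup E] [NormedSpace ℝ E]
  {H : Type*} [TopologicalSpace H] {I : ModelWithCorners ℝ E H}
  {M : Type*} [TopologicalSpace M] [ChartedSpace H M]

/-- The solution of a regular system of linear equations with smooth coefficients is smooth. -/
lemma contMDiffAt_of_linear_system {ι : Type*} [Fintype ι] {p : M} {G : M → ι → ι → ℝ}
    {b y : M → ι → ℝ}
    (hG : ∀ i j, ContMDiffAt I 𝓘(ℝ, ℝ) ∞ (fun x => G x i j) p)
    (hb : ∀ j, ContMDiffAt I 𝓘(ℝ, ℝ) ∞ (fun x => b x j) p)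
    (hinj : ∀ c : ι → ℝ, (∀ j, ∑ i, c i * G p i j = 0) → c = 0)
    (hy : ∀ᶠ x in 𝓝 p, ∀ j, ∑ i, y x i * G x i j = b x j) (i : ι) :
    ContMDiffAt I 𝓘(ℝ, ℝ) ∞ (fun x => y x i) p := by
  classical
  -- The system is y(x) T(x) = b(x). Since T(p) is invertible, T stays invertible near p, and
  -- inversion of operators is smooth, so y = T⁻¹b is smooth.
  let T : M → ((ι → ℝ) →L[ℝ] (ι → ℝ)) := fun x =>
    ∑ i, ∑ j, G x i j • ((ContinuousLinearMap.proj i : (ι → ℝ) →L[ℝ] ℝ).smulRight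
      (Pi.single j (1 : ℝ) : ι → ℝ))
  have hT : ∀ x (c : ι → ℝ) j, T x c j = ∑ i, c i * G x i j := by
    intro x c j
    simp only [T, _root_.sum_apply, Finset.sum_apply, _root_.smul_apply,
      ContinuousLinearMap.smulRight_apply, ContinuousLinearMap.proj_apply, Pi.smul_apply,
      smul_eq_mul, Pi.single_apply]
    refine Finset.sum_congr rfl fun i _ => ?_
    simp [mul_comm]
  have hTs : ContMDiffAt I 𝓘(ℝ, (ι → ℝ) →L[ℝ] (ι → ℝ)) ∞ T p := by
    apply ContMDiffAt.sum
    intro i _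
    apply ContMDiffAt.sum
    intro j _
    exact (hG i j).smul contMDiffAt_const
  have hTinj : Function.Injective (T p) := by
    rw [injective_iff_map_eq_zero]
    intro c hc
    apply hinj
    intro j
    rw [← hT, hc]; rfl
  let e : (ι → ℝ) ≃L[ℝ] (ι → ℝ) :=
    (LinearEquiv.ofInjectiveEndo (T p : (ι → ℝ) →ₗ[ℝ] (ι → ℝ)) hTinj).toContinuousLinearEquiv
  have he : (e : (ι → ℝ) →L[ℝ] (ι → ℝ)) = T p := by ext c j; rfl
  have hinv : ContMDiffAt I 𝓘(ℝ, (ι → ℝ) →L[ℝ] (ι → ℝ)) ∞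
      (fun x => ContinuousLinearMap.inverse (T x)) p := by
    have h1 : ContDiffAt ℝ ∞ (ContinuousLinearMap.inverse :
      ((ι → ℝ) →L[ℝ] (ι → ℝ)) → _) (T p) := by
      rw [← he]; exact contDiffAt_map_inverse e
    exact h1.contMDiffAt.comp p hTs
  have hbs : ContMDiffAt I 𝓘(ℝ, ι → ℝ) ∞ b p := contMDiffAt_pi_space.2 hb
  have h2 := hinv.clm_apply hbs
  have h3 : ∀ᶠ x in 𝓝 p, y x = ContinuousLinearMap.inverse (T x) (b x) := by
    have h4 : ∀ᶠ x in 𝓝 p, T x ∈ range ((↑) : ((ι → ℝ) ≃L[ℝ] (ι → ℝ)) → _) := by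
      apply hTs.continuousAt.eventually
      rw [← he]
      exact ContinuousLinearEquiv.nhds e
    filter_upwards [h4, hy] with x ⟨e', hx⟩ hx'
    have : b x = T x (y x) := by ext j; rw [hT, hx']
    rw [this, ← hx]
    simp
  have h5 := h2.congr_of_eventuallyEq h3
  exact contMDiffAt_pi_space.1 h5 i

end LinearSolve

/-! ### The Levi-Civita connection and its invariance under Killing fields. -/

section LeviCivita

variable {E : Type*} [NormedAddCommGroup E] [NormedSpace ℝ E] [FiniteDimensional ℝ E]
  {H : Type*} [TopologicalSpace H] {I : ModelWithCorners ℝ E H}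
  {M : Type*} [TopologicalSpace M] [ChartedSpace H M] [IsManifold I ∞ M]

variable (I) in
/-- `g` is a (pseudo-Riemannian) metric. -/
structure IsMetric (g : Bilin I M) : Prop where
  smooth : ∀ {X Y : VF I M}, SmoothVF I X → SmoothVF I Y → SmoothFn I (pair I g X Y)
  symm : ∀ p (x y : TangentSpace I p), g p x y = g p y x
  nondeg : ∀ p (x : TangentSpace I p), (∀ y, g p x y = 0) → x = 0

lemma pair_add_left (g : Bilin I M) (X Y Z : VF I M) :
    pair I g (X + Y) Z = fun p => pair I g X Z p + pair I g Y Z p := by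
  ext p; simp [pair]

lemma pair_add_right (g : Bilin I M) (X Y Z : VF I M) :
    pair I g X (Y + Z) = fun p => pair I g X Y p + pair I g X Z p := by
  ext p; simp [pair]

lemma pair_smul_left (g : Bilin I M) (f : M → ℝ) (X Y : VF I M) :
    pair I g (f • X) Y = fun p => f p * pair I g X Y p := by
  ext p; simp [pair]

lemma pair_smul_right (g : Bilin I M) (f : M → ℝ) (X Y : VF I M) :
    pair I g X (f • Y) = fun p => f p * pair I g X Y p := by
  ext p; simp [pair]

lemma IsMetric.pair_comm {g : Bilin I M} (hg : IsMetric I g) (X Y : VF I M) :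
    pair I g X Y = pair I g Y X := by
  ext p; exact hg.symm p _ _

variable [T2Space M] {g : Bilin I M} (hg : IsMetric I g)
include hg

lemma IsMetric.exists_dual (p : M) (L : TangentSpace I p →ₗ[ℝ] ℝ) :
    ∃ w : TangentSpace I p, ∀ z, g p w z = L z := by
  have : FiniteDimensional ℝ (TangentSpace I p) := inferInstanceAs (FiniteDimensional ℝ E)
  let T : TangentSpace I p →ₗ[ℝ] Module.Dual ℝ (TangentSpace I p) :=
    { toFun := fun w => (g p w : TangentSpace I p →ₗ[ℝ] ℝ)
      map_add' := fun a b => by ext z; simp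
      map_smul' := fun a b => by ext z; simp }
  have hinj : Function.Injective T := by
    rw [injective_iff_map_eq_zero]
    intro w hw
    exact hg.nondeg p w fun y => by simpa [T] using LinearMap.congr_fun hw y
  obtain ⟨w, hw⟩ := (LinearMap.injective_iff_surjective_of_finrank_eq_finrank
    (by simp [Subspace.dual_finrank_eq])).1 hinj L
  exact ⟨w, fun z => by simpa [T] using LinearMap.congr_fun hw z⟩

lemma IsMetric.ext_vec {p : M} {v w : TangentSpace I p}
    (h : ∀ Z : VF I M, SmoothVF I Z → g p v (Z p) = g p w (Z p)) : v = w := by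
  rw [← sub_eq_zero]
  apply hg.nondeg p
  intro y
  obtain ⟨Z, hZ, hZp⟩ := exists_smoothVF_apply_eq I p y
  rw [← hZp]
  simp [h Z hZ]

/-- `nabla` is a choice, so a vector with the required property must exist: the Koszul expression is
tensorial in Z, hence a covector at p, and nondegeneracy represents it. -/
lemma nabla_spec {X Y Z : VF I M} (hX : SmoothVF I X) (hY : SmoothVF I Y) (hZ : SmoothVF I Z)
    (p : M) : g p (nabla I g X Y p) (Z p) = koszul I g X Y Z p := by
  have hXY := hX.bracket hY
  obtain ⟨L, hL⟩ := exists_linear_of_tensorial (I := I) (p := p)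
    (fun Z => koszul I g X Y Z p) (by
      intro Z Z' hZ hZ'
      simp only [koszul, pair_add_right, pair_add_left, bracket_add_right hZ hZ']
      rw [dir_fun_add _ ((hg.smooth hY hZ).mdiff p) ((hg.smooth hY hZ').mdiff p),
        dir_fun_add _ ((hg.smooth hX hZ).mdiff p) ((hg.smooth hX hZ').mdiff p), dir_add]
      ring) (by
      intro f Z hf hZ
      simp only [koszul, pair_smul_right, pair_add_left, pair_smul_left, bracket_smul_right hf hZ]
      rw [dir_fun_mul _ (hf.mdiff p) ((hg.smooth hY hZ).mdiff p),
        dir_fun_mul _ (hf.mdiff p) ((hg.smooth hX hZ).mdiff p), dir_smul,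
        hg.pair_comm Z Y, hg.pair_comm Z X, smul_eq_mul]
      ring)
  obtain ⟨w, hw⟩ := hg.exists_dual p L
  have := Classical.epsilon_spec (p := fun w : TangentSpace I p =>
    ∀ Z : VF I M, SmoothVF I Z → g p w (Z p) = koszul I g X Y Z p)
    ⟨w, fun Z hZ => by rw [hw, hL Z hZ]⟩
  exact this Z hZ

lemma nabla_pair {X Y Z : VF I M} (hX : SmoothVF I X) (hY : SmoothVF I Y) (hZ : SmoothVF I Z)
    (p : M) : pair I g (nabla I g X Y) Z p = koszul I g X Y Z p :=
  nabla_spec hg hX hY hZ p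

-- The predicate that defines the choice at p only sees germs of X and Y, so the two choices are
-- made from the same predicate and no property of g is needed.
omit hg [T2Space M] in
lemma nabla_congr {X X' Y Y' : VF I M} {p : M} (hX : ∀ᶠ x in 𝓝 p, X x = X' x)
    (hY : ∀ᶠ x in 𝓝 p, Y x = Y' x) : nabla I g X Y p = nabla I g X' Y' p := by
  have hXp := hX.self_of_nhds
  have hYp := hY.self_of_nhds
  have h : ∀ Z, koszul I g X Y Z p = koszul I g X' Y' Z p := by
    intro Z
    unfold koszul
    have b1 := Filter.EventuallyEq.mlieBracket_vectorField_eq (I := I) hX hY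
    have b2 := Filter.EventuallyEq.mlieBracket_vectorField_eq (I := I) hX
      (Filter.EventuallyEq.refl (𝓝 p) Z)
    have b3 := Filter.EventuallyEq.mlieBracket_vectorField_eq (I := I) hY
      (Filter.EventuallyEq.refl (𝓝 p) Z)
    have e1 : pair I g Y Z =ᶠ[𝓝 p] pair I g Y' Z := by
      filter_upwards [hY] with x hx; simp [pair, hx]
    have e2 : pair I g X Z =ᶠ[𝓝 p] pair I g X' Z := by
      filter_upwards [hX] with x hx; simp [pair, hx]
    have e3 : pair I g X Y =ᶠ[𝓝 p] pair I g X' Y' := by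
      filter_upwards [hX, hY] with x hx hy; simp [pair, hx, hy]
    rw [dir_congr_fun X e1, dir_congr_fun Y e2, dir_congr_fun Z e3, dir_congr_vec _ hXp,
      dir_congr_vec _ hYp]
    simp only [pair, b1, b2, b3, hXp, hYp]
  unfold nabla
  simp only [h]

/-- The components of V in a local frame solve a linear system whose matrix is the Gram matrix of
the frame, regular because g is nondegenerate. -/
lemma smoothVF_of_pair {V : VF I M}
    (h : ∀ Z, SmoothVF I Z → SmoothFn I (pair I g V Z)) : SmoothVF I V := by
  intro p
  obtain ⟨b, c, hb, hcs, hc, hcb⟩ := exists_frame I p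
  have key : ∀ i, ContMDiffAt I 𝓘(ℝ, ℝ) ∞ (fun x => c i x (V x)) p := by
    refine contMDiffAt_of_linear_system (G := fun x i j => pair I g (b i) (b j) x)
      (b := fun x j => pair I g V (b j) x) (y := fun x i => c i x (V x))
      (fun i j => hg.smooth (hb i) (hb j) p) (fun j => h _ (hb j) p) ?_ ?_
    · intro d hd
      have h1 : ∑ i, d i • b i p = 0 := by
        apply hg.nondeg
        intro y
        rw [hc.self_of_nhds y]
        simp only [map_sum, map_smul, _root_.sum_apply,
          _root_.smul_apply]
        refine Finset.sum_eq_zero fun j _ => ?_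
        have := hd j
        simp only [pair] at this
        simp only [smul_eq_mul]
        rw [this, mul_zero]
      ext i
      have h2 := congrArg (c i p) h1
      simp only [map_sum, map_smul, smul_eq_mul, map_zero, hcb.self_of_nhds, mul_ite, mul_one,
        mul_zero, Finset.sum_ite_eq, Finset.mem_univ, if_true] at h2
      simpa using h2
    · filter_upwards [hc] with x hx j
      conv_rhs => rw [pair, hx (V x)]
      simp [pair]
  have : ContMDiffAt I I.tangent ∞
      (fun x => (⟨x, ∑ i, c i x (V x) • b i x⟩ : TangentBundle I M)) p :=
    ContMDiffAt.sum_section fun i _ => ContMDiffAt.smul_section (key i) (hb i p)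
  refine this.congr_of_eventuallyEq ?_
  filter_upwards [hc] with x hx
  rw [← hx (V x)]

lemma SmoothVF.nabla {X Y : VF I M} (hX : SmoothVF I X) (hY : SmoothVF I Y) :
    SmoothVF I (nabla I g X Y) := by
  apply smoothVF_of_pair hg
  intro Z hZ
  have h : pair I g (NEH.nabla I g X Y) Z = koszul I g X Y Z := by
    ext p; exact nabla_spec hg hX hY hZ p
  rw [h]
  have h1 := hX.dir (hg.smooth hY hZ)
  have h2 := hY.dir (hg.smooth hX hZ)
  have h3 := hZ.dir (hg.smooth hX hY)
  have h4 := hg.smooth (hX.bracket hY) hZ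
  have h5 := hg.smooth (hX.bracket hZ) hY
  have h6 := hg.smooth (hY.bracket hZ) hX
  exact (SmoothFn.const (1 / 2)).mul (((((h1.add h2).sub h3).add h4).sub h5).sub h6)

lemma nabla_torsion {X Y : VF I M} (hX : SmoothVF I X) (hY : SmoothVF I Y) :
    nabla I g X Y - nabla I g Y X = mlieBracket I X Y := by
  ext1 p
  apply hg.ext_vec
  intro Z hZ
  simp only [Pi.sub_apply, map_sub, _root_.sub_apply, nabla_spec hg hX hY hZ,
    nabla_spec hg hY hX hZ, koszul]
  rw [hg.pair_comm X Y, bracket_swap Y X]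
  simp only [pair, Pi.neg_apply, map_neg, _root_.neg_apply]
  ring

lemma nabla_metric {X Y Z : VF I M} (hX : SmoothVF I X) (hY : SmoothVF I Y) (hZ : SmoothVF I Z)
    (p : M) : dir I X (pair I g Y Z) p =
      pair I g (nabla I g X Y) Z p + pair I g Y (nabla I g X Z) p := by
  rw [hg.pair_comm Y (nabla I g X Z), nabla_pair hg hX hY hZ, nabla_pair hg hX hZ hY, koszul,
    koszul, hg.pair_comm Z Y, bracket_swap Z Y]
  simp only [pair, Pi.neg_apply, map_neg, _root_.neg_apply]
  ring

lemma nabla_add_left {X X' Y : VF I M} (hX : SmoothVF I X) (hX' : SmoothVF I X')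
    (hY : SmoothVF I Y) : nabla I g (X + X') Y = nabla I g X Y + nabla I g X' Y := by
  ext1 p
  apply hg.ext_vec
  intro Z hZ
  simp only [Pi.add_apply, map_add, _root_.add_apply,
    nabla_spec hg (hX.add hX') hY hZ, nabla_spec hg hX hY hZ, nabla_spec hg hX' hY hZ, koszul,
    pair_add_left, pair_add_right, bracket_add_left hX hX', dir_add]
  rw [dir_fun_add _ ((hg.smooth hX hZ).mdiff p) ((hg.smooth hX' hZ).mdiff p),
    dir_fun_add _ ((hg.smooth hX hY).mdiff p) ((hg.smooth hX' hY).mdiff p)]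
  ring

lemma nabla_smul_left {f : M → ℝ} {X Y : VF I M} (hf : SmoothFn I f) (hX : SmoothVF I X)
    (hY : SmoothVF I Y) : nabla I g (f • X) Y = f • nabla I g X Y := by
  ext1 p
  apply hg.ext_vec
  intro Z hZ
  have hn : ∀ (A B C : VF I M), pair I g (-(A) + B) C = fun p => - pair I g A C p + pair I g B C p := by
    intro A B C; ext p; simp [pair]
  simp only [Pi.smul_apply', map_smul, _root_.smul_apply, smul_eq_mul,
    nabla_spec hg (SmoothVF.smul hf hX) hY hZ, nabla_spec hg hX hY hZ, koszul,
    pair_smul_left, pair_smul_right, bracket_smul_left hf hX, dir_smul, hn]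
  rw [dir_fun_mul _ (hf.mdiff p) ((hg.smooth hX hZ).mdiff p),
    dir_fun_mul _ (hf.mdiff p) ((hg.smooth hX hY).mdiff p)]
  ring

/-- Vanishing torsion reduces linearity in the differentiated field to linearity in the direction.
-/
lemma nabla_add_right {X Y Y' : VF I M} (hX : SmoothVF I X) (hY : SmoothVF I Y)
    (hY' : SmoothVF I Y') : nabla I g X (Y + Y') = nabla I g X Y + nabla I g X Y' := by
  have h1 := nabla_torsion hg hX (hY.add hY')
  have h2 := nabla_torsion hg hX hY
  have h3 := nabla_torsion hg hX hY'
  rw [bracket_add_right hY hY', ← h2, ← h3, nabla_add_left hg hY hY' hX] at h1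
  have := sub_eq_iff_eq_add.1 h1
  rw [this]; abel

lemma nabla_smul_right {f : M → ℝ} {X Y : VF I M} (hf : SmoothFn I f) (hX : SmoothVF I X)
    (hY : SmoothVF I Y) :
    nabla I g X (f • Y) = dir I X f • Y + f • nabla I g X Y := by
  have h1 := nabla_torsion hg hX (SmoothVF.smul hf hY)
  have h2 := nabla_torsion hg hX hY
  rw [bracket_smul_right hf hY, ← h2, nabla_smul_left hg hf hY hX] at h1
  have := sub_eq_iff_eq_add.1 h1
  rw [this, smul_sub]; abel

lemma nabla_neg_left {X Y : VF I M} (hX : SmoothVF I X) (hY : SmoothVF I Y) :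
    nabla I g (-X) Y = - nabla I g X Y := by
  have := nabla_smul_left hg (SmoothFn.const (-1)) hX hY
  have e : ∀ Z : VF I M, (fun _ : M => (-1 : ℝ)) • Z = -Z := by
    intro Z; ext1 p; simp
  rwa [e, e] at this

/-- The covariant derivative at `p` depends on the direction at `p` only. -/
lemma nabla_congr_left {X X' Y : VF I M} {p : M} (hX : SmoothVF I X) (hX' : SmoothVF I X')
    (hY : SmoothVF I Y) (h : X p = X' p) : nabla I g X Y p = nabla I g X' Y p :=
  tensorial_congr (fun X => nabla I g X Y p)
    (fun A B hA hB => by rw [nabla_add_left hg hA hB hY]; rfl)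
    (fun f A hf hA => by rw [nabla_smul_left hg hf hA hY]; rfl) hX hX' h

/-- The Lie derivative along a Killing field of the Levi-Civita connection vanishes. -/
lemma killing_nabla {K : VF I M} (hK : SmoothVF I K)
    (hKg : ∀ Y Z, SmoothVF I Y → SmoothVF I Z → ∀ p, lieBilin I K g Y Z p = 0)
    {X Y : VF I M} (hX : SmoothVF I X) (hY : SmoothVF I Y) :
    mlieBracket I K (nabla I g X Y) =
      nabla I g (mlieBracket I K X) Y + nabla I g X (mlieBracket I K Y) := by
  -- S is the Lie derivative of the connection along K. It is symmetric in X, Y since the torsion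
  -- vanishes, and g(S(X,Y),Z) is skew in Y, Z since K preserves g. A tensor with both symmetries is
  -- zero, as in the uniqueness of the Levi-Civita connection.
  let S : VF I M → VF I M → VF I M := fun X Y => mlieBracket I K (nabla I g X Y) -
      (nabla I g (mlieBracket I K X) Y + nabla I g X (mlieBracket I K Y))
  have hsym : ∀ X Y, SmoothVF I X → SmoothVF I Y → S X Y = S Y X := by
    intro X Y hX hY
    have h1 := congrArg (mlieBracket I K) (nabla_torsion hg hX hY)
    have hs : nabla I g X Y - nabla I g Y X = nabla I g X Y + (-nabla I g Y X) := by abel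
    have hYX := SmoothVF.nabla hg hY hX
    have hneg : mlieBracket I K (-nabla I g Y X) = - mlieBracket I K (nabla I g Y X) := by
      have := bracket_smul_right (X := K) (SmoothFn.const (I := I) (M := M) (-1)) hYX
      have e : ∀ Z : VF I M, (fun _ : M => (-1 : ℝ)) • Z = -Z := by
        intro Z; ext1 p; simp
      rw [e, e] at this
      rw [this]
      ext1 p
      simp [dir_const]
    rw [hs, bracket_add_right (SmoothVF.nabla hg hX hY) hYX.neg, hneg, jacobi hK hX hY,
      ← nabla_torsion hg (hK.bracket hX) hY, ← nabla_torsion hg hX (hK.bracket hY)] at h1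
    simp only [S]
    rw [← sub_eq_zero]
    have h2 := sub_eq_zero.2 h1
    rw [← h2]
    abel
  have hL : ∀ Y Z, SmoothVF I Y → SmoothVF I Z → ∀ p, dir I K (pair I g Y Z) p =
      pair I g (mlieBracket I K Y) Z p + pair I g Y (mlieBracket I K Z) p := by
    intro Y Z hY hZ p
    have := hKg Y Z hY hZ p
    unfold lieBilin at this
    linarith
  have hanti : ∀ X Y Z, SmoothVF I X → SmoothVF I Y → SmoothVF I Z → ∀ p,
      pair I g (S X Y) Z p + pair I g Y (S X Z) p = 0 := by
    intro X Y Z hX hY hZ p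
    have hXY := SmoothVF.nabla hg hX hY
    have hXZ := SmoothVF.nabla hg hX hZ
    have hKY := hK.bracket hY
    have hKZ := hK.bracket hZ
    have h1 := dir_bracket hK hX (hg.smooth hY hZ) p
    have e1 : dir I X (pair I g Y Z) = fun p =>
      pair I g (nabla I g X Y) Z p + pair I g Y (nabla I g X Z) p := by
      ext p; exact nabla_metric hg hX hY hZ p
    have e2 : dir I K (pair I g Y Z) = fun p =>
      pair I g (mlieBracket I K Y) Z p + pair I g Y (mlieBracket I K Z) p := by
      ext p; exact hL Y Z hY hZ p
    rw [e1, e2, dir_fun_add _ ((hg.smooth hXY hZ).mdiff p) ((hg.smooth hY hXZ).mdiff p),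
      dir_fun_add _ ((hg.smooth hKY hZ).mdiff p) ((hg.smooth hY hKZ).mdiff p),
      hL _ _ hXY hZ, hL _ _ hY hXZ, nabla_metric hg hX hKY hZ, nabla_metric hg hX hY hKZ,
      nabla_metric hg (hK.bracket hX) hY hZ] at h1
    simp only [S, pair, Pi.sub_apply, Pi.add_apply, map_sub, map_add,
      _root_.sub_apply, _root_.add_apply] at h1 ⊢
    linarith
  have h0 : S X Y = 0 := by
    ext1 p
    apply hg.ext_vec
    intro Z hZ
    have a1 := hanti X Y Z hX hY hZ p
    have a2 := hanti Y Z X hY hZ hX p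
    have a3 := hanti Z X Y hZ hX hY p
    rw [hg.pair_comm Y (S X Z), hsym X Z hX hZ] at a1
    rw [hg.pair_comm Z (S Y X), hsym Y X hY hX] at a2
    rw [hg.pair_comm X (S Z Y), hsym Z Y hZ hY] at a3
    simp only [pair] at a1 a2 a3
    simp only [Pi.zero_apply, map_zero, _root_.zero_apply]
    linarith
  exact sub_eq_zero.1 h0

end LeviCivita

end NEH

namespace NEH

open VectorField Filter Set

/-! ### Detecting tangent vectors and smoothness by functions. -/

section Criterion

variable {E : Type*} [NormedAddCommGroup E] [NormedSpace ℝ E] [FiniteDimensional ℝ E]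
  {H : Type*} [TopologicalSpace H] {I : ModelWithCorners ℝ E H}
  {M : Type*} [TopologicalSpace M] [ChartedSpace H M] [IsManifold I ∞ M] [T2Space M]

variable (I) in
/-- Smooth functions which are coordinates at `p`. -/
lemma exists_coordinates (p : M) : ∃ y : Fin (Module.finrank ℝ E) → M → ℝ,
    (∀ i, SmoothFn I (y i)) ∧ ∀ v w : TangentSpace I p,
      (∀ i, mvfderiv I (y i) p v = mvfderiv I (y i) p w) → v = w := by
  obtain ⟨ψ, h1, h2, h3⟩ := exists_bump I ((chartAt H p).open_source.mem_nhds (mem_chart_source H p))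
  let B := Module.finBasis ℝ E
  let L : Fin (Module.finrank ℝ E) → E →L[ℝ] ℝ :=
    fun i => LinearMap.toContinuousLinearMap (B.coord i)
  refine ⟨fun i x => ψ x * L i (extChartAt I p x), fun i => ?_, fun v w h => ?_⟩
  · refine smoothFn_bump_mul (chartAt H p).open_source ?_ h1 h3
    exact ((L i).contMDiff (n := ∞)).comp_contMDiffOn (contMDiffOn_extChartAt (I := I) (x := p))
  have hinv := isInvertible_mfderiv_extChartAt (I := I) (mem_extChartAt_source (I := I) p)
  apply hinv.injective
  apply B.ext_elem
  intro i
  have h5 : (fun x => ψ x * L i (extChartAt I p x)) =ᶠ[𝓝 p] (L i ∘ extChartAt I p) := by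
    filter_upwards [h2] with x hx
    simp [hx]
  have h6 : ∀ u : TangentSpace I p, mvfderiv I (fun x => ψ x * L i (extChartAt I p x)) p u =
      L i (mfderiv I 𝓘(ℝ, E) (extChartAt I p) p u) := by
    intro u
    rw [mvfderiv_congr h5]
    have hc : MDifferentiableAt I 𝓘(ℝ, E) (extChartAt I p) p :=
      mdifferentiableAt_extChartAt (mem_chart_source H p)
    rw [mvfderiv_comp_apply p ((L i).mdifferentiableAt) hc]
    have : mvfderiv 𝓘(ℝ, E) (L i) (extChartAt I p p) = L i := by
      unfold mvfderiv
      rw [ContinuousLinearMap.mfderiv_eq]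
      rfl
    rw [this]
    rfl
  have h4 := h i
  rw [h6, h6] at h4
  exact h4

/-- Smooth functions separate tangent vectors. -/
lemma eq_of_forall_mvfderiv_eq {p : M} {v w : TangentSpace I p}
    (h : ∀ f : M → ℝ, SmoothFn I f → mvfderiv I f p v = mvfderiv I f p w) : v = w := by
  obtain ⟨y, hy, hy'⟩ := exists_coordinates I p
  exact hy' v w fun i => h _ (hy i)

/-- A vector field is smooth if it maps smooth functions to smooth functions. -/
lemma smoothVF_of_dir {V : VF I M} (h : ∀ f, SmoothFn I f → SmoothFn I (dir I V f)) :
    SmoothVF I V := by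
  intro p
  obtain ⟨b, c, hb, hcs, hc, hcb⟩ := exists_frame I p
  obtain ⟨y, hy, hy'⟩ := exists_coordinates I p
  have key : ∀ i, ContMDiffAt I 𝓘(ℝ, ℝ) ∞ (fun x => c i x (V x)) p := by
    refine contMDiffAt_of_linear_system (G := fun x i j => dir I (b i) (y j) x)
      (b := fun x j => dir I V (y j) x) (y := fun x i => c i x (V x))
      (fun i j => (hb i).dir (hy j) p) (fun j => h _ (hy j) p) ?_ ?_
    · intro d hd
      have h1 : ∑ i, d i • b i p = 0 := by
        apply hy'
        intro j
        have := hd j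
        simp only [dir] at this
        simpa [map_sum] using this
      ext i
      have h2 := congrArg (c i p) h1
      simp only [map_sum, map_smul, smul_eq_mul, map_zero, hcb.self_of_nhds, mul_ite, mul_one,
        mul_zero, Finset.sum_ite_eq, Finset.mem_univ, if_true] at h2
      simpa using h2
    · filter_upwards [hc] with x hx j
      exact (dir_vec_sum Finset.univ V b (y j) x _ (hx (V x))).symm
  have : ContMDiffAt I I.tangent ∞
      (fun x => (⟨x, ∑ i, c i x (V x) • b i x⟩ : TangentBundle I M)) p :=
    ContMDiffAt.sum_section fun i _ => ContMDiffAt.smul_section (key i) (hb i p)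
  refine this.congr_of_eventuallyEq ?_
  filter_upwards [hc] with x hx
  rw [← hx (V x)]

end Criterion

/-! ### Immersions: local left inverses, extension of fields, related fields. -/

section Immersion

variable {E : Type*} [NormedAddCommGroup E] [NormedSpace ℝ E] [FiniteDimensional ℝ E]
  {H : Type*} [TopologicalSpace H] {I : ModelWithCorners ℝ E H}
  {M : Type*} [TopologicalSpace M] [ChartedSpace H M] [IsManifold I ∞ M]
  {E' : Type*} [NormedAddCommGroup E'] [NormedSpace ℝ E'] [FiniteDimensional ℝ E']
  {H' : Type*} [TopologicalSpace H'] {J : ModelWithCorners ℝ E' H'}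
  {N : Type*} [TopologicalSpace N] [ChartedSpace H' N] [IsManifold J ∞ N]

/-- An immersion has smooth local left inverses. -/
lemma exists_local_left_inverse [J.Boundaryless] {e : N → M} (he : ContMDiff J I ∞ e) (p : N)
    (hinj : Function.Injective (mfderiv J I e p)) :
    ∃ (ρ : M → N) (u : Set M), IsOpen u ∧ e p ∈ u ∧ ContMDiffOn I J ∞ ρ u ∧
      ∀ᶠ p' in 𝓝 p, ρ (e p') = p' := by
  have := FiniteDimensional.complete ℝ E'
  let φ := extChartAt I (e p)
  let χ := extChartAt J p
  let G : E' → E := φ ∘ e ∘ χ.symm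
  let A : E' →L[ℝ] E := mfderiv J I e p
  obtain ⟨L₀, hL₀⟩ := LinearMap.exists_leftInverse_of_injective (A : E' →ₗ[ℝ] E)
    (LinearMap.ker_eq_bot.2 hinj)
  let L : E →L[ℝ] E' := LinearMap.toContinuousLinearMap L₀
  have hLA : L.comp A = ContinuousLinearMap.id ℝ E' := by
    ext x
    exact LinearMap.congr_fun hL₀ x
  let F : E' → E' := L ∘ G
  let W : Set E' := χ.target ∩ (e ∘ χ.symm) ⁻¹' φ.source
  have hχo : IsOpen χ.target := isOpen_extChartAt_target p
  have hφo : IsOpen φ.source := isOpen_extChartAt_source (e p)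
  have hsymm : ContMDiffOn 𝓘(ℝ, E') J ∞ χ.symm χ.target := contMDiffOn_extChartAt_symm p
  have heχ : ContMDiffOn 𝓘(ℝ, E') I ∞ (e ∘ χ.symm) χ.target := he.comp_contMDiffOn hsymm
  have hWo : IsOpen W := heχ.continuousOn.isOpen_inter_preimage hχo hφo
  have hpW : χ p ∈ W := ⟨mem_extChartAt_target p, by
    simp only [mem_preimage, Function.comp]
    rw [extChartAt_to_inv p]
    exact mem_extChartAt_source (e p)⟩
  have hG : ContMDiffOn 𝓘(ℝ, E') 𝓘(ℝ, E) ∞ G W :=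
    (contMDiffOn_extChartAt (I := I) (x := e p)).comp (heχ.mono inter_subset_left)
      (fun x hx => by simpa [φ] using hx.2)
  have hF : ContDiffOn ℝ ∞ F W :=
    (L.contDiff (n := ∞)).comp_contDiffOn (contMDiffOn_iff_contDiffOn.1 hG)
  have hGd : HasFDerivAt G A (χ p) := by
    have h1 : MDifferentiableAt J I e p := (he p).mdifferentiableAt (by simp)
    have h2 : HasFDerivWithinAt G A (range J) (χ p) := h1.hasMFDerivAt.2
    rw [J.range_eq_univ] at h2
    exact hasFDerivWithinAt_univ.1 h2
  have hFd : HasFDerivAt F ((ContinuousLinearEquiv.refl ℝ E' : E' ≃L[ℝ] E') : E' →L[ℝ] E') (χ p) := by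
    have := L.hasFDerivAt.comp (χ p) hGd
    rw [hLA] at this
    exact this
  have hFat : ContDiffAt ℝ ∞ F (χ p) := hF.contDiffAt (hWo.mem_nhds hpW)
  let h := hFat.toOpenPartialHomeomorph F hFd (by simp)
  have hsrc : χ p ∈ h.source := hFat.mem_toOpenPartialHomeomorph_source hFd (by simp)
  have hcoe : ∀ x, h x = F x := fun x => rfl
  -- The inverse function theorem gives smoothness of the inverse only at points where the
  -- derivative is invertible; V is the open set of such points.
  let V : Set E' := {x | x ∈ W ∧ fderiv ℝ F x ∈ range ((↑) : (E' ≃L[ℝ] E') → E' →L[ℝ] E')}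
  have hVo : IsOpen V := by
    have hc : ContinuousOn (fderiv ℝ F) W := hF.continuousOn_fderiv_of_isOpen hWo (by simp)
    exact hc.isOpen_inter_preimage hWo (ContinuousLinearEquiv.isOpen)
  have hpV : χ p ∈ V := ⟨hpW, by rw [hFd.fderiv]; exact ⟨_, rfl⟩⟩
  let T : Set E' := h.target ∩ h.symm ⁻¹' V
  have hTo : IsOpen T := h.symm.continuousOn.isOpen_inter_preimage h.open_target hVo
  have hsm : ContDiffOn ℝ ∞ h.symm T := by
    intro y hy
    obtain ⟨A', hA'⟩ := hy.2.2
    have hd : HasFDerivAt F (A' : E' →L[ℝ] E') (h.symm y) := by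
      rw [hA']
      exact ((hF.contDiffAt (hWo.mem_nhds hy.2.1)).differentiableAt (by simp)).hasFDerivAt
    exact (h.contDiffAt_symm hy.1 hd (hF.contDiffAt (hWo.mem_nhds hy.2.1))).contDiffWithinAt
  have hLφ : ContMDiffOn I 𝓘(ℝ, E') ∞ (L ∘ φ) φ.source :=
    (L.contMDiff (n := ∞)).comp_contMDiffOn (by
      simpa [φ] using contMDiffOn_extChartAt (I := I) (x := e p) (n := ∞))
  let u : Set M := φ.source ∩ (L ∘ φ) ⁻¹' T
  have huo : IsOpen u := hLφ.continuousOn.isOpen_inter_preimage hφo hTo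
  have hFp : (L ∘ φ) (e p) = F (χ p) := by
    simp only [F, G, Function.comp]
    rw [extChartAt_to_inv p]
  have hleft : ∀ x ∈ h.source, h.symm (F x) = x := fun x hx => h.left_inv hx
  refine ⟨χ.symm ∘ h.symm ∘ L ∘ φ, u, huo, ⟨mem_extChartAt_source (e p), ?_⟩, ?_, ?_⟩
  · change (L ∘ φ) (e p) ∈ T
    rw [hFp]
    exact ⟨h.map_source hsrc, by rw [mem_preimage, hleft _ hsrc]; exact hpV⟩
  · refine hsymm.comp ((contMDiffOn_iff_contDiffOn.2 hsm).comp (hLφ.mono inter_subset_left)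
      fun x hx => hx.2) ?_
    intro x hx
    exact hx.2.2.1.1
  · have h1 : ∀ᶠ p' in 𝓝 p, p' ∈ χ.source ∧ χ p' ∈ h.source := by
      have hcont : ContinuousAt χ p := continuousAt_extChartAt p
      exact Filter.Eventually.and (extChartAt_source_mem_nhds (I := J) p)
        (hcont.eventually (h.open_source.mem_nhds hsrc))
    filter_upwards [h1] with p' hp'
    have h2 : (L ∘ φ) (e p') = F (χ p') := by
      simp only [F, G, Function.comp]
      rw [χ.left_inv hp'.1]
    change χ.symm (h.symm ((L ∘ φ) (e p'))) = p'
    rw [h2, hleft _ hp'.2, χ.left_inv hp'.1]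

/-- Vector fields on `N` and `M` agree near `p` along the map `e`. -/
def Related (J : ModelWithCorners ℝ E' H') (I : ModelWithCorners ℝ E H) (e : N → M)
    (X : VF J N) (X' : VF I M) (p : N) : Prop :=
  ∀ᶠ p' in 𝓝 p, mfderiv J I e p' (X p') = X' (e p')

variable {e : N → M}

lemma mvfderiv_comp_map (he : ContMDiff J I ∞ e) {f : M → ℝ} (p : N)
    (hf : MDifferentiableAt I 𝓘(ℝ, ℝ) f (e p)) (w : TangentSpace J p) :
    mvfderiv J (fun x => f (e x)) p w = mvfderiv I f (e p) (mfderiv J I e p w) :=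
  mvfderiv_comp_apply p hf ((he p).mdifferentiableAt (by simp)) w

lemma SmoothFn.comp_map {f : M → ℝ} (hf : SmoothFn I f) (he : ContMDiff J I ∞ e) :
    SmoothFn J (fun x => f (e x)) := ContMDiff.comp hf he

lemma Related.dir_eq (he : ContMDiff J I ∞ e) {X : VF J N} {X' : VF I M} {p : N}
    (h : Related J I e X X' p) {f : M → ℝ} (hf : SmoothFn I f) :
    ∀ᶠ p' in 𝓝 p, dir J X (fun x => f (e x)) p' = dir I X' f (e p') := by
  filter_upwards [h] with p' hp'
  simp only [dir]
  rw [mvfderiv_comp_map he p' (hf.mdiff _), hp']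

/-- Extension of smooth functions from an immersed manifold. -/
lemma exists_extension_fn [T2Space M] [J.Boundaryless] (he : ContMDiff J I ∞ e) (p : N)
    (hinj : Function.Injective (mfderiv J I e p)) {f : N → ℝ} (hf : SmoothFn J f) :
    ∃ f' : M → ℝ, SmoothFn I f' ∧ ∀ᶠ p' in 𝓝 p, f' (e p') = f p' := by
  obtain ⟨ρ, u, hu, hpu, hρ, hρe⟩ := exists_local_left_inverse he p hinj
  obtain ⟨f', h1, h2⟩ := exists_smoothFn_eventuallyEq (I := I) hu
    (ContMDiff.comp_contMDiffOn hf hρ) hpu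
  refine ⟨f', h1, ?_⟩
  filter_upwards [he.continuous.continuousAt.eventually h2, hρe] with p' a b
  rw [a, Function.comp, b]

/-- Extension of smooth vector fields from an immersed manifold. -/
lemma exists_extension [T2Space M] [J.Boundaryless] (he : ContMDiff J I ∞ e) (p : N)
    (hinj : Function.Injective (mfderiv J I e p)) {X : VF J N} (hX : SmoothVF J X) :
    ∃ X' : VF I M, SmoothVF I X' ∧ Related J I e X X' p := by
  obtain ⟨ρ, u, hu, hpu, hρ, hρe⟩ := exists_local_left_inverse he p hinj
  let t := trivializationAt E (TangentSpace I : M → Type _) (e p)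
  have hpt : e p ∈ t.baseSet := FiberBundle.mem_baseSet_trivializationAt' (e p)
  let w : N → E := fun p' => (t ⟨e p', mfderiv J I e p' (X p')⟩).2
  have hw : ContMDiffOn J 𝓘(ℝ, E) ∞ w (e ⁻¹' t.baseSet) := by
    have h1 : ContMDiff J I.tangent ∞ (fun p' => tangentMap J I e ⟨p', X p'⟩) :=
      (ContMDiff.contMDiff_tangentMap he (m := ∞) (by simp)).comp hX
    have h2 := (t.contMDiffOn (IB := I) (n := ∞)).comp (h1.contMDiffOn (s := e ⁻¹' t.baseSet))
      (fun x hx => by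
        rw [mem_preimage, t.mem_source]
        exact hx)
    exact contMDiff_snd.comp_contMDiffOn h2
  let u' : Set M := (u ∩ t.baseSet) ∩ ((fun x => e (ρ x)) ⁻¹' t.baseSet)
  have hu' : IsOpen u' :=
    ((he.continuous.comp_continuousOn hρ.continuousOn).mono inter_subset_left).isOpen_inter_preimage
      (hu.inter t.open_baseSet) t.open_baseSet
  have hρp : ρ (e p) = p := hρe.self_of_nhds
  have hpu' : e p ∈ u' := ⟨⟨hpu, hpt⟩, by simpa [hρp] using hpt⟩
  -- The components of e_*X in a trivialization near e p are extended by making them constant on the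
  -- fibres of the left inverse ρ.
  let Y : VF I M := fun x => t.symm x (w (ρ x))
  have hY : SmoothVFOn I Y u' := by
    refine (t.contMDiffOn_section_iff (IB := I) (n := ∞) hu' (fun x hx => hx.1.2)).2 ?_
    refine (hw.comp (hρ.mono fun x hx => hx.1.1) (fun x hx => hx.2)).congr ?_
    intro x hx
    simp only [Y, Function.comp]
    rw [t.apply_mk_symm hx.1.2]
  obtain ⟨X', h1, h2⟩ := exists_smoothVF_eventuallyEq hu' hY hpu'
  refine ⟨X', h1, ?_⟩
  filter_upwards [he.continuous.continuousAt.eventually h2, hρe,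
    he.continuous.continuousAt.eventually (t.open_baseSet.mem_nhds hpt)] with p' a b c
  rw [a]
  have hval : w p' = t.continuousLinearMapAt ℝ (e p') (mfderiv J I e p' (X p')) := by
    simp only [w]
    rw [t.continuousLinearMapAt_apply_of_mem _ c]
  simp only [Y, b]
  rw [hval]
  exact (t.symmL_continuousLinearMapAt (R := ℝ) c (mfderiv J I e p' (X p'))).symm.trans
    (t.symmL_apply (R := ℝ) c _)

/-- Brackets of related vector fields are related. -/
lemma Related.bracket [T2Space M] [T2Space N] (he : ContMDiff J I ∞ e) {X Y : VF J N}
    {X' Y' : VF I M} {p : N} (hX : SmoothVF J X) (hY : SmoothVF J Y) (hX' : SmoothVF I X')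
    (hY' : SmoothVF I Y') (h1 : Related J I e X X' p) (h2 : Related J I e Y Y' p) :
    Related J I e (mlieBracket J X Y) (mlieBracket I X' Y') p := by
  have key : ∀ p, Related J I e X X' p → Related J I e Y Y' p →
      mfderiv J I e p (mlieBracket J X Y p) = mlieBracket I X' Y' (e p) := by
    intro p h1 h2
    apply eq_of_forall_mvfderiv_eq
    intro f hf
    rw [← mvfderiv_comp_map he p (hf.mdiff _)]
    have e1 := dir_bracket hX hY (hf.comp_map he) p
    have e2 := dir_bracket hX' hY' hf (e p)
    have e3 : dir J X (dir J Y fun x => f (e x)) p = dir I X' (dir I Y' f) (e p) := by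
      rw [dir_congr_fun X (h2.dir_eq he hf)]
      exact (h1.dir_eq he (hY'.dir hf)).self_of_nhds
    have e4 : dir J Y (dir J X fun x => f (e x)) p = dir I Y' (dir I X' f) (e p) := by
      rw [dir_congr_fun Y (h1.dir_eq he hf)]
      exact (h2.dir_eq he (hX'.dir hf)).self_of_nhds
    rw [e3, e4, ← e2] at e1
    exact e1
  filter_upwards [h1.eventually_nhds, h2.eventually_nhds] with p' a b
  exact key p' a b

/-- A vector field on an immersed manifold which extends to a smooth field is smooth. -/
lemma smoothVF_of_related [T2Space M] [T2Space N] [J.Boundaryless] (he : ContMDiff J I ∞ e)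
    (hinj : ∀ p, Function.Injective (mfderiv J I e p)) {X : VF J N}
    (h : ∀ p, ∃ X' : VF I M, SmoothVF I X' ∧ Related J I e X X' p) : SmoothVF J X := by
  apply smoothVF_of_dir
  intro f hf p
  obtain ⟨X', hX', hr⟩ := h p
  obtain ⟨f', hf', hff⟩ := exists_extension_fn he p (hinj p) hf
  have h1 := (hX'.dir hf').comp_map he p
  refine h1.congr_of_eventuallyEq ?_
  filter_upwards [hr.dir_eq he hf', hff.eventually_nhds] with p' a b
  rw [← a]
  exact dir_congr_fun X (b.mono fun x hx => hx.symm)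

end Immersion

end NEH

namespace NEH

open VectorField Filter Set

/-! ### The connection induced on a totally geodesic immersed manifold. -/

section InducedConnection

variable {E : Type*} [NormedAddCommGroup E] [NormedSpace ℝ E] [FiniteDimensional ℝ E]
  {H : Type*} [TopologicalSpace H] {I : ModelWithCorners ℝ E H}
  {M : Type*} [TopologicalSpace M] [ChartedSpace H M] [IsManifold I ∞ M] [T2Space M]
  {E' : Type*} [NormedAddCommGroup E'] [NormedSpace ℝ E'] [FiniteDimensional ℝ E']
  {H' : Type*} [TopologicalSpace H'] {J : ModelWithCorners ℝ E' H'}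
  {N : Type*} [TopologicalSpace N] [ChartedSpace H' N] [IsManifold J ∞ N] [T2Space N]
  [J.Boundaryless] {e : N → M} {g : Bilin I M}

lemma Related.add {X Y : VF J N} {X' Y' : VF I M} {p : N} (h1 : Related J I e X X' p)
    (h2 : Related J I e Y Y' p) : Related J I e (X + Y) (X' + Y') p := by
  filter_upwards [h1, h2] with p' a b
  simp [a, b]

lemma Related.smul {X : VF J N} {X' : VF I M} {p : N} {f : N → ℝ} {f' : M → ℝ}
    (hf : ∀ᶠ p' in 𝓝 p, f' (e p') = f p') (h1 : Related J I e X X' p) :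
    Related J I e (f • X) (f' • X') p := by
  filter_upwards [h1, hf] with p' a b
  simp [a, b]

lemma Related.at {X : VF J N} {X' : VF I M} {p : N} (h : Related J I e X X' p) :
    mfderiv J I e p (X p) = X' (e p) := h.self_of_nhds

lemma Related.nhds {X : VF J N} {X' : VF I M} {p : N} (h : Related J I e X X' p) :
    ∀ᶠ p' in 𝓝 p, Related J I e X X' p' := h.eventually_nhds

variable (I J e) in
/-- The Levi-Civita connection preserves tangency to the immersed manifold. -/
def TotallyGeodesic (g : Bilin I M) : Prop :=
  ∀ (X Y : VF J N) (X' Y' : VF I M) (p : N), SmoothVF J X → SmoothVF J Y → SmoothVF I X' →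
    SmoothVF I Y' → Related J I e X X' p → Related J I e Y Y' p →
    ∃ w : TangentSpace J p, mfderiv J I e p w = nabla I g X' Y' (e p)

/-- Tangential derivatives of a field vanishing along the immersed manifold. -/
lemma nabla_eq_zero_of_related_zero (hg : IsMetric I g) (he : ContMDiff J I ∞ e) {X' W : VF I M}
    (hX' : SmoothVF I X') (hW : SmoothVF I W) {p : N} {x : TangentSpace J p}
    (hx : mfderiv J I e p x = X' (e p)) (h0 : ∀ᶠ p' in 𝓝 p, W (e p') = 0) :
    nabla I g X' W (e p) = 0 := by
  apply hg.ext_vec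
  intro Z hZ
  have h1 := nabla_metric hg hX' hW hZ (e p)
  have h2 : dir I X' (pair I g W Z) (e p) = 0 := by
    unfold dir
    rw [← hx, ← mvfderiv_comp_map he p ((hg.smooth hW hZ).mdiff _)]
    rw [mvfderiv_congr (g := fun _ => (0 : ℝ)), mvfderiv_const]
    · rfl
    · filter_upwards [h0] with p' hp'
      simp [pair, hp']
  have h3 : pair I g W (nabla I g X' Z) (e p) = 0 := by simp [pair, h0.self_of_nhds]
  rw [h2, h3, add_zero] at h1
  simpa [pair] using h1.symm

/-- The covariant derivative depends only on the fields along the immersed manifold. -/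
lemma nabla_eq_of_related (hg : IsMetric I g) (he : ContMDiff J I ∞ e) {X Y : VF J N}
    {X' X'' Y' Y'' : VF I M} {p : N} (hX' : SmoothVF I X') (hX'' : SmoothVF I X'')
    (hY' : SmoothVF I Y') (hY'' : SmoothVF I Y'') (h1 : Related J I e X X' p)
    (h2 : Related J I e X X'' p) (h3 : Related J I e Y Y' p) (h4 : Related J I e Y Y'' p) :
    nabla I g X' Y' (e p) = nabla I g X'' Y'' (e p) := by
  rw [nabla_congr_left hg hX' hX'' hY' (h1.at.symm.trans h2.at)]
  have h5 := nabla_add_right hg hX'' hY'' (hY'.sub hY'')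
  rw [add_sub_cancel] at h5
  rw [h5, Pi.add_apply, nabla_eq_zero_of_related_zero hg he hX'' (hY'.sub hY'') h2.at, add_zero]
  filter_upwards [h3, h4] with p' a b
  simp [← a, ← b]

variable (hg : IsMetric I g) (he : ContMDiff J I ∞ e)
  (hinj : ∀ p, Function.Injective (mfderiv J I e p)) (htg : TotallyGeodesic I J e g)
include hg he htg

/-- The choice in `inducedD` asks for one vector that serves all extensions. Tangency supplies it
for one pair of extensions, and ∇ along the submanifold does not depend on the extensions. -/
lemma inducedD_spec {X Y : VF J N} (hX : SmoothVF J X) (hY : SmoothVF J Y) {X' Y' : VF I M}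
    (hX' : SmoothVF I X') (hY' : SmoothVF I Y') {p : N} (h1 : Related J I e X X' p)
    (h2 : Related J I e Y Y' p) :
    mfderiv J I e p (inducedD I J g e X Y p) = nabla I g X' Y' (e p) := by
  obtain ⟨w, hw⟩ := htg X Y X' Y' p hX hY hX' hY' h1 h2
  exact Classical.epsilon_spec (p := fun w : TangentSpace J p =>
    ∀ X' Y' : VF I M, SmoothVF I X' → SmoothVF I Y' →
      (∀ᶠ p' in 𝓝 p, mfderiv J I e p' (X p') = X' (e p')) →
      (∀ᶠ p' in 𝓝 p, mfderiv J I e p' (Y p') = Y' (e p')) →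
      mfderiv J I e p w = nabla I g X' Y' (e p))
    ⟨w, fun X'' Y'' hX'' hY'' a b => by
      rw [hw]
      exact nabla_eq_of_related hg he hX' hX'' hY' hY'' h1 a h2 b⟩ X' Y' hX' hY' h1 h2

lemma Related.inducedD {X Y : VF J N} (hX : SmoothVF J X) (hY : SmoothVF J Y) {X' Y' : VF I M}
    (hX' : SmoothVF I X') (hY' : SmoothVF I Y') {p : N} (h1 : Related J I e X X' p)
    (h2 : Related J I e Y Y' p) :
    Related J I e (NEH.inducedD I J g e X Y) (nabla I g X' Y') p := by
  filter_upwards [h1.nhds, h2.nhds] with p' a b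
  exact inducedD_spec hg he htg hX hY hX' hY' a b

include hinj

lemma SmoothVF.inducedD {X Y : VF J N} (hX : SmoothVF J X) (hY : SmoothVF J Y) :
    SmoothVF J (inducedD I J g e X Y) := by
  apply smoothVF_of_related (I := I) he hinj
  intro p
  obtain ⟨X', hX', h1⟩ := exists_extension he p (hinj p) hX
  obtain ⟨Y', hY', h2⟩ := exists_extension he p (hinj p) hY
  exact ⟨_, SmoothVF.nabla hg hX' hY', h1.inducedD hg he htg hX hY hX' hY' h2⟩

lemma inducedD_torsion {X Y : VF J N} (hX : SmoothVF J X) (hY : SmoothVF J Y) :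
    inducedD I J g e X Y - inducedD I J g e Y X = mlieBracket J X Y := by
  ext1 p
  obtain ⟨X', hX', h1⟩ := exists_extension he p (hinj p) hX
  obtain ⟨Y', hY', h2⟩ := exists_extension he p (hinj p) hY
  apply hinj p
  rw [Pi.sub_apply, map_sub, inducedD_spec hg he htg hX hY hX' hY' h1 h2,
    inducedD_spec hg he htg hY hX hY' hX' h2 h1, (h1.bracket he hX hY hX' hY' h2).at,
    ← nabla_torsion hg hX' hY']
  rfl

lemma inducedD_add_left {X X₂ Y : VF J N} (hX : SmoothVF J X) (hX₂ : SmoothVF J X₂)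
    (hY : SmoothVF J Y) :
    inducedD I J g e (X + X₂) Y = inducedD I J g e X Y + inducedD I J g e X₂ Y := by
  ext1 p
  obtain ⟨X', hX', h1⟩ := exists_extension he p (hinj p) hX
  obtain ⟨X₂', hX₂', h3⟩ := exists_extension he p (hinj p) hX₂
  obtain ⟨Y', hY', h2⟩ := exists_extension he p (hinj p) hY
  apply hinj p
  rw [Pi.add_apply, map_add, inducedD_spec hg he htg hX hY hX' hY' h1 h2,
    inducedD_spec hg he htg hX₂ hY hX₂' hY' h3 h2,
    inducedD_spec hg he htg (hX.add hX₂) hY (hX'.add hX₂') hY' (h1.add h3) h2,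
    nabla_add_left hg hX' hX₂' hY']
  rfl

lemma inducedD_add_right {X Y Y₂ : VF J N} (hX : SmoothVF J X) (hY : SmoothVF J Y)
    (hY₂ : SmoothVF J Y₂) :
    inducedD I J g e X (Y + Y₂) = inducedD I J g e X Y + inducedD I J g e X Y₂ := by
  ext1 p
  obtain ⟨X', hX', h1⟩ := exists_extension he p (hinj p) hX
  obtain ⟨Y₂', hY₂', h3⟩ := exists_extension he p (hinj p) hY₂
  obtain ⟨Y', hY', h2⟩ := exists_extension he p (hinj p) hY
  apply hinj p
  rw [Pi.add_apply, map_add, inducedD_spec hg he htg hX hY hX' hY' h1 h2,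
    inducedD_spec hg he htg hX hY₂ hX' hY₂' h1 h3,
    inducedD_spec hg he htg hX (hY.add hY₂) hX' (hY'.add hY₂') h1 (h2.add h3),
    nabla_add_right hg hX' hY' hY₂']
  rfl

lemma inducedD_smul_left {f : N → ℝ} {X Y : VF J N} (hf : SmoothFn J f) (hX : SmoothVF J X)
    (hY : SmoothVF J Y) :
    inducedD I J g e (f • X) Y = f • inducedD I J g e X Y := by
  ext1 p
  obtain ⟨X', hX', h1⟩ := exists_extension he p (hinj p) hX
  obtain ⟨Y', hY', h2⟩ := exists_extension he p (hinj p) hY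
  obtain ⟨f', hf', h3⟩ := exists_extension_fn he p (hinj p) hf
  apply hinj p
  rw [Pi.smul_apply', map_smul, inducedD_spec hg he htg hX hY hX' hY' h1 h2,
    inducedD_spec hg he htg (SmoothVF.smul hf hX) hY (SmoothVF.smul hf' hX') hY'
      (Related.smul h3 h1) h2, nabla_smul_left hg hf' hX' hY', Pi.smul_apply', h3.self_of_nhds]

lemma inducedD_smul_right {f : N → ℝ} {X Y : VF J N} (hf : SmoothFn J f) (hX : SmoothVF J X)
    (hY : SmoothVF J Y) :
    inducedD I J g e X (f • Y) = dir J X f • Y + f • inducedD I J g e X Y := by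
  ext1 p
  obtain ⟨X', hX', h1⟩ := exists_extension he p (hinj p) hX
  obtain ⟨Y', hY', h2⟩ := exists_extension he p (hinj p) hY
  obtain ⟨f', hf', h3⟩ := exists_extension_fn he p (hinj p) hf
  apply hinj p
  rw [Pi.add_apply, Pi.smul_apply', Pi.smul_apply', map_add, map_smul, map_smul,
    inducedD_spec hg he htg hX hY hX' hY' h1 h2,
    inducedD_spec hg he htg hX (SmoothVF.smul hf hY) hX' (SmoothVF.smul hf' hY') h1
      (Related.smul h3 h2), nabla_smul_right hg hf' hX' hY', Pi.add_apply, Pi.smul_apply',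
    Pi.smul_apply', h3.self_of_nhds, h2.at, ← (h1.dir_eq he hf').self_of_nhds,
    dir_congr_fun X h3]

/-- A Killing field tangent to the immersed manifold preserves the induced connection. -/
lemma killing_inducedD {K : VF I M} (hK : SmoothVF I K)
    (hKg : ∀ Y Z, SmoothVF I Y → SmoothVF I Z → ∀ p, lieBilin I K g Y Z p = 0)
    {k : VF J N} (hk : SmoothVF J k) (hkK : ∀ p, mfderiv J I e p (k p) = K (e p))
    {X Y : VF J N} (hX : SmoothVF J X) (hY : SmoothVF J Y) :
    mlieBracket J k (inducedD I J g e X Y) =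
      inducedD I J g e (mlieBracket J k X) Y + inducedD I J g e X (mlieBracket J k Y) := by
  ext1 p
  obtain ⟨X', hX', h1⟩ := exists_extension he p (hinj p) hX
  obtain ⟨Y', hY', h2⟩ := exists_extension he p (hinj p) hY
  have hr : Related J I e k K p := Eventually.of_forall hkK
  apply hinj p
  rw [(hr.bracket he hk (SmoothVF.inducedD hg he hinj htg hX hY) hK (SmoothVF.nabla hg hX' hY')
    (h1.inducedD hg he htg hX hY hX' hY' h2)).at, killing_nabla hg hK hKg hX' hY', Pi.add_apply,
    Pi.add_apply, map_add,
    inducedD_spec hg he htg (hk.bracket hX) hY (hK.bracket hX') hY'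
      (hr.bracket he hk hX hK hX' h1) h2,
    inducedD_spec hg he htg hX (hk.bracket hY) hX' (hK.bracket hY') h1
      (hr.bracket he hk hY hK hY' h2)]

end InducedConnection

/-! ### Pullbacks of tensors and of their Lie derivatives. -/

section PullbackMetric

variable {E : Type*} [NormedAddCommGroup E] [NormedSpace ℝ E] [FiniteDimensional ℝ E]
  {H : Type*} [TopologicalSpace H] {I : ModelWithCorners ℝ E H}
  {M : Type*} [TopologicalSpace M] [ChartedSpace H M] [IsManifold I ∞ M] [T2Space M]
  {E' : Type*} [NormedAddCommGroup E'] [NormedSpace ℝ E'] [FiniteDimensional ℝ E']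
  {H' : Type*} [TopologicalSpace H'] {J : ModelWithCorners ℝ E' H'}
  {N : Type*} [TopologicalSpace N] [ChartedSpace H' N] [IsManifold J ∞ N] [T2Space N]
  [J.Boundaryless] {e : N → M} {g : Bilin I M}

lemma pair_pullback {X Y : VF J N} {X' Y' : VF I M} {p : N} (h1 : Related J I e X X' p)
    (h2 : Related J I e Y Y' p) :
    ∀ᶠ p' in 𝓝 p, pair J (pullbackBilin I J e g) X Y p' = pair I g X' Y' (e p') := by
  filter_upwards [h1, h2] with p' a b
  simp only [pair, pullbackBilin_apply, a, b]

lemma smoothFn_pair_pullback (he : ContMDiff J I ∞ e)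
    (hinj : ∀ p, Function.Injective (mfderiv J I e p))
    (hg : ∀ {X Y : VF I M}, SmoothVF I X → SmoothVF I Y → SmoothFn I (pair I g X Y))
    {X Y : VF J N} (hX : SmoothVF J X) (hY : SmoothVF J Y) :
    SmoothFn J (pair J (pullbackBilin I J e g) X Y) := by
  intro p
  obtain ⟨X', hX', h1⟩ := exists_extension he p (hinj p) hX
  obtain ⟨Y', hY', h2⟩ := exists_extension he p (hinj p) hY
  exact ((hg hX' hY').comp_map he p).congr_of_eventuallyEq (pair_pullback h1 h2)

lemma lieBilin_pullback (he : ContMDiff J I ∞ e)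
    (hg : ∀ {X Y : VF I M}, SmoothVF I X → SmoothVF I Y → SmoothFn I (pair I g X Y))
    {X Y Z : VF J N} (hX : SmoothVF J X) (hY : SmoothVF J Y) (hZ : SmoothVF J Z)
    {X' Y' Z' : VF I M} {p : N} (hX' : SmoothVF I X') (hY' : SmoothVF I Y') (hZ' : SmoothVF I Z')
    (h1 : Related J I e X X' p) (h2 : Related J I e Y Y' p) (h3 : Related J I e Z Z' p) :
    lieBilin J X (pullbackBilin I J e g) Y Z p = lieBilin I X' g Y' Z' (e p) := by
  unfold lieBilin
  rw [dir_congr_fun X (pair_pullback (g := g) h2 h3),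
    (h1.dir_eq he (hg hY' hZ')).self_of_nhds,
    (pair_pullback (g := g) (h1.bracket he hX hY hX' hY' h2) h3).self_of_nhds,
    (pair_pullback (g := g) h2 (h1.bracket he hX hZ hX' hZ' h3)).self_of_nhds]

end PullbackMetric

end NEH

namespace NEH

open VectorField Filter Set

/-! ### Dual systems, Gram matrices and Lorentzian forms. -/

section LinearAlgebra

variable {V : Type*} [AddCommGroup V] [Module ℝ V]

/-- Expansion of vectors with respect to a system with a dual system. -/
lemma eq_sum_of_dual {ι : Type*} [Fintype ι] [DecidableEq ι] [FiniteDimensional ℝ V] (v : ι → V)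
    (d : ι → V →ₗ[ℝ] ℝ) (hd : ∀ i j, d i (v j) = if i = j then 1 else 0)
    (hcard : Fintype.card ι = Module.finrank ℝ V) :
    ∃ b : Module.Basis ι ℝ V, (∀ i, b i = v i) ∧ ∀ i w, b.repr w i = d i w := by
  have hli : LinearIndependent ℝ v := by
    rw [Fintype.linearIndependent_iff]
    intro c hc i
    have := congrArg (d i) hc
    simpa [hd] using this
  let b := basisOfLinearIndependentOfCardEqFinrank' v hli hcard
  have hb : ∀ i, b i = v i := fun i => by simp [b]
  refine ⟨b, hb, fun i w => ?_⟩
  conv_rhs => rw [← b.sum_repr w]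
  simp [hb, hd]

lemma trace_eq_sum_of_dual {ι : Type*} [Fintype ι] [DecidableEq ι] [FiniteDimensional ℝ V]
    (v : ι → V) (d : ι → V →ₗ[ℝ] ℝ) (hd : ∀ i j, d i (v j) = if i = j then 1 else 0)
    (hcard : Fintype.card ι = Module.finrank ℝ V) (L : V →ₗ[ℝ] V) :
    LinearMap.trace ℝ V L = ∑ i, d i (L (v i)) := by
  obtain ⟨b, hb, hr⟩ := eq_sum_of_dual v d hd hcard
  rw [LinearMap.trace_eq_matrix_trace ℝ b L, Matrix.trace]
  refine Finset.sum_congr rfl fun i _ => ?_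
  rw [Matrix.diag_apply, LinearMap.toMatrix_apply, hr, hb]

open scoped MatrixOrder Matrix.Norms.L2Operator in
lemma exists_eq_conjTranspose_mul_self {m : ℕ} {A : Matrix (Fin m) (Fin m) ℝ}
    (hA : A.PosSemidef) : ∃ B : Matrix (Fin m) (Fin m) ℝ, A = B.conjTranspose * B := by
  obtain ⟨B, hB⟩ := CStarAlgebra.nonneg_iff_eq_star_mul_self.mp hA.nonneg
  exact ⟨B, hB⟩

/-- Contraction with the inverse of the Gram matrix of a system is the trace over some orthonormal
system. -/
lemma exists_orthonormal_inv_gram {m : ℕ} (q : V →ₗ[ℝ] V →ₗ[ℝ] ℝ) (hsymm : ∀ x y, q x y = q y x)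
    (hq : ∀ x, 0 ≤ q x x) (F : Fin m → V) (hdet : (Matrix.of fun i j => q (F i) (F j)).det ≠ 0) :
    ∃ F' : Fin m → V, (∀ i j, q (F' i) (F' j) = if i = j then 1 else 0) ∧
      ∀ S : V →ₗ[ℝ] V →ₗ[ℝ] ℝ,
        ∑ i, ∑ j, (Matrix.of fun i j => q (F i) (F j))⁻¹ i j * S (F i) (F j) =
          ∑ i, S (F' i) (F' i) := by
  set G : Matrix (Fin m) (Fin m) ℝ := Matrix.of fun i j => q (F i) (F j) with hG
  have hGh : G.IsHermitian := by
    ext i j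
    simp [G, hsymm (F j) (F i)]
  have hpsd : G.PosSemidef := by
    refine Matrix.PosSemidef.of_dotProduct_mulVec_nonneg hGh fun x => ?_
    have := hq (∑ i, x i • F i)
    simp only [map_sum, map_smul, LinearMap.sum_apply, LinearMap.smul_apply, smul_eq_mul] at this
    simp only [dotProduct, Matrix.mulVec, G, Matrix.of_apply, Pi.star_apply, star_trivial]
    refine this.trans_eq (Finset.sum_congr rfl fun i _ => ?_)
    congr 1
    refine Finset.sum_congr rfl fun j _ => ?_
    rw [hsymm (F j) (F i)]
    ring
  have hu : IsUnit G.det := isUnit_iff_ne_zero.2 hdet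
  have hinv : G⁻¹.PosSemidef := hpsd.inv
  -- With G⁻¹ = BᵀB one has B G Bᵀ = 1, so the rows of B combine the F i into an orthonormal system,
  -- and contraction with G⁻¹ becomes the trace over it.
  obtain ⟨B, hB⟩ := exists_eq_conjTranspose_mul_self hinv
  have hBt : B.conjTranspose = B.transpose := by ext i j; simp
  rw [hBt] at hB
  have h1 : G * (B.transpose * B) = 1 := by rw [← hB]; exact Matrix.mul_nonsing_inv G hu
  have h2 : (G * B.transpose) * B = 1 := by rw [Matrix.mul_assoc]; exact h1
  have h3 : B * (G * B.transpose) = 1 := mul_eq_one_comm.1 h2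
  refine ⟨fun i => ∑ j, B i j • F j, ?_, fun S => ?_⟩
  · intro i k
    have := congrFun (congrFun h3 i) k
    rw [Matrix.one_apply] at this
    rw [← this]
    simp only [Matrix.mul_apply, Matrix.transpose_apply, map_sum, map_smul, LinearMap.sum_apply,
      LinearMap.smul_apply, smul_eq_mul, G, Matrix.of_apply, Finset.mul_sum]
    rw [Finset.sum_comm]
    refine Finset.sum_congr rfl fun a _ => Finset.sum_congr rfl fun b _ => ?_
    ring
  rw [hB]
  simp only [Matrix.mul_apply, Matrix.transpose_apply, map_sum, map_smul, LinearMap.sum_apply,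
      LinearMap.smul_apply, smul_eq_mul, Finset.sum_mul]
  have e : ∀ i, ∑ j, ∑ x, B x i * B x j * S (F i) (F j) =
      ∑ x, ∑ j, B x i * B x j * S (F i) (F j) := fun i => Finset.sum_comm
  simp only [e]
  rw [Finset.sum_comm]
  refine Finset.sum_congr rfl fun x _ => ?_
  rw [Finset.sum_comm]
  refine Finset.sum_congr rfl fun a _ => ?_
  simp only [Finset.mul_sum]
  refine Finset.sum_congr rfl fun b _ => ?_
  ring

/-- Orthonormal systems for a form which is positive definite on the span of a system. -/
lemma exists_orthonormal {m : ℕ} (q : V →ₗ[ℝ] V →ₗ[ℝ] ℝ) (hsymm : ∀ x y, q x y = q y x)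
    (hq : ∀ x, 0 ≤ q x x) (F : Fin m → V)
    (hpos : ∀ c : Fin m → ℝ, q (∑ i, c i • F i) (∑ i, c i • F i) = 0 → c = 0) :
    ∃ B : Matrix (Fin m) (Fin m) ℝ, ∀ i k,
      q (∑ j, B i j • F j) (∑ j, B k j • F j) = if i = k then 1 else 0 := by
  set G : Matrix (Fin m) (Fin m) ℝ := Matrix.of fun i j => q (F i) (F j) with hG
  have hGh : G.IsHermitian := by
    ext i j
    simp [G, hsymm (F j) (F i)]
  have hexp : ∀ x : Fin m → ℝ, star x ⬝ᵥ (G.mulVec x) = q (∑ i, x i • F i) (∑ i, x i • F i) := by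
    intro x
    simp only [dotProduct, Matrix.mulVec, G, Matrix.of_apply, Pi.star_apply, star_trivial, map_sum,
      map_smul, LinearMap.sum_apply, LinearMap.smul_apply, smul_eq_mul, Finset.mul_sum]
    rw [Finset.sum_comm]
    refine Finset.sum_congr rfl fun i _ => Finset.sum_congr rfl fun j _ => ?_
    rw [hsymm (F j) (F i)]
    ring
  have hpd : G.PosDef := by
    refine Matrix.PosDef.of_dotProduct_mulVec_pos hGh fun x hx => ?_
    rw [hexp]
    exact lt_of_le_of_ne (hq _) fun h => hx (hpos x h.symm)
  have hu : IsUnit G.det := (Matrix.isUnit_iff_isUnit_det _).1 hpd.isUnit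
  obtain ⟨B, hB⟩ := exists_eq_conjTranspose_mul_self hpd.posSemidef.inv
  have hBt : B.conjTranspose = B.transpose := by ext i j; simp
  rw [hBt] at hB
  have h1 : G * (B.transpose * B) = 1 := by rw [← hB]; exact Matrix.mul_nonsing_inv G hu
  have h2 : (G * B.transpose) * B = 1 := by rw [Matrix.mul_assoc]; exact h1
  have h3 : B * (G * B.transpose) = 1 := mul_eq_one_comm.1 h2
  -- The matrix is returned rather than the new system, so that linear conditions satisfied by the F
  -- i visibly pass to their combinations.
  refine ⟨B, fun i k => ?_⟩
  have := congrFun (congrFun h3 i) k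
  rw [Matrix.one_apply] at this
  rw [← this]
  simp only [Matrix.mul_apply, Matrix.transpose_apply, map_sum, map_smul, LinearMap.sum_apply,
    LinearMap.smul_apply, smul_eq_mul, G, Matrix.of_apply, Finset.mul_sum]
  rw [Finset.sum_comm]
  refine Finset.sum_congr rfl fun a _ => Finset.sum_congr rfl fun b _ => ?_
  ring

/-! ### Lorentzian forms -/

/-- The signature of the bilinear form `g` is `(-,+,…,+)`. -/
def IsLorentz {k : ℕ} (g : V →ₗ[ℝ] V →ₗ[ℝ] ℝ) (b : Module.Basis (Fin (k + 1)) ℝ V) : Prop :=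
  ∀ i j, g (b i) (b j) = if i = j then (if i = 0 then -1 else 1) else 0

variable {k : ℕ} {g : V →ₗ[ℝ] V →ₗ[ℝ] ℝ} {b : Module.Basis (Fin (k + 1)) ℝ V}

lemma IsLorentz.eq (h : IsLorentz g b) (v w : V) :
    g v w = - (b.repr v 0 * b.repr w 0) + ∑ i : Fin k, b.repr v i.succ * b.repr w i.succ := by
  conv_lhs => rw [← b.sum_repr v, ← b.sum_repr w]
  simp only [map_sum, map_smul, LinearMap.sum_apply, LinearMap.smul_apply, h _ _, smul_eq_mul,
    mul_ite, mul_zero, Finset.sum_ite_eq', Finset.mem_univ, if_true]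
  rw [Fin.sum_univ_succ]
  simp [Fin.succ_ne_zero, mul_comm]

lemma IsLorentz.symm (h : IsLorentz g b) (v w : V) : g v w = g w v := by
  rw [h.eq v w, h.eq w v, mul_comm (b.repr v 0)]
  congr 1
  exact Finset.sum_congr rfl fun i _ => mul_comm _ _

lemma IsLorentz.nondeg (h : IsLorentz g b) (v : V) (hv : ∀ w, g v w = 0) : v = 0 := by
  apply b.ext_elem
  intro i
  have h1 := hv (b i)
  rw [← b.sum_repr v] at h1
  simp only [map_sum, map_smul, LinearMap.sum_apply, LinearMap.smul_apply, h _ _, smul_eq_mul,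
    mul_ite, mul_zero, Finset.sum_ite_eq', Finset.mem_univ, if_true] at h1
  split_ifs at h1 with h2
  · simp; linarith
  · simp; linarith

/-- The orthogonal complement of a null vector is semidefinite, and its null vectors are the
multiples of the given one. -/
lemma IsLorentz.null_orthogonal (h : IsLorentz g b) {l w : V} (hl : g l l = 0) (hl0 : l ≠ 0)
    (hlw : g l w = 0) : 0 ≤ g w w ∧ (g w w = 0 → ∃ c : ℝ, w = c • l) := by
  -- A null vector without time component has spatial part of length zero, hence vanishes.
  have hl00 : b.repr l 0 ≠ 0 := by
    intro h0
    apply hl0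
    rw [h.eq, h0] at hl
    simp only [mul_zero, neg_zero, zero_add] at hl
    have := (Finset.sum_eq_zero_iff_of_nonneg (fun i _ => mul_self_nonneg _)).1 hl
    apply b.ext_elem
    intro i
    refine Fin.cases ?_ (fun i => ?_) i
    · simpa using h0
    · simpa using mul_self_eq_zero.1 (this i (Finset.mem_univ _))
  -- This multiple of l removes the time component of w. As l is null and orthogonal to w, the
  -- square of w is unchanged and becomes a sum of squares.
  set c := b.repr w 0 / b.repr l 0 with hc
  set u := w - c • l with hu
  have hu0 : b.repr u 0 = 0 := by
    simp only [hu, map_sub, map_smul, Finsupp.coe_sub, Finsupp.coe_smul, Pi.sub_apply,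
      Pi.smul_apply, smul_eq_mul, hc]
    field_simp
    ring
  have huu : g u u = g w w := by
    simp only [hu, map_sub, map_smul, LinearMap.sub_apply, LinearMap.smul_apply, smul_eq_mul, hl,
      hlw, h.symm w l]
    ring
  have hue := h.eq u u
  rw [hu0] at hue
  simp only [mul_zero, neg_zero, zero_add] at hue
  refine ⟨?_, fun h0 => ⟨c, ?_⟩⟩
  · rw [← huu, hue]
    exact Finset.sum_nonneg fun i _ => mul_self_nonneg _
  · rw [← huu, hue] at h0
    have := (Finset.sum_eq_zero_iff_of_nonneg (fun i _ => mul_self_nonneg _)).1 h0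
    rw [← sub_eq_zero]
    change u = 0
    apply b.ext_elem
    intro i
    refine Fin.cases ?_ (fun i => ?_) i
    · simpa using hu0
    · simpa using mul_self_eq_zero.1 (this i (Finset.mem_univ _))

/-- Causal vectors in the same half of the light cone have nonpositive product. -/
lemma IsLorentz.causal (h : IsLorentz g b) {t v w : V} (ht : g t t < 0) (hv : g v v ≤ 0)
    (hw : g w w ≤ 0) (hvt : g v t ≤ 0) (hwt : g w t ≤ 0) : g v w ≤ 0 := by
  have cs : ∀ x y : V, (∑ i : Fin k, b.repr x i.succ * b.repr y i.succ) ^ 2 ≤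
      (∑ i : Fin k, b.repr x i.succ * b.repr x i.succ) *
        (∑ i : Fin k, b.repr y i.succ * b.repr y i.succ) := by
    intro x y
    have := Finset.sum_mul_sq_le_sq_mul_sq Finset.univ (fun i : Fin k => b.repr x i.succ)
      (fun i : Fin k => b.repr y i.succ)
    simpa [pow_two] using this
  have nn : ∀ x : V, 0 ≤ ∑ i : Fin k, b.repr x i.succ * b.repr x i.succ := fun x =>
    Finset.sum_nonneg fun i _ => mul_self_nonneg _
  -- By the Cauchy–Schwarz inequality in the spatial part, the sign of the product of a causal and a
  -- timelike vector is governed by their time components. Hence v, w and t lie in the same half of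
  -- the cone.
  have half : ∀ x : V, g x x ≤ 0 → g x t ≤ 0 → 0 ≤ b.repr x 0 * b.repr t 0 := by
    intro x hx hxt
    by_contra hneg
    push Not at hneg
    rw [h.eq] at hx hxt ht
    have c := cs x t
    have n1 := nn x
    have n2 := nn t
    set s := ∑ i : Fin k, b.repr x i.succ * b.repr t i.succ
    set sx := ∑ i : Fin k, b.repr x i.succ * b.repr x i.succ
    set st := ∑ i : Fin k, b.repr t i.succ * b.repr t i.succ
    set x0 := b.repr x 0
    set t0 := b.repr t 0
    have hx0 : 0 < x0 * x0 := by
      rcases eq_or_ne x0 0 with h0 | h0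
      · rw [h0] at hneg; simp at hneg
      · exact mul_self_pos.2 h0
    have h1 : s ≤ x0 * t0 := by linarith
    have h2 : (x0 * t0) ^ 2 ≤ s ^ 2 := by nlinarith
    have h3 : sx * st ≤ (x0 * x0) * st := mul_le_mul_of_nonneg_right (by linarith) n2
    have h4 : (x0 * x0) * st < (x0 * x0) * (t0 * t0) := mul_lt_mul_of_pos_left (by linarith) hx0
    nlinarith
  have h1 := half v hv hvt
  have h2 := half w hw hwt
  have ht0 : 0 < b.repr t 0 * b.repr t 0 := by
    rw [h.eq] at ht
    have := nn t
    linarith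
  have h3 : 0 ≤ b.repr v 0 * b.repr w 0 := by
    by_contra hneg
    push Not at hneg
    have : 0 ≤ (b.repr v 0 * b.repr w 0) * (b.repr t 0 * b.repr t 0) := by
      have := mul_nonneg h1 h2
      linarith
    nlinarith
  rw [h.eq] at hv hw ⊢
  have c := cs v w
  have n1 := nn v
  have n2 := nn w
  set s := ∑ i : Fin k, b.repr v i.succ * b.repr w i.succ
  set sv := ∑ i : Fin k, b.repr v i.succ * b.repr v i.succ
  set sw := ∑ i : Fin k, b.repr w i.succ * b.repr w i.succ
  have h4 : sv * sw ≤ (b.repr v 0 * b.repr v 0) * (b.repr w 0 * b.repr w 0) :=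
    mul_le_mul (by linarith) (by linarith) n2 (mul_self_nonneg _)
  have h5 : s ^ 2 ≤ (b.repr v 0 * b.repr w 0) ^ 2 := by nlinarith
  have h6 := abs_le_of_sq_le_sq' h5 h3
  linarith [h6.2]

end LinearAlgebra

/-! ### Lie derivatives of traces with respect to a possibly degenerate metric. -/

section TraceLie

variable {E : Type*} [NormedAddCommGroup E] [NormedSpace ℝ E] [FiniteDimensional ℝ E]
  {H : Type*} [TopologicalSpace H] {I : ModelWithCorners ℝ E H}
  {M : Type*} [TopologicalSpace M] [ChartedSpace H M] [IsManifold I ∞ M]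

/-- A bilinear form at a point as an algebraic bilinear map. -/
noncomputable def toLin₂ (S : Bilin I M) (p : M) : TangentSpace I p →ₗ[ℝ] TangentSpace I p →ₗ[ℝ] ℝ :=
  LinearMap.mk₂ ℝ (fun x y => S p x y) (by simp) (by simp) (by simp) (by simp)

@[simp] lemma toLin₂_apply (S : Bilin I M) (p : M) (x y : TangentSpace I p) :
    toLin₂ S p x y = S p x y := rfl

/-- The inverse of the Gram matrix of a system which is orthonormal at a point. -/
lemma inv_gram_smooth {m : ℕ} {q : Bilin I M}
    (hq : ∀ {X Y : VF I M}, SmoothVF I X → SmoothVF I Y → SmoothFn I (pair I q X Y)) {p : M}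
    {F : Fin m → VF I M} (hF : ∀ i, SmoothVF I (F i)) (hon : OrthonormalAt I q F p) :
    (Matrix.of fun i j => q p (F i p) (F j p)) = 1 ∧
    (∀ᶠ x in 𝓝 p, (Matrix.of fun i j => q x (F i x) (F j x)).det ≠ 0) ∧
    ∀ i j, ContMDiffAt I 𝓘(ℝ, ℝ) ∞
      (fun x => (Matrix.of fun i j => q x (F i x) (F j x))⁻¹ i j) p := by
  let G : M → Matrix (Fin m) (Fin m) ℝ := fun x => Matrix.of fun i j => q x (F i x) (F j x)
  have hGp : G p = 1 := by
    ext i j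
    simp only [G, Matrix.of_apply, Matrix.one_apply]
    exact hon i j
  have hGs : ∀ i j, SmoothFn I (fun x => G x i j) := fun i j => hq (hF i) (hF j)
  have hdet : ∀ᶠ x in 𝓝 p, (G x).det ≠ 0 := by
    have hc : Continuous G := by
      refine continuous_matrix fun i j => ?_
      exact ContMDiff.continuous (hGs i j)
    have := hc.matrix_det.continuousAt (x := p)
    exact this.eventually_ne (by simp [hGp])
  refine ⟨hGp, hdet, fun i j => ?_⟩
  refine contMDiffAt_of_linear_system (I := I) (p := p) (G := fun x a b => G x a b)
    (b := fun _ a => if i = a then 1 else 0) (y := fun x a => (G x)⁻¹ i a)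
    (fun a b => hGs a b p) (fun a => contMDiffAt_const) ?_ ?_ j
  · intro c hc
    ext a
    have := hc a
    simpa [hGp, Matrix.one_apply] using this
  · filter_upwards [hdet] with x hx a
    have := congrFun (congrFun (Matrix.nonsing_inv_mul _ (isUnit_iff_ne_zero.2 hx)) i) a
    rwa [Matrix.mul_apply, Matrix.one_apply] at this

/-- The trace of the Lie derivative of a trace-free tensor. -/
lemma trace_lieBilin {m : ℕ} {q S : Bilin I M}
    (hq : ∀ {X Y : VF I M}, SmoothVF I X → SmoothVF I Y → SmoothFn I (pair I q X Y))
    (hS : ∀ {X Y : VF I M}, SmoothVF I X → SmoothVF I Y → SmoothFn I (pair I S X Y))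
    (hsymm : ∀ p x y, q p x y = q p y x) (hpos : ∀ p x, 0 ≤ q p x x) {p : M} {k : VF I M}
    {F : Fin m → VF I M} (hF : ∀ i, SmoothVF I (F i)) (hon : OrthonormalAt I q F p)
    (htr : ∀ᶠ x in 𝓝 p, ∀ F' : Fin m → TangentSpace I x,
      (∀ i j, q x (F' i) (F' j) = if i = j then 1 else 0) → ∑ i, S x (F' i) (F' i) = 0)
    (hdec : ∀ i, ∃ ξ : TangentSpace I p, mlieBracket I k (F i) p =
      ∑ j, q p (mlieBracket I k (F i) p) (F j p) • F j p + ξ ∧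
        S p ξ (F i p) + S p (F i p) ξ = 0) :
    ∑ i, lieBilin I k S (F i) (F i) p =
      ∑ i, ∑ j, S p (F i p) (F j p) * lieBilin I k q (F i) (F j) p := by
  let G : M → Matrix (Fin m) (Fin m) ℝ := fun x => Matrix.of fun i j => q x (F i x) (F j x)
  obtain ⟨hGp, hdet, hPc⟩ := inv_gram_smooth hq hF hon
  change G p = 1 at hGp
  have hGs : ∀ i j, SmoothFn I (fun x => G x i j) := fun i j => hq (hF i) (hF j)
  -- The F i are orthonormal at p only, so the trace nearby is written with the inverse Gram matrix
  -- P. At p, where G = 1, the derivative of P is minus that of G.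
  let P : M → Matrix (Fin m) (Fin m) ℝ := fun x => (G x)⁻¹
  have hPG : ∀ᶠ x in 𝓝 p, P x * G x = 1 := by
    filter_upwards [hdet] with x hx
    exact Matrix.nonsing_inv_mul _ (isUnit_iff_ne_zero.2 hx)
  have hPp : P p = 1 := by simp [P, hGp]
  have hPs : ∀ i j, MDifferentiableAt I 𝓘(ℝ, ℝ) (fun x => P x i j) p := fun i j =>
    (hPc i j).mdifferentiableAt (by simp)
  have hGd : ∀ i j, MDifferentiableAt I 𝓘(ℝ, ℝ) (fun x => G x i j) p := fun i j =>
    (hGs i j).mdiff p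
  have hP' : ∀ i j, dir I k (fun x => P x i j) p = - dir I k (fun x => G x i j) p := by
    intro i j
    have h1 : dir I k (fun x => ∑ a, P x i a * G x a j) p = 0 := by
      refine dir_eq_zero_of_eventually_const k (c := if i = j then 1 else 0) ?_
      filter_upwards [hPG] with x hx
      have := congrFun (congrFun hx i) j
      rwa [Matrix.mul_apply, Matrix.one_apply] at this
    rw [dir_fun_sum k (f := fun a x => P x i a * G x a j) fun a _ => (hPs i a).mul (hGd a j)] at h1
    have h2 : ∀ a, dir I k (fun x => P x i a * G x a j) p =
        (if i = a then dir I k (fun x => G x a j) p else 0) +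
          (if a = j then dir I k (fun x => P x i a) p else 0) := by
      intro a
      rw [dir_fun_mul k (hPs i a) (hGd a j), hPp, hGp, Matrix.one_apply, Matrix.one_apply]
      simp [ite_mul]
    simp only [h2, Finset.sum_add_distrib, Finset.sum_ite_eq, Finset.sum_ite_eq', Finset.mem_univ,
      if_true] at h1
    linarith
  let Sf : Fin m → Fin m → M → ℝ := fun i j => pair I S (F i) (F j)
  have hSd : ∀ i j, MDifferentiableAt I 𝓘(ℝ, ℝ) (Sf i j) p := fun i j =>
    (hS (hF i) (hF j)).mdiff p
  -- The function being differentiated is the trace of S near p, which vanishes identically.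
  have hz : dir I k (fun x => ∑ i, ∑ j, P x i j * Sf i j x) p = 0 := by
    refine dir_eq_zero_of_eventually_const k (c := 0) ?_
    filter_upwards [hdet, htr] with x hx hx'
    obtain ⟨F', hF', h⟩ := exists_orthonormal_inv_gram (toLin₂ q x) (hsymm x) (hpos x)
      (fun i => F i x) hx
    exact (h (toLin₂ S x)).trans (hx' F' hF')
  rw [dir_fun_sum k (f := fun i x => ∑ j, P x i j * Sf i j x) fun i _ => by
    have := fun j => (hPs i j).mul (hSd i j)
    classical
    have hsum : ∀ s : Finset (Fin m), MDifferentiableAt I 𝓘(ℝ, ℝ)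
        (fun x => ∑ j ∈ s, P x i j * Sf i j x) p := by
      intro s
      induction s using Finset.induction_on with
      | empty => simpa using mdifferentiableAt_const
      | insert a s ha ih =>
        simp only [Finset.sum_insert ha]
        exact (this a).add ih
    exact hsum _] at hz
  have hz2 : ∀ i, dir I k (fun x => ∑ j, P x i j * Sf i j x) p =
      dir I k (Sf i i) p - ∑ j, Sf i j p * dir I k (fun x => G x i j) p := by
    intro i
    rw [dir_fun_sum k (f := fun j x => P x i j * Sf i j x) fun j _ => (hPs i j).mul (hSd i j)]
    have : ∀ j, dir I k (fun x => P x i j * Sf i j x) p =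
        (if i = j then dir I k (Sf i j) p else 0) - Sf i j p * dir I k (fun x => G x i j) p := by
      intro j
      rw [dir_fun_mul k (hPs i j) (hSd i j), hPp, hP', Matrix.one_apply]
      simp only [ite_mul, one_mul, zero_mul]
      ring
    simp only [this, Finset.sum_sub_distrib, Finset.sum_ite_eq, Finset.mem_univ, if_true]
  simp only [hz2, Finset.sum_sub_distrib] at hz
  let A : Fin m → Fin m → ℝ := fun i j => q p (mlieBracket I k (F i) p) (F j p)
  have hG' : ∀ i j, dir I k (fun x => G x i j) p = lieBilin I k q (F i) (F j) p + A i j + A j i := by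
    intro i j
    have : (fun x => G x i j) = pair I q (F i) (F j) := rfl
    rw [this, lieBilin]
    simp only [A, pair]
    rw [hsymm p (F i p) (mlieBracket I k (F j) p)]
    ring
  -- The part ξ of [k, F i] outside the span of the F j is harmless because S annihilates it in the
  -- required symmetric combination. The coefficients A i j cancel against those from the derivative
  -- of the Gram matrix.
  have hS' : ∀ i, dir I k (Sf i i) p = lieBilin I k S (F i) (F i) p +
      (∑ j, A i j * Sf j i p + ∑ j, A i j * Sf i j p) := by
    intro i
    obtain ⟨ξ, h1, h2⟩ := hdec i
    have e1 : S p (mlieBracket I k (F i) p) (F i p) = ∑ j, A i j * Sf j i p + S p ξ (F i p) := by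
      rw [h1]
      simp only [map_add, map_sum, map_smul, _root_.add_apply, _root_.sum_apply, _root_.smul_apply,
        smul_eq_mul]
      rfl
    have e2 : S p (F i p) (mlieBracket I k (F i) p) = ∑ j, A i j * Sf i j p + S p (F i p) ξ := by
      rw [h1]
      simp only [map_add, map_sum, map_smul, smul_eq_mul]
      rfl
    simp only [lieBilin, pair] at e1 e2 ⊢
    rw [e1, e2]
    change _ = dir I k (Sf i i) p - _ - _ + _
    linarith
  simp only [hS', hG', Finset.sum_add_distrib, mul_add] at hz
  have hsw : ∑ i, ∑ j, Sf i j p * A j i = ∑ i, ∑ j, A i j * Sf j i p := by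
    rw [Finset.sum_comm]
    exact Finset.sum_congr rfl fun i _ => Finset.sum_congr rfl fun j _ => mul_comm _ _
  have hsw2 : ∑ i, ∑ j, Sf i j p * A i j = ∑ i, ∑ j, A i j * Sf i j p :=
    Finset.sum_congr rfl fun i _ => Finset.sum_congr rfl fun j _ => mul_comm _ _
  have hfin : ∑ i, ∑ j, S p (F i p) (F j p) * lieBilin I k q (F i) (F j) p =
      ∑ i, ∑ j, Sf i j p * lieBilin I k q (F i) (F j) p := rfl
  rw [hfin]
  linarith

end TraceLie

end NEH

namespace NEH

open VectorField Filter Set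

/-! ### The curvature as a tensor and the Ricci tensor as a trace. -/

section Curvature

variable {E : Type*} [NormedAddCommGroup E] [NormedSpace ℝ E] [FiniteDimensional ℝ E]
  {H : Type*} [TopologicalSpace H] {I : ModelWithCorners ℝ E H}
  {M : Type*} [TopologicalSpace M] [ChartedSpace H M] [IsManifold I ∞ M] [T2Space M]

/-- A function of pairs of vector fields which is bilinear over the smooth functions comes from a
tensor field. -/
lemma exists_bilin_of_tensorial (Φ : VF I M → VF I M → M → ℝ)
    (hadd₁ : ∀ X X' Y, SmoothVF I X → SmoothVF I X' → SmoothVF I Y →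
      ∀ p, Φ (X + X') Y p = Φ X Y p + Φ X' Y p)
    (hsmul₁ : ∀ f X Y, SmoothFn I f → SmoothVF I X → SmoothVF I Y →
      ∀ p, Φ (f • X) Y p = f p * Φ X Y p)
    (hadd₂ : ∀ X Y Y', SmoothVF I X → SmoothVF I Y → SmoothVF I Y' →
      ∀ p, Φ X (Y + Y') p = Φ X Y p + Φ X Y' p)
    (hsmul₂ : ∀ f X Y, SmoothFn I f → SmoothVF I X → SmoothVF I Y →
      ∀ p, Φ X (f • Y) p = f p * Φ X Y p) :
    ∃ S : Bilin I M, ∀ X Y, SmoothVF I X → SmoothVF I Y → ∀ p, S p (X p) (Y p) = Φ X Y p := by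
  have key : ∀ p : M, ∃ s : TangentSpace I p →L[ℝ] TangentSpace I p →L[ℝ] ℝ,
      ∀ X Y, SmoothVF I X → SmoothVF I Y → s (X p) (Y p) = Φ X Y p := by
    intro p
    have h1 : ∀ X, SmoothVF I X → ∃ L : TangentSpace I p →ₗ[ℝ] ℝ,
        ∀ Y, SmoothVF I Y → Φ X Y p = L (Y p) := fun X hX =>
      exists_linear_of_tensorial (fun Y => Φ X Y p) (fun Y Y' hY hY' => hadd₂ X Y Y' hX hY hY' p)
        (fun f Y hf hY => hsmul₂ f X Y hf hX hY p)
    classical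
    let A : VF I M → (TangentSpace I p →ₗ[ℝ] ℝ) := fun X =>
      if hX : SmoothVF I X then (h1 X hX).choose else 0
    have hA : ∀ X, SmoothVF I X → ∀ Y, SmoothVF I Y → Φ X Y p = A X (Y p) := by
      intro X hX
      simp only [A, dif_pos hX]
      exact (h1 X hX).choose_spec
    obtain ⟨L, hL⟩ := exists_linear_of_tensorial (p := p) A
      (by
        intro X X' hX hX'
        ext w
        obtain ⟨Y, hY, rfl⟩ := exists_smoothVF_apply_eq I p w
        rw [LinearMap.add_apply, ← hA _ (hX.add hX') Y hY, ← hA _ hX Y hY, ← hA _ hX' Y hY,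
          hadd₁ X X' Y hX hX' hY])
      (by
        intro f X hf hX
        ext w
        obtain ⟨Y, hY, rfl⟩ := exists_smoothVF_apply_eq I p w
        rw [LinearMap.smul_apply, ← hA _ (SmoothVF.smul hf hX) Y hY, ← hA _ hX Y hY,
          hsmul₁ f X Y hf hX hY, smul_eq_mul])
    have : FiniteDimensional ℝ (TangentSpace I p) := inferInstanceAs (FiniteDimensional ℝ E)
    have : T2Space (TangentSpace I p) := inferInstanceAs (T2Space E)
    refine ⟨LinearMap.toContinuousLinearMap
      ((LinearMap.toContinuousLinearMap (𝕜 := ℝ) (E := TangentSpace I p) (F' := ℝ)).toLinearMap ∘ₗ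
        L), fun X Y hX hY => ?_⟩
    rw [hA X hX Y hY, hL X hX]
    rfl
  choose S hS using key
  exact ⟨S, fun X Y hX hY p => hS p X Y hX hY⟩

variable {g : Bilin I M} (hg : IsMetric I g)

include hg

lemma lieBilin_eq_nabla {K X Y : VF I M} (hK : SmoothVF I K) (hX : SmoothVF I X)
    (hY : SmoothVF I Y) (p : M) : lieBilin I K g X Y p =
      pair I g (nabla I g X K) Y p + pair I g X (nabla I g Y K) p := by
  have h1 := nabla_metric hg hK hX hY p
  have h2 := congrFun (nabla_torsion hg hK hX) p
  have h3 := congrFun (nabla_torsion hg hK hY) p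
  simp only [lieBilin, pair] at h1 ⊢
  rw [h1, ← h2, ← h3]
  simp only [Pi.sub_apply, map_sub, _root_.sub_apply]
  ring

lemma curvature_swap {X Y Z : VF I M} (hX : SmoothVF I X) (hY : SmoothVF I Y)
    (hZ : SmoothVF I Z) : curvature I g X Y Z = - curvature I g Y X Z := by
  unfold curvature
  rw [bracket_swap X Y, nabla_neg_left hg (hY.bracket hX) hZ]
  abel

lemma curvature_add_left {X X' Y Z : VF I M} (hX : SmoothVF I X) (hX' : SmoothVF I X')
    (hY : SmoothVF I Y) (hZ : SmoothVF I Z) :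
    curvature I g (X + X') Y Z = curvature I g X Y Z + curvature I g X' Y Z := by
  unfold curvature
  rw [bracket_add_left hX hX', nabla_add_left hg hX hX' (SmoothVF.nabla hg hY hZ),
    nabla_add_left hg hX hX' hZ, nabla_add_left hg (hX.bracket hY) (hX'.bracket hY) hZ,
    nabla_add_right hg hY (SmoothVF.nabla hg hX hZ) (SmoothVF.nabla hg hX' hZ)]
  abel

lemma curvature_smul_left {f : M → ℝ} {X Y Z : VF I M} (hf : SmoothFn I f) (hX : SmoothVF I X)
    (hY : SmoothVF I Y) (hZ : SmoothVF I Z) :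
    curvature I g (f • X) Y Z = f • curvature I g X Y Z := by
  have hd : SmoothFn I (- dir I Y f) := (hY.dir hf).neg
  have e : - (dir I Y f • X) = (- dir I Y f) • X := by
    funext p; simp
  unfold curvature
  rw [bracket_smul_left hf hX, nabla_smul_left hg hf hX (SmoothVF.nabla hg hY hZ),
    nabla_smul_left hg hf hX hZ, nabla_smul_right hg hf hY (SmoothVF.nabla hg hX hZ), e,
    nabla_add_left hg (SmoothVF.smul hd hX) (SmoothVF.smul hf (hX.bracket hY)) hZ,
    nabla_smul_left hg hd hX hZ, nabla_smul_left hg hf (hX.bracket hY) hZ]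
  funext p
  simp only [Pi.sub_apply, Pi.add_apply, Pi.smul_apply', Pi.neg_apply, smul_sub, neg_smul]
  abel

lemma curvature_add_right {X Y Z Z' : VF I M} (hX : SmoothVF I X) (hY : SmoothVF I Y)
    (hZ : SmoothVF I Z) (hZ' : SmoothVF I Z') :
    curvature I g X Y (Z + Z') = curvature I g X Y Z + curvature I g X Y Z' := by
  unfold curvature
  rw [nabla_add_right hg hY hZ hZ', nabla_add_right hg hX hZ hZ',
    nabla_add_right hg (hX.bracket hY) hZ hZ',
    nabla_add_right hg hX (SmoothVF.nabla hg hY hZ) (SmoothVF.nabla hg hY hZ'),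
    nabla_add_right hg hY (SmoothVF.nabla hg hX hZ) (SmoothVF.nabla hg hX hZ')]
  abel

lemma curvature_smul_right {f : M → ℝ} {X Y Z : VF I M} (hf : SmoothFn I f) (hX : SmoothVF I X)
    (hY : SmoothVF I Y) (hZ : SmoothVF I Z) :
    curvature I g X Y (f • Z) = f • curvature I g X Y Z := by
  have n1 := SmoothVF.nabla hg hY hZ
  have n2 := SmoothVF.nabla hg hX hZ
  unfold curvature
  rw [nabla_smul_right hg hf hY hZ, nabla_smul_right hg hf hX hZ,
    nabla_smul_right hg hf (hX.bracket hY) hZ,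
    nabla_add_right hg hX (SmoothVF.smul (hY.dir hf) hZ) (SmoothVF.smul hf n1),
    nabla_add_right hg hY (SmoothVF.smul (hX.dir hf) hZ) (SmoothVF.smul hf n2),
    nabla_smul_right hg (hY.dir hf) hX hZ, nabla_smul_right hg (hX.dir hf) hY hZ,
    nabla_smul_right hg hf hX n1, nabla_smul_right hg hf hY n2]
  funext p
  simp only [Pi.sub_apply, Pi.add_apply, Pi.smul_apply', smul_sub, dir_bracket hX hY hf p, sub_smul]
  abel

/-- The curvature operator is skew with respect to the metric. -/
lemma pair_curvature_self {X Y Z : VF I M} (hX : SmoothVF I X) (hY : SmoothVF I Y)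
    (hZ : SmoothVF I Z) (p : M) : pair I g (curvature I g X Y Z) Z p = 0 := by
  have hF := hg.smooth hZ hZ
  have n1 := SmoothVF.nabla hg hY hZ
  have n2 := SmoothVF.nabla hg hX hZ
  have d : ∀ {V : VF I M}, SmoothVF I V →
      dir I V (pair I g Z Z) = fun p => 2 * pair I g (nabla I g V Z) Z p := by
    intro V hV
    funext p
    rw [nabla_metric hg hV hZ hZ, hg.pair_comm Z]
    ring
  have h1 := dir_bracket hX hY hF p
  rw [d (hX.bracket hY), d hY, d hX,
    dir_fun_mul X mdifferentiableAt_const ((hg.smooth n1 hZ).mdiff p),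
    dir_fun_mul Y mdifferentiableAt_const ((hg.smooth n2 hZ).mdiff p), dir_const, dir_const,
    nabla_metric hg hX n1 hZ, nabla_metric hg hY n2 hZ,
    hg.pair_comm (nabla I g X Z) (nabla I g Y Z)] at h1
  simp only [pair, curvature, Pi.sub_apply, map_sub, _root_.sub_apply] at h1 ⊢
  linarith

/-- The Ricci tensor as a trace. -/
lemma exists_ricci_eq_trace {Y Z : VF I M} (hY : SmoothVF I Y) (hZ : SmoothVF I Z) (p : M) :
    ∃ L : TangentSpace I p →ₗ[ℝ] TangentSpace I p,
      (∀ X, SmoothVF I X → curvature I g X Y Z p = L (X p)) ∧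
      ricci I g p (Y p) (Z p) = LinearMap.trace ℝ _ L := by
  obtain ⟨L, hL⟩ := exists_linear_of_tensorial (p := p) (fun X => curvature I g X Y Z p)
    (fun X X' hX hX' => by rw [curvature_add_left hg hX hX' hY hZ]; rfl)
    (fun f X hf hX => by rw [curvature_smul_left hg hf hX hY hZ]; rfl)
  refine ⟨L, hL, ?_⟩
  rw [LinearMap.trace_eq_matrix_trace ℝ (tangentBasis I p) L, Matrix.trace, ricci]
  refine Finset.sum_congr rfl fun i _ => ?_
  rw [Matrix.diag_apply, LinearMap.toMatrix_apply, Module.Basis.coord_apply]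
  obtain ⟨hx, hx'⟩ := smoothExtension_spec p (tangentBasis I p i)
  obtain ⟨hy, hy'⟩ := smoothExtension_spec p (Y p)
  obtain ⟨hz, hz'⟩ := smoothExtension_spec p (Z p)
  have e1 : curvature I g (smoothExtension I p (tangentBasis I p i)) (smoothExtension I p (Y p))
      (smoothExtension I p (Z p)) p =
      curvature I g (smoothExtension I p (tangentBasis I p i)) Y (smoothExtension I p (Z p)) p := by
    rw [curvature_swap hg hx hy hz, curvature_swap hg hx hY hz, Pi.neg_apply, Pi.neg_apply]
    congr 1
    exact tensorial_congr (p := p) (fun X => curvature I g X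
      (smoothExtension I p (tangentBasis I p i)) (smoothExtension I p (Z p)) p)
      (fun X X' hX hX' => by rw [curvature_add_left hg hX hX' hx hz]; rfl)
      (fun f X hf hX => by rw [curvature_smul_left hg hf hX hx hz]; rfl) hy hY hy'
  have e2 : curvature I g (smoothExtension I p (tangentBasis I p i)) Y
      (smoothExtension I p (Z p)) p =
      curvature I g (smoothExtension I p (tangentBasis I p i)) Y Z p :=
    tensorial_congr (p := p) (fun X => curvature I g
      (smoothExtension I p (tangentBasis I p i)) Y X p)
      (fun X X' hX hX' => by rw [curvature_add_right hg hx hY hX hX']; rfl)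
      (fun f X hf hX => by rw [curvature_smul_right hg hf hx hY hX]; rfl) hz hZ hz'
  rw [e1, e2, hL _ hx, hx']

end Curvature

end NEH

namespace NEH

open VectorField Filter Set

/-! ### Null frames of Lorentzian spaces and frames for degenerate forms. -/

section Frames

variable {V : Type*} [AddCommGroup V] [Module ℝ V] [FiniteDimensional ℝ V]

/-- Expansions and traces with respect to a null frame `(F, l, n)`. -/
lemma null_frame {m : ℕ} (hdim : Module.finrank ℝ V = m + 2) (g : V →ₗ[ℝ] V →ₗ[ℝ] ℝ)
    (hsymm : ∀ x y, g x y = g y x) {l n : V} {F : Fin m → V} (hll : g l l = 0) (hnn : g n n = 0)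
    (hnl : g n l = -1) (hlF : ∀ i, g l (F i) = 0) (hnF : ∀ i, g n (F i) = 0)
    (hFF : ∀ i j, g (F i) (F j) = if i = j then 1 else 0) :
    (∀ w, w = ∑ i, g (F i) w • F i - g n w • l - g l w • n) ∧
    ∀ L : V →ₗ[ℝ] V, LinearMap.trace ℝ V L =
      ∑ i, g (F i) (L (F i)) - g n (L l) - g l (L n) := by
  classical
  let v : Option (Option (Fin m)) → V := fun o => o.elim n fun o => o.elim l F
  -- Because g(n,l) = -1, the covector dual to n is -g(l,·) and the one dual to l is -g(n,·).
  let d : Option (Option (Fin m)) → V →ₗ[ℝ] ℝ :=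
    fun o => o.elim (- g l) fun o => o.elim (- g n) fun i => g (F i)
  have hd : ∀ i j, d i (v j) = if i = j then 1 else 0 := by
    rintro (_ | _ | i) (_ | _ | j) <;>
      simp [d, v, hll, hnn, hnl, hlF, hnF, hFF, hsymm l n, hsymm (F _) n, hsymm (F _) l]
  have hcard : Fintype.card (Option (Option (Fin m))) = Module.finrank ℝ V := by
    simp [hdim]
  refine ⟨fun w => ?_, fun L => ?_⟩
  · obtain ⟨b, hb, hr⟩ := eq_sum_of_dual v d hd hcard
    conv_lhs => rw [← b.sum_repr w]
    simp only [hb, hr, Fintype.sum_option]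
    simp only [d, v, Option.elim, LinearMap.neg_apply, neg_smul]
    abel
  · rw [trace_eq_sum_of_dual v d hd hcard L]
    simp only [Fintype.sum_option]
    simp only [d, v, Option.elim, LinearMap.neg_apply]
    ring

/-- Expansions with respect to a frame `(F, l)` for a degenerate form with kernel spanned by `l`. -/
lemma degenerate_frame {m : ℕ} (hdim : Module.finrank ℝ V = m + 1) (q : V →ₗ[ℝ] V →ₗ[ℝ] ℝ)
    (hsymm : ∀ x y, q x y = q y x) {l : V} {F : Fin m → V} (hl : ∀ x, q l x = 0)
    (η : V →ₗ[ℝ] ℝ) (hη : η l = 1) (hFF : ∀ i j, q (F i) (F j) = if i = j then 1 else 0) (w : V) :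
    ∃ c : ℝ, w = ∑ i, q w (F i) • F i + c • l := by
  classical
  let v : Option (Fin m) → V := fun o => o.elim l F
  -- q cannot supply a covector dual to l; η is corrected so that it annihilates the F i as well.
  let d : Option (Fin m) → V →ₗ[ℝ] ℝ :=
    fun o => o.elim (η - ∑ i, η (F i) • q (F i)) fun i => q (F i)
  have hd : ∀ i j, d i (v j) = if i = j then 1 else 0 := by
    rintro (_ | i) (_ | j) <;>
      simp [d, v, hl, hη, hFF, hsymm (F _) l]
  have hcard : Fintype.card (Option (Fin m)) = Module.finrank ℝ V := by
    simp [hdim]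
  obtain ⟨b, hb, hr⟩ := eq_sum_of_dual v d hd hcard
  refine ⟨d none w, ?_⟩
  conv_lhs => rw [← b.sum_repr w]
  simp only [hb, hr, Fintype.sum_option]
  rw [add_comm]
  congr 1
  exact Finset.sum_congr rfl fun i _ => by simp [v, d, hsymm w]

end Frames

/-! ### The Lie derivative of a (0,2) tensor is a tensor. -/

section LieBilin

variable {E : Type*} [NormedAddCommGroup E] [NormedSpace ℝ E] [FiniteDimensional ℝ E]
  {H : Type*} [TopologicalSpace H] {I : ModelWithCorners ℝ E H}
  {M : Type*} [TopologicalSpace M] [ChartedSpace H M] [IsManifold I ∞ M] [T2Space M]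
  {S : Bilin I M} (hS : ∀ {X Y : VF I M}, SmoothVF I X → SmoothVF I Y → SmoothFn I (pair I S X Y))

include hS

lemma smoothFn_lieBilin {K X Y : VF I M} (hK : SmoothVF I K) (hX : SmoothVF I X)
    (hY : SmoothVF I Y) : SmoothFn I (lieBilin I K S X Y) :=
  ((hK.dir (hS hX hY)).sub (hS (hK.bracket hX) hY)).sub (hS hX (hK.bracket hY))

lemma lieBilin_add_left {K X X' Y : VF I M} (hX : SmoothVF I X)
    (hX' : SmoothVF I X') (hY : SmoothVF I Y) (p : M) :
    lieBilin I K S (X + X') Y p = lieBilin I K S X Y p + lieBilin I K S X' Y p := by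
  simp only [lieBilin]
  rw [bracket_add_right hX hX', pair_add_left,
    dir_fun_add K ((hS hX hY).mdiff p) ((hS hX' hY).mdiff p)]
  simp only [pair_add_left]
  ring

lemma lieBilin_add_right {K X Y Y' : VF I M} (hX : SmoothVF I X)
    (hY : SmoothVF I Y) (hY' : SmoothVF I Y') (p : M) :
    lieBilin I K S X (Y + Y') p = lieBilin I K S X Y p + lieBilin I K S X Y' p := by
  simp only [lieBilin]
  rw [bracket_add_right hY hY', pair_add_right,
    dir_fun_add K ((hS hX hY).mdiff p) ((hS hX hY').mdiff p)]
  simp only [pair_add_right]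
  ring

lemma lieBilin_smul_left {f : M → ℝ} {K X Y : VF I M} (hf : SmoothFn I f)
    (hX : SmoothVF I X) (hY : SmoothVF I Y) (p : M) :
    lieBilin I K S (f • X) Y p = f p * lieBilin I K S X Y p := by
  simp only [lieBilin]
  rw [bracket_smul_right hf hX, pair_smul_left, dir_fun_mul K (hf.mdiff p) ((hS hX hY).mdiff p)]
  simp only [pair_add_left, pair_smul_left]
  ring

lemma lieBilin_smul_right {f : M → ℝ} {K X Y : VF I M} (hf : SmoothFn I f)
    (hX : SmoothVF I X) (hY : SmoothVF I Y) (p : M) :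
    lieBilin I K S X (f • Y) p = f p * lieBilin I K S X Y p := by
  simp only [lieBilin]
  rw [bracket_smul_right hf hY, pair_smul_right, dir_fun_mul K (hf.mdiff p) ((hS hX hY).mdiff p)]
  simp only [pair_add_right, pair_smul_right]
  ring

/-- The Lie derivative of a smooth tensor field is a smooth tensor field. -/
lemma exists_lieBilin_tensor {K : VF I M} (hK : SmoothVF I K) : ∃ T : Bilin I M,
    (∀ X Y, SmoothVF I X → SmoothVF I Y → ∀ p, T p (X p) (Y p) = lieBilin I K S X Y p) ∧
    ∀ {X Y}, SmoothVF I X → SmoothVF I Y → SmoothFn I (pair I T X Y) := by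
  obtain ⟨T, hT⟩ := exists_bilin_of_tensorial (I := I) (fun X Y p => lieBilin I K S X Y p)
    (fun X X' Y hX hX' hY p => lieBilin_add_left hS hX hX' hY p)
    (fun f X Y hf hX hY p => lieBilin_smul_left hS hf hX hY p)
    (fun X Y Y' hX hY hY' p => lieBilin_add_right hS hX hY hY' p)
    (fun f X Y hf hX hY p => lieBilin_smul_right hS hf hX hY p)
  refine ⟨T, hT, fun {X Y} hX hY => ?_⟩
  have : pair I T X Y = lieBilin I K S X Y := funext fun p => hT X Y hX hY p
  rw [this]
  exact smoothFn_lieBilin hS hK hX hY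

end LieBilin

/-! ### Derivatives along a submanifold not yet known to be totally geodesic. -/

section Submanifold

variable {E : Type*} [NormedAddCommGroup E] [NormedSpace ℝ E] [FiniteDimensional ℝ E]
  {H : Type*} [TopologicalSpace H] {I : ModelWithCorners ℝ E H}
  {M : Type*} [TopologicalSpace M] [ChartedSpace H M] [IsManifold I ∞ M] [T2Space M]
  {E' : Type*} [NormedAddCommGroup E'] [NormedSpace ℝ E'] [FiniteDimensional ℝ E']
  {H' : Type*} [TopologicalSpace H'] {J : ModelWithCorners ℝ E' H'}
  {N : Type*} [TopologicalSpace N] [ChartedSpace H' N] [IsManifold J ∞ N] [T2Space N]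
  [J.Boundaryless] {e : N → M} {g : Bilin I M}

lemma Related.dir_pair (he : ContMDiff J I ∞ e) {X Y Z : VF J N} {X' Y' Z' : VF I M} {p : N}
    (hg : SmoothFn I (pair I g Y' Z'))
    (h1 : Related J I e X X' p) (h2 : Related J I e Y Y' p) (h3 : Related J I e Z Z' p) :
    dir J X (pair J (pullbackBilin I J e g) Y Z) p = dir I X' (pair I g Y' Z') (e p) := by
  rw [dir_congr_fun X (pair_pullback h2 h3)]
  exact (h1.dir_eq he hg).self_of_nhds

/-- Tangency is required for one pair of fields at one point only. This allows D_ℓ ℓ to be evaluated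
before the horizon is known to be totally geodesic. -/
lemma inducedD_spec_of_tangent (hg : IsMetric I g) (he : ContMDiff J I ∞ e) {X Y : VF J N}
    {X' Y' : VF I M}
    (hX' : SmoothVF I X') (hY' : SmoothVF I Y') {p : N} (h1 : Related J I e X X' p)
    (h2 : Related J I e Y Y' p) (h : ∃ w, mfderiv J I e p w = nabla I g X' Y' (e p)) :
    mfderiv J I e p (inducedD I J g e X Y p) = nabla I g X' Y' (e p) := by
  obtain ⟨w, hw⟩ := h
  exact Classical.epsilon_spec (p := fun w : TangentSpace J p =>
    ∀ X' Y' : VF I M, SmoothVF I X' → SmoothVF I Y' →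
      (∀ᶠ p' in 𝓝 p, mfderiv J I e p' (X p') = X' (e p')) →
      (∀ᶠ p' in 𝓝 p, mfderiv J I e p' (Y p') = Y' (e p')) →
      mfderiv J I e p w = nabla I g X' Y' (e p))
    ⟨w, fun X'' Y'' hX'' hY'' a b => by
      rw [hw]
      exact nabla_eq_of_related hg he hX' hX'' hY' hY'' h1 a h2 b⟩ X' Y' hX' hY' h1 h2

end Submanifold

/-! ### The degenerate metric of the horizon. -/

section HorizonMetric

lemma Spacetime.exists_isLorentz {k : ℕ} {M : Type*} [TopologicalSpace M]
    [ChartedSpace (EuclideanSpace ℝ (Fin (k + 1))) M] [IsManifold (𝓡 (k + 1)) ∞ M]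
    (S : Spacetime (k + 1) M) (p : M) :
    ∃ b : Module.Basis (Fin (k + 1)) ℝ (TangentSpace (𝓡 (k + 1)) p),
      IsLorentz (toLin₂ S.g p) b := S.g_lorentz p

lemma Spacetime.isMetric {k : ℕ} {M : Type*} [TopologicalSpace M]
    [ChartedSpace (EuclideanSpace ℝ (Fin (k + 1))) M] [IsManifold (𝓡 (k + 1)) ∞ M]
    (S : Spacetime (k + 1) M) : IsMetric (𝓡 (k + 1)) S.g where
  smooth := by
    intro X Y hX hY p
    have : ContMDiffAt (𝓡 (k + 1)) ((𝓡 (k + 1)).prod 𝓘(ℝ, ℝ)) ∞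
        (fun x => Bundle.TotalSpace.mk' ℝ (E := Bundle.Trivial M ℝ) x (S.g x (X x) (Y x))) p :=
      ContMDiffAt.clm_bundle_apply₂ (F₁ := EuclideanSpace ℝ (Fin (k + 1)))
        (F₂ := EuclideanSpace ℝ (Fin (k + 1))) (S.g_smooth p) (hX p) (hY p)
    simp only [Bundle.contMDiffAt_totalSpace] at this
    exact this.2
  symm p x y := by
    obtain ⟨b, hb⟩ := S.exists_isLorentz p
    exact hb.symm x y
  nondeg p x hx := by
    obtain ⟨b, hb⟩ := S.exists_isLorentz p
    exact hb.nondeg x hx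

variable {m : ℕ} {M : Type*} [TopologicalSpace M] [T2Space M]
  [ChartedSpace (EuclideanSpace ℝ (Fin (m + 2))) M] [IsManifold (𝓡 (m + 2)) ∞ M]
  {B : Type*} [TopologicalSpace B] [T2Space B] [ChartedSpace (EuclideanSpace ℝ (Fin m)) B]
  [IsManifold (𝓡 m) ∞ B] {S : Spacetime (m + 2) M}

namespace Horizon

variable (Δ : Horizon S B)

lemma q_apply (p : B × ℝ) (x y : TangentSpace (modelH m) p) :
    Δ.q p x y = S.g (Δ.e p) (Δ.push p x) (Δ.push p y) := rfl

lemma q_symm (p : B × ℝ) (x y : TangentSpace (modelH m) p) : Δ.q p x y = Δ.q p y x :=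
  S.isMetric.symm _ _ _

lemma q_smooth {X Y : VF (modelH m) (B × ℝ)} (hX : SmoothVF (modelH m) X)
    (hY : SmoothVF (modelH m) Y) : SmoothFn (modelH m) (pair (modelH m) Δ.q X Y) :=
  smoothFn_pair_pullback Δ.e_smooth Δ.e_immersion S.isMetric.smooth hX hY

/-- The tangent vector of the null curve. -/
def vert (p : B × ℝ) : TangentSpace (modelH m) p :=
  ((0, 1) : EuclideanSpace ℝ (Fin m) × ℝ)

lemma q_vert (p : B × ℝ) (y : TangentSpace (modelH m) p) : Δ.q p (vert p) y = 0 := Δ.null p y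

lemma push_vert_ne (p : B × ℝ) : Δ.push p (vert p) ≠ 0 := by
  intro h
  have : vert p = (0 : TangentSpace (modelH m) p) :=
    Δ.e_immersion p (by rw [map_zero]; exact h)
  have h2 : ((0, 1) : EuclideanSpace ℝ (Fin m) × ℝ) = 0 := this
  simpa using congrArg Prod.snd h2

/-- The tangent space of the horizon is orthogonal to a nonzero null vector of a Lorentzian space.
-/
lemma q_nonneg (p : B × ℝ) (x : TangentSpace (modelH m) p) : 0 ≤ Δ.q p x x := by
  obtain ⟨b, hb⟩ := S.exists_isLorentz (Δ.e p)
  exact (hb.null_orthogonal (Δ.q_vert p (vert p)) (Δ.push_vert_ne p) (Δ.q_vert p x)).1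

lemma eq_smul_vert {p : B × ℝ} {x : TangentSpace (modelH m) p} (hx : Δ.q p x x = 0) :
    ∃ c : ℝ, x = c • vert p := by
  obtain ⟨b, hb⟩ := S.exists_isLorentz (Δ.e p)
  obtain ⟨c, hc⟩ := (hb.null_orthogonal (Δ.q_vert p (vert p)) (Δ.push_vert_ne p)
    (Δ.q_vert p x)).2 hx
  refine ⟨c, Δ.e_immersion p ?_⟩
  rw [map_smul]
  exact hc

lemma q_left_of_null {p : B × ℝ} {x : TangentSpace (modelH m) p} (hx : Δ.q p x x = 0)
    (y : TangentSpace (modelH m) p) : Δ.q p x y = 0 := by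
  obtain ⟨c, rfl⟩ := Δ.eq_smul_vert hx
  rw [map_smul, _root_.smul_apply, Δ.q_vert, smul_zero]

lemma eq_smul_of_null {p : B × ℝ} {l x : TangentSpace (modelH m) p} (hl : Δ.q p l l = 0)
    (hl0 : l ≠ 0) (hx : Δ.q p x x = 0) : ∃ c : ℝ, x = c • l := by
  obtain ⟨c, rfl⟩ := Δ.eq_smul_vert hx
  obtain ⟨d, rfl⟩ := Δ.eq_smul_vert hl
  have hd : d ≠ 0 := by rintro rfl; simp at hl0
  exact ⟨c / d, by rw [smul_smul, div_mul_cancel₀ _ hd]⟩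

/-- Orthonormal systems annihilated by a given form which does not vanish on null vectors. -/
lemma exists_orthonormal_frame {p : B × ℝ} {l : TangentSpace (modelH m) p} (hl : Δ.q p l l = 0)
    (η : TangentSpace (modelH m) p →ₗ[ℝ] ℝ) (hη : η l = 1) :
    ∃ F : Fin m → TangentSpace (modelH m) p,
      (∀ i j, Δ.q p (F i) (F j) = if i = j then 1 else 0) ∧ ∀ i, η (F i) = 0 := by
  let b : Fin m → TangentSpace (modelH m) p := fun i =>
    ((EuclideanSpace.single i 1, 0) : EuclideanSpace ℝ (Fin m) × ℝ)
  -- Shifting the base directions along l puts them in the kernel of η without changing their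
  -- products.
  let F : Fin m → TangentSpace (modelH m) p := fun i => b i - η (b i) • l
  obtain ⟨d, hd⟩ := Δ.eq_smul_vert hl
  have hF : ∀ i, η (F i) = 0 := fun i => by simp [F, hη]
  obtain ⟨A, hA⟩ := exists_orthonormal (toLin₂ Δ.q p) (Δ.q_symm p) (Δ.q_nonneg p) F (by
    intro c hc
    -- A null combination is a multiple of the vertical vector, so its base components, which are
    -- the coefficients c, vanish.
    obtain ⟨a, ha⟩ := Δ.eq_smul_vert hc
    have h1 : ∑ i, c i • b i = (a + (∑ i, c i * η (b i)) * d) • vert p := by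
      have : ∑ i, c i • F i = ∑ i, c i • b i - (∑ i, c i * η (b i)) • l := by
        simp only [F, smul_sub, Finset.sum_sub_distrib, smul_smul, Finset.sum_smul]
      rw [this, hd] at ha
      rw [add_smul, ← smul_smul, ← ha]
      abel
    have h2 : ((∑ i, c i • (EuclideanSpace.single i (1 : ℝ), (0 : ℝ)) :
        EuclideanSpace ℝ (Fin m) × ℝ)) =
        (a + (∑ i, c i * η (b i)) * d) • ((0, 1) : EuclideanSpace ℝ (Fin m) × ℝ) := h1
    have h3 := congrArg Prod.fst h2
    rw [Prod.fst_sum] at h3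
    ext j
    have h4 := congrArg (fun v : EuclideanSpace ℝ (Fin m) => v j) h3
    simpa [Pi.single_apply] using h4)
  exact ⟨fun i => ∑ j, A i j • F j, hA, fun i => by simp [hF]⟩

lemma finrank_tangent (p : B × ℝ) :
    Module.finrank ℝ (TangentSpace (modelH m) p) = m + 1 := by
  change Module.finrank ℝ (EuclideanSpace ℝ (Fin m) × ℝ) = m + 1
  simp

/-- Expansion of a vector in an orthonormal system and a null vector. -/
lemma exists_expansion {p : B × ℝ} {l : TangentSpace (modelH m) p} (hl : Δ.q p l l = 0)
    (hl0 : l ≠ 0) {F : Fin m → TangentSpace (modelH m) p}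
    (hF : ∀ i j, Δ.q p (F i) (F j) = if i = j then 1 else 0) (w : TangentSpace (modelH m) p) :
    ∃ c : ℝ, w = ∑ i, Δ.q p w (F i) • F i + c • l := by
  have : FiniteDimensional ℝ (TangentSpace (modelH m) p) :=
    inferInstanceAs (FiniteDimensional ℝ (EuclideanSpace ℝ (Fin m) × ℝ))
  obtain ⟨η, hη⟩ := Module.Projective.exists_dual_eq_one ℝ hl0
  exact degenerate_frame (finrank_tangent p) (toLin₂ Δ.q p) (Δ.q_symm p) (Δ.q_left_of_null hl) η hη
    hF w

end Horizon

end HorizonMetric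

end NEH

namespace NEH

open VectorField Filter Set

namespace Horizon

/-! ### The second fundamental form of the horizon. -/

section Raychaudhuri

variable {m : ℕ} {M : Type*} [TopologicalSpace M] [T2Space M]
  [ChartedSpace (EuclideanSpace ℝ (Fin (m + 2))) M] [IsManifold (𝓡 (m + 2)) ∞ M]
  {B : Type*} [TopologicalSpace B] [T2Space B] [ChartedSpace (EuclideanSpace ℝ (Fin m)) B]
  [IsManifold (𝓡 m) ∞ B] {S : Spacetime (m + 2) M} (Δ : Horizon S B)

lemma exists_extension {X : VF (modelH m) (B × ℝ)} (hX : SmoothVF (modelH m) X) (p : B × ℝ) :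
    ∃ X' : VF (𝓡 (m + 2)) M, SmoothVF (𝓡 (m + 2)) X' ∧
      Related (modelH m) (𝓡 (m + 2)) Δ.e X X' p :=
  NEH.exists_extension Δ.e_smooth p (Δ.e_immersion p) hX

variable {ℓ : VF (modelH m) (B × ℝ)} (hℓ : SmoothVF (modelH m) ℓ) (hnull : Δ.IsNull ℓ)

include hℓ hnull

lemma pair_q_null (Y : VF (modelH m) (B × ℝ)) : pair (modelH m) Δ.q ℓ Y = fun _ => 0 :=
  funext fun p => Δ.q_left_of_null (hnull p) _

lemma lie_q_symm (X Y : VF (modelH m) (B × ℝ)) (p : B × ℝ) :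
    lieBilin (modelH m) ℓ Δ.q X Y p = lieBilin (modelH m) ℓ Δ.q Y X p := by
  have : pair (modelH m) Δ.q X Y = pair (modelH m) Δ.q Y X :=
    funext fun p => Δ.q_symm p _ _
  simp only [lieBilin, this]
  simp only [pair, Δ.q_symm p (mlieBracket (modelH m) ℓ X p),
    Δ.q_symm p (mlieBracket (modelH m) ℓ Y p)]
  ring

lemma lie_q_null (Y : VF (modelH m) (B × ℝ)) (p : B × ℝ) :
    lieBilin (modelH m) ℓ Δ.q ℓ Y p = 0 := by
  have h1 : mlieBracket (modelH m) ℓ ℓ p = 0 := by simp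
  simp only [lieBilin, Δ.pair_q_null hℓ hnull, dir_const]
  simp [pair, h1]

variable {p : B × ℝ} {ℓ' X' Y' : VF (𝓡 (m + 2)) M} {X Y : VF (modelH m) (B × ℝ)}
  (hℓ' : SmoothVF (𝓡 (m + 2)) ℓ') (rℓ : Related (modelH m) (𝓡 (m + 2)) Δ.e ℓ ℓ' p)
  (hX : SmoothVF (modelH m) X) (hX' : SmoothVF (𝓡 (m + 2)) X')
  (rX : Related (modelH m) (𝓡 (m + 2)) Δ.e X X' p)
  (hY : SmoothVF (modelH m) Y) (hY' : SmoothVF (𝓡 (m + 2)) Y')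
  (rY : Related (modelH m) (𝓡 (m + 2)) Δ.e Y Y' p)

include hℓ' rℓ hX hX' rX hY' rY

/-- This is the derivative along X of the identity g(ℓ,Y) = 0, valid along the horizon. -/
lemma pair_nabla_null : pair (𝓡 (m + 2)) S.g (nabla (𝓡 (m + 2)) S.g X' ℓ') Y' (Δ.e p) =
    - pair (𝓡 (m + 2)) S.g ℓ' (nabla (𝓡 (m + 2)) S.g X' Y') (Δ.e p) := by
  have h1 := nabla_metric S.isMetric hX' hℓ' hY' (Δ.e p)
  have h2 := Related.dir_pair Δ.e_smooth (S.isMetric.smooth hℓ' hY') rX rℓ rY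
  change dir _ X (pair (modelH m) Δ.q ℓ Y) p = _ at h2
  rw [Δ.pair_q_null hℓ hnull, dir_const] at h2
  rw [← h2] at h1
  linarith

include hY

/-- 𝓛_ℓ q is the symmetrization of g(∇_X ℓ, Y). That form is already symmetric: it equals -g(ℓ, ∇_X
Y), and ℓ is orthogonal to the tangent field [X,Y]. -/
lemma lie_q_eq : lieBilin (modelH m) ℓ Δ.q X Y p =
    2 * pair (𝓡 (m + 2)) S.g (nabla (𝓡 (m + 2)) S.g X' ℓ') Y' (Δ.e p) := by
  have h1 : lieBilin (modelH m) ℓ Δ.q X Y p = lieBilin (𝓡 (m + 2)) ℓ' S.g X' Y' (Δ.e p) :=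
    lieBilin_pullback Δ.e_smooth S.isMetric.smooth hℓ hX hY hℓ' hX' hY' rℓ rX rY
  have h2 := Δ.pair_nabla_null hℓ hnull hℓ' rℓ hX hX' rX hY' rY
  have h3 := Δ.pair_nabla_null hℓ hnull hℓ' rℓ hY hY' rY hX' rX
  have h4 := congrFun (nabla_torsion S.isMetric hX' hY') (Δ.e p)
  have h5 : pair (𝓡 (m + 2)) S.g ℓ' (mlieBracket (𝓡 (m + 2)) X' Y') (Δ.e p) = 0 := by
    have := Δ.q_left_of_null (hnull p) (mlieBracket (modelH m) X Y p)
    rw [q_apply] at this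
    rw [pair, ← rℓ.at, ← (rX.bracket Δ.e_smooth hX hY hX' hY' rY).at]
    exact this
  rw [h1, lieBilin_eq_nabla S.isMetric hℓ' hX' hY',
    S.isMetric.pair_comm X' (nabla (𝓡 (m + 2)) S.g Y' ℓ'), h2, h3]
  simp only [pair, Pi.sub_apply, ← h4, map_sub] at h5 ⊢
  linarith

end Raychaudhuri

end Horizon

end NEH

namespace NEH

open VectorField Filter Set

namespace Horizon

/-! ### The Raychaudhuri equation and the vanishing of 𝓛_ℓ q. -/

section Raychaudhuri

variable {m : ℕ} {M : Type*} [TopologicalSpace M] [T2Space M]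
  [ChartedSpace (EuclideanSpace ℝ (Fin (m + 2))) M] [IsManifold (𝓡 (m + 2)) ∞ M]
  {B : Type*} [TopologicalSpace B] [T2Space B] [ChartedSpace (EuclideanSpace ℝ (Fin m)) B]
  [IsManifold (𝓡 m) ∞ B] {S : Spacetime (m + 2) M} (Δ : Horizon S B)
  {ℓ : VF (modelH m) (B × ℝ)} (hℓ : SmoothVF (modelH m) ℓ) (hnull : Δ.IsNull ℓ)
  (hκ : ∀ p, Δ.D ℓ ℓ p = ℓ p) {v₀ : B × ℝ → ℝ} (hv : ∀ p, dir (modelH m) ℓ v₀ p = 1)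
  (𝓑 : BondiNeighbourhood Δ ℓ v₀)

include hnull hv 𝓑 in
/-- Null frames adapted to the horizon. -/
lemma exists_null_frame (p : B × ℝ) : ∃ (F : Fin m → TangentSpace (modelH m) p)
    (n : TangentSpace (𝓡 (m + 2)) (Δ.e p)),
    (∀ i j, Δ.q p (F i) (F j) = if i = j then 1 else 0) ∧
    (∀ w, w = ∑ i, S.g (Δ.e p) (Δ.push p (F i)) w • Δ.push p (F i)
      - S.g (Δ.e p) n w • Δ.push p (ℓ p) - S.g (Δ.e p) (Δ.push p (ℓ p)) w • n) ∧
    ∀ L : TangentSpace (𝓡 (m + 2)) (Δ.e p) →ₗ[ℝ] TangentSpace (𝓡 (m + 2)) (Δ.e p),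
      LinearMap.trace ℝ _ L =
        ∑ i, S.g (Δ.e p) (Δ.push p (F i)) (L (Δ.push p (F i)))
          - S.g (Δ.e p) n (L (Δ.push p (ℓ p))) - S.g (Δ.e p) (Δ.push p (ℓ p)) (L n) := by
  -- As g(n,·) restricts to -dv on the horizon, choosing the F i in the kernel of dv makes them
  -- orthogonal to n, and ℓ(v) = 1 gives g(n,ℓ) = -1.
  obtain ⟨F, hF, hF'⟩ := Δ.exists_orthonormal_frame (hnull p)
    (mvfderiv (modelH m) v₀ p).toLinearMap (hv p)
  have : FiniteDimensional ℝ (TangentSpace (𝓡 (m + 2)) (Δ.e p)) :=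
    inferInstanceAs (FiniteDimensional ℝ (EuclideanSpace ℝ (Fin (m + 2))))
  have hdim : Module.finrank ℝ (TangentSpace (𝓡 (m + 2)) (Δ.e p)) = m + 2 := by
    change Module.finrank ℝ (EuclideanSpace ℝ (Fin (m + 2))) = m + 2
    simp
  refine ⟨F, 𝓑.n (Δ.e p), hF, ?_⟩
  refine null_frame hdim (toLin₂ S.g (Δ.e p)) (S.isMetric.symm _) (hnull p) (𝓑.n_null p) ?_
    (fun i => Δ.q_left_of_null (hnull p) (F i)) (fun i => ?_) hF
  · rw [toLin₂_apply, 𝓑.n_horizon]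
    exact congrArg Neg.neg (hv p)
  · rw [toLin₂_apply, 𝓑.n_horizon, neg_eq_zero]
    exact hF' i

include hnull hv 𝓑 in
/-- Vectors orthogonal to the null direction are tangent to the horizon. -/
lemma exists_push_eq {p : B × ℝ} {w : TangentSpace (𝓡 (m + 2)) (Δ.e p)}
    (hw : S.g (Δ.e p) (Δ.push p (ℓ p)) w = 0) : ∃ x, Δ.push p x = w := by
  obtain ⟨F, n, -, h, -⟩ := Δ.exists_null_frame hnull hv 𝓑 p
  refine ⟨∑ i, S.g (Δ.e p) (Δ.push p (F i)) w • F i - S.g (Δ.e p) n w • ℓ p, ?_⟩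
  conv_rhs => rw [h w, hw]
  simp

include hℓ hnull

lemma pair_nabla_null_self {p : B × ℝ} {ℓ' X' : VF (𝓡 (m + 2)) M} {X : VF (modelH m) (B × ℝ)}
    (hℓ' : SmoothVF (𝓡 (m + 2)) ℓ') (rℓ : Related (modelH m) (𝓡 (m + 2)) Δ.e ℓ ℓ' p)
    (hX : SmoothVF (modelH m) X) (hX' : SmoothVF (𝓡 (m + 2)) X')
    (rX : Related (modelH m) (𝓡 (m + 2)) Δ.e X X' p) :
    pair (𝓡 (m + 2)) S.g ℓ' (nabla (𝓡 (m + 2)) S.g X' ℓ') (Δ.e p) = 0 := by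
  have h := Δ.pair_nabla_null hℓ hnull hℓ' rℓ hX hX' rX hℓ' rℓ
  rw [S.isMetric.pair_comm] at h
  linarith

-- The surface gravity condition concerns D, but the curvature needs ∇. Here tangency of ∇_ℓ ℓ comes
-- from g(ℓ, ∇_ℓ ℓ) = 0 alone, without assuming a totally geodesic horizon.
include hκ hv 𝓑 in
lemma related_nabla_self {p : B × ℝ} {ℓ' : VF (𝓡 (m + 2)) M}
    (hℓ' : SmoothVF (𝓡 (m + 2)) ℓ') (rℓ : Related (modelH m) (𝓡 (m + 2)) Δ.e ℓ ℓ' p) :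
    Related (modelH m) (𝓡 (m + 2)) Δ.e ℓ (nabla (𝓡 (m + 2)) S.g ℓ' ℓ') p := by
  filter_upwards [rℓ.nhds] with p' r
  rw [← hκ p']
  refine inducedD_spec_of_tangent S.isMetric Δ.e_smooth hℓ' hℓ' r r ?_
  refine Δ.exists_push_eq hnull hv 𝓑 ?_
  have := Δ.pair_nabla_null_self hℓ hnull hℓ' r hℓ hℓ' r
  rw [pair, ← r.at] at this
  exact this

include hκ hv 𝓑 in
/-- The curvature component entering the Raychaudhuri equation; `T` is the Lie derivative of the
metric of the horizon along `ℓ`. -/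
lemma pair_curvature_null {T : Bilin (modelH m) (B × ℝ)}
    (hT : ∀ X Y, SmoothVF (modelH m) X → SmoothVF (modelH m) Y →
      ∀ p, T p (X p) (Y p) = lieBilin (modelH m) ℓ Δ.q X Y p)
    {p : B × ℝ} {ℓ' X' : VF (𝓡 (m + 2)) M} {X : VF (modelH m) (B × ℝ)}
    (hℓ' : SmoothVF (𝓡 (m + 2)) ℓ') (rℓ : Related (modelH m) (𝓡 (m + 2)) Δ.e ℓ ℓ' p)
    (hX : SmoothVF (modelH m) X) (hX' : SmoothVF (𝓡 (m + 2)) X')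
    (rX : Related (modelH m) (𝓡 (m + 2)) Δ.e X X' p) :
    pair (𝓡 (m + 2)) S.g (curvature (𝓡 (m + 2)) S.g X' ℓ' ℓ') X' (Δ.e p) =
      (1 / 2) * T p (X p) (X p) - (1 / 2) * lieBilin (modelH m) ℓ T X X p +
        pair (𝓡 (m + 2)) S.g (nabla (𝓡 (m + 2)) S.g X' ℓ') (nabla (𝓡 (m + 2)) S.g X' ℓ')
          (Δ.e p) := by
  have hg := S.isMetric
  have n1 := SmoothVF.nabla hg hX' hℓ'
  have n2 := SmoothVF.nabla hg hℓ' hℓ'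
  -- Unit surface gravity turns ∇_X ∇_ℓ ℓ into ∇_X ℓ, the source of the undifferentiated term
  -- ½T(X,X).
  have a : nabla (𝓡 (m + 2)) S.g X' (nabla (𝓡 (m + 2)) S.g ℓ' ℓ') (Δ.e p) =
      nabla (𝓡 (m + 2)) S.g X' ℓ' (Δ.e p) :=
    nabla_eq_of_related hg Δ.e_smooth hX' hX' n2 hℓ' rX rX
      (Δ.related_nabla_self hℓ hnull hκ hv 𝓑 hℓ' rℓ) rℓ
  have bX := rℓ.bracket Δ.e_smooth hℓ hX hℓ' hX' rX
  have b1 := nabla_metric hg hℓ' n1 hX' (Δ.e p)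
  -- Along the horizon g(∇_X ℓ, X) = ½T(X,X), and ℓ differentiates within the horizon; this brings
  -- in 𝓛_ℓ T.
  have b2 : dir (𝓡 (m + 2)) ℓ' (pair (𝓡 (m + 2)) S.g (nabla (𝓡 (m + 2)) S.g X' ℓ') X') (Δ.e p) =
      (1 / 2) * dir (modelH m) ℓ (pair (modelH m) T X X) p := by
    rw [← (rℓ.dir_eq Δ.e_smooth (hg.smooth n1 hX')).self_of_nhds]
    have e1 : ∀ᶠ p' in 𝓝 p, pair (𝓡 (m + 2)) S.g (nabla (𝓡 (m + 2)) S.g X' ℓ') X' (Δ.e p') =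
        (1 / 2) * pair (modelH m) T X X p' := by
      filter_upwards [rℓ.nhds, rX.nhds] with p' r r'
      rw [pair.eq_1 (modelH m) T, hT X X hX hX,
        Δ.lie_q_eq hℓ hnull hℓ' r hX hX' r' hX hX' r']
      ring
    have e2 : SmoothFn (modelH m) (pair (modelH m) T X X) := by
      have : pair (modelH m) T X X = lieBilin (modelH m) ℓ Δ.q X X :=
        funext fun p' => hT X X hX hX p'
      rw [this]
      exact smoothFn_lieBilin Δ.q_smooth hℓ hX hX
    rw [dir_congr_fun ℓ e1, dir_fun_mul ℓ mdifferentiableAt_const (e2.mdiff p), dir_const]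
    ring
  have b3 := congrFun (nabla_torsion hg hℓ' hX') (Δ.e p)
  have b4 := Δ.lie_q_eq hℓ hnull hℓ' rℓ hX hX' rX (hℓ.bracket hX) (hℓ'.bracket hX') bX
  have c1 := Δ.lie_q_eq hℓ hnull hℓ' rℓ (hℓ.bracket hX) (hℓ'.bracket hX') bX hX hX' rX
  have c2 : nabla (𝓡 (m + 2)) S.g (mlieBracket (𝓡 (m + 2)) X' ℓ') ℓ' =
      - nabla (𝓡 (m + 2)) S.g (mlieBracket (𝓡 (m + 2)) ℓ' X') ℓ' := by
    rw [bracket_swap X' ℓ', nabla_neg_left hg (hℓ'.bracket hX') hℓ']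
  have b5 : nabla (𝓡 (m + 2)) S.g ℓ' X' (Δ.e p) = nabla (𝓡 (m + 2)) S.g X' ℓ' (Δ.e p) +
      mlieBracket (𝓡 (m + 2)) ℓ' X' (Δ.e p) := by
    rw [← b3, Pi.sub_apply]; abel
  rw [← hT _ _ hX (hℓ.bracket hX)] at b4
  rw [← hT _ _ (hℓ.bracket hX) hX] at c1
  have t1 := hT X X hX hX p
  rw [Δ.lie_q_eq hℓ hnull hℓ' rℓ hX hX' rX hX hX' rX] at t1
  rw [b2] at b1
  simp only [pair, curvature, lieBilin, Pi.sub_apply, map_sub, _root_.sub_apply, a, c2, b5, map_add,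
    Pi.neg_apply, map_neg, _root_.neg_apply] at b1 b4 c1 t1 ⊢
  rw [t1, b4, c1]
  linarith

include hκ hv 𝓑 in
/-- The Raychaudhuri equation for a nonexpanding null hypersurface. -/
lemma ricci_null {T : Bilin (modelH m) (B × ℝ)}
    (hT : ∀ X Y, SmoothVF (modelH m) X → SmoothVF (modelH m) Y →
      ∀ p, T p (X p) (Y p) = lieBilin (modelH m) ℓ Δ.q X Y p)
    (hℓ0 : ∀ p, ℓ p ≠ 0) (p : B × ℝ) :
    ∃ F : Fin m → TangentSpace (modelH m) p,
      (∀ i j, Δ.q p (F i) (F j) = if i = j then 1 else 0) ∧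
      ricci (𝓡 (m + 2)) S.g (Δ.e p) (Δ.push p (ℓ p)) (Δ.push p (ℓ p)) =
        - ((1 / 4) * ∑ i, ∑ j, T p (F i) (F j) * T p (F i) (F j)) := by
  have hg := S.isMetric
  obtain ⟨F₀, n, hF₀, hexp, htr⟩ := Δ.exists_null_frame hnull hv 𝓑 p
  refine ⟨F₀, hF₀, ?_⟩
  choose F hF hFp using fun i => exists_smoothVF_apply_eq (modelH m) p (F₀ i)
  obtain ⟨ℓ', hℓ', rℓ⟩ := Δ.exists_extension hℓ p
  choose F' hF' rF using fun i => Δ.exists_extension (hF i) p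
  have rℓp : Δ.push p (ℓ p) = ℓ' (Δ.e p) := rℓ.at
  have rFp : ∀ i, Δ.push p (F₀ i) = F' i (Δ.e p) := fun i => by rw [← hFp i]; exact (rF i).at
  obtain ⟨L, hL, hric⟩ := exists_ricci_eq_trace hg hℓ' hℓ' (Δ.e p)
  have z1 : L (Δ.push p (ℓ p)) = 0 := by
    rw [rℓp, ← hL ℓ' hℓ']
    have := congrFun (curvature_swap hg hℓ' hℓ' hℓ') (Δ.e p)
    rw [Pi.neg_apply] at this
    have h2 : (2 : ℝ) • curvature (𝓡 (m + 2)) S.g ℓ' ℓ' ℓ' (Δ.e p) = 0 := by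
      rw [two_smul]
      exact (congrArg (_ + ·) this).trans (add_neg_cancel _)
    exact (smul_eq_zero.1 h2).resolve_left two_ne_zero
  -- The transversal direction does not contribute to Ric(ℓ,ℓ), by skewness of the curvature
  -- operator R(n,ℓ).
  have z2 : S.g (Δ.e p) (Δ.push p (ℓ p)) (L n) = 0 := by
    obtain ⟨n', hn', hn⟩ := exists_smoothVF_apply_eq (𝓡 (m + 2)) (Δ.e p) n
    rw [← hn, ← hL n' hn', rℓp, hg.symm]
    exact pair_curvature_self hg hn' hℓ' hℓ' (Δ.e p)
  have z3 : ∀ i, S.g (Δ.e p) (Δ.push p (F₀ i)) (L (Δ.push p (F₀ i))) =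
      (1 / 2) * T p (F₀ i) (F₀ i) - (1 / 2) * lieBilin (modelH m) ℓ T (F i) (F i) p +
        (1 / 4) * ∑ j, T p (F₀ i) (F₀ j) * T p (F₀ i) (F₀ j) := by
    intro i
    have h1 := Δ.pair_curvature_null hℓ hnull hκ hv 𝓑 hT hℓ' rℓ (hF i) (hF' i) (rF i)
    rw [rFp, ← hL _ (hF' i), hg.symm]
    have h2 : ∀ j, S.g (Δ.e p) (Δ.push p (F₀ j)) (nabla (𝓡 (m + 2)) S.g (F' i) ℓ' (Δ.e p)) =
        (1 / 2) * T p (F₀ i) (F₀ j) := by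
      intro j
      have := Δ.lie_q_eq hℓ hnull hℓ' rℓ (hF i) (hF' i) (rF i) (hF j) (hF' j) (rF j)
      rw [← hT _ _ (hF i) (hF j), hFp, hFp] at this
      rw [rFp, hg.symm, this, pair]
      ring
    have h3 : S.g (Δ.e p) (Δ.push p (ℓ p)) (nabla (𝓡 (m + 2)) S.g (F' i) ℓ' (Δ.e p)) = 0 := by
      rw [rℓp]
      exact Δ.pair_nabla_null_self hℓ hnull hℓ' rℓ (hF i) (hF' i) (rF i)
    have h4 : pair (𝓡 (m + 2)) S.g (nabla (𝓡 (m + 2)) S.g (F' i) ℓ')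
        (nabla (𝓡 (m + 2)) S.g (F' i) ℓ') (Δ.e p) =
        (1 / 4) * ∑ j, T p (F₀ i) (F₀ j) * T p (F₀ i) (F₀ j) := by
      -- The field ∇_X ℓ is orthogonal to ℓ, so its square involves only its components along the
      -- orthonormal vectors, which are ½T.
      rw [pair]
      set W := nabla (𝓡 (m + 2)) S.g (F' i) ℓ' (Δ.e p) with hW
      have h5 := hexp W
      rw [h3, zero_smul, sub_zero] at h5
      have h6 : ∀ u, S.g (Δ.e p) W u = ∑ j, (1 / 2) * T p (F₀ i) (F₀ j) *
          S.g (Δ.e p) (Δ.push p (F₀ j)) u -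
            S.g (Δ.e p) n W * S.g (Δ.e p) (Δ.push p (ℓ p)) u := by
        intro u
        conv_lhs => rw [h5]
        simp only [map_sub, map_sum, map_smul, _root_.sub_apply, _root_.sum_apply,
          _root_.smul_apply, smul_eq_mul, h2]
      rw [h6 W]
      simp only [h3, h2, mul_zero, sub_zero, Finset.mul_sum]
      exact Finset.sum_congr rfl fun j _ => by ring
    rw [pair, hFp, h4] at h1
    exact h1
  have hon : OrthonormalAt (modelH m) Δ.q F p := fun i j => by rw [hFp, hFp]; exact hF₀ i j
  have t1 : ∑ i, T p (F₀ i) (F₀ i) = 0 := by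
    rw [← Δ.nonexpanding ℓ hℓ hnull F hF p hon]
    exact Finset.sum_congr rfl fun i _ => by
      rw [← hFp]
      exact hT _ _ (hF i) (hF i) p
  have hTl : ∀ p (y : TangentSpace (modelH m) p), T p (ℓ p) y = 0 := by
    intro p y
    obtain ⟨Y, hY, rfl⟩ := exists_smoothVF_apply_eq (modelH m) p y
    rw [hT _ _ hℓ hY, Δ.lie_q_null hℓ hnull]
  have hTl' : ∀ p (y : TangentSpace (modelH m) p), T p y (ℓ p) = 0 := by
    intro p y
    obtain ⟨Y, hY, rfl⟩ := exists_smoothVF_apply_eq (modelH m) p y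
    rw [hT _ _ hY hℓ, Δ.lie_q_symm hℓ hnull, Δ.lie_q_null hℓ hnull]
  -- T is trace free, and its own defining relation T = 𝓛_ℓ q makes the trace of 𝓛_ℓ T equal to
  -- |T|². Summing `z3` gives 0 - ½|T|² + ¼|T|² = -¼|T|².
  have t2 : ∑ i, lieBilin (modelH m) ℓ T (F i) (F i) p =
      ∑ i, ∑ j, T p (F i p) (F j p) * lieBilin (modelH m) ℓ Δ.q (F i) (F j) p := by
    refine trace_lieBilin Δ.q_smooth ?_ Δ.q_symm Δ.q_nonneg hF hon (Eventually.of_forall ?_) ?_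
    · intro X Y hX hY
      have : pair (modelH m) T X Y = lieBilin (modelH m) ℓ Δ.q X Y :=
        funext fun p' => hT X Y hX hY p'
      rw [this]
      exact smoothFn_lieBilin Δ.q_smooth hℓ hX hY
    · intro x G hG
      choose G' hG' hGx using fun i => exists_smoothVF_apply_eq (modelH m) x (G i)
      rw [← Δ.nonexpanding ℓ hℓ hnull G' hG' x (fun i j => by rw [hGx, hGx]; exact hG i j)]
      exact Finset.sum_congr rfl fun i _ => by
        rw [← hGx]
        exact hT _ _ (hG' i) (hG' i) x
    · intro i
      obtain ⟨c, hc⟩ := Δ.exists_expansion (hnull p) (hℓ0 p) (F := fun j => F j p) hon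
        (mlieBracket (modelH m) ℓ (F i) p)
      refine ⟨c • ℓ p, hc, ?_⟩
      rw [map_smul, map_smul, _root_.smul_apply, hTl, hTl']
      simp
  simp only [← hT _ _ (hF _) (hF _), hFp] at t2
  rw [rℓp, hric, htr, z1, z2, Finset.sum_congr rfl fun i _ => z3 i, map_zero, sub_zero, sub_zero,
    Finset.sum_add_distrib, Finset.sum_sub_distrib, ← Finset.mul_sum, ← Finset.mul_sum,
    ← Finset.mul_sum, t1, t2]
  ring

include hκ hv 𝓑 in
/-- On a nonexpanding horizon the energy condition makes the induced metric invariant. -/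
lemma lie_q_eq_zero (hE : Δ.StrongerEnergyCondition) (hℓ0 : ∀ p, ℓ p ≠ 0)
    {X Y : VF (modelH m) (B × ℝ)} (hX : SmoothVF (modelH m) X) (hY : SmoothVF (modelH m) Y)
    (p : B × ℝ) : lieBilin (modelH m) ℓ Δ.q X Y p = 0 := by
  have hg := S.isMetric
  obtain ⟨T, hT, -⟩ := exists_lieBilin_tensor Δ.q_smooth hℓ
  obtain ⟨F, hF, hric⟩ := Δ.ricci_null hℓ hnull hκ hv 𝓑 hT hℓ0 p
  have hll : S.g (Δ.e p) (Δ.push p (ℓ p)) (Δ.push p (ℓ p)) = 0 := hnull p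
  have hein := S.einstein (Δ.e p) (Δ.push p (ℓ p)) (Δ.push p (ℓ p))
  rw [hll] at hein
  -- For future oriented l the vector w dual to -T(l,·) is causal and future oriented, hence g(w,l)
  -- ≤ 0, which is T(l,l) ≥ 0.
  have energy : ∀ l : TangentSpace (modelH m) p, Δ.q p l l = 0 →
      S.g (Δ.e p) (Δ.push p l) (S.future (Δ.e p)) ≤ 0 →
      0 ≤ S.T (Δ.e p) (Δ.push p l) (Δ.push p l) := by
    intro l hl hf
    obtain ⟨w, hw⟩ := hg.exists_dual (Δ.e p) (-(S.T (Δ.e p) (Δ.push p l))).toLinearMap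
    have hc := hE p l hl ⟨le_of_eq hl, hf⟩ w (fun Y => hw Y)
    obtain ⟨b, hb⟩ := S.exists_isLorentz (Δ.e p)
    have := hb.causal (S.future_timelike (Δ.e p)) hc.1 (le_of_eq hl) hc.2 hf
    change S.g _ w (Δ.push p l) ≤ 0 at this
    rw [hw] at this
    simpa using this
  -- The time orientation of ℓ is not prescribed, but T(ℓ,ℓ) is even in ℓ.
  have hpos : 0 ≤ S.T (Δ.e p) (Δ.push p (ℓ p)) (Δ.push p (ℓ p)) := by
    rcases le_total (S.g (Δ.e p) (Δ.push p (ℓ p)) (S.future (Δ.e p))) 0 with h | h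
    · exact energy _ (hnull p) h
    · have := energy (-ℓ p) (by simpa using hnull p) (by simpa using h)
      simpa using this
  -- Since g(ℓ,ℓ) = 0, the Einstein equations equate -¼|T|² with a nonnegative multiple of the
  -- energy-momentum term.
  have hsum : ∑ i, ∑ j, T p (F i) (F j) * T p (F i) (F j) = 0 := by
    have h1 : 0 ≤ ∑ i, ∑ j, T p (F i) (F j) * T p (F i) (F j) :=
      Finset.sum_nonneg fun i _ => Finset.sum_nonneg fun j _ => mul_self_nonneg _
    have h2 : 0 ≤ 8 * Real.pi * S.newton * S.T (Δ.e p) (Δ.push p (ℓ p)) (Δ.push p (ℓ p)) := by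
      have := S.newton_pos
      have := Real.pi_pos
      positivity
    rw [← hein, hric] at h2
    linarith
  have hz : ∀ i j, T p (F i) (F j) = 0 := by
    intro i j
    have h1 := (Finset.sum_eq_zero_iff_of_nonneg
      (fun i _ => Finset.sum_nonneg fun j _ => mul_self_nonneg _)).1 hsum i (Finset.mem_univ _)
    exact mul_self_eq_zero.1 ((Finset.sum_eq_zero_iff_of_nonneg
      (fun j _ => mul_self_nonneg _)).1 h1 j (Finset.mem_univ _))
  have hTl : ∀ (y : TangentSpace (modelH m) p), T p (ℓ p) y = 0 := by
    intro y
    obtain ⟨Y, hY, rfl⟩ := exists_smoothVF_apply_eq (modelH m) p y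
    rw [hT _ _ hℓ hY, Δ.lie_q_null hℓ hnull]
  have hTl' : ∀ (y : TangentSpace (modelH m) p), T p y (ℓ p) = 0 := by
    intro y
    obtain ⟨Y, hY, rfl⟩ := exists_smoothVF_apply_eq (modelH m) p y
    rw [hT _ _ hY hℓ, Δ.lie_q_symm hℓ hnull, Δ.lie_q_null hℓ hnull]
  rw [← hT X Y hX hY]
  obtain ⟨c, hc⟩ := Δ.exists_expansion (hnull p) (hℓ0 p) hF (X p)
  obtain ⟨d, hd⟩ := Δ.exists_expansion (hnull p) (hℓ0 p) hF (Y p)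
  rw [hc, hd]
  simp [hz, hTl, hTl']

-- g(ℓ, ∇_X Y) = -½(𝓛_ℓ q)(X,Y) = 0, and the vectors orthogonal to ℓ are exactly those tangent to
-- the horizon.
include hκ hv 𝓑 in
lemma totallyGeodesic (hE : Δ.StrongerEnergyCondition) (hℓ0 : ∀ p, ℓ p ≠ 0) :
    TotallyGeodesic (𝓡 (m + 2)) (modelH m) Δ.e S.g := by
  intro X Y X' Y' p hX hY hX' hY' rX rY
  obtain ⟨ℓ', hℓ', rℓ⟩ := Δ.exists_extension hℓ p
  refine Δ.exists_push_eq hnull hv 𝓑 ?_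
  have h1 := Δ.lie_q_eq_zero hℓ hnull hκ hv 𝓑 hE hℓ0 hX hY p
  rw [Δ.lie_q_eq hℓ hnull hℓ' rℓ hX hX' rX hY hY' rY,
    Δ.pair_nabla_null hℓ hnull hℓ' rℓ hX hX' rX hY' rY] at h1
  have rℓp : Δ.push p (ℓ p) = ℓ' (Δ.e p) := rℓ.at
  rw [rℓp]
  simp only [pair] at h1
  linarith

end Raychaudhuri

end Horizon

end NEH

namespace NEH

open VectorField Filter Set

lemma bracket_sub_right {E : Type*} [NormedAddCommGroup E] [NormedSpace ℝ E]
    [FiniteDimensional ℝ E] {H : Type*} [TopologicalSpace H] {I : ModelWithCorners ℝ E H}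
    {M : Type*} [TopologicalSpace M] [ChartedSpace H M] [IsManifold I ∞ M] {X Y Z : VF I M}
    (hY : SmoothVF I Y) (hZ : SmoothVF I Z) :
    mlieBracket I X (Y - Z) = mlieBracket I X Y - mlieBracket I X Z := by
  have := bracket_add_right (X := X) (hY.sub hZ) hZ
  rw [sub_add_cancel] at this
  rw [this, add_sub_cancel_right]

namespace Horizon

/-! ### The Lie derivative of D, the tensor N and the rotation one-form. -/

section Connection

variable {m : ℕ} {M : Type*} [TopologicalSpace M] [T2Space M]
  [ChartedSpace (EuclideanSpace ℝ (Fin (m + 2))) M] [IsManifold (𝓡 (m + 2)) ∞ M]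
  {B : Type*} [TopologicalSpace B] [T2Space B] [ChartedSpace (EuclideanSpace ℝ (Fin m)) B]
  [IsManifold (𝓡 m) ∞ B] {S : Spacetime (m + 2) M} (Δ : Horizon S B)
  (htg : TotallyGeodesic (𝓡 (m + 2)) (modelH m) Δ.e S.g)

include htg

variable {X X' Y Y' : VF (modelH m) (B × ℝ)}

lemma D_smooth (hX : SmoothVF (modelH m) X) (hY : SmoothVF (modelH m) Y) :
    SmoothVF (modelH m) (Δ.D X Y) :=
  SmoothVF.inducedD S.isMetric Δ.e_smooth Δ.e_immersion htg hX hY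

lemma D_torsion (hX : SmoothVF (modelH m) X) (hY : SmoothVF (modelH m) Y) :
    Δ.D X Y - Δ.D Y X = mlieBracket (modelH m) X Y :=
  inducedD_torsion S.isMetric Δ.e_smooth Δ.e_immersion htg hX hY

lemma D_add_left (hX : SmoothVF (modelH m) X) (hX' : SmoothVF (modelH m) X')
    (hY : SmoothVF (modelH m) Y) : Δ.D (X + X') Y = Δ.D X Y + Δ.D X' Y :=
  inducedD_add_left S.isMetric Δ.e_smooth Δ.e_immersion htg hX hX' hY

lemma D_add_right (hX : SmoothVF (modelH m) X) (hY : SmoothVF (modelH m) Y)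
    (hY' : SmoothVF (modelH m) Y') : Δ.D X (Y + Y') = Δ.D X Y + Δ.D X Y' :=
  inducedD_add_right S.isMetric Δ.e_smooth Δ.e_immersion htg hX hY hY'

lemma D_smul_left {f : B × ℝ → ℝ} (hf : SmoothFn (modelH m) f) (hX : SmoothVF (modelH m) X)
    (hY : SmoothVF (modelH m) Y) : Δ.D (f • X) Y = f • Δ.D X Y :=
  inducedD_smul_left S.isMetric Δ.e_smooth Δ.e_immersion htg hf hX hY

lemma D_smul_right {f : B × ℝ → ℝ} (hf : SmoothFn (modelH m) f) (hX : SmoothVF (modelH m) X)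
    (hY : SmoothVF (modelH m) Y) :
    Δ.D X (f • Y) = dir (modelH m) X f • Y + f • Δ.D X Y :=
  inducedD_smul_right S.isMetric Δ.e_smooth Δ.e_immersion htg hf hX hY

lemma lieD_smooth {Z : VF (modelH m) (B × ℝ)} (hZ : SmoothVF (modelH m) Z)
    (hX : SmoothVF (modelH m) X) (hY : SmoothVF (modelH m) Y) :
    SmoothVF (modelH m) (Δ.lieD Z X Y) :=
  ((hZ.bracket (Δ.D_smooth htg hX hY)).sub (Δ.D_smooth htg (hZ.bracket hX) hY)).sub
    (Δ.D_smooth htg hX (hZ.bracket hY))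

/-- The skew part is the Lie derivative of the torsion of D, zero by the Jacobi identity. -/
lemma lieD_symm {Z : VF (modelH m) (B × ℝ)} (hZ : SmoothVF (modelH m) Z)
    (hX : SmoothVF (modelH m) X) (hY : SmoothVF (modelH m) Y) :
    Δ.lieD Z X Y = Δ.lieD Z Y X := by
  have h1 := Δ.D_torsion htg hX hY
  have h2 := Δ.D_torsion htg (hZ.bracket hX) hY
  have h3 := Δ.D_torsion htg hX (hZ.bracket hY)
  have h4 := jacobi hZ hX hY
  rw [← h1, bracket_sub_right (Δ.D_smooth htg hX hY) (Δ.D_smooth htg hY hX), ← h2, ← h3] at h4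
  unfold lieD
  rw [← sub_eq_zero] at h4 ⊢
  rw [← h4]
  abel

lemma lieD_add {Z Z' : VF (modelH m) (B × ℝ)} (hZ : SmoothVF (modelH m) Z)
    (hZ' : SmoothVF (modelH m) Z') (hX : SmoothVF (modelH m) X) (hY : SmoothVF (modelH m) Y) :
    Δ.lieD (Z + Z') X Y = Δ.lieD Z X Y + Δ.lieD Z' X Y := by
  unfold lieD
  rw [bracket_add_left hZ hZ', bracket_add_left hZ hZ', bracket_add_left hZ hZ',
    Δ.D_add_left htg (hZ.bracket hX) (hZ'.bracket hX) hY,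
    Δ.D_add_right htg hX (hZ.bracket hY) (hZ'.bracket hY)]
  abel

/-- The commutator of Lie derivatives of the connection. -/
lemma lieD_bracket {k ℓ : VF (modelH m) (B × ℝ)} (hk : SmoothVF (modelH m) k)
    (hℓ : SmoothVF (modelH m) ℓ)
    (hkD : ∀ {X Y}, SmoothVF (modelH m) X → SmoothVF (modelH m) Y →
      mlieBracket (modelH m) k (Δ.D X Y) =
        Δ.D (mlieBracket (modelH m) k X) Y + Δ.D X (mlieBracket (modelH m) k Y))
    (hX : SmoothVF (modelH m) X) (hY : SmoothVF (modelH m) Y) :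
    Δ.lieD (mlieBracket (modelH m) k ℓ) X Y = mlieBracket (modelH m) k (Δ.lieD ℓ X Y) -
      Δ.lieD ℓ (mlieBracket (modelH m) k X) Y - Δ.lieD ℓ X (mlieBracket (modelH m) k Y) := by
  have s1 := hℓ.bracket (Δ.D_smooth htg hX hY)
  have s2 := Δ.D_smooth htg (hℓ.bracket hX) hY
  have s3 := Δ.D_smooth htg hX (hℓ.bracket hY)
  have e0 : mlieBracket (modelH m) k (Δ.lieD ℓ X Y) =
      mlieBracket (modelH m) k (mlieBracket (modelH m) ℓ (Δ.D X Y)) -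
      mlieBracket (modelH m) k (Δ.D (mlieBracket (modelH m) ℓ X) Y) -
      mlieBracket (modelH m) k (Δ.D X (mlieBracket (modelH m) ℓ Y)) := by
    unfold lieD
    rw [bracket_sub_right (s1.sub s2) s3, bracket_sub_right s1 s2]
  rw [e0, hkD (hℓ.bracket hX) hY, hkD hX (hℓ.bracket hY), jacobi hk hℓ (Δ.D_smooth htg hX hY),
    hkD hX hY, bracket_add_right (Δ.D_smooth htg (hk.bracket hX) hY)
      (Δ.D_smooth htg hX (hk.bracket hY)), jacobi hk hℓ hX, jacobi hk hℓ hY,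
    Δ.D_add_left htg ((hk.bracket hℓ).bracket hX) (hℓ.bracket (hk.bracket hX)) hY,
    Δ.D_add_right htg hX ((hk.bracket hℓ).bracket hY) (hℓ.bracket (hk.bracket hY))]
  unfold lieD
  abel

variable {ℓ : VF (modelH m) (B × ℝ)} (hℓ : Δ.IsNatural ℓ) (hℓ0 : ∀ p, ℓ p ≠ 0)
  {v₀ : B × ℝ → ℝ} (hvs : SmoothFn (modelH m) v₀) (hv : ∀ p, dir (modelH m) ℓ v₀ p = 1)

include hℓ

omit htg in
lemma D_self : Δ.D ℓ ℓ = ℓ := funext hℓ.surface_gravity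

/-- As D_ℓ ℓ = ℓ, each term contains the bracket of ℓ with itself. This gives N(ℓ,ℓ) = 0. -/
lemma lieD_self : Δ.lieD ℓ ℓ ℓ = 0 := by
  have h0 : mlieBracket (modelH m) ℓ ℓ = 0 := by simp
  have h1 : Δ.D 0 ℓ = 0 := by
    have := Δ.D_smul_left htg (f := fun _ => 0) contMDiff_const hℓ.smooth hℓ.smooth
    have z : ∀ Z : VF (modelH m) (B × ℝ), (fun _ : B × ℝ => (0 : ℝ)) • Z = 0 := by
      intro Z; funext p; simp
    rwa [z, z] at this
  have h2 : Δ.D ℓ 0 = 0 := by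
    have := Δ.D_torsion htg hℓ.smooth (SmoothVF.zero (I := modelH m))
    rw [h1, sub_zero] at this
    rw [this]
    simp
  unfold lieD
  rw [Δ.D_self hℓ, h0, h1, h2]
  simp

include hℓ0 hvs hv

/-- The tensor `N` of the invariant vector field. -/
lemma exists_N : ∃ N : Bilin (modelH m) (B × ℝ),
    (∀ X Y, SmoothVF (modelH m) X → SmoothVF (modelH m) Y →
      ∀ p, Δ.lieD ℓ X Y p = N p (X p) (Y p) • ℓ p) ∧
    (∀ {X Y}, SmoothVF (modelH m) X → SmoothVF (modelH m) Y →
      SmoothFn (modelH m) (pair (modelH m) N X Y)) ∧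
    (∀ (p : B × ℝ) (F : Fin m → TangentSpace (modelH m) p),
      (∀ i j, Δ.q p (F i) (F j) = if i = j then 1 else 0) → ∑ i, N p (F i) (F i) = 0) ∧
    (∀ p x, N p (ℓ p) x = 0) ∧ ∀ p x, N p x (ℓ p) = 0 := by
  obtain ⟨N, hN, htr⟩ := hℓ.trace_free
  have hN' := fun X Y hX hY p => hN X Y hX hY p (hℓ0 p)
  have htr' : ∀ (p : B × ℝ) (F : Fin m → TangentSpace (modelH m) p),
      (∀ i j, Δ.q p (F i) (F j) = if i = j then 1 else 0) → ∑ i, N p (F i) (F i) = 0 := by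
    intro p F hF
    choose F' hF' hFp using fun i => exists_smoothVF_apply_eq (modelH m) p (F i)
    have := htr F' p (hℓ0 p) (fun i j => by rw [hFp, hFp]; exact hF i j)
    simpa only [hFp] using this
  have hsymm : ∀ p x y, N p x y = N p y x := by
    intro p x y
    obtain ⟨X, hX, rfl⟩ := exists_smoothVF_apply_eq (modelH m) p x
    obtain ⟨Y, hY, rfl⟩ := exists_smoothVF_apply_eq (modelH m) p y
    have := congrFun (Δ.lieD_symm htg hℓ.smooth hX hY) p
    rw [hN' X Y hX hY, hN' Y X hY hX] at this
    exact smul_left_injective ℝ (hℓ0 p) this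
  have hll : ∀ p, N p (ℓ p) (ℓ p) = 0 := by
    intro p
    have := hN' ℓ ℓ hℓ.smooth hℓ.smooth p
    rw [Δ.lieD_self htg hℓ, Pi.zero_apply, eq_comm, smul_eq_zero] at this
    exact this.resolve_right (hℓ0 p)
  have hl : ∀ p x, N p (ℓ p) x = 0 := by
    intro p x
    obtain ⟨F, hF, -⟩ := Δ.exists_orthonormal_frame (hℓ.null p)
      (mvfderiv (modelH m) v₀ p).toLinearMap (hv p)
    have hFi : ∀ i, N p (ℓ p) (F i) = 0 := by
      intro i
      have h1 := htr' p F hF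
      -- Adding ℓ to F i keeps the system orthonormal because ℓ is in the kernel of q. The two trace
      -- conditions differ by 2N(ℓ, F i) + N(ℓ,ℓ), so N descends to the quotient by ℓ.
      have h2 := htr' p (fun j => F j + (if j = i then (1 : ℝ) else 0) • ℓ p) (by
        intro a b
        simp only [map_add, map_smul, _root_.add_apply, _root_.smul_apply, smul_eq_mul,
          Δ.q_left_of_null (hℓ.null p), Δ.q_symm p (F _) (ℓ p), mul_zero, add_zero]
        exact hF a b)
      simp only [map_add, map_smul, _root_.add_apply, _root_.smul_apply, smul_eq_mul, hll,
        mul_zero, add_zero, hsymm p (F _) (ℓ p), Finset.sum_add_distrib, h1, zero_add,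
        ite_mul, one_mul, zero_mul, Finset.sum_ite_eq', Finset.mem_univ, if_true] at h2
      linarith
    obtain ⟨c, hc⟩ := Δ.exists_expansion (hℓ.null p) (hℓ0 p) hF x
    rw [hc]
    simp [hFi, hll]
  refine ⟨N, hN', ?_, htr', hl, fun p x => by rw [hsymm, hl]⟩
  intro X Y hX hY
  -- N is given only pointwise; ℓ(v) = 1 allows it to be read off from a smooth field.
  have : pair (modelH m) N X Y = dir (modelH m) (Δ.lieD ℓ X Y) v₀ := by
    funext p
    have h1 := hv p
    rw [dir] at h1 ⊢
    rw [hN' X Y hX hY, map_smul, h1, smul_eq_mul, mul_one, pair]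
  rw [this]
  exact (Δ.lieD_smooth htg hℓ.smooth hX hY).dir hvs

variable {α : OneForm (modelH m) (B × ℝ)} (hα : Δ.IsRotationForm ℓ α)

include hα

lemma smoothFn_rotation (hX : SmoothVF (modelH m) X) :
    SmoothFn (modelH m) (fun p => α p (X p)) := by
  have : (fun p => α p (X p)) = dir (modelH m) (Δ.D X ℓ) v₀ := by
    funext p
    have h1 := hv p
    rw [dir] at h1 ⊢
    rw [hα X hX, map_smul, h1, smul_eq_mul, mul_one]
  rw [this]
  exact (Δ.D_smooth htg hX hℓ.smooth).dir hvs

omit htg hvs hv in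
lemma rotation_self (p : B × ℝ) : α p (ℓ p) = 1 := by
  have := hα ℓ hℓ.smooth p
  rw [hℓ.surface_gravity] at this
  have h2 : (1 : ℝ) • ℓ p = α p (ℓ p) • ℓ p := by rw [one_smul]; exact this
  exact (smul_left_injective ℝ (hℓ0 p) h2).symm

omit htg hvs hv hℓ0 in
lemma D_eq_rotation (hX : SmoothVF (modelH m) X) : Δ.D X ℓ = (fun p => α p (X p)) • ℓ :=
  funext fun p => hα X hX p

/-- The rotation one-form is Lie dragged by the invariant vector field. -/
lemma lie_rotation (hX : SmoothVF (modelH m) X) (p : B × ℝ) :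
    dir (modelH m) ℓ (fun p => α p (X p)) p = α p (mlieBracket (modelH m) ℓ X p) := by
  obtain ⟨N, hN, -, -, -, hNl⟩ := Δ.exists_N htg hℓ hℓ0 hvs hv
  -- N(X,ℓ) = 0 says that ([𝓛_ℓ, D])(X,ℓ) = 0, and D_X ℓ = ω(X)ℓ turns this into (𝓛_ℓ ω)(X) = 0.
  have h1 := hN X ℓ hX hℓ.smooth p
  have h0 : mlieBracket (modelH m) ℓ ℓ = 0 := by simp
  have h2 : Δ.D X 0 = 0 := by
    have := Δ.D_smul_right htg (f := fun _ => 0) contMDiff_const hX hX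
    have z : ∀ Z : VF (modelH m) (B × ℝ), (fun _ : B × ℝ => (0 : ℝ)) • Z = 0 := by
      intro Z; funext p; simp
    rw [z, z, add_zero] at this
    rw [this]
    funext p
    simp [dir_const]
  rw [hNl, zero_smul, lieD, h0, h2, Δ.D_eq_rotation hℓ hα hX,
    bracket_smul_right (Δ.smoothFn_rotation htg hℓ hℓ0 hvs hv hα hX) hℓ.smooth, h0,
    Δ.D_eq_rotation hℓ hα (hℓ.smooth.bracket hX)] at h1
  simp only [Pi.sub_apply, Pi.smul_apply', Pi.zero_apply, smul_zero, add_zero,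
    sub_zero, ← sub_smul, smul_eq_zero, hℓ0 p, or_false] at h1
  linarith

end Connection

/-! ### Tangent Killing fields commute with the invariant vector field. -/

section Killing

variable {m : ℕ} {M : Type*} [TopologicalSpace M] [T2Space M]
  [ChartedSpace (EuclideanSpace ℝ (Fin (m + 2))) M] [IsManifold (𝓡 (m + 2)) ∞ M]
  {B : Type*} [TopologicalSpace B] [T2Space B] [ChartedSpace (EuclideanSpace ℝ (Fin m)) B]
  [IsManifold (𝓡 m) ∞ B] {S : Spacetime (m + 2) M} (Δ : Horizon S B)
  (htg : TotallyGeodesic (𝓡 (m + 2)) (modelH m) Δ.e S.g)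
  {K : VF (𝓡 (m + 2)) M} (hK : S.IsKilling K)
  {k : VF (modelH m) (B × ℝ)} (hkK : ∀ p, Δ.push p (k p) = K (Δ.e p))

include hK hkK

lemma smooth_of_push : SmoothVF (modelH m) k :=
  smoothVF_of_related Δ.e_smooth Δ.e_immersion fun _ =>
    ⟨K, hK.1, Eventually.of_forall fun p' => hkK p'⟩

lemma lie_q_killing {X Y : VF (modelH m) (B × ℝ)} (hX : SmoothVF (modelH m) X)
    (hY : SmoothVF (modelH m) Y) (p : B × ℝ) : lieBilin (modelH m) k Δ.q X Y p = 0 := by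
  obtain ⟨X', hX', rX⟩ := Δ.exists_extension hX p
  obtain ⟨Y', hY', rY⟩ := Δ.exists_extension hY p
  rw [← hK.2 X' Y' hX' hY' (Δ.e p)]
  exact lieBilin_pullback Δ.e_smooth S.isMetric.smooth (Δ.smooth_of_push hK hkK) hX hY hK.1 hX' hY'
    (Eventually.of_forall fun p' => hkK p') rX rY

include htg

lemma bracket_D_killing {X Y : VF (modelH m) (B × ℝ)} (hX : SmoothVF (modelH m) X)
    (hY : SmoothVF (modelH m) Y) : mlieBracket (modelH m) k (Δ.D X Y) =
      Δ.D (mlieBracket (modelH m) k X) Y + Δ.D X (mlieBracket (modelH m) k Y) :=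
  killing_inducedD S.isMetric Δ.e_smooth Δ.e_immersion htg hK.1 hK.2 (Δ.smooth_of_push hK hkK)
    hkK hX hY

lemma lieD_killing {X Y : VF (modelH m) (B × ℝ)} (hX : SmoothVF (modelH m) X)
    (hY : SmoothVF (modelH m) Y) (p : B × ℝ) : Δ.lieD k X Y p = 0 := by
  unfold lieD
  rw [Δ.bracket_D_killing htg hK hkK hX hY]
  simp

variable {ℓ : VF (modelH m) (B × ℝ)} (hℓ : Δ.IsNatural ℓ) (hℓ0 : ∀ p, ℓ p ≠ 0)
  {v₀ : B × ℝ → ℝ} (hvs : SmoothFn (modelH m) v₀) (hv : ∀ p, dir (modelH m) ℓ v₀ p = 1)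

include hℓ hℓ0 hvs hv

-- Evaluating 𝓛_k q = 0 on ℓ and [k,ℓ] leaves q([k,ℓ],[k,ℓ]) = 0, since ℓ is in the kernel of q. The
-- factor is [k,ℓ](v), hence smooth.
omit htg in
lemma exists_bracket_null : ∃ f : B × ℝ → ℝ, SmoothFn (modelH m) f ∧
    mlieBracket (modelH m) k ℓ = f • ℓ := by
  have hk := Δ.smooth_of_push hK hkK
  refine ⟨dir (modelH m) (mlieBracket (modelH m) k ℓ) v₀, (hk.bracket hℓ.smooth).dir hvs, ?_⟩
  funext p
  have h0 : Δ.q p (mlieBracket (modelH m) k ℓ p) (mlieBracket (modelH m) k ℓ p) = 0 := by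
    have h := Δ.lie_q_killing hK hkK hℓ.smooth (hk.bracket hℓ.smooth) p
    simp only [lieBilin, Δ.pair_q_null hℓ.smooth hℓ.null, dir_const] at h
    simp only [pair] at h
    linarith
  obtain ⟨c, hc⟩ := Δ.eq_smul_of_null (hℓ.null p) (hℓ0 p) h0
  have h1 := hv p
  rw [dir] at h1
  rw [Pi.smul_apply', dir, hc, map_smul, h1, smul_eq_mul, mul_one]

/-- A Killing field tangent to the horizon commutes with the invariant vector field. -/
lemma bracket_killing_natural (hgen : Δ.InvariantGeneric) : mlieBracket (modelH m) k ℓ = 0 := by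
  have hk := Δ.smooth_of_push hK hkK
  have hkD := fun {X Y} => Δ.bracket_D_killing htg hK hkK (X := X) (Y := Y)
  obtain ⟨f, hf, hfe⟩ := Δ.exists_bracket_null hK hkK hℓ hℓ0 hvs hv
  obtain ⟨N, hN, hNs, hNtr, hNl, hNl'⟩ := Δ.exists_N htg hℓ hℓ0 hvs hv
  -- Applying 𝓛_k to D_ℓ ℓ = ℓ gives fℓ = D_{fℓ}ℓ + D_ℓ(fℓ) = (2f + ℓ(f))ℓ.
  have hℓf : ∀ p, dir (modelH m) ℓ f p = - f p := by
    intro p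
    have h1 := congrFun (hkD hℓ.smooth hℓ.smooth) p
    rw [Δ.D_self hℓ, hfe, Δ.D_smul_left htg hf hℓ.smooth hℓ.smooth,
      Δ.D_smul_right htg hf hℓ.smooth hℓ.smooth, Δ.D_self hℓ] at h1
    simp only [Pi.add_apply, Pi.smul_apply', ← add_smul] at h1
    have := smul_left_injective ℝ (hℓ0 p) h1
    linarith
  -- The flow of k maps natural fields to natural fields; Gℓ = ℓ + [k,ℓ] is the first-order version
  -- of this, and it turns out to be natural exactly. That k may be incomplete is then of no
  -- concern.
  set G : B × ℝ → ℝ := fun p => 1 + f p with hG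
  have hGs : SmoothFn (modelH m) G := SmoothFn.add (SmoothFn.const 1) hf
  have hℓG : ∀ p, dir (modelH m) ℓ G p = 1 - G p := by
    intro p
    rw [hG, dir_fun_add ℓ mdifferentiableAt_const (hf.mdiff p), dir_const, hℓf]
    ring
  have hGe : G • ℓ = ℓ + mlieBracket (modelH m) k ℓ := by
    rw [hfe]
    funext p
    simp [G, add_smul]
  obtain ⟨T, hT, -⟩ := exists_lieBilin_tensor hNs hk
  -- The trace is formed with q, which k preserves, so 𝓛_k N is trace free along with N.
  have hNtr2 : ∀ (p : B × ℝ) (F : Fin m → TangentSpace (modelH m) p),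
      (∀ i j, Δ.q p (F i) (F j) = if i = j then 1 else 0) → ∑ i, T p (F i) (F i) = 0 := by
    intro p F₀ hF₀
    choose F hF hFp using fun i => exists_smoothVF_apply_eq (modelH m) p (F₀ i)
    have hon : OrthonormalAt (modelH m) Δ.q F p := fun i j => by rw [hFp, hFp]; exact hF₀ i j
    have h1 := trace_lieBilin Δ.q_smooth hNs Δ.q_symm Δ.q_nonneg (k := k) hF hon
      (Eventually.of_forall hNtr) (by
        intro i
        obtain ⟨c, hc⟩ := Δ.exists_expansion (hℓ.null p) (hℓ0 p) (F := fun j => F j p) hon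
          (mlieBracket (modelH m) k (F i) p)
        refine ⟨c • ℓ p, hc, ?_⟩
        rw [map_smul, map_smul, _root_.smul_apply, hNl, hNl']
        simp)
    simp only [Δ.lie_q_killing hK hkK (hF _) (hF _), mul_zero, Finset.sum_const_zero] at h1
    rw [← h1]
    exact Finset.sum_congr rfl fun i _ => by rw [← hFp, hT _ _ (hF i) (hF i)]
  have hnat : Δ.IsNatural (G • ℓ) := by
    refine ⟨SmoothVF.smul hGs hℓ.smooth, ?_, ?_, ?_, ?_⟩
    · intro p
      simp only [Pi.smul_apply', map_smul, _root_.smul_apply, Δ.q_left_of_null (hℓ.null p),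
        smul_zero]
    -- On an open set where G vanished, ℓ(G) = 1 - G would be both 0 and 1; so the zeros of Gℓ have
    -- empty interior.
    · intro p
      rw [mem_closure_iff_nhds]
      intro s hs
      by_contra hne
      rw [Set.not_nonempty_iff_eq_empty] at hne
      have h0 : ∀ᶠ x in 𝓝 p, G x = 0 := by
        filter_upwards [hs] with x hx
        by_contra hx'
        have : x ∈ s ∩ {p | (G • ℓ) p ≠ 0} := ⟨hx, smul_ne_zero hx' (hℓ0 x)⟩
        rw [hne] at this
        exact this
      have h1 := dir_eq_zero_of_eventually_const ℓ h0
      rw [hℓG, h0.self_of_nhds] at h1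
      norm_num at h1
    · intro p
      rw [Δ.D_smul_left htg hGs hℓ.smooth (SmoothVF.smul hGs hℓ.smooth),
        Δ.D_smul_right htg hGs hℓ.smooth hℓ.smooth, Δ.D_self hℓ]
      simp only [Pi.add_apply, Pi.smul_apply', ← add_smul, hℓG, smul_smul]
      congr 1
      ring
    -- With T = 𝓛_k N and k preserving D, the Lie derivative of D along ℓ + [k,ℓ] is Nℓ + 𝓛_k(Nℓ) =
    -- N Gℓ + Tℓ. Factoring out Gℓ leaves N + G⁻¹T.
    · refine ⟨fun p => N p + (G p)⁻¹ • T p, ?_, ?_⟩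
      · intro X Y hX hY p hp
        have hGp : G p ≠ 0 := by
          intro h0
          apply hp
          rw [Pi.smul_apply', h0, zero_smul]
        have e1 : Δ.lieD ℓ X Y = pair (modelH m) N X Y • ℓ := funext fun p => hN X Y hX hY p
        rw [hGe, Δ.lieD_add htg hℓ.smooth (hk.bracket hℓ.smooth) hX hY,
          Δ.lieD_bracket htg hk hℓ.smooth hkD hX hY, e1,
          bracket_smul_right (hNs hX hY) hℓ.smooth, ← hGe, hfe]
        simp only [Pi.add_apply, Pi.sub_apply, Pi.smul_apply', hN _ _ (hk.bracket hX) hY,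
          hN _ _ hX (hk.bracket hY), smul_smul, ← add_smul, ← sub_smul]
        congr 1
        simp only [_root_.add_apply, _root_.smul_apply, hT X Y hX hY, lieBilin, smul_eq_mul]
        simp only [pair, G, Pi.mul_apply] at hGp ⊢
        field_simp
        ring
      · intro F p hp hF
        simp only [_root_.add_apply, _root_.smul_apply, smul_eq_mul, Finset.sum_add_distrib,
          ← Finset.mul_sum]
        rw [hNtr p (fun i => F i p) hF, hNtr2 p (fun i => F i p) hF]
        simp
  have huniq := hgen.unique hnat hℓ
  rw [hfe]
  funext p
  have h1 := congrFun huniq p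
  have h2 : (1 + f p) • ℓ p = (1 : ℝ) • ℓ p := by rw [one_smul]; exact h1
  have h3 := smul_left_injective ℝ (hℓ0 p) h2
  have h4 : f p = 0 := by linarith
  rw [Pi.smul_apply', h4, zero_smul]
  rfl

variable {α : OneForm (modelH m) (B × ℝ)} (hα : Δ.IsRotationForm ℓ α)

include hα

/-- The rotation one-form is Lie dragged by the Killing field. -/
lemma lie_rotation_killing (hgen : Δ.InvariantGeneric) {X : VF (modelH m) (B × ℝ)}
    (hX : SmoothVF (modelH m) X) (p : B × ℝ) :
    dir (modelH m) k (fun p => α p (X p)) p = α p (mlieBracket (modelH m) k X p) := by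
  have hk := Δ.smooth_of_push hK hkK
  have h0 := Δ.bracket_killing_natural htg hK hkK hℓ hℓ0 hvs hv hgen
  -- With [k,ℓ] = 0, applying 𝓛_k to D_X ℓ = ω(X)ℓ gives k(ω(X)) = ω([k,X]).
  have h1 := congrFun (Δ.bracket_D_killing htg hK hkK hX hℓ.smooth) p
  have h2 : Δ.D X 0 = 0 := by
    have := Δ.D_smul_right htg (f := fun _ => 0) contMDiff_const hX hX
    have z : ∀ Z : VF (modelH m) (B × ℝ), (fun _ : B × ℝ => (0 : ℝ)) • Z = 0 := by
      intro Z; funext p; simp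
    rw [z, z, add_zero] at this
    rw [this]
    funext p
    simp [dir_const]
  rw [h0, h2, Δ.D_eq_rotation hℓ hα hX,
    bracket_smul_right (Δ.smoothFn_rotation htg hℓ hℓ0 hvs hv hα hX) hℓ.smooth, h0,
    Δ.D_eq_rotation hℓ hα (hk.bracket hX)] at h1
  simp only [Pi.add_apply, Pi.smul_apply', Pi.zero_apply, smul_zero, add_zero] at h1
  exact smul_left_injective ℝ (hℓ0 p) h1

end Killing

end Horizon

end NEH

namespace NEH

open VectorField Filter Set

namespace Horizon

/-! ### Vertical and horizontal vectors on B × ℝ. -/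

section Product

variable {m : ℕ} {B : Type*} [TopologicalSpace B] [T2Space B]
  [ChartedSpace (EuclideanSpace ℝ (Fin m)) B] [IsManifold (𝓡 m) ∞ B]

/-- The differential of the projection to the base. -/
noncomputable def dfst (p : B × ℝ) :
    TangentSpace (modelH m) p →L[ℝ] TangentSpace (𝓡 m) p.1 :=
  mfderiv (modelH m) (𝓡 m) Prod.fst p

lemma smooth_fst : ContMDiff (modelH m) (𝓡 m) ∞ (Prod.fst : B × ℝ → B) := contMDiff_fst

lemma smooth_slice (t : ℝ) : ContMDiff (𝓡 m) (modelH m) ∞ (fun x : B => (x, t)) :=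
  contMDiff_id.prodMk contMDiff_const

/-- The tangent vector of a slice with a given projection. -/
def horiz (p : B × ℝ) (w : TangentSpace (𝓡 m) p.1) : TangentSpace (modelH m) p :=
  ((w, 0) : EuclideanSpace ℝ (Fin m) × ℝ)

lemma dfst_vert (p : B × ℝ) : dfst p (vert (m := m) p) = 0 := by
  rw [dfst, mfderiv_fst]
  rfl

lemma dfst_horiz (p : B × ℝ) (w : TangentSpace (𝓡 m) p.1) : dfst p (horiz p w) = w := by
  rw [dfst, mfderiv_fst]
  rfl

lemma eq_horiz_add_vert (p : B × ℝ) (w : TangentSpace (modelH m) p) :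
    ∃ c : ℝ, w = horiz p (dfst p w) + c • vert p := by
  refine ⟨Prod.snd (α := EuclideanSpace ℝ (Fin m)) w, ?_⟩
  rw [dfst, mfderiv_fst]
  have : ∀ w : EuclideanSpace ℝ (Fin m) × ℝ,
      w = (w.1, (0 : ℝ)) + w.2 • ((0, 1) : EuclideanSpace ℝ (Fin m) × ℝ) := fun w =>
    Prod.ext (by simp) (by simp)
  exact this w

lemma eq_smul_vert_of_dfst {p : B × ℝ} {w : TangentSpace (modelH m) p} (h : dfst p w = 0) :
    ∃ c : ℝ, w = c • vert p := by
  obtain ⟨c, hc⟩ := eq_horiz_add_vert p w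
  refine ⟨c, ?_⟩
  rw [h] at hc
  rw [hc]
  have : horiz p (0 : TangentSpace (𝓡 m) p.1) = 0 := rfl
  rw [this, zero_add]

lemma mfderiv_slice (x : B) (t : ℝ) (w : TangentSpace (𝓡 m) x) :
    mfderiv (𝓡 m) (modelH m) (fun x : B => (x, t)) x w = horiz (x, t) w := by
  rw [mfderiv_prod_left]
  rfl

/-- The lift of a vector field on the base which is tangent to the slices. -/
def lift (X : VF (𝓡 m) B) : VF (modelH m) (B × ℝ) := fun p => horiz p (X p.1)

lemma lift_smooth {X : VF (𝓡 m) B} (hX : SmoothVF (𝓡 m) X) : SmoothVF (modelH m) (lift X) := by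
  have h1 : ContMDiff (modelH m) (𝓡 m).tangent ∞
      (fun p : B × ℝ => (⟨p.1, X p.1⟩ : TangentBundle (𝓡 m) B)) := hX.comp smooth_fst
  have h2 : ContMDiff (modelH m) 𝓘(ℝ, ℝ).tangent ∞
      (fun p : B × ℝ => (⟨p.2, 0⟩ : TangentBundle 𝓘(ℝ, ℝ) ℝ)) :=
    (Bundle.contMDiff_zeroSection (n := ∞) ℝ (F := ℝ) (IB := 𝓘(ℝ, ℝ))
      (TangentSpace 𝓘(ℝ, ℝ) : ℝ → Type _)).comp (contMDiff_snd (M := B) (I := 𝓡 m))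
  exact contMDiff_equivTangentBundleProd_symm.comp (h1.prodMk h2)

lemma related_fst_lift (X : VF (𝓡 m) B) (p : B × ℝ) :
    Related (modelH m) (𝓡 m) Prod.fst (lift X) X p :=
  Eventually.of_forall fun p' => dfst_horiz p' (X p'.1)

lemma hasDerivAt_line {f : B × ℝ → ℝ} (hf : SmoothFn (modelH m) f) (x : B) (s : ℝ) :
    HasDerivAt (fun s : ℝ => f (x, s)) (mvfderiv (modelH m) f (x, s) (vert (x, s))) s := by
  have h1 : ContMDiff 𝓘(ℝ, ℝ) (modelH m) ∞ (fun s : ℝ => (x, s)) :=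
    contMDiff_const.prodMk contMDiff_id
  have h2 := mvfderiv_comp_map h1 s (hf.mdiff (x, s)) (1 : ℝ)
  have h3 : mfderiv 𝓘(ℝ, ℝ) (modelH m) (fun s : ℝ => (x, s)) s (1 : ℝ) = vert (x, s) := by
    rw [mfderiv_prod_right]
    rfl
  rw [h3] at h2
  have h4 : DifferentiableAt ℝ (fun s : ℝ => f (x, s)) s :=
    ((hf.comp_map h1).contDiff.differentiable (by simp)) s
  have h5 : deriv (fun s : ℝ => f (x, s)) s =
      mvfderiv 𝓘(ℝ, ℝ) (fun s : ℝ => f (x, s)) s (1 : ℝ) := by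
    rw [← fderiv_apply_one_eq_deriv]
    simp only [mvfderiv, mfderiv_eq_fderiv]
    rfl
  rw [← h2, ← h5]
  exact h4.hasDerivAt

/-- Functions which are constant along the null curves. -/
lemma eq_slice_of_dir_eq_zero {f : B × ℝ → ℝ} (hf : SmoothFn (modelH m) f)
    (h : ∀ p, mvfderiv (modelH m) f p (vert p) = 0) (x : B) (t : ℝ) : f (x, t) = f (x, 0) := by
  have hd : ∀ s : ℝ, HasDerivAt (fun s : ℝ => f (x, s)) 0 s := by
    intro s
    have := hasDerivAt_line hf x s
    rwa [h] at this
  exact is_const_of_deriv_eq_zero (fun s => (hd s).differentiableAt) (fun s => (hd s).deriv) t 0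

end Product

/-! ### The Riemannian metric of the base. -/

section Base

variable {m : ℕ} {M : Type*} [TopologicalSpace M] [T2Space M]
  [ChartedSpace (EuclideanSpace ℝ (Fin (m + 2))) M] [IsManifold (𝓡 (m + 2)) ∞ M]
  {B : Type*} [TopologicalSpace B] [T2Space B] [ChartedSpace (EuclideanSpace ℝ (Fin m)) B]
  [IsManifold (𝓡 m) ∞ B] {S : Spacetime (m + 2) M} (Δ : Horizon S B)
  {ℓ : VF (modelH m) (B × ℝ)} (hℓ : SmoothVF (modelH m) ℓ) (hnull : Δ.IsNull ℓ)
  (hℓ0 : ∀ p, ℓ p ≠ 0)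
  (hq : ∀ X Y, SmoothVF (modelH m) X → SmoothVF (modelH m) Y →
    ∀ p, lieBilin (modelH m) ℓ Δ.q X Y p = 0)

include hnull

lemma dfst_null (p : B × ℝ) : dfst p (ℓ p) = 0 := by
  obtain ⟨c, hc⟩ := Δ.eq_smul_vert (hnull p)
  rw [hc, map_smul, dfst_vert, smul_zero]

lemma related_null_zero (p : B × ℝ) :
    Related (modelH m) (𝓡 m) Prod.fst ℓ (0 : VF (𝓡 m) B) p :=
  Eventually.of_forall fun p' => Δ.dfst_null hnull p'

include hℓ in
-- ℓ projects to zero and X projects to X', so their bracket projects to [0, X'] = 0.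
lemma dfst_bracket_null {X : VF (modelH m) (B × ℝ)} (hX : SmoothVF (modelH m) X)
    {X' : VF (𝓡 m) B} (hX' : SmoothVF (𝓡 m) X') {p : B × ℝ}
    (r : Related (modelH m) (𝓡 m) Prod.fst X X' p) :
    dfst p (mlieBracket (modelH m) ℓ X p) = 0 := by
  have h1 := ((Δ.related_null_zero hnull p).bracket smooth_fst hℓ hX SmoothVF.zero hX' r).at
  rw [dfst, h1]
  simp

include hℓ0

lemma exists_smul_eq_vert (p : B × ℝ) : ∃ c : ℝ, vert p = c • ℓ p :=
  Δ.eq_smul_of_null (hnull p) (hℓ0 p) (Δ.q_vert p _)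

lemma eq_slice_of_dir {f : B × ℝ → ℝ} (hf : SmoothFn (modelH m) f)
    (h : ∀ p, dir (modelH m) ℓ f p = 0) (x : B) (t : ℝ) : f (x, t) = f (x, 0) := by
  refine eq_slice_of_dir_eq_zero hf (fun p => ?_) x t
  obtain ⟨c, hc⟩ := Δ.exists_smul_eq_vert hnull hℓ0 p
  have := h p
  rw [dir] at this
  rw [hc, map_smul, this, smul_zero]

omit hnull hℓ0 in
lemma q_dfst (p : B × ℝ) (v w : TangentSpace (modelH m) p) :
    Δ.q p v w = Δ.q p (horiz p (dfst p v)) (horiz p (dfst p w)) := by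
  obtain ⟨c, hc⟩ := eq_horiz_add_vert p v
  obtain ⟨d, hd⟩ := eq_horiz_add_vert p w
  conv_lhs => rw [hc, hd]
  simp only [map_add, map_smul, _root_.add_apply, _root_.smul_apply, Δ.q_vert,
    Δ.q_symm p (horiz p (dfst p v)) (vert p)]
  simp

omit hnull hℓ0 in
lemma baseMetric_apply (x : B) (v w : TangentSpace (𝓡 m) x) :
    Δ.baseMetric x v w = Δ.q (x, 0) (horiz (x, 0) v) (horiz (x, 0) w) := by
  rw [← mfderiv_slice, ← mfderiv_slice]
  rfl

include hℓ hq

/-- The metric of the horizon is the pullback of the metric of the base. -/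
lemma q_eq_pullback : Δ.q = pullbackBilin (𝓡 m) (modelH m) Prod.fst Δ.baseMetric := by
  funext p
  ext v w
  obtain ⟨x, t⟩ := p
  rw [pullbackBilin_apply, Δ.q_dfst]
  change _ = Δ.baseMetric x (dfst (x, t) v) (dfst (x, t) w)
  rw [Δ.baseMetric_apply]
  obtain ⟨X, hX, hXp⟩ := exists_smoothVF_apply_eq (𝓡 m) x (dfst (x, t) v)
  obtain ⟨Y, hY, hYp⟩ := exists_smoothVF_apply_eq (𝓡 m) x (dfst (x, t) w)
  -- Brackets of ℓ with lifts are vertical and drop out of q, so 𝓛_ℓ q = 0 says that q of two lifts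
  -- is constant along the null curves.
  have h1 := Δ.eq_slice_of_dir hnull hℓ0 (Δ.q_smooth (lift_smooth hX) (lift_smooth hY)) (by
    intro p
    have h := hq _ _ (lift_smooth hX) (lift_smooth hY) p
    have z : ∀ Z : VF (𝓡 m) B, SmoothVF (𝓡 m) Z → ∃ c : ℝ,
        mlieBracket (modelH m) ℓ (lift Z) p = c • vert p := fun Z hZ =>
      eq_smul_vert_of_dfst (Δ.dfst_bracket_null hℓ hnull (lift_smooth hZ) hZ
        (related_fst_lift Z p))
    obtain ⟨c, hc⟩ := z X hX
    obtain ⟨d, hd⟩ := z Y hY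
    simp only [lieBilin] at h
    rw [pair.eq_1 (modelH m) Δ.q (mlieBracket _ _ _), pair.eq_1 (modelH m) Δ.q _
      (mlieBracket _ _ _), hc, hd, Δ.q_symm p (lift X p)] at h
    simpa [Δ.q_vert] using h) x t
  rw [← hXp, ← hYp]
  exact h1

omit hnull hℓ0 hℓ hq in
lemma isMetric_baseMetric : IsMetric (𝓡 m) Δ.baseMetric where
  smooth := by
    intro X Y hX hY
    have := (Δ.q_smooth (lift_smooth hX) (lift_smooth hY)).comp_map (smooth_slice 0)
    convert this using 2 with x
    exact Δ.baseMetric_apply x _ _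
  symm x v w := by rw [Δ.baseMetric_apply, Δ.baseMetric_apply, Δ.q_symm]
  nondeg x v h := by
    have h1 := h v
    rw [Δ.baseMetric_apply] at h1
    obtain ⟨c, hc⟩ := Δ.eq_smul_vert h1
    rw [← dfst_horiz (x, 0) v, hc, map_smul, dfst_vert, smul_zero]

omit hnull hℓ0 hℓ hq in
lemma baseMetric_nonneg (x : B) (v : TangentSpace (𝓡 m) x) : 0 ≤ Δ.baseMetric x v v := by
  rw [Δ.baseMetric_apply]
  exact Δ.q_nonneg _ _

omit hnull hℓ0 hℓ hq in
lemma eq_zero_of_baseMetric (x : B) (v : TangentSpace (𝓡 m) x) (h : Δ.baseMetric x v v = 0) :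
    v = 0 := by
  rw [Δ.baseMetric_apply] at h
  obtain ⟨c, hc⟩ := Δ.eq_smul_vert h
  rw [← dfst_horiz (x, 0) v, hc, map_smul, dfst_vert, smul_zero]

end Base

/-! ### Projection of symmetries of the horizon to Killing fields of the base. -/

section Projection

variable {m : ℕ} {M : Type*} [TopologicalSpace M] [T2Space M]
  [ChartedSpace (EuclideanSpace ℝ (Fin (m + 2))) M] [IsManifold (𝓡 (m + 2)) ∞ M]
  {B : Type*} [TopologicalSpace B] [T2Space B] [ChartedSpace (EuclideanSpace ℝ (Fin m)) B]
  [IsManifold (𝓡 m) ∞ B] {S : Spacetime (m + 2) M} (Δ : Horizon S B)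
  {ℓ : VF (modelH m) (B × ℝ)} (hℓ : SmoothVF (modelH m) ℓ) (hnull : Δ.IsNull ℓ)
  (hℓ0 : ∀ p, ℓ p ≠ 0) {k : VF (modelH m) (B × ℝ)} (hk : SmoothVF (modelH m) k)
  (hkℓ : mlieBracket (modelH m) k ℓ = 0)

/-- The projection to the base of a vector field on the horizon, along the slice `t = 0`. -/
noncomputable def projVF (k : VF (modelH m) (B × ℝ)) : VF (𝓡 m) B := fun x => dfst (x, 0) (k (x, 0))

include hℓ hnull hℓ0 hk hkℓ

lemma dir_commute {f : B × ℝ → ℝ} (hf : SmoothFn (modelH m) f) (p : B × ℝ) :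
    dir (modelH m) ℓ (dir (modelH m) k f) p = dir (modelH m) k (dir (modelH m) ℓ f) p := by
  have h := dir_bracket hk hℓ hf p
  rw [hkℓ, dir, Pi.zero_apply, map_zero] at h
  linarith

/-- For f on B, ℓ(k(f∘π)) = k(ℓ(f∘π)) = 0, so the action of k on functions pulled back from B is the
same at all points of a null curve. -/
lemma dfst_eq_projVF (p : B × ℝ) : dfst p (k p) = projVF k p.1 := by
  obtain ⟨x, t⟩ := p
  apply eq_of_forall_mvfderiv_eq
  intro f hf
  have hF := hf.comp_map (J := modelH m) (N := B × ℝ) smooth_fst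
  have hz : ∀ p, dir (modelH m) ℓ (dir (modelH m) k (fun p : B × ℝ => f p.1)) p = 0 := by
    intro p
    rw [Δ.dir_commute hℓ hnull hℓ0 hk hkℓ hF]
    have : dir (modelH m) ℓ (fun p : B × ℝ => f p.1) = fun _ => 0 := by
      funext p'
      rw [dir, mvfderiv_comp_map smooth_fst p' (hf.mdiff _)]
      have := Δ.dfst_null hnull p'
      rw [dfst] at this
      rw [this, map_zero]
    rw [this, dir_const]
  have h1 := Δ.eq_slice_of_dir hnull hℓ0 (hk.dir hF) hz x t
  rw [dir, dir, mvfderiv_comp_map smooth_fst _ (hf.mdiff _),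
    mvfderiv_comp_map smooth_fst _ (hf.mdiff _)] at h1
  exact h1

lemma related_projVF (p : B × ℝ) : Related (modelH m) (𝓡 m) Prod.fst k (projVF k) p :=
  Eventually.of_forall fun p' => Δ.dfst_eq_projVF hℓ hnull hℓ0 hk hkℓ p'

omit hℓ hnull hℓ0 hkℓ in
lemma projVF_smooth : SmoothVF (𝓡 m) (projVF k) := by
  apply smoothVF_of_dir
  intro f hf
  have hF := hf.comp_map (J := modelH m) (N := B × ℝ) smooth_fst
  have h1 := (hk.dir hF).comp_map (smooth_slice (B := B) (m := m) 0)
  convert h1 using 2 with x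
  rw [dir, dir, mvfderiv_comp_map smooth_fst _ (hf.mdiff _)]
  rfl

/-- The projection of a symmetry of the degenerate metric is a Killing field. -/
lemma projVF_killing (hq : ∀ X Y, SmoothVF (modelH m) X → SmoothVF (modelH m) Y →
      ∀ p, lieBilin (modelH m) ℓ Δ.q X Y p = 0)
    (hkq : ∀ X Y, SmoothVF (modelH m) X → SmoothVF (modelH m) Y →
      ∀ p, lieBilin (modelH m) k Δ.q X Y p = 0) {X Y : VF (𝓡 m) B} (hX : SmoothVF (𝓡 m) X)
    (hY : SmoothVF (𝓡 m) Y) (x : B) : lieBilin (𝓡 m) (projVF k) Δ.baseMetric X Y x = 0 := by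
  have h1 := hkq _ _ (lift_smooth hX) (lift_smooth hY) (x, 0)
  rw [Δ.q_eq_pullback hℓ hnull hℓ0 hq] at h1
  rw [← h1]
  exact (lieBilin_pullback smooth_fst Δ.isMetric_baseMetric.smooth hk (lift_smooth hX)
    (lift_smooth hY) (projVF_smooth hk) hX hY (Δ.related_projVF hℓ hnull hℓ0 hk hkℓ (x, 0))
    (related_fst_lift X _) (related_fst_lift Y _)).symm

end Projection

end Horizon

end NEH

namespace NEH

open VectorField Filter Set

/-! ### Killing fields and divergence-free one-forms. -/

section Laplacian

variable {m : ℕ} {B : Type*} [TopologicalSpace B] [T2Space B]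
  [ChartedSpace (EuclideanSpace ℝ (Fin m)) B] [IsManifold (𝓡 m) ∞ B] {g : Bilin (𝓡 m) B}

lemma exists_basis_of_orthonormal {x : B} {F : Fin m → TangentSpace (𝓡 m) x}
    (hF : ∀ i j, g x (F i) (F j) = if i = j then 1 else 0) (w : TangentSpace (𝓡 m) x) :
    w = ∑ i, g x (F i) w • F i := by
  have : FiniteDimensional ℝ (TangentSpace (𝓡 m) x) :=
    inferInstanceAs (FiniteDimensional ℝ (EuclideanSpace ℝ (Fin m)))
  have hdim : Fintype.card (Fin m) = Module.finrank ℝ (TangentSpace (𝓡 m) x) := by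
    change _ = Module.finrank ℝ (EuclideanSpace ℝ (Fin m))
    simp
  obtain ⟨b, hb, hr⟩ := eq_sum_of_dual F (fun i => toLin₂ g x (F i)) hF hdim
  conv_lhs => rw [← b.sum_repr w]
  simp only [hb, hr, toLin₂_apply]

/-- If a Killing field maps a divergence-free one-form to an exact one-form `- da`, then `a` is
harmonic. -/
lemma laplacian_eq_zero (hg : IsMetric (𝓡 m) g) (hpos : ∀ x v, 0 ≤ g x v v) {K : VF (𝓡 m) B}
    (hK : SmoothVF (𝓡 m) K)
    (hKg : ∀ X Y, SmoothVF (𝓡 m) X → SmoothVF (𝓡 m) Y → ∀ x, lieBilin (𝓡 m) K g X Y x = 0)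
    {β : OneForm (𝓡 m) B}
    (hβ : ∀ X, SmoothVF (𝓡 m) X → SmoothFn (𝓡 m) (fun x => β x (X x)))
    {a : B → ℝ} (ha : SmoothFn (𝓡 m) a)
    (hβa : ∀ X, SmoothVF (𝓡 m) X → ∀ x, dir (𝓡 m) K (fun x => β x (X x)) x
      - β x (mlieBracket (𝓡 m) K X x) = - dir (𝓡 m) X a x)
    (hdiv : ∀ x, ∀ F : Fin m → VF (𝓡 m) B, (∀ i, SmoothVF (𝓡 m) (F i)) →
      OrthonormalAt (𝓡 m) g F x → ∑ i, (dir (𝓡 m) (F i) (fun y => β y (F i y)) x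
        - β x (nabla (𝓡 m) g (F i) (F i) x)) = 0)
    {x : B} {F : Fin m → VF (𝓡 m) B} (hF : ∀ i, SmoothVF (𝓡 m) (F i))
    (hon : OrthonormalAt (𝓡 m) g F x) :
    ∑ i, (dir (𝓡 m) (F i) (dir (𝓡 m) (F i) a) x - dir (𝓡 m) (nabla (𝓡 m) g (F i) (F i)) a x)
      = 0 := by
  -- T is the covariant derivative of β, whose trace is the divergence.
  obtain ⟨T, hT⟩ := exists_bilin_of_tensorial (I := 𝓡 m) (M := B)
    (fun X Y x => dir (𝓡 m) X (fun y => β y (Y y)) x - β x (nabla (𝓡 m) g X Y x))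
    (by
      intro X X' Y hX hX' hY p
      rw [dir_add, nabla_add_left hg hX hX' hY, Pi.add_apply, map_add]
      ring)
    (by
      intro f X Y hf hX hY p
      rw [dir_smul, nabla_smul_left hg hf hX hY, Pi.smul_apply', map_smul, smul_eq_mul]
      ring)
    (by
      intro X Y Y' hX hY hY' p
      have : (fun y => β y ((Y + Y') y)) = fun y => β y (Y y) + β y (Y' y) := by
        funext y; simp
      rw [this, dir_fun_add X ((hβ Y hY).mdiff p) ((hβ Y' hY').mdiff p),
        nabla_add_right hg hX hY hY', Pi.add_apply, map_add]
      ring)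
    (by
      intro f X Y hf hX hY p
      have : (fun y => β y ((f • Y) y)) = fun y => f y * β y (Y y) := by
        funext y; simp
      rw [this, dir_fun_mul X (hf.mdiff p) ((hβ Y hY).mdiff p), nabla_smul_right hg hf hX hY]
      simp only [Pi.add_apply, Pi.smul_apply', map_add, map_smul, smul_eq_mul]
      ring)
  have hTs : ∀ {X Y}, SmoothVF (𝓡 m) X → SmoothVF (𝓡 m) Y → SmoothFn (𝓡 m) (pair (𝓡 m) T X Y) := by
    intro X Y hX hY
    have : pair (𝓡 m) T X Y =
        fun x => dir (𝓡 m) X (fun y => β y (Y y)) x - β x (nabla (𝓡 m) g X Y x) :=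
      funext fun x => hT X Y hX hY x
    rw [this]
    exact (hX.dir (hβ Y hY)).sub (hβ _ (SmoothVF.nabla hg hX hY))
  -- Since 𝓛_K g = 0, taking the trace commutes with 𝓛_K; hence 𝓛_K ∇β is trace free.
  have htr := trace_lieBilin hg.smooth hTs hg.symm hpos (k := K) hF hon
    (Eventually.of_forall fun y G hG => by
      choose G' hG' hGy using fun i => exists_smoothVF_apply_eq (𝓡 m) y (G i)
      rw [← hdiv y G' hG' (fun i j => by rw [hGy, hGy]; exact hG i j)]
      exact Finset.sum_congr rfl fun i _ => by rw [← hT _ _ (hG' i) (hG' i), hGy])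
    (fun i => ⟨0, by
      rw [add_zero]
      conv_lhs => rw [exists_basis_of_orthonormal hon (mlieBracket (𝓡 m) K (F i) x)]
      exact Finset.sum_congr rfl fun j _ => by rw [hg.symm], by simp⟩)
  simp only [hKg _ _ (hF _) (hF _), mul_zero, Finset.sum_const_zero] at htr
  rw [← neg_eq_zero, ← htr, ← Finset.sum_neg_distrib]
  refine Finset.sum_congr rfl fun i _ => ?_
  have hX := hF i
  set X := F i
  have hn := SmoothVF.nabla hg hX hX
  have hb := hK.bracket hX
  have e1 : pair (𝓡 m) T X X =
      fun x => dir (𝓡 m) X (fun y => β y (X y)) x - β x (nabla (𝓡 m) g X X x) :=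
    funext fun x => hT X X hX hX x
  -- 𝓛_K also commutes with ∇, so 𝓛_K ∇β = ∇ 𝓛_K β = -∇da, minus the Hessian of a.
  have c1 := congrArg (β x) (congrFun (killing_nabla hg hK hKg hX hX) x)
  have c2 := dir_bracket hK hX (hβ X hX) x
  have c3 := hβa _ hn x
  have c4 : dir (𝓡 m) X (dir (𝓡 m) K fun y => β y (X y)) x =
      dir (𝓡 m) X (fun y => β y (mlieBracket (𝓡 m) K X y)) x - dir (𝓡 m) X (dir (𝓡 m) X a) x := by
    have : (dir (𝓡 m) K fun y => β y (X y)) =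
        fun y => β y (mlieBracket (𝓡 m) K X y) - dir (𝓡 m) X a y := by
      funext y
      have := hβa X hX y
      linarith
    rw [this, dir_fun_sub X ((hβ _ hb).mdiff x) ((hX.dir ha).mdiff x)]
  rw [lieBilin, e1, dir_fun_sub K ((hX.dir (hβ X hX)).mdiff x) ((hβ _ hn).mdiff x),
    pair, pair, hT _ _ hb hX, hT _ _ hX hb]
  rw [Pi.add_apply, map_add] at c1
  linarith

end Laplacian

namespace Horizon

/-! ### Local sections inside level sets. -/

section LevelSets

variable {m : ℕ} {B : Type*} [TopologicalSpace B] [T2Space B]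
  [ChartedSpace (EuclideanSpace ℝ (Fin m)) B] [IsManifold (𝓡 m) ∞ B]

/-- Local sections contained in the level sets of a function which is not constant along the
fibres. -/
lemma exists_local_section {v : B × ℝ → ℝ} (hv : SmoothFn (modelH m) v)
    (hne : ∀ p, mvfderiv (modelH m) v p (vert p) ≠ 0) (x₀ : B) :
    ∃ (U : Set B) (s : B → B × ℝ), IsOpen U ∧ x₀ ∈ U ∧ ContMDiffOn (𝓡 m) (modelH m) ∞ s U ∧
      ∀ x ∈ U, (s x).1 = x ∧ v (s x) = v (x₀, 0) := by
  set c := v (x₀, 0) with hc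
  -- The section is x ↦ ρ(x,c) with ρ a local left inverse of Φ. This lies over x and in the level
  -- set once (x,c) is known to be of the form Φ(x,t) with t near 0.
  let Φ : B × ℝ → B × ℝ := fun p => (p.1, v p)
  have hΦ : ContMDiff (modelH m) (modelH m) ∞ Φ := contMDiff_fst.prodMk hv
  have hinj : Function.Injective (mfderiv (modelH m) (modelH m) Φ (x₀, 0)) := by
    rw [injective_iff_map_eq_zero]
    intro w hw
    have hΦd := (hΦ (x₀, 0)).mdifferentiableAt (by simp)
    have h1 : dfst (x₀, 0) w = 0 := by
      have := mfderiv_comp_apply (I := modelH m) (I' := modelH m) (I'' := 𝓡 m) (x₀, (0 : ℝ))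
        (g := Prod.fst) (f := Φ) mdifferentiableAt_fst hΦd w
      rw [hw, map_zero] at this
      exact this
    obtain ⟨d, rfl⟩ := eq_smul_vert_of_dfst h1
    have h2 := mvfderiv_comp_map hΦ (x₀, (0 : ℝ)) (f := Prod.snd) mdifferentiableAt_snd
      (d • vert (x₀, 0))
    rw [hw, map_zero, map_smul] at h2
    rw [(smul_eq_zero.1 h2).resolve_right (hne _), zero_smul]
  obtain ⟨ρ, u, hu, hxu, hρ, hρΦ⟩ := exists_local_left_inverse hΦ (x₀, 0) hinj
  rw [nhds_prod_eq, eventually_prod_iff] at hρΦ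
  obtain ⟨P, hP, Q, hQ, hPQ⟩ := hρΦ
  -- The vertical derivative of v is nonzero, so v - c changes sign between -t and t. The sign
  -- change is an open condition in x and gives the required t by the intermediate value theorem.
  have hsgn : ∀ᶠ t in 𝓝[>] (0 : ℝ), (v (x₀, t) - c) * (v (x₀, -t) - c) < 0 := by
    have h1 := hasDerivAt_iff_tendsto_slope_zero.1 (hasDerivAt_line hv x₀ 0)
    set d := mvfderiv (modelH m) v (x₀, 0) (vert (x₀, 0)) with hd
    have h2 : Tendsto (fun t : ℝ => t⁻¹ • (v (x₀, 0 + t) - v (x₀, 0))) (𝓝[>] 0) (𝓝 d) :=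
      h1.mono_left (nhdsWithin_mono _ fun t ht => ne_of_gt ht)
    have h3 : Tendsto (fun t : ℝ => (-t)⁻¹ • (v (x₀, 0 + -t) - v (x₀, 0))) (𝓝[>] 0) (𝓝 d) := by
      refine h1.comp (tendsto_nhdsWithin_iff.2 ⟨?_, ?_⟩)
      · have : Tendsto (fun t : ℝ => -t) (𝓝 0) (𝓝 0) := by
          simpa using (continuous_neg (G := ℝ)).tendsto 0
        exact this.mono_left nhdsWithin_le_nhds
      · filter_upwards [self_mem_nhdsWithin] with t ht
        exact neg_ne_zero.2 (ne_of_gt ht)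
    have h4 := (h2.mul h3).eventually_const_lt (mul_self_pos.2 (hne (x₀, 0)))
    filter_upwards [h4, self_mem_nhdsWithin] with t ht (ht0 : 0 < t)
    simp only [zero_add, smul_eq_mul, ← hc] at ht
    have h5 : t⁻¹ * (v (x₀, t) - c) * ((-t)⁻¹ * (v (x₀, -t) - c)) =
        - ((t⁻¹ * t⁻¹) * ((v (x₀, t) - c) * (v (x₀, -t) - c))) := by
      rw [inv_neg]; ring
    rw [h5] at ht
    have h6 : 0 < t⁻¹ * t⁻¹ := by positivity
    by_contra hcon
    push Not at hcon
    have := mul_nonneg h6.le hcon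
    linarith
  obtain ⟨ε, hε, hεQ⟩ := Metric.eventually_nhds_iff.1 hQ
  obtain ⟨δ, hδ1, hδ2⟩ : ∃ δ : ℝ, (v (x₀, δ) - c) * (v (x₀, -δ) - c) < 0 ∧ 0 < δ ∧ δ < ε := by
    have : ∀ᶠ t in 𝓝[>] (0 : ℝ), 0 < t ∧ t < ε := by
      have := Ioo_mem_nhdsGT hε
      filter_upwards [this] with t ht using ht
    exact (hsgn.and this).exists
  have hcont : ∀ t : ℝ, Continuous fun x => v (x, t) := fun t =>
    hv.continuous.comp (Continuous.prodMk_left t)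
  obtain ⟨V, hVP, hV, hxV⟩ := mem_nhds_iff.1 hP
  refine ⟨V ∩ {x | (v (x, δ) - c) * (v (x, -δ) - c) < 0} ∩ (fun x => (x, c)) ⁻¹' u,
    fun x => ρ (x, c), ?_, ?_, ?_, ?_⟩
  · refine (hV.inter ?_).inter (hu.preimage (Continuous.prodMk_left c))
    exact isOpen_lt (((hcont δ).sub continuous_const).mul ((hcont (-δ)).sub continuous_const))
      continuous_const
  · exact ⟨⟨hxV, hδ1⟩, hxu⟩
  · exact hρ.comp (smooth_slice c).contMDiffOn fun x hx => hx.2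
  · rintro x ⟨⟨hxV', hx⟩, -⟩
    have hsub := intermediate_value_uIcc (a := -δ) (b := δ) (f := fun t : ℝ => v (x, t))
      (hv.continuous.comp (Continuous.prodMk_right x)).continuousOn
    have hcmem : c ∈ uIcc (v (x, -δ)) (v (x, δ)) := by
      rw [mem_uIcc]
      simp only [mem_ofPred_eq] at hx
      rcases le_total (v (x, δ)) c with h | h
      · right
        refine ⟨h, ?_⟩
        by_contra hh
        push Not at hh
        have := mul_nonneg_of_nonpos_of_nonpos (sub_nonpos.2 h) (sub_nonpos.2 hh.le)
        linarith
      · left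
        refine ⟨?_, h⟩
        by_contra hh
        push Not at hh
        have := mul_nonneg (sub_nonneg.2 h) (sub_nonneg.2 hh.le)
        linarith
    obtain ⟨t, ht, htc⟩ := hsub hcmem
    have htc : v (x, t) = c := htc
    have hQt : Q t := hεQ (by
      rw [uIcc_of_le (by linarith), mem_Icc] at ht
      rw [Real.dist_eq, sub_zero, abs_lt]
      constructor <;> linarith)
    have hρx : ρ (x, c) = (x, t) := by
      have := hPQ (hVP hxV') hQt
      simp only [Φ, htc] at this
      exact this
    simp only [hρx]
    exact ⟨trivial, htc⟩

end LevelSets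

end Horizon

end NEH

namespace NEH

open VectorField Filter Set

namespace Horizon

/-! ### The one-form β on the base with ω = dv + π*β. -/

section BaseForm

variable {m : ℕ} {M : Type*} [TopologicalSpace M] [T2Space M]
  [ChartedSpace (EuclideanSpace ℝ (Fin (m + 2))) M] [IsManifold (𝓡 (m + 2)) ∞ M]
  {B : Type*} [TopologicalSpace B] [T2Space B] [ChartedSpace (EuclideanSpace ℝ (Fin m)) B]
  [IsManifold (𝓡 m) ∞ B] {S : Spacetime (m + 2) M} (Δ : Horizon S B)

/-- The one-form on the base whose pullback is `α - dv`. -/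
noncomputable def baseForm (α : OneForm (modelH m) (B × ℝ)) (v : B × ℝ → ℝ) : OneForm (𝓡 m) B :=
  pullbackForm (modelH m) (𝓡 m) (fun x => (x, (0 : ℝ))) (fun p => α p - mvfderiv (modelH m) v p)

lemma baseForm_apply (α : OneForm (modelH m) (B × ℝ)) (v : B × ℝ → ℝ) (x : B)
    (w : TangentSpace (𝓡 m) x) : baseForm α v x w =
      α (x, 0) (horiz (x, 0) w) - mvfderiv (modelH m) v (x, 0) (horiz (x, 0) w) := by
  rw [← mfderiv_slice]
  rfl

variable {ℓ : VF (modelH m) (B × ℝ)} (hℓ : SmoothVF (modelH m) ℓ) (hnull : Δ.IsNull ℓ)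
  (hℓ0 : ∀ p, ℓ p ≠ 0) {v₀ : B × ℝ → ℝ} (hvs : SmoothFn (modelH m) v₀)
  (hv : ∀ p, dir (modelH m) ℓ v₀ p = 1) {α : OneForm (modelH m) (B × ℝ)}
  (hα1 : ∀ p, α p (ℓ p) = 1)
  (hαs : ∀ X, SmoothVF (modelH m) X → SmoothFn (modelH m) (fun p => α p (X p)))
  (hαℓ : ∀ X, SmoothVF (modelH m) X → ∀ p,
    dir (modelH m) ℓ (fun p => α p (X p)) p = α p (mlieBracket (modelH m) ℓ X p))

lemma baseForm_smooth (hvs : SmoothFn (modelH m) v₀)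
    (hαs : ∀ X, SmoothVF (modelH m) X → SmoothFn (modelH m) (fun p => α p (X p)))
    {X : VF (𝓡 m) B} (hX : SmoothVF (𝓡 m) X) :
    SmoothFn (𝓡 m) (fun x => baseForm α v₀ x (X x)) := by
  have h := ((hαs _ (lift_smooth hX)).sub ((lift_smooth hX).dir hvs)).comp_map
    (smooth_slice (B := B) (m := m) 0)
  convert h using 2 with x
  exact baseForm_apply α v₀ x (X x)

include hnull hℓ0 hv in
lemma mvfderiv_vert_ne (p : B × ℝ) : mvfderiv (modelH m) v₀ p (vert p) ≠ 0 := by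
  obtain ⟨c, hc⟩ := Δ.exists_smul_eq_vert hnull hℓ0 p
  have h1 := hv p
  rw [dir] at h1
  rw [hc, map_smul, h1, smul_eq_mul, mul_one]
  rintro rfl
  rw [zero_smul] at hc
  exact Δ.push_vert_ne p (by rw [hc, map_zero])

include hnull hℓ0 hv hα1 in
lemma rotation_vert (p : B × ℝ) : α p (vert p) = mvfderiv (modelH m) v₀ p (vert p) := by
  obtain ⟨c, hc⟩ := Δ.exists_smul_eq_vert hnull hℓ0 p
  have h1 := hv p
  rw [dir] at h1
  rw [hc, map_smul, map_smul, h1, hα1]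

include hℓ hnull hℓ0 hvs hv hα1 hαs hαℓ

/-- The rotation one-form differs from `dv` by the pullback of a one-form on the base. -/
lemma rotation_eq (p : B × ℝ) (w : TangentSpace (modelH m) p) :
    α p w = mvfderiv (modelH m) v₀ p w + baseForm α v₀ p.1 (dfst p w) := by
  obtain ⟨c, hc⟩ := eq_horiz_add_vert p w
  obtain ⟨X, hX, hXp⟩ := exists_smoothVF_apply_eq (𝓡 m) p.1 (dfst p w)
  have hl := lift_smooth hX
  -- Both ω and dv are dragged by ℓ, and they agree on vertical vectors such as [ℓ, lift X]; so ω -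
  -- dv on a lift is constant along the null curves.
  have h1 := Δ.eq_slice_of_dir hnull hℓ0 ((hαs _ hl).sub (hl.dir hvs)) (by
    intro p
    have h2 : dir (modelH m) (mlieBracket (modelH m) ℓ (lift X)) v₀ p =
        dir (modelH m) ℓ (dir (modelH m) (lift X) v₀) p := by
      rw [dir_bracket hℓ hl hvs]
      have : dir (modelH m) ℓ v₀ = fun _ => 1 := funext hv
      rw [this, dir_const, sub_zero]
    obtain ⟨d, hd⟩ := eq_smul_vert_of_dfst (Δ.dfst_bracket_null hℓ hnull hl hX
      (related_fst_lift X p))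
    rw [dir_fun_sub ℓ ((hαs _ hl).mdiff p) ((hl.dir hvs).mdiff p), hαℓ _ hl, ← h2, dir, hd,
      map_smul, map_smul, Δ.rotation_vert hnull hℓ0 hv hα1, sub_self]) p.1 p.2
  have h3 : α p (lift X p) - dir (modelH m) (lift X) v₀ p = baseForm α v₀ p.1 (X p.1) := by
    rw [baseForm_apply]
    exact h1
  conv_lhs => rw [hc]
  conv_rhs => rw [hc]
  simp only [map_add, map_smul, dfst_vert, dfst_horiz, smul_zero, add_zero,
    Δ.rotation_vert hnull hℓ0 hv hα1]
  rw [← hXp, ← h3]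
  change α p (lift X p) + _ = dir (modelH m) (lift X) v₀ p + _ + _
  ring

/-- The good cuts condition. -/
lemma divFree_baseForm
    (hgood : ∀ (U : Set B) (s : B → B × ℝ) (c : ℝ), IsOpen U →
      ContMDiffOn (𝓡 m) (modelH m) ∞ s U → (∀ x ∈ U, (s x).1 = x ∧ v₀ (s x) = c) →
      ∀ x ∈ U, Δ.DivFreeAt (pullbackForm (modelH m) (𝓡 m) s α) x) (x₀ : B) :
    Δ.DivFreeAt (baseForm α v₀) x₀ := by
  obtain ⟨U, s, hU, hxU, hs, hsU⟩ := exists_local_section hvs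
    (Δ.mvfderiv_vert_ne hnull hℓ0 hv) x₀
  have hdf := hgood U s _ hU hs hsU x₀ hxU
  -- A section in a level set of v pulls dv back to zero, so it pulls ω back to β.
  have key : ∀ y ∈ U, pullbackForm (modelH m) (𝓡 m) s α y = baseForm α v₀ y := by
    intro y hy
    have hUy := hU.mem_nhds hy
    have hsd : MDifferentiableAt (𝓡 m) (modelH m) s y :=
      ((hs y hy).contMDiffAt hUy).mdifferentiableAt (by simp)
    ext w
    change α (s y) (mfderiv (𝓡 m) (modelH m) s y w) = _
    rw [Δ.rotation_eq hℓ hnull hℓ0 hvs hv hα1 hαs hαℓ]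
    have h1 : mvfderiv (modelH m) v₀ (s y) (mfderiv (𝓡 m) (modelH m) s y w) = 0 := by
      rw [← mvfderiv_comp_apply y (hvs.mdiff (s y)) hsd w]
      have : mvfderiv (𝓡 m) (v₀ ∘ s) y = mvfderiv (𝓡 m) (fun _ => v₀ (x₀, 0)) y :=
        mvfderiv_congr (by filter_upwards [hUy] with z hz using (hsU z hz).2)
      rw [this]
      exact dir_const (I := 𝓡 m) (M := B) (fun _ => (w : EuclideanSpace ℝ (Fin m))) (v₀ (x₀, 0)) y
    have h2 : (dfst (s y) (mfderiv (𝓡 m) (modelH m) s y w) : EuclideanSpace ℝ (Fin m)) = w := by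
      have e1 := mfderiv_comp_apply (I := 𝓡 m) (I' := modelH m) (I'' := 𝓡 m) y
        (g := Prod.fst) (f := s) mdifferentiableAt_fst hsd w
      have e2 : (Prod.fst ∘ s) =ᶠ[𝓝 y] id := by
        filter_upwards [hUy] with z hz using (hsU z hz).1
      have e3 : mfderiv (𝓡 m) (𝓡 m) (Prod.fst ∘ s) y = mfderiv (𝓡 m) (𝓡 m) id y := e2.mfderiv_eq
      have e4 : (mfderiv (𝓡 m) (𝓡 m) (Prod.fst ∘ s) y w : EuclideanSpace ℝ (Fin m)) = w := by
        rw [e3, mfderiv_id]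
        rfl
      exact e1.symm.trans e4
    rw [h1, zero_add]
    -- The base points (s y).1 and y are equal but not definitionally so; vectors are compared in
    -- the common model space.
    have h3 : ∀ b : B, b = y → ∀ u : EuclideanSpace ℝ (Fin m), u = w →
        baseForm α v₀ b u = baseForm α v₀ y w := by
      rintro b rfl u rfl; rfl
    exact h3 _ (hsU y hy).1 _ h2
  intro F hF hon
  rw [← hdf F hF hon]
  refine Finset.sum_congr rfl fun i _ => ?_
  rw [key x₀ hxU]
  congr 1
  apply dir_congr_fun
  filter_upwards [hU.mem_nhds hxU] with y hy
  rw [key y hy]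

variable {k : VF (modelH m) (B × ℝ)} (hk : SmoothVF (modelH m) k)
  (hkℓ : mlieBracket (modelH m) k ℓ = 0)
  (hαk : ∀ X, SmoothVF (modelH m) X → ∀ p,
    dir (modelH m) k (fun p => α p (X p)) p = α p (mlieBracket (modelH m) k X p))

include hk hkℓ

-- ℓ(k(v)) = k(ℓ(v)) = k(1) = 0, so k(v) descends to the base.
omit hα1 hαs hαℓ in
lemma dir_killing_eq_slice (p : B × ℝ) :
    dir (modelH m) k v₀ p = dir (modelH m) k v₀ (p.1, 0) := by
  refine Δ.eq_slice_of_dir hnull hℓ0 (hk.dir hvs) (fun p => ?_) p.1 p.2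
  rw [Δ.dir_commute hℓ hnull hℓ0 hk hkℓ hvs]
  have : dir (modelH m) ℓ v₀ = fun _ => 1 := funext hv
  rw [this, dir_const]

include hαk in
/-- The Lie derivative of the base form is exact. -/
lemma lie_baseForm {X : VF (𝓡 m) B} (hX : SmoothVF (𝓡 m) X) (x : B) :
    dir (𝓡 m) (projVF k) (fun x => baseForm α v₀ x (X x)) x
      - baseForm α v₀ x (mlieBracket (𝓡 m) (projVF k) X x) =
      - dir (𝓡 m) X (fun x => dir (modelH m) k v₀ (x, 0)) x := by
  have hl := lift_smooth hX
  have hrot := Δ.rotation_eq hℓ hnull hℓ0 hvs hv hα1 hαs hαℓ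
  have hkv := hk.dir hvs
  have h1 : dir (modelH m) k (fun p => baseForm α v₀ p.1 (X p.1)) (x, 0) =
      dir (𝓡 m) (projVF k) (fun x => baseForm α v₀ x (X x)) x := by
    rw [dir, mvfderiv_comp_map smooth_fst (x, (0 : ℝ)) ((baseForm_smooth hvs hαs hX).mdiff x)]
    rfl
  have h2 : (fun p : B × ℝ => baseForm α v₀ p.1 (X p.1)) =
      fun p => α p (lift X p) - dir (modelH m) (lift X) v₀ p := by
    funext p
    have := hrot p (lift X p)
    rw [lift, dfst_horiz] at this
    rw [lift, this, dir]
    simp [lift]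
  have h3 := hrot (x, 0) (mlieBracket (modelH m) k (lift X) (x, 0))
  have h4 : dfst (x, 0) (mlieBracket (modelH m) k (lift X) (x, 0)) =
      mlieBracket (𝓡 m) (projVF k) X x :=
    ((Δ.related_projVF hℓ hnull hℓ0 hk hkℓ (x, 0)).bracket smooth_fst hk hl (projVF_smooth hk) hX
      (related_fst_lift X (x, 0))).at
  have h5 := dir_bracket hk hl hvs (x, 0)
  have h6 : dir (modelH m) (lift X) (dir (modelH m) k v₀) (x, 0) =
      dir (𝓡 m) X (fun x => dir (modelH m) k v₀ (x, 0)) x := by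
    have := mvfderiv_comp_map (smooth_slice (B := B) (m := m) 0) x (hkv.mdiff (x, 0)) (X x)
    rw [mfderiv_slice] at this
    exact this.symm
  rw [h4] at h3
  -- As 𝓛_k ω = 0, only -𝓛_k dv = -d(k(v)) survives from β = ω - dv.
  rw [← h1, h2, dir_fun_sub k ((hαs _ hl).mdiff _) ((hl.dir hvs).mdiff _), hαk _ hl, h3, ← h6]
  rw [dir] at h5
  linarith

end BaseForm

end Horizon

end NEH

namespace NEH

open VectorField Filter Set

/-! ### Derivatives along integral curves and the second-derivative test. -/

section Curves

variable {E : Type*} [NormedAddCommGroup E] [NormedSpace ℝ E] [FiniteDimensional ℝ E]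
  {H : Type*} [TopologicalSpace H] {I : ModelWithCorners ℝ E H}
  {M : Type*} [TopologicalSpace M] [ChartedSpace H M] [IsManifold I ∞ M]

/-- The derivative of a function along a curve. -/
lemma hasDerivAt_comp_curve {γ : ℝ → M} {t : ℝ} {v : TangentSpace I (γ t)}
    (hγ : HasMFDerivAt 𝓘(ℝ, ℝ) I γ t (ContinuousLinearMap.smulRight (1 : ℝ →L[ℝ] ℝ) v))
    {f : M → ℝ} (hf : MDifferentiableAt I 𝓘(ℝ, ℝ) f (γ t)) :
    HasDerivAt (fun s => f (γ s)) (mvfderiv I f (γ t) v) t := by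
  have h1 := hf.hasMFDerivAt.comp t hγ
  have h2 : HasMFDerivAt 𝓘(ℝ, ℝ) 𝓘(ℝ, ℝ) (f ∘ γ) t
      (ContinuousLinearMap.smulRight (1 : ℝ →L[ℝ] ℝ) (mvfderiv I f (γ t) v : ℝ)) := by
    convert h1 using 1
    refine ContinuousLinearMap.ext fun c => ?_
    let c' : ℝ := c
    change c' • mfderiv I 𝓘(ℝ, ℝ) f (γ t) v = mfderiv I 𝓘(ℝ, ℝ) f (γ t) (c' • v)
    rw [map_smul]
  have h3 : HasFDerivAt (f ∘ γ) (ContinuousLinearMap.smulRight (1 : ℝ →L[ℝ] ℝ)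
      (mvfderiv I f (γ t) v : ℝ)) t := hasMFDerivAt_iff_hasFDerivAt.1 h2
  have h4 := h3.hasDerivAt
  simp only [ContinuousLinearMap.smulRight_apply, one_apply_eq_self, one_smul] at h4
  exact h4

variable [I.Boundaryless] [T2Space M]

/-- First and second derivatives at a local maximum. -/
lemma dir_dir_nonpos_of_isLocalMax {h : M → ℝ} (hh : SmoothFn I h) {x : M}
    (hx : IsLocalMax h x) {X : VF I M} (hX : SmoothVF I X) :
    dir I X h x = 0 ∧ dir I X (dir I X h) x ≤ 0 := by
  obtain ⟨γ, hγ0, hγ⟩ := exists_isMIntegralCurveAt_of_contMDiffAt_boundaryless (I := I) (v := X)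
    (0 : ℝ) (x₀ := x) ((hX x).of_le (by exact_mod_cast le_top))
  have hd : ∀ {f : M → ℝ}, SmoothFn I f → ∀ᶠ t in 𝓝 (0 : ℝ),
      HasDerivAt (fun s => f (γ s)) (dir I X f (γ t)) t := by
    intro f hf
    filter_upwards [hγ] with t ht
    exact hasDerivAt_comp_curve ht (hf.mdiff _)
  have hcont : ContinuousAt γ 0 := hγ.self_of_nhds.continuousAt
  have hmax : IsLocalMax (fun t => h (γ t)) 0 := by
    have : ∀ᶠ y in 𝓝 (γ 0), h y ≤ h (γ 0) := by rw [hγ0]; exact hx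
    exact hcont.eventually this
  have h1 := hmax.hasDerivAt_eq_zero (hd hh).self_of_nhds
  have h2 : deriv (fun t => h (γ t)) =ᶠ[𝓝 0] fun t => dir I X h (γ t) := by
    filter_upwards [hd hh] with t ht using ht.deriv
  have h3 : deriv (deriv fun t => h (γ t)) 0 = dir I X (dir I X h) x := by
    rw [h2.deriv_eq, (hd (hX.dir hh)).self_of_nhds.deriv, hγ0]
  refine ⟨by rw [← hγ0]; exact h1, ?_⟩
  by_contra hpos
  push Not at hpos
  -- A positive second derivative would make the maximum also a minimum; the function would be
  -- constant along the curve near 0, with second derivative 0.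
  have hmin := isLocalMin_of_deriv_deriv_pos (f := fun t => h (γ t)) (x₀ := 0) (by rw [h3]; exact hpos)
    (by rw [h2.self_of_nhds]; exact h1) (hd hh).self_of_nhds.continuousAt
  have hconst : (fun t => h (γ t)) =ᶠ[𝓝 0] fun _ => h (γ 0) := by
    filter_upwards [hmin, hmax] with t h4 h5 using le_antisymm h5 h4
  have h6 : deriv (fun t => h (γ t)) =ᶠ[𝓝 0] deriv fun _ => h (γ 0) := hconst.deriv
  rw [h6.deriv_eq] at h3
  simp at h3
  linarith

end Curves

/-! ### Hessians and Hopf's lemma. -/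

section MaximumPrinciple

variable {m : ℕ} {B : Type*} [TopologicalSpace B] [T2Space B]
  [ChartedSpace (EuclideanSpace ℝ (Fin m)) B] [IsManifold (𝓡 m) ∞ B] {g : Bilin (𝓡 m) B}

/-- The Hessian of a function. -/
lemma exists_hessian (hg : IsMetric (𝓡 m) g) {h : B → ℝ} (hh : SmoothFn (𝓡 m) h) :
    ∃ T : Bilin (𝓡 m) B, (∀ X Y, SmoothVF (𝓡 m) X → SmoothVF (𝓡 m) Y → ∀ x, T x (X x) (Y x) =
      dir (𝓡 m) X (dir (𝓡 m) Y h) x - dir (𝓡 m) (nabla (𝓡 m) g X Y) h x) := by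
  refine exists_bilin_of_tensorial (I := 𝓡 m) (M := B)
    (fun X Y x => dir (𝓡 m) X (dir (𝓡 m) Y h) x - dir (𝓡 m) (nabla (𝓡 m) g X Y) h x) ?_ ?_ ?_ ?_
  · intro X X' Y hX hX' hY p
    rw [dir_add, nabla_add_left hg hX hX' hY, dir_add]
    ring
  · intro f X Y hf hX hY p
    rw [dir_smul, nabla_smul_left hg hf hX hY, dir_smul]
    ring
  · intro X Y Y' hX hY hY' p
    have : dir (𝓡 m) (Y + Y') h = fun x => dir (𝓡 m) Y h x + dir (𝓡 m) Y' h x :=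
      funext fun x => dir_add Y Y' h x
    rw [this, dir_fun_add X ((hY.dir hh).mdiff p) ((hY'.dir hh).mdiff p),
      nabla_add_right hg hX hY hY', dir_add]
    ring
  · intro f X Y hf hX hY p
    have : dir (𝓡 m) (f • Y) h = fun x => f x * dir (𝓡 m) Y h x :=
      funext fun x => dir_smul f Y h x
    rw [this, dir_fun_mul X (hf.mdiff p) ((hY.dir hh).mdiff p), nabla_smul_right hg hf hX hY,
      dir_add, dir_smul, dir_smul]
    ring

lemma dir_exp {X : VF (𝓡 m) B} {ψ : B → ℝ} (hψ : SmoothFn (𝓡 m) ψ) (κ : ℝ) (x : B) :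
    dir (𝓡 m) X (fun x => Real.exp (κ * ψ x)) x =
      κ * Real.exp (κ * ψ x) * dir (𝓡 m) X ψ x := by
  have hd : HasDerivAt (fun s : ℝ => Real.exp (κ * s)) (Real.exp (κ * ψ x) * (κ * 1)) (ψ x) :=
    ((hasDerivAt_id (ψ x)).const_mul κ).exp
  have h1 := mvfderiv_comp_apply (I := 𝓘(ℝ, ℝ)) (I' := 𝓡 m) x (f := ψ)
    (g := fun s : ℝ => Real.exp (κ * s)) hd.differentiableAt.mdifferentiableAt (hψ.mdiff x) (X x)
  have h2 : ∀ r : ℝ, mvfderiv 𝓘(ℝ, ℝ) (fun s : ℝ => Real.exp (κ * s)) (ψ x) r =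
      κ * Real.exp (κ * ψ x) * r := by
    intro r
    have h3 : mvfderiv 𝓘(ℝ, ℝ) (fun s : ℝ => Real.exp (κ * s)) (ψ x) r =
        fderiv ℝ (fun s : ℝ => Real.exp (κ * s)) (ψ x) r := by
      simp only [mvfderiv, mfderiv_eq_fderiv]
      rfl
    rw [h3, hd.hasFDerivAt.fderiv]
    simp
    ring
  exact h1.trans (h2 _)

lemma smooth_exp {ψ : B → ℝ} (hψ : SmoothFn (𝓡 m) ψ) (κ : ℝ) :
    SmoothFn (𝓡 m) (fun x => Real.exp (κ * ψ x)) :=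
  Real.contDiff_exp.contMDiff.comp (SmoothFn.mul (SmoothFn.const κ) hψ)

/-- Orthonormal frames at a point. -/
lemma exists_orthonormal_frame (hg : IsMetric (𝓡 m) g) (hpos : ∀ x v, 0 ≤ g x v v)
    (hdef : ∀ x v, g x v v = 0 → v = 0) (x : B) :
    ∃ F : Fin m → VF (𝓡 m) B, (∀ i, SmoothVF (𝓡 m) (F i)) ∧ OrthonormalAt (𝓡 m) g F x := by
  let b : Fin m → TangentSpace (𝓡 m) x := fun i =>
    (EuclideanSpace.single i 1 : EuclideanSpace ℝ (Fin m))
  obtain ⟨A, hA⟩ := exists_orthonormal (toLin₂ g x) (hg.symm x) (hpos x) b (by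
    intro c hc
    have h1 : (∑ i, c i • (EuclideanSpace.single i (1 : ℝ)) : EuclideanSpace ℝ (Fin m)) = 0 :=
      hdef x _ hc
    ext j
    have := congrArg (fun v : EuclideanSpace ℝ (Fin m) => v j) h1
    simpa [Pi.single_apply] using this)
  choose F hF hFx using fun i => exists_smoothVF_apply_eq (𝓡 m) x (∑ j, A i j • b j)
  exact ⟨F, hF, fun i j => by rw [hFx, hFx]; exact hA i j⟩

/-- Hopf's lemma: a harmonic function cannot have a strict maximum relative to one side of a
hypersurface. -/
lemma hopf (hg : IsMetric (𝓡 m) g) (hpos : ∀ x v, 0 ≤ g x v v)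
    (hdef : ∀ x v, g x v v = 0 → v = 0) {u : B → ℝ} (hu : SmoothFn (𝓡 m) u)
    (hlap : ∀ x, ∀ F : Fin m → VF (𝓡 m) B, (∀ i, SmoothVF (𝓡 m) (F i)) →
      OrthonormalAt (𝓡 m) g F x → ∑ i, (dir (𝓡 m) (F i) (dir (𝓡 m) (F i) u) x
        - dir (𝓡 m) (nabla (𝓡 m) g (F i) (F i)) u x) = 0)
    {z : B} (hmaxu : ∀ x, u x ≤ u z) {ψ : B → ℝ} (hψ : SmoothFn (𝓡 m) ψ) (hdψ : mvfderiv (𝓡 m) ψ z ≠ 0)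
    (hstrict : ∀ᶠ x in 𝓝 z, ψ x ≤ ψ z → x ≠ z → u x < u z) : False := by
  have : LocallyCompactSpace B :=
    ChartedSpace.locallyCompactSpace (EuclideanSpace ℝ (Fin m)) B
  obtain ⟨Tu, hTu⟩ := exists_hessian hg hu
  obtain ⟨Tψ, hTψ⟩ := exists_hessian hg hψ
  obtain ⟨F, hF, hon⟩ := exists_orthonormal_frame hg hpos hdef z
  obtain ⟨hG1, hdet, hPs⟩ := inv_gram_smooth hg.smooth hF hon
  set P : B → Matrix (Fin m) (Fin m) ℝ := fun x =>
    (Matrix.of fun i j => g x (F i x) (F j x))⁻¹ with hP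
  have hPz : P z = 1 := by simp only [hP, hG1, inv_one]
  -- A = |dψ|² and L is the Laplacian of ψ, written in a frame fixed near z with the inverse Gram
  -- matrix so that both are continuous at z.
  let A : B → ℝ := fun x => ∑ i, ∑ j, P x i j * (dir (𝓡 m) (F i) ψ x * dir (𝓡 m) (F j) ψ x)
  let L : B → ℝ := fun x => ∑ i, ∑ j, P x i j * Tψ x (F i x) (F j x)
  have hPc : ∀ i j, ContinuousAt (fun x => P x i j) z := fun i j => (hPs i j).continuousAt
  have hAc : ContinuousAt A z := by
    refine tendsto_finsetSum _ fun i _ => tendsto_finsetSum _ fun j _ => ?_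
    exact (hPc i j).mul ((((hF i).dir hψ).continuous.continuousAt).mul
      (((hF j).dir hψ).continuous.continuousAt))
  have hLc : ContinuousAt L z := by
    refine tendsto_finsetSum _ fun i _ => tendsto_finsetSum _ fun j _ => ?_
    refine (hPc i j).mul ?_
    have : (fun x => Tψ x (F i x) (F j x)) = fun x =>
        dir (𝓡 m) (F i) (dir (𝓡 m) (F j) ψ) x - dir (𝓡 m) (nabla (𝓡 m) g (F i) (F j)) ψ x :=
      funext fun x => hTψ _ _ (hF i) (hF j) x
    rw [this]
    exact ((((hF i).dir ((hF j).dir hψ)).continuous.continuousAt).sub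
      (((SmoothVF.nabla hg (hF i) (hF j)).dir hψ).continuous.continuousAt))
  have hAz : 0 < A z := by
    have h1 : A z = ∑ i, dir (𝓡 m) (F i) ψ z * dir (𝓡 m) (F i) ψ z := by
      simp only [A, hPz, Matrix.one_apply, ite_mul, one_mul, zero_mul, Finset.sum_ite_eq,
        Finset.mem_univ, if_true]
    rw [h1]
    refine lt_of_le_of_ne (Finset.sum_nonneg fun i _ => mul_self_nonneg _) fun h0 => hdψ ?_
    have h2 := (Finset.sum_eq_zero_iff_of_nonneg (fun i _ => mul_self_nonneg _)).1 h0.symm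
    ext w
    rw [exists_basis_of_orthonormal hon w, map_sum]
    refine Finset.sum_eq_zero fun i _ => ?_
    have h3 := mul_self_eq_zero.1 (h2 i (Finset.mem_univ _))
    rw [dir] at h3
    rw [map_smul, h3, smul_zero]
  -- The Laplacian of exp(-κψ) is κ exp(-κψ)(κA - L), positive near z for this κ.
  obtain ⟨κ, hκ, hκz⟩ : ∃ κ : ℝ, 0 < κ ∧ L z < κ * A z := by
    refine ⟨|L z| / A z + 1, by positivity, ?_⟩
    rw [add_mul, div_mul_cancel₀ _ hAz.ne', one_mul]
    have := le_abs_self (L z)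
    linarith
  have hκn : ∀ᶠ x in 𝓝 z, L x < κ * A x :=
    hLc.eventually_lt (continuousAt_const.mul hAc) hκz
  obtain ⟨W, hW, hWo, hzW⟩ := mem_nhds_iff.1 (hstrict.and (hdet.and hκn))
  obtain ⟨O, hO, hzO, hOW⟩ := exists_compact_subset hWo hzW
  -- The barrier: strictly subharmonic near z, zero at z, and negative where ψ > ψ(z).
  let w : B → ℝ := fun x => Real.exp (-κ * ψ x) - Real.exp (-κ * ψ z)
  have hes := smooth_exp hψ (-κ)
  have hws : SmoothFn (𝓡 m) w := hes.sub (SmoothFn.const _)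
  obtain ⟨δ, hδ, hδQ⟩ : ∃ δ : ℝ, 0 < δ ∧
      ∀ x ∈ O, x ∉ interior O → ψ x ≤ ψ z → u x ≤ u z - δ := by
    have hQ : IsCompact ((O \ interior O) ∩ {x | ψ x ≤ ψ z}) :=
      (hO.diff isOpen_interior).inter_right (isClosed_le hψ.continuous continuous_const)
    rcases Set.eq_empty_or_nonempty ((O \ interior O) ∩ {x | ψ x ≤ ψ z}) with he | hne
    · exact ⟨1, one_pos, fun x h1 h2 h3 => absurd
        (show x ∈ (O \ interior O) ∩ {x | ψ x ≤ ψ z} from ⟨⟨h1, h2⟩, h3⟩) (by rw [he]; simp)⟩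
    · obtain ⟨y, ⟨⟨hy1, hy2⟩, hy3⟩, hy⟩ := hQ.exists_isMaxOn hne hu.continuous.continuousOn
      have hyz : y ≠ z := by rintro rfl; exact hy2 hzO
      have := (hW (hOW hy1)).1 hy3 hyz
      refine ⟨u z - u y, by linarith, fun x h1 h2 h3 => ?_⟩
      have : u x ≤ u y := hy (show x ∈ (O \ interior O) ∩ {x | ψ x ≤ ψ z} from ⟨⟨h1, h2⟩, h3⟩)
      linarith
  obtain ⟨b, hb⟩ := hO.bddAbove_image hws.continuous.continuousOn
  have hb' : ∀ x ∈ O, w x ≤ |b| := fun x hx =>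
    (hb (mem_image_of_mem _ hx)).trans (le_abs_self b)
  set ε := δ / (2 * (|b| + 1)) with hε
  have hε0 : 0 < ε := by positivity
  have hεw : ∀ x ∈ O, ε * w x < δ := by
    intro x hx
    have h1 : ε * w x ≤ ε * |b| := mul_le_mul_of_nonneg_left (hb' x hx) hε0.le
    have h2 : ε * (|b| + 1) = δ / 2 := by
      rw [hε]
      have : |b| + 1 ≠ 0 := by positivity
      field_simp
    nlinarith
  let h : B → ℝ := fun x => u x + ε * w x
  have hhs : SmoothFn (𝓡 m) h := hu.add (SmoothFn.mul (SmoothFn.const ε) hws)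
  obtain ⟨y, hyO, hy⟩ := hO.exists_isMaxOn ⟨z, interior_subset hzO⟩ hhs.continuous.continuousOn
  have hhz : h z = u z := by simp [h, w]
  have hyz : u z ≤ h y := by rw [← hhz]; exact hy (interior_subset hzO)
  -- On the rest of O, h < u(z): where ψ ≤ ψ(z), u loses δ and εw gains less than δ; where ψ > ψ(z),
  -- w is negative and u is at most its maximum. Since z is interior in B, no normal derivative is
  -- needed.
  have hyi : y ∈ interior O := by
    by_contra hyi
    rcases le_or_gt (ψ y) (ψ z) with h1 | h1
    · have h2 := hδQ y hyO hyi h1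
      have h3 := hεw y hyO
      simp only [h] at hyz
      linarith
    · have h2 : w y < 0 := by
        simp only [w, sub_neg, Real.exp_lt_exp]
        nlinarith
      have h3 := mul_neg_of_pos_of_neg hε0 h2
      simp only [h] at hyz
      have h4 := hmaxu y
      linarith
  have hmax : IsLocalMax h y := by
    filter_upwards [mem_interior_iff_mem_nhds.1 hyi] with x hx using hy hx
  obtain ⟨-, hdy, hLy⟩ := hW (hOW hyO)
  obtain ⟨F', hF', htr⟩ := exists_orthonormal_inv_gram (toLin₂ g y) (hg.symm y) (hpos y)
    (fun i => F i y) hdy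
  choose V hV hVy using fun i => exists_smoothVF_apply_eq (𝓡 m) y (F' i)
  have honV : OrthonormalAt (𝓡 m) g V y := fun i j => by rw [hVy, hVy]; exact hF' i j
  have hLt : L y = ∑ i, Tψ y (V i y) (V i y) := by
    have := htr (toLin₂ Tψ y)
    simp only [hVy]
    exact this
  have hAt : A y = ∑ i, dir (𝓡 m) (V i) ψ y * dir (𝓡 m) (V i) ψ y := by
    have := htr (LinearMap.mk₂ ℝ (fun a b => mvfderiv (𝓡 m) ψ y a * mvfderiv (𝓡 m) ψ y b)
      (by intros; rw [map_add]; ring) (by intros; rw [map_smul, smul_eq_mul, smul_eq_mul]; ring)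
      (by intros; rw [map_add]; ring) (by intros; rw [map_smul, smul_eq_mul, smul_eq_mul]; ring))
    simp only [dir, hVy]
    exact this
  -- At the interior maximum y each diagonal Hessian entry of h = u + εw is nonpositive. Summed over
  -- an orthonormal frame, this contradicts u being harmonic and w strictly subharmonic.
  have hneg : ∀ i, (dir (𝓡 m) (V i) (dir (𝓡 m) (V i) u) y
      - dir (𝓡 m) (nabla (𝓡 m) g (V i) (V i)) u y) + ε * (Real.exp (-κ * ψ y) *
        (κ * (κ * (dir (𝓡 m) (V i) ψ y * dir (𝓡 m) (V i) ψ y) - Tψ y (V i y) (V i y)))) ≤ 0 := by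
    intro i
    have hX := hV i
    set X := V i
    have hn := SmoothVF.nabla hg hX hX
    have h1 := (dir_dir_nonpos_of_isLocalMax hhs hmax hX).2
    have h2 := (dir_dir_nonpos_of_isLocalMax hhs hmax hn).1
    have d1 : ∀ Y x, dir (𝓡 m) Y h x = dir (𝓡 m) Y u x +
        ε * (-κ * Real.exp (-κ * ψ x) * dir (𝓡 m) Y ψ x) := by
      intro Y x
      rw [← dir_exp hψ]
      simp only [h]
      rw [dir_fun_add Y (hu.mdiff x) ((SmoothFn.mul (SmoothFn.const ε) hws).mdiff x),
        dir_fun_mul Y mdifferentiableAt_const (hws.mdiff x), dir_const]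
      simp only [w]
      rw [dir_fun_sub Y (hes.mdiff x) mdifferentiableAt_const, dir_const]
      ring
    have e0 : dir (𝓡 m) X h = fun x => dir (𝓡 m) X u x +
        ε * (-κ * (Real.exp (-κ * ψ x) * dir (𝓡 m) X ψ x)) :=
      funext fun x => by rw [d1]; ring
    have hXψ := hX.dir hψ
    have s1 : SmoothFn (𝓡 m) (fun x => Real.exp (-κ * ψ x) * dir (𝓡 m) X ψ x) := hes.mul hXψ
    have s2 : SmoothFn (𝓡 m) (fun x => -κ * (Real.exp (-κ * ψ x) * dir (𝓡 m) X ψ x)) :=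
      SmoothFn.mul (SmoothFn.const _) s1
    have s3 : SmoothFn (𝓡 m) (fun x => ε * (-κ * (Real.exp (-κ * ψ x) * dir (𝓡 m) X ψ x))) :=
      SmoothFn.mul (SmoothFn.const _) s2
    rw [e0, dir_fun_add X ((hX.dir hu).mdiff y) (s3.mdiff y),
      dir_fun_mul X mdifferentiableAt_const (s2.mdiff y),
      dir_fun_mul X mdifferentiableAt_const (s1.mdiff y),
      dir_fun_mul X (hes.mdiff y) (hXψ.mdiff y), dir_exp hψ, dir_const, dir_const] at h1
    rw [d1] at h2
    rw [hTψ _ _ hX hX]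
    linarith
  have hsum := Finset.sum_nonpos fun i (_ : i ∈ Finset.univ) => hneg i
  rw [Finset.sum_add_distrib, hlap y V hV honV, zero_add, ← Finset.mul_sum, ← Finset.mul_sum,
    ← Finset.mul_sum, Finset.sum_sub_distrib, ← Finset.mul_sum, ← hLt, ← hAt] at hsum
  have : 0 < ε * (Real.exp (-κ * ψ y) * (κ * (κ * A y - L y))) := by
    have := Real.exp_pos (-κ * ψ y)
    have h1 : 0 < κ * A y - L y := by linarith
    positivity
  linarith

end MaximumPrinciple

end NEH

namespace NEH

open VectorField Filter Set

/-! ### The strong maximum principle and the constancy of k(v). -/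

section StrongMaximum

variable {m : ℕ} {B : Type*} [TopologicalSpace B] [T2Space B] [CompactSpace B] [ConnectedSpace B]
  [ChartedSpace (EuclideanSpace ℝ (Fin m)) B] [IsManifold (𝓡 m) ∞ B] {g : Bilin (𝓡 m) B}

/-- Harmonic functions on a compact connected Riemannian manifold are constant. -/
lemma harmonic_const (hg : IsMetric (𝓡 m) g) (hpos : ∀ x v, 0 ≤ g x v v)
    (hdef : ∀ x v, g x v v = 0 → v = 0) {u : B → ℝ} (hu : SmoothFn (𝓡 m) u)
    (hlap : ∀ x, ∀ F : Fin m → VF (𝓡 m) B, (∀ i, SmoothVF (𝓡 m) (F i)) →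
      OrthonormalAt (𝓡 m) g F x → ∑ i, (dir (𝓡 m) (F i) (dir (𝓡 m) (F i) u) x
        - dir (𝓡 m) (nabla (𝓡 m) g (F i) (F i)) u x) = 0) :
    ∃ c, ∀ x, u x = c := by
  obtain ⟨z, -, hz⟩ := isCompact_univ.exists_isMaxOn univ_nonempty
    hu.continuous.continuousOn (f := u)
  have hmax : ∀ x, u x ≤ u z := fun x => hz (mem_univ x)
  set c := u z with hc
  refine ⟨c, fun x => ?_⟩
  have hclosed : IsClosed {x | u x = c} := isClosed_eq hu.continuous continuous_const
  suffices hopen : IsOpen {x | u x = c} by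
    have := IsClopen.eq_univ ⟨hclosed, hopen⟩ ⟨z, rfl⟩
    exact (this ▸ mem_univ x : x ∈ {x | u x = c})
  rw [isOpen_iff_mem_nhds]
  intro z₀ hz₀
  by_contra hnot
  set φ := chartAt (EuclideanSpace ℝ (Fin m)) z₀ with hφ
  have hz₀s : z₀ ∈ φ.source := mem_chart_source _ z₀
  obtain ⟨ρ, hρ, hρt⟩ := Metric.isOpen_iff.1 φ.open_target _ (φ.map_source hz₀s)
  -- The touching ball below has radius less than R and its centre is within R of φ z₀, so radius 3R
  -- leaves room for it in the chart.
  obtain ⟨R, hR, hRt⟩ : ∃ R : ℝ, 0 < R ∧ Metric.closedBall (φ z₀) (3 * R) ⊆ φ.target :=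
    ⟨ρ / 6, by positivity, (Metric.closedBall_subset_ball (by linarith)).trans hρt⟩
  obtain ⟨y, hys, hyR, hyZ⟩ : ∃ y, y ∈ φ.source ∧ dist (φ y) (φ z₀) < R ∧ u y ≠ c := by
    by_contra hcon
    push Not at hcon
    refine hnot ?_
    filter_upwards [φ.open_source.mem_nhds hz₀s,
      (φ.continuousAt hz₀s).preimage_mem_nhds (Metric.ball_mem_nhds _ hR)] with y h1 h2
      using hcon y h1 h2
  let D : Set (EuclideanSpace ℝ (Fin m)) :=
    Metric.closedBall (φ z₀) (3 * R) ∩ (fun x => u (φ.symm x)) ⁻¹' {c}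
  have hDc : IsCompact D := by
    refine (isCompact_closedBall (φ z₀) (3 * R)).of_isClosed_subset ?_ inter_subset_left
    exact (hu.continuous.comp_continuousOn (φ.continuousOn_symm.mono hRt)).preimage_isClosed_of_isClosed
      Metric.isClosed_closedBall isClosed_singleton
  have hDz : φ z₀ ∈ D := ⟨Metric.mem_closedBall_self (by positivity), by
    simpa [φ.left_inv hz₀s] using hz₀⟩
  -- A nearest point of the maximum set: the open ball about φ y reaching to z' misses that set, and
  -- z' lies on its boundary.
  obtain ⟨z', hz'D, hz'⟩ := hDc.exists_infDist_eq_dist ⟨_, hDz⟩ (φ y)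
  have hr1 : dist (φ y) z' < R := by
    rw [← hz']
    exact (Metric.infDist_le_dist_of_mem hDz).trans_lt hyR
  have hr0 : 0 < dist (φ y) z' := by
    rw [dist_pos]
    rintro h
    apply hyZ
    have := hz'D.2
    rw [← h] at this
    simpa [φ.left_inv hys] using this
  have hin : ∀ x ∈ φ.source, dist (φ x) (φ y) < dist (φ y) z' → u x < c := by
    intro x hx hd
    refine lt_of_le_of_ne (hmax x) fun hxc => ?_
    have hxD : φ x ∈ D := ⟨by
      have := dist_triangle (φ x) (φ y) (φ z₀)
      rw [Metric.mem_closedBall]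
      linarith, by simpa [φ.left_inv hx] using hxc⟩
    have := Metric.infDist_le_dist_of_mem (x := φ y) hxD
    rw [hz', dist_comm _ (φ x)] at this
    linarith
  have hz't : z' ∈ φ.target := hRt hz'D.1
  have hz1s := φ.map_target hz't
  set z₁ := φ.symm z' with hz1
  have hφz1 : φ z₁ = z' := φ.right_inv hz't
  have huz1 : u z₁ = c := hz'D.2
  -- Other points of the maximum set may lie on the same sphere. The second term removes them: Q ≤
  -- Q(z') forces x = z' or x in the open ball. The gradient of Q at z' is 2(z' - φ y), which is
  -- nonzero.
  let Q : EuclideanSpace ℝ (Fin m) → ℝ := fun x => ‖x - φ y‖ ^ 2 + ‖x - z'‖ ^ 2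
  have hQs : ContDiff ℝ ∞ Q :=
    ((contDiff_id.sub contDiff_const).norm_sq ℝ).add ((contDiff_id.sub contDiff_const).norm_sq ℝ)
  have hφs : ContMDiffOn (𝓡 m) 𝓘(ℝ, EuclideanSpace ℝ (Fin m)) ∞ φ φ.source :=
    contMDiffOn_chart
  obtain ⟨ψ, hψ, hψe⟩ := exists_smoothFn_eventuallyEq φ.open_source
    (hQs.contMDiff.comp_contMDiffOn hφs) hz1s
  have hdψ : mvfderiv (𝓡 m) ψ z₁ ≠ 0 := by
    intro h0
    have h1 : HasMFDerivAt (𝓡 m) 𝓘(ℝ, ℝ) ψ z₁ 0 := by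
      have := (hψ.mdiff z₁).hasMFDerivAt
      convert this using 1
      exact h0.symm
    have hsymm : MDifferentiableAt 𝓘(ℝ, EuclideanSpace ℝ (Fin m)) (𝓡 m) φ.symm z' :=
      ((contMDiffOn_chart_symm (I := 𝓡 m) (n := ∞) (x := z₀)).contMDiffAt
        (φ.open_target.mem_nhds hz't)).mdifferentiableAt (by simp)
    have h2 := h1.comp z' hsymm.hasMFDerivAt
    have h3 : HasMFDerivAt 𝓘(ℝ, EuclideanSpace ℝ (Fin m)) 𝓘(ℝ, ℝ) (ψ ∘ φ.symm) z' 0 := by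
      exact h2.congr_mfderiv (ContinuousLinearMap.ext fun _ => rfl)
    have h4 : HasFDerivAt (ψ ∘ φ.symm) (0 : EuclideanSpace ℝ (Fin m) →L[ℝ] ℝ) z' :=
      hasMFDerivAt_iff_hasFDerivAt.1 h3
    have h5 : ψ ∘ φ.symm =ᶠ[𝓝 z'] Q := by
      have h6 := (φ.continuousAt_symm hz't).eventually hψe
      filter_upwards [h6, φ.open_target.mem_nhds hz't] with x hx hxt
      rw [Function.comp_apply, hx, Function.comp_apply, φ.right_inv hxt]
    have h6 := h4.congr_of_eventuallyEq h5.symm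
    have h7 := ((hasFDerivAt_id (𝕜 := ℝ) z').sub_const (φ y)).norm_sq.add
      ((hasFDerivAt_id (𝕜 := ℝ) z').sub_const z').norm_sq
    have h8 := congrArg (fun L => L (z' - φ y)) (h6.unique h7)
    simp only [map_sub] at h8
    have h8' : 0 = 2 * inner ℝ (z' - φ y) (z' - φ y) := by
      rw [inner_sub_right, inner_sub_left, inner_sub_left, real_inner_self_eq_norm_sq,
        real_inner_self_eq_norm_sq, real_inner_comm]
      simp at h8
      rw [real_inner_comm] at h8
      linarith [real_inner_comm z' (φ y)]
    rw [dist_comm, dist_pos] at hr0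
    exact hr0 (sub_eq_zero.1 (inner_self_eq_zero.1 (by linarith : inner ℝ (z' - φ y) (z' - φ y) = (0 : ℝ))))
  have hψz : ψ z₁ = dist (φ y) z' ^ 2 := by
    rw [hψe.self_of_nhds]
    simp [Q, hφz1, dist_eq_norm, norm_sub_rev]
  refine hopf hg hpos hdef hu hlap (z := z₁) (fun x => by rw [huz1]; exact hmax x) hψ hdψ ?_
  filter_upwards [hψe, φ.open_source.mem_nhds hz1s] with x hx hxs hle hne
  rw [huz1]
  refine hin x hxs ?_
  rw [hψz, hx] at hle
  have hne' : φ x - z' ≠ 0 := by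
    rw [sub_ne_zero, ← hφz1]
    exact fun h => hne (φ.injOn hxs hz1s h)
  have h1 : 0 < ‖φ x - z'‖ ^ 2 := by positivity
  have h2 : ‖φ x - φ y‖ ^ 2 + ‖φ x - z'‖ ^ 2 ≤ dist (φ y) z' ^ 2 := hle
  rw [dist_eq_norm]
  exact lt_of_pow_lt_pow_left₀ 2 hr0.le (by linarith)

end StrongMaximum

namespace Horizon

variable {m : ℕ} {M : Type*} [TopologicalSpace M] [T2Space M]
  [ChartedSpace (EuclideanSpace ℝ (Fin (m + 2))) M] [IsManifold (𝓡 (m + 2)) ∞ M]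
  {B : Type*} [TopologicalSpace B] [T2Space B] [CompactSpace B] [ConnectedSpace B]
  [ChartedSpace (EuclideanSpace ℝ (Fin m)) B] [IsManifold (𝓡 m) ∞ B]
  {S : Spacetime (m + 2) M} (Δ : Horizon S B)

/-- A tangent Killing field preserves the invariant foliation. -/
lemma dir_killing_const (hgen : Δ.InvariantGeneric) {ℓ : VF (modelH m) (B × ℝ)}
    (hℓ : Δ.IsNatural ℓ) (hℓ0 : ∀ p, ℓ p ≠ 0) {v₀ : B × ℝ → ℝ} (hv₀ : Δ.IsGoodCutFunction ℓ v₀)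
    (htg : TotallyGeodesic (𝓡 (m + 2)) (modelH m) Δ.e S.g)
    (hq : ∀ X Y, SmoothVF (modelH m) X → SmoothVF (modelH m) Y →
      ∀ p, lieBilin (modelH m) ℓ Δ.q X Y p = 0)
    {K : VF (𝓡 (m + 2)) M} (hK : S.IsKilling K) {k : VF (modelH m) (B × ℝ)}
    (hkK : ∀ p, Δ.push p (k p) = K (Δ.e p)) :
    ∃ a₀ : ℝ, ∀ p, dir (modelH m) k v₀ p = a₀ := by
  have hvs := hv₀.smooth
  have hv := hv₀.normalized
  obtain ⟨α, hα, hgood⟩ := hv₀.good_cuts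
  have hks := Δ.smooth_of_push hK hkK
  have hkℓ := Δ.bracket_killing_natural htg hK hkK hℓ hℓ0 hvs hv hgen
  have hα1 := Δ.rotation_self hℓ hℓ0 hα
  have hαs := fun X hX => Δ.smoothFn_rotation (X := X) htg hℓ hℓ0 hvs hv hα hX
  have hαℓ := fun X hX => Δ.lie_rotation (X := X) htg hℓ hℓ0 hvs hv hα hX
  have hαk := fun X hX => Δ.lie_rotation_killing htg hK hkK hℓ hℓ0 hvs hv hα hgen (X := X) hX
  have hu : SmoothFn (𝓡 m) (fun x => dir (modelH m) k v₀ (x, 0)) :=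
    (hks.dir hvs).comp_map (smooth_slice 0)
  obtain ⟨a₀, ha₀⟩ := harmonic_const Δ.isMetric_baseMetric Δ.baseMetric_nonneg
    Δ.eq_zero_of_baseMetric hu fun x F hF hon =>
      laplacian_eq_zero Δ.isMetric_baseMetric Δ.baseMetric_nonneg (projVF_smooth hks)
        (fun X Y hX hY => Δ.projVF_killing hℓ.smooth hℓ.null hℓ0 hks hkℓ hq
          (fun X Y hX hY => Δ.lie_q_killing hK hkK hX hY) hX hY)
        (β := baseForm α v₀) (fun X hX => baseForm_smooth hvs hαs hX) hu
        (fun X hX => Δ.lie_baseForm hℓ.smooth hℓ.null hℓ0 hvs hv hα1 hαs hαℓ hks hkℓ hαk hX)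
        (Δ.divFree_baseForm hℓ.smooth hℓ.null hℓ0 hvs hv hα1 hαs hαℓ hgood) hF hon
  exact ⟨a₀, fun p => by
    rw [Δ.dir_killing_eq_slice hℓ.smooth hℓ.null hℓ0 hvs hv hks hkℓ, ha₀]⟩

end Horizon

end NEH

/-! ### Propagation of zeros along integral curves by linear ODEs. -/

namespace NEH

open VectorField Filter Set

/-- Zeros of solutions of linear ordinary differential equations propagate. -/
lemma linear_ode_zero_iff {d : ℕ} {c : Fin d → ℝ → ℝ} {A : Fin d → Fin d → ℝ → ℝ} {t₀ : ℝ}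
    (hA : ∀ i j, ContinuousAt (A i j) t₀)
    (hc : ∀ᶠ t in 𝓝 t₀, ∀ j, HasDerivAt (c j) (∑ i, A i j t * c i t) t) :
    ∀ᶠ t in 𝓝 t₀, ((∀ j, c j t = 0) ↔ ∀ j, c j t₀ = 0) := by
  obtain ⟨C, hC⟩ : ∃ C : ℝ, ∀ᶠ t in 𝓝 t₀, ∀ i j, |A i j t| ≤ C := by
    refine ⟨1 + ∑ i, ∑ j, |A i j t₀|, ?_⟩
    simp only [eventually_all]
    intro i j
    have h1 : |A i j t₀| < 1 + ∑ i, ∑ j, |A i j t₀| := by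
      have h2 : |A i j t₀| ≤ ∑ j, |A i j t₀| :=
        Finset.single_le_sum (f := fun j => |A i j t₀|) (fun _ _ => abs_nonneg _) (Finset.mem_univ j)
      have h3 : ∑ j, |A i j t₀| ≤ ∑ i, ∑ j, |A i j t₀| :=
        Finset.single_le_sum (f := fun i => ∑ j, |A i j t₀|)
          (fun _ _ => Finset.sum_nonneg fun _ _ => abs_nonneg _) (Finset.mem_univ i)
      linarith
    exact ((hA i j).abs.eventually_lt continuousAt_const h1).mono fun _ h => h.le
  obtain ⟨ε, hε, hball⟩ := Metric.eventually_nhds_iff_ball.1 (hc.and hC)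
  rw [Real.ball_eq_Ioo] at hball
  have ht₀ : t₀ ∈ Ioo (t₀ - ε) (t₀ + ε) := ⟨by linarith, by linarith⟩
  have key : ∀ t₁ ∈ Ioo (t₀ - ε) (t₀ + ε), (∀ j, c j t₁ = 0) →
      ∀ t ∈ Ioo (t₀ - ε) (t₀ + ε), ∀ j, c j t = 0 := by
    intro t₁ ht₁ h0 t ht j
    -- Uniqueness is applied against the zero solution; d·C bounds the operator norm of the
    -- coefficient matrix in the sup norm, where C bounds its entries.
    have := ODE_solution_unique_of_mem_Ioo (E := Fin d → ℝ) (t₀ := t₁) (K := Real.toNNReal (d * C))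
      (v := fun t x j => ∑ i, A i j t * x i) (s := fun _ => univ) (f := fun t j => c j t)
      (g := fun _ => 0) (a := t₀ - ε) (b := t₀ + ε) ?_ ht₁ ?_ ?_ (funext h0)
    · exact congrFun (this ht) j
    · intro s hs
      have hbd := (hball s hs).2
      refine LipschitzOnWith.of_dist_le_mul fun x _ y _ => ?_
      rw [dist_pi_le_iff (by positivity)]
      intro j
      have hC0 : 0 ≤ C := (abs_nonneg _).trans (hbd j j)
      rw [Real.coe_toNNReal _ (by positivity), Real.dist_eq, ← Finset.sum_sub_distrib]
      calc |∑ i, (A i j s * x i - A i j s * y i)| ≤ ∑ i, |A i j s * x i - A i j s * y i| :=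
            Finset.abs_sum_le_sum_abs _ _
        _ ≤ ∑ _i : Fin d, C * dist x y := by
            refine Finset.sum_le_sum fun i _ => ?_
            rw [← mul_sub, abs_mul]
            have : |x i - y i| ≤ dist x y := by
              rw [← Real.dist_eq]
              exact dist_le_pi_dist x y i
            exact mul_le_mul (hbd i j) this (abs_nonneg _) hC0
        _ = d * C * dist x y := by simp [mul_assoc]
    · intro s hs
      exact ⟨hasDerivAt_pi.2 fun j => (hball s hs).1 j, mem_univ _⟩
    · intro s hs
      refine ⟨hasDerivAt_pi.2 fun j => ?_, mem_univ _⟩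
      simpa using hasDerivAt_const s (0 : ℝ)
  filter_upwards [Ioo_mem_nhds ht₀.1 ht₀.2] with t ht
  exact ⟨fun h => key t ht h t₀ ht₀, fun h => key t₀ ht₀ h t ht⟩

section Propagation

variable {E : Type*} [NormedAddCommGroup E] [NormedSpace ℝ E] [FiniteDimensional ℝ E]
  {H : Type*} [TopologicalSpace H] {I : ModelWithCorners ℝ E H}
  {M : Type*} [TopologicalSpace M] [ChartedSpace H M] [IsManifold I ∞ M] [T2Space M]
  {γ : ℝ → M} {t₀ : ℝ} {N : VF I M}

lemma hasDerivAt_comp_integralCurve (hγ : IsMIntegralCurveAt γ N t₀) {f : M → ℝ}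
    (hf : SmoothFn I f) :
    ∀ᶠ t in 𝓝 t₀, HasDerivAt (fun t => f (γ t)) (dir I N f (γ t)) t := by
  filter_upwards [hγ] with t ht using hasDerivAt_comp_curve ht (hf.mdiff _)

lemma bracket_sum_right {ι : Type*} {s : Finset ι} {X : VF I M} {Y : ι → VF I M}
    (hY : ∀ i ∈ s, SmoothVF I (Y i)) :
    mlieBracket I X (fun p => ∑ i ∈ s, Y i p) = fun p => ∑ i ∈ s, mlieBracket I X (Y i) p := by
  classical
  induction s using Finset.induction_on with
  | empty => exact mlieBracket_zero_right
  | insert i s hi ih =>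
    simp only [Finset.sum_insert hi]
    have h1 := hY i (Finset.mem_insert_self i s)
    have h2 := fun j hj => hY j (Finset.mem_insert_of_mem hj)
    exact (bracket_add_right (X := X) h1 (SmoothVF.sum h2)).trans (by rw [ih h2]; rfl)

/-- The differential of a function which is affine along `N` either vanishes all along an integral
curve of `N` or nowhere. -/
lemma mvfderiv_zero_iff (hN : SmoothVF I N) (hγ : IsMIntegralCurveAt γ N t₀) {f : M → ℝ}
    (hf : SmoothFn I f) {a : ℝ} (ha : ∀ᶠ x in 𝓝 (γ t₀), dir I N f x = a) :
    ∀ᶠ t in 𝓝 t₀, (mvfderiv I f (γ t) = 0 ↔ mvfderiv I f (γ t₀) = 0) := by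
  obtain ⟨b, c, hb, hc, hbc, -⟩ := exists_frame I (γ t₀)
  have hzero : ∀ᶠ t in 𝓝 t₀, (mvfderiv I f (γ t) = 0 ↔ ∀ j, dir I (b j) f (γ t) = 0) := by
    filter_upwards [hγ.continuousAt.eventually hbc] with t ht
    refine ⟨fun h j => by rw [dir, h]; rfl, fun h => ContinuousLinearMap.ext fun w => ?_⟩
    rw [ht w, map_sum]
    refine Finset.sum_eq_zero fun i _ => ?_
    have := h i
    rw [dir] at this
    rw [map_smul, this, smul_zero]
  -- As N(f) is constant, N(b_j f) = [N,b_j] f, and expanding the bracket in the frame gives a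
  -- linear system for the b_j f.
  have hode := linear_ode_zero_iff (t₀ := t₀) (c := fun j t => dir I (b j) f (γ t))
    (A := fun i j t => c i (γ t) (mlieBracket I N (b j) (γ t)))
    (fun i j => ((hc i _ (hN.bracket (hb j))).continuous.continuousAt).comp hγ.continuousAt) (by
      simp only [eventually_all]
      intro j
      filter_upwards [hasDerivAt_comp_integralCurve hγ ((hb j).dir hf),
        hγ.continuousAt.eventually (hbc.and ha.eventually_nhds)] with t h1 h2
      convert h1 using 1
      rw [← dir_vec_sum _ (mlieBracket I N (b j)) b f (γ t) _ (h2.1 _), dir_bracket hN (hb j) hf,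
        dir_congr_fun (b j) (h2.2 : dir I N f =ᶠ[𝓝 (γ t)] fun _ => a), dir_const, sub_zero])
  filter_upwards [hode, hzero] with t h1 h2
  rw [h2, h1, ← hzero.self_of_nhds]

/-- A solution `Y` of `[N, Y] = -2 ∇_Y N` either vanishes all along an integral curve of `N`, or
nowhere. -/
lemma apply_zero_iff {g : Bilin I M} (hg : IsMetric I g) (hN : SmoothVF I N)
    (hγ : IsMIntegralCurveAt γ N t₀) {Y : VF I M} (hY : SmoothVF I Y)
    (hNY : ∀ᶠ x in 𝓝 (γ t₀), mlieBracket I N Y x = (-2 : ℝ) • nabla I g Y N x) :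
    ∀ᶠ t in 𝓝 t₀, (Y (γ t) = 0 ↔ Y (γ t₀) = 0) := by
  obtain ⟨b, c, hb, hc, hbc, hcb⟩ := exists_frame I (γ t₀)
  have hzero : ∀ᶠ t in 𝓝 t₀, (Y (γ t) = 0 ↔ ∀ j, c j (γ t) (Y (γ t)) = 0) := by
    filter_upwards [hγ.continuousAt.eventually hbc] with t ht
    refine ⟨fun h j => by rw [h, map_zero], fun h => ?_⟩
    rw [ht (Y (γ t))]
    exact Finset.sum_eq_zero fun i _ => by rw [h i, zero_smul]
  have hYs : ∀ i, SmoothFn I (fun x => c i x (Y x)) := fun i => hc i Y hY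
  have hbracket : ∀ᶠ x in 𝓝 (γ t₀), mlieBracket I N Y x =
      ∑ i, (dir I N (fun x => c i x (Y x)) x • b i x + c i x (Y x) • mlieBracket I N (b i) x) := by
    filter_upwards [hbc.eventually_nhds] with x hx
    let Y' : VF I M := fun x => ∑ i, ((fun x => c i x (Y x)) • b i) x
    have h1 : Y =ᶠ[𝓝 x] Y' := by
      filter_upwards [hx] with z hz using hz (Y z)
    have h2 : mlieBracket I N Y x = mlieBracket I N Y' x :=
      EventuallyEq.mlieBracket_vectorField_eq (EventuallyEq.refl _ N) h1
    have h3 := congrFun (bracket_sum_right (X := N) (s := Finset.univ)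
      (fun i _ => SmoothVF.smul (hYs i) (hb i))) x
    refine (h2.trans h3).trans (Finset.sum_congr rfl fun i _ => ?_)
    rw [bracket_smul_right (hYs i) (hb i)]
    rfl
  have hnabla : ∀ x, (∀ w : TangentSpace I x, w = ∑ i, c i x w • b i x) →
      nabla I g Y N x = ∑ i, c i x (Y x) • nabla I g (b i) N x := by
    intro x hx
    obtain ⟨L, hL⟩ := exists_linear_of_tensorial (I := I) (p := x) (fun X => nabla I g X N x)
      (fun A B hA hB => by rw [nabla_add_left hg hA hB hN]; rfl)
      (fun f A hf hA => by rw [nabla_smul_left hg hf hA hN]; rfl)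
    have h1 := hL Y hY
    rw [hx (Y x), map_sum] at h1
    refine h1.trans (Finset.sum_congr rfl fun i _ => ?_)
    rw [map_smul]
    exact congrArg _ (hL _ (hb i)).symm
  -- For Y = Σ c_i b_i, the equation [N,Y] = -2∇_Y N becomes Σ N(c_i) b_i = Σ c_i G_i, a linear
  -- system for the components.
  let G : Fin (Module.finrank ℝ E) → VF I M := fun i =>
    (fun _ : M => (-2 : ℝ)) • nabla I g (b i) N - mlieBracket I N (b i)
  have hG : ∀ i, SmoothVF I (G i) := fun i =>
    (SmoothVF.smul (SmoothFn.const _) (SmoothVF.nabla hg (hb i) hN)).sub (hN.bracket (hb i))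
  have hode := linear_ode_zero_iff (t₀ := t₀) (c := fun j t => c j (γ t) (Y (γ t)))
    (A := fun i j t => c j (γ t) (G i (γ t)))
    (fun i j => ((hc j _ (hG i)).continuous.continuousAt).comp hγ.continuousAt) (by
      simp only [eventually_all]
      intro j
      filter_upwards [hasDerivAt_comp_integralCurve hγ (hYs j),
        hγ.continuousAt.eventually ((hbc.and hcb).and (hNY.and hbracket))] with t h1 h2
      obtain ⟨⟨h3, h4⟩, h5, h6⟩ := h2
      convert h1 using 1
      have h7 : ∑ i, dir I N (fun x => c i x (Y x)) (γ t) • b i (γ t) =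
          ∑ i, c i (γ t) (Y (γ t)) • G i (γ t) := by
        rw [h6, Finset.sum_add_distrib, hnabla _ h3, Finset.smul_sum] at h5
        rw [eq_sub_of_add_eq h5, ← Finset.sum_sub_distrib]
        refine Finset.sum_congr rfl fun i _ => ?_
        simp only [G, Pi.sub_apply, Pi.smul_apply', smul_sub]
        rw [smul_comm]
      have h8 := congrArg (c j (γ t)) h7
      simp only [map_sum, map_smul, h4, smul_eq_mul, mul_ite, mul_one, mul_zero,
        Finset.sum_ite_eq, Finset.mem_univ, if_true] at h8
      rw [h8]
      exact Finset.sum_congr rfl fun i _ => mul_comm _ _)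
  filter_upwards [hode, hzero] with t h1 h2
  rw [h2, h1, ← hzero.self_of_nhds]

/-- If `X` commutes with `N`, then `X(f)` is constant along the integral curves of `N` for each
function `f` which is affine along `N`. -/
lemma hasDerivAt_dir_zero (hN : SmoothVF I N) (hγ : IsMIntegralCurveAt γ N t₀) {X : VF I M}
    (hX : SmoothVF I X) (hNX : mlieBracket I N X (γ t₀) = 0) {f : M → ℝ} (hf : SmoothFn I f)
    {a : ℝ} (ha : ∀ᶠ x in 𝓝 (γ t₀), dir I N f x = a) :
    HasDerivAt (fun t => dir I X f (γ t)) 0 t₀ := by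
  convert (hasDerivAt_comp_integralCurve hγ (hX.dir hf)).self_of_nhds using 1
  have h := dir_bracket hN hX hf (γ t₀)
  rw [dir_congr_fun X (show dir I N f =ᶠ[𝓝 (γ t₀)] fun _ => a from ha), dir_const, sub_zero] at h
  rw [← h, dir, hNX, map_zero]

end Propagation

end NEH

namespace NEH

open VectorField Filter Set

/-! ### Tangent Killing fields commute with the geodesic field n. -/

namespace BondiNeighbourhood

variable {m : ℕ} {M : Type*} [TopologicalSpace M] [T2Space M]
  [ChartedSpace (EuclideanSpace ℝ (Fin (m + 2))) M] [IsManifold (𝓡 (m + 2)) ∞ M]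
  {B : Type*} [TopologicalSpace B] [T2Space B]
  [ChartedSpace (EuclideanSpace ℝ (Fin m)) B] [IsManifold (𝓡 m) ∞ B]
  {S : Spacetime (m + 2) M} {Δ : Horizon S B} {ℓ : VF (modelH m) (B × ℝ)}
  {v₀ : B × ℝ → ℝ} (𝓑 : BondiNeighbourhood Δ ℓ v₀)

lemma exists_smooth_n {x : M} (hx : x ∈ 𝓑.U) :
    ∃ N : VF (𝓡 (m + 2)) M, SmoothVF (𝓡 (m + 2)) N ∧ ∀ᶠ y in 𝓝 x, N y = 𝓑.n y :=
  exists_smoothVF_eventuallyEq 𝓑.U_open 𝓑.n_smooth hx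

lemma integralCurve_congr {γ : ℝ → M} {t : ℝ} {N N' : VF (𝓡 (m + 2)) M}
    (hγ : IsMIntegralCurveAt γ N t) (h : ∀ᶠ y in 𝓝 (γ t), N' y = N y) :
    IsMIntegralCurveAt γ N' t := by
  filter_upwards [hγ, hγ.continuousAt.eventually h] with s h1 h2
  rw [h2]
  exact h1

lemma exists_curve {x : M} (hx : x ∈ 𝓑.U) : ∃ (p : B × ℝ) (γ : ℝ → M) (a b s : ℝ),
    (0 : ℝ) ∈ Ioo a b ∧ s ∈ Ioo a b ∧ γ 0 = Δ.e p ∧ γ s = x ∧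
      ∀ t ∈ Ioo a b, γ t ∈ 𝓑.U ∧ IsMIntegralCurveAt γ 𝓑.n t := by
  obtain ⟨p, γ, a, b, s, h0, hs, hγ0, hγs, hU, hγ⟩ := 𝓑.swept x hx
  exact ⟨p, γ, a, b, s, h0, hs, hγ0, hγs, fun t ht =>
    ⟨hU t ht, hγ.isMIntegralCurveAt (Ioo_mem_nhds ht.1 ht.2)⟩⟩

/-- Properties which propagate locally along the integral curves of `n` propagate from the
horizon. -/
lemma iff_of_curve {P : M → Prop} {γ : ℝ → M} {a b s₁ s₂ : ℝ} (h₁ : s₁ ∈ Ioo a b)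
    (h₂ : s₂ ∈ Ioo a b)
    (h : ∀ t ∈ Ioo a b, ∀ᶠ t' in 𝓝 t, (P (γ t') ↔ P (γ t))) : P (γ s₁) → P (γ s₂) :=
  isPreconnected_Ioo.induction₂' (fun s t => P (γ s) → P (γ t))
    (fun t ht => (h t ht).filter_mono nhdsWithin_le_nhds |>.mono fun _ h => ⟨h.2, h.1⟩)
    (fun _ _ _ _ _ _ h h' => h' ∘ h) h₁ h₂

section Killing

variable {K : VF (𝓡 (m + 2)) M} (hK : S.IsKilling K) {k : VF (modelH m) (B × ℝ)}
  (hkK : ∀ p, Δ.push p (k p) = K (Δ.e p))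

-- Along the horizon n is determined by being null and by g(n,·) = -dv on tangent vectors. K
-- preserves g, and k preserves dv because k(v) is constant; hence [K,n] is orthogonal to n and to
-- the horizon.
include hK hkK in
lemma bracket_killing_n_horizon (hnull : Δ.IsNull ℓ) (hvs : SmoothFn (modelH m) v₀)
    (hv : ∀ p, dir (modelH m) ℓ v₀ p = 1) {a₀ : ℝ} (ha₀ : ∀ p, dir (modelH m) k v₀ p = a₀)
    (p : B × ℝ) : mlieBracket (𝓡 (m + 2)) K 𝓑.n (Δ.e p) = 0 := by
  obtain ⟨N, hN, hNn⟩ := 𝓑.exists_smooth_n (𝓑.horizon_subset p)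
  have hks := Δ.smooth_of_push hK hkK
  have hgm := S.isMetric
  have hNe : ∀ᶠ p' in 𝓝 p, N (Δ.e p') = 𝓑.n (Δ.e p') :=
    Δ.e_smooth.continuous.continuousAt.eventually hNn
  have hrelk : Related (modelH m) (𝓡 (m + 2)) Δ.e k K p := Eventually.of_forall hkK
  have hdir : ∀ f, SmoothFn (𝓡 (m + 2)) f →
      dir (𝓡 (m + 2)) K f (Δ.e p) = dir (modelH m) k (fun p => f (Δ.e p)) p :=
    fun f hf => ((hrelk.dir_eq Δ.e_smooth hf).self_of_nhds).symm
  have htan : ∀ w, S.g (Δ.e p) (mlieBracket (𝓡 (m + 2)) K N (Δ.e p)) (Δ.push p w) = 0 := by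
    intro w
    obtain ⟨X, hX, rfl⟩ := exists_smoothVF_apply_eq (modelH m) p w
    obtain ⟨Z, hZ, hXZ⟩ := Δ.exists_extension hX p
    have h1 := hK.2 N Z hN hZ (Δ.e p)
    have h2 := (Related.bracket Δ.e_smooth hks hX hK.1 hZ hrelk hXZ).self_of_nhds
    rw [lieBilin, hdir _ (hgm.smooth hN hZ), pair, pair, ← h2, hNe.self_of_nhds] at h1
    have h3 : (fun p => pair (𝓡 (m + 2)) S.g N Z (Δ.e p)) =ᶠ[𝓝 p]
        fun p => - dir (modelH m) X v₀ p := by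
      filter_upwards [hNe, hXZ] with p' h4 h5
      rw [pair, h4, ← h5]
      exact 𝓑.n_horizon p' (X p')
    have h4 := 𝓑.n_horizon p (mlieBracket (modelH m) k X p)
    have h5 := dir_bracket hks hX hvs p
    have h6 : dir (modelH m) k v₀ = fun _ => a₀ := funext ha₀
    have h7 : dir (modelH m) k (fun p => - dir (modelH m) X v₀ p) p =
        - dir (modelH m) k (dir (modelH m) X v₀) p := dir_fun_neg _
    rw [dir_congr_fun k h3, h7] at h1
    rw [h6, dir_const, sub_zero] at h5
    have h8 := hXZ.self_of_nhds
    change _ - S.g (Δ.e p) _ (Z (Δ.e p)) - S.g (Δ.e p) (𝓑.n (Δ.e p)) (Δ.push p _) = 0 at h1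
    rw [h4, ← h8] at h1
    change S.g (Δ.e p) _ (mfderiv (modelH m) (𝓡 (m + 2)) Δ.e p (X p)) = 0
    rw [dir] at h5
    linarith
  have hnn : S.g (Δ.e p) (mlieBracket (𝓡 (m + 2)) K N (Δ.e p)) (𝓑.n (Δ.e p)) = 0 := by
    have h1 := hK.2 N N hN hN (Δ.e p)
    have h3 : (fun p => pair (𝓡 (m + 2)) S.g N N (Δ.e p)) =ᶠ[𝓝 p] fun p => 0 := by
      filter_upwards [hNe] with p' h4
      rw [pair, h4]
      exact 𝓑.n_null p'
    rw [lieBilin, hdir _ (hgm.smooth hN hN), dir_congr_fun k h3, dir_const, pair, pair,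
      hNe.self_of_nhds, hgm.symm _ (𝓑.n (Δ.e p))] at h1
    linarith
  have hKn : mlieBracket (𝓡 (m + 2)) K 𝓑.n (Δ.e p) = mlieBracket (𝓡 (m + 2)) K N (Δ.e p) :=
    EventuallyEq.mlieBracket_vectorField_eq (EventuallyEq.refl _ K)
      (hNn.mono fun _ h => h.symm)
  rw [hKn]
  refine hgm.nondeg _ _ fun w => ?_
  have h1 : S.g (Δ.e p) (Δ.push p (ℓ p)) (𝓑.n (Δ.e p)) = -1 := by
    rw [hgm.symm, 𝓑.n_horizon]
    exact congrArg _ (hv p)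
  -- Because g(ℓ,n) = -1, adding this multiple of n to w gives a vector orthogonal to ℓ, hence
  -- tangent.
  obtain ⟨x, hx⟩ := Δ.exists_push_eq hnull hv 𝓑
    (w := w + S.g (Δ.e p) (Δ.push p (ℓ p)) w • 𝓑.n (Δ.e p)) (by
      rw [map_add, map_smul, h1]
      simp)
  have h2 := htan x
  rw [hx, map_add, map_smul, hnn, smul_zero, add_zero] at h2
  exact h2

include hK hkK in
/-- A tangent Killing field commutes with `n`. -/
lemma bracket_killing_n (hnull : Δ.IsNull ℓ) (hvs : SmoothFn (modelH m) v₀)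
    (hv : ∀ p, dir (modelH m) ℓ v₀ p = 1) {a₀ : ℝ} (ha₀ : ∀ p, dir (modelH m) k v₀ p = a₀)
    {x : M} (hx : x ∈ 𝓑.U) : mlieBracket (𝓡 (m + 2)) 𝓑.n K x = 0 := by
  obtain ⟨p, γ, a, b, s, h0, hs, hγ0, hγs, hγ⟩ := 𝓑.exists_curve hx
  rw [bracket_swap, Pi.neg_apply, neg_eq_zero, ← hγs]
  refine iff_of_curve (P := fun x => mlieBracket (𝓡 (m + 2)) K 𝓑.n x = 0) h0 hs ?_ (by
    rw [hγ0]
    exact 𝓑.bracket_killing_n_horizon hK hkK hnull hvs hv ha₀ p)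
  intro t ht
  obtain ⟨hU, hcurve⟩ := hγ t ht
  obtain ⟨N, hN, hNn⟩ := 𝓑.exists_smooth_n hU
  have hY := hK.1.bracket hN
  have hYe : ∀ᶠ y in 𝓝 (γ t), mlieBracket (𝓡 (m + 2)) K 𝓑.n y = mlieBracket (𝓡 (m + 2)) K N y := by
    filter_upwards [hNn.eventually_nhds] with y hy
    exact EventuallyEq.mlieBracket_vectorField_eq (EventuallyEq.refl _ K)
      (hy.mono fun _ h => h.symm)
  have hgm := S.isMetric
  have hgeo : ∀ᶠ y in 𝓝 (γ t), nabla (𝓡 (m + 2)) S.g N N y = 0 := by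
    filter_upwards [hNn.eventually_nhds, 𝓑.U_open.mem_nhds hU] with y hy hyU
    rw [nabla_congr hy hy, 𝓑.n_geodesic y hyU]
  -- With Y = [K,N], applying 𝓛_K to ∇_N N = 0 gives ∇_Y N + ∇_N Y = 0, so [N,Y] = ∇_N Y - ∇_Y N =
  -- -2∇_Y N.
  have hNY : ∀ᶠ y in 𝓝 (γ t), mlieBracket (𝓡 (m + 2)) N (mlieBracket (𝓡 (m + 2)) K N) y =
      (-2 : ℝ) • nabla (𝓡 (m + 2)) S.g (mlieBracket (𝓡 (m + 2)) K N) N y := by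
    filter_upwards [hgeo.eventually_nhds] with y hy
    have h1 : mlieBracket (𝓡 (m + 2)) K (nabla (𝓡 (m + 2)) S.g N N) y = 0 := by
      have h2 : mlieBracket (𝓡 (m + 2)) K (nabla (𝓡 (m + 2)) S.g N N) y =
          mlieBracket (𝓡 (m + 2)) K (0 : VF (𝓡 (m + 2)) M) y :=
        EventuallyEq.mlieBracket_vectorField_eq (EventuallyEq.refl _ K) hy
      rw [h2, mlieBracket_zero_right]
      rfl
    rw [killing_nabla hgm hK.1 hK.2 hN hN, Pi.add_apply] at h1
    rw [← nabla_torsion hgm hN hY, Pi.sub_apply, eq_neg_of_add_eq_zero_right h1]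
    module
  filter_upwards [apply_zero_iff hgm hN (integralCurve_congr hcurve hNn) hY hNY,
    hcurve.continuousAt.eventually hYe] with t' h1 h2
  rw [h2, hYe.self_of_nhds, h1]

end Killing

end BondiNeighbourhood

end NEH

/-! ### Transport along n; proj, r and v as coordinates. -/

namespace NEH

open VectorField Filter Set

lemma apply_inverse_of_injective {V W : Type*} [NormedAddCommGroup V] [NormedSpace ℝ V]
    [FiniteDimensional ℝ V] [NormedAddCommGroup W] [NormedSpace ℝ W] [FiniteDimensional ℝ W]
    {L : V →L[ℝ] W} (hL : Function.Injective L)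
    (hd : Module.finrank ℝ V = Module.finrank ℝ W) (w : W) : L (L.inverse w) = w := by
  let e := (LinearEquiv.ofInjectiveOfFinrankEq (L : V →ₗ[ℝ] W) hL hd).toContinuousLinearEquiv
  have he : L = (e : V →L[ℝ] W) := by ext; rfl
  rw [he, ContinuousLinearMap.inverse_equiv]
  exact e.apply_symm_apply w

section Generic

variable {E : Type*} [NormedAddCommGroup E] [NormedSpace ℝ E] [FiniteDimensional ℝ E]
  {H : Type*} [TopologicalSpace H] {I : ModelWithCorners ℝ E H}
  {M : Type*} [TopologicalSpace M] [ChartedSpace H M] [IsManifold I ∞ M] [T2Space M]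
  [I.Boundaryless]

/-- Every covector is the differential of a smooth function. -/
lemma exists_smoothFn_mvfderiv_eq {p : M} (L : TangentSpace I p →ₗ[ℝ] ℝ) :
    ∃ f : M → ℝ, SmoothFn I f ∧ ∀ w, mvfderiv I f p w = L w := by
  obtain ⟨y, hy, hinj⟩ := exists_coordinates I p
  let Y : TangentSpace I p →ₗ[ℝ] (Fin (Module.finrank ℝ E) → ℝ) :=
    LinearMap.pi fun i => (mvfderiv I (y i) p : TangentSpace I p →ₗ[ℝ] ℝ)
  have hY : LinearMap.ker Y = ⊥ := LinearMap.ker_eq_bot.2 fun v w h =>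
    hinj v w fun i => congrFun h i
  obtain ⟨G, hG⟩ := Y.exists_leftInverse_of_injective hY
  have hs : ∀ i, SmoothFn I (fun x => L (G (Pi.single i 1)) * y i x) := fun i =>
    SmoothFn.mul (SmoothFn.const _) (hy i)
  refine ⟨fun x => ∑ i, L (G (Pi.single i 1)) * y i x, SmoothFn.sum fun i _ => hs i, fun w => ?_⟩
  obtain ⟨X, hX, rfl⟩ := exists_smoothVF_apply_eq I p w
  change dir I X _ p = _
  rw [dir_fun_sum X fun i _ => (hs i).mdiff p]
  have h1 : X p = G (Y (X p)) := (LinearMap.congr_fun hG (X p)).symm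
  have h2 : Y (X p) = ∑ i, Y (X p) i • Pi.single i (1 : ℝ) := pi_eq_sum_univ' _
  conv_rhs => rw [h1, h2, map_sum, map_sum]
  refine Finset.sum_congr rfl fun i _ => ?_
  rw [dir_fun_mul X mdifferentiableAt_const ((hy i).mdiff p), dir_const, map_smul, map_smul]
  simp [Y, dir, mul_comm]

lemma eq_of_forall_smoothFn {x y : M} (h : ∀ f : M → ℝ, SmoothFn I f → f x = f y) : x = y := by
  by_contra hne
  obtain ⟨ψ, h1, h2, h3⟩ := exists_bump I (isOpen_compl_singleton.mem_nhds hne)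
  have h4 : ψ y = 0 := by
    by_contra h0
    exact h3 (subset_tsupport ψ h0) rfl
  have := h ψ h1
  rw [h2.self_of_nhds, h4] at this
  exact one_ne_zero this

end Generic

namespace BondiNeighbourhood

variable {m : ℕ} {M : Type*} [TopologicalSpace M] [T2Space M]
  [ChartedSpace (EuclideanSpace ℝ (Fin (m + 2))) M] [IsManifold (𝓡 (m + 2)) ∞ M]
  {B : Type*} [TopologicalSpace B] [T2Space B]
  [ChartedSpace (EuclideanSpace ℝ (Fin m)) B] [IsManifold (𝓡 m) ∞ B]
  {S : Spacetime (m + 2) M} {Δ : Horizon S B} {ℓ : VF (modelH m) (B × ℝ)}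
  {v₀ : B × ℝ → ℝ} (𝓑 : BondiNeighbourhood Δ ℓ v₀)

lemma proj_mdiff {x : M} (hx : x ∈ 𝓑.U) : MDifferentiableAt (𝓡 (m + 2)) (𝓡 m) 𝓑.proj x :=
  ((𝓑.proj_smooth x hx).contMDiffAt (𝓑.U_open.mem_nhds hx)).mdifferentiableAt (by simp)

lemma mvfderiv_comp_proj {x : M} (hx : x ∈ 𝓑.U) {f : B → ℝ} (hf : SmoothFn (𝓡 m) f)
    (w : TangentSpace (𝓡 (m + 2)) x) : mvfderiv (𝓡 (m + 2)) (fun y => f (𝓑.proj y)) x w =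
      mvfderiv (𝓡 m) f (𝓑.proj x) (mfderiv (𝓡 (m + 2)) (𝓡 m) 𝓑.proj x w) :=
  mvfderiv_comp_apply x (hf.mdiff _) (𝓑.proj_mdiff hx) w

lemma comp_proj_smooth {f : B → ℝ} (hf : SmoothFn (𝓡 m) f) :
    ContMDiffOn (𝓡 (m + 2)) 𝓘(ℝ, ℝ) ∞ (fun y => f (𝓑.proj y)) 𝓑.U :=
  hf.comp_contMDiffOn 𝓑.proj_smooth

lemma dir_n_comp_proj {x : M} (hx : x ∈ 𝓑.U) {f : B → ℝ} (hf : SmoothFn (𝓡 m) f) :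
    dir (𝓡 (m + 2)) 𝓑.n (fun y => f (𝓑.proj y)) x = 0 := by
  rw [dir, 𝓑.mvfderiv_comp_proj hx hf, 𝓑.proj_n x hx, map_zero]

/-- Every point of the neighbourhood is joined to a point `p` of the horizon by an integral curve
of `n`, along which derivatives and critical points of suitable functions propagate. -/
lemma exists_transport {x : M} (hx : x ∈ 𝓑.U) : ∃ p : B × ℝ, 𝓑.proj x = p.1 ∧
    (∀ (X : VF (𝓡 (m + 2)) M) (f : M → ℝ) (a : ℝ), SmoothVFOn (𝓡 (m + 2)) X 𝓑.U →
      (∀ y ∈ 𝓑.U, mlieBracket (𝓡 (m + 2)) 𝓑.n X y = 0) →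
      ContMDiffOn (𝓡 (m + 2)) 𝓘(ℝ, ℝ) ∞ f 𝓑.U → (∀ y ∈ 𝓑.U, dir (𝓡 (m + 2)) 𝓑.n f y = a) →
      dir (𝓡 (m + 2)) X f x = dir (𝓡 (m + 2)) X f (Δ.e p)) ∧
    ∀ (f : M → ℝ) (a : ℝ), ContMDiffOn (𝓡 (m + 2)) 𝓘(ℝ, ℝ) ∞ f 𝓑.U →
      (∀ y ∈ 𝓑.U, dir (𝓡 (m + 2)) 𝓑.n f y = a) →
      mvfderiv (𝓡 (m + 2)) f x = 0 → mvfderiv (𝓡 (m + 2)) f (Δ.e p) = 0 := by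
  obtain ⟨p, γ, a, b, s, h0, hs, hγ0, hγs, hγ⟩ := 𝓑.exists_curve hx
  have hconst : ∀ h : ℝ → ℝ, (∀ t ∈ Ioo a b, HasDerivAt h 0 t) → h s = h 0 := fun h hd =>
    isOpen_Ioo.is_const_of_deriv_eq_zero isPreconnected_Ioo
      (fun t ht => (hd t ht).differentiableAt.differentiableWithinAt)
      (fun t ht => (hd t ht).deriv) hs h0
  refine ⟨p, ?_, ?_, ?_⟩
  · apply eq_of_forall_smoothFn (I := 𝓡 m)
    intro f hf
    have h1 := hconst (fun t => f (𝓑.proj (γ t))) fun t ht => by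
      obtain ⟨hU, hc⟩ := hγ t ht
      convert hasDerivAt_comp_curve (f := fun y => f (𝓑.proj y)) hc.hasMFDerivAt
        (((𝓑.comp_proj_smooth hf _ hU).contMDiffAt (𝓑.U_open.mem_nhds hU)).mdifferentiableAt
          (by simp)) using 1
      exact (𝓑.dir_n_comp_proj hU hf).symm
    rw [hγ0, hγs, 𝓑.proj_horizon] at h1
    exact h1
  · intro X f a hX hXn hf ha
    have h1 := hconst (fun t => dir (𝓡 (m + 2)) X f (γ t)) fun t ht => by
      obtain ⟨hU, hc⟩ := hγ t ht
      obtain ⟨N, hN, hNn⟩ := 𝓑.exists_smooth_n hU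
      obtain ⟨X', hX', hXX⟩ := exists_smoothVF_eventuallyEq 𝓑.U_open hX hU
      obtain ⟨f', hf', hff⟩ := exists_smoothFn_eventuallyEq 𝓑.U_open hf hU
      have h2 : mlieBracket (𝓡 (m + 2)) N X' (γ t) = 0 := by
        rw [← hXn _ hU]
        exact EventuallyEq.mlieBracket_vectorField_eq hNn hXX
      have h3 : ∀ᶠ y in 𝓝 (γ t), dir (𝓡 (m + 2)) N f' y = a := by
        filter_upwards [hNn, hff.eventually_nhds, 𝓑.U_open.mem_nhds hU] with y h4 h5 h6
        rw [dir_congr_vec f' h4, dir_congr_fun _ h5, ha y h6]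
      refine (hasDerivAt_dir_zero hN (integralCurve_congr hc hNn) hX' h2 hf' h3).congr_of_eventuallyEq ?_
      filter_upwards [hc.continuousAt.eventually (hXX.and hff.eventually_nhds)] with t' h4
      rw [dir_congr_vec f' h4.1, dir_congr_fun _ h4.2]
    rw [hγ0, hγs] at h1
    exact h1
  · intro f a hf ha hz
    rw [← hγ0]
    rw [← hγs] at hz
    refine iff_of_curve (P := fun x => mvfderiv (𝓡 (m + 2)) f x = 0) hs h0 ?_ hz
    intro t ht
    obtain ⟨hU, hc⟩ := hγ t ht
    obtain ⟨N, hN, hNn⟩ := 𝓑.exists_smooth_n hU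
    obtain ⟨f', hf', hff⟩ := exists_smoothFn_eventuallyEq 𝓑.U_open hf hU
    have h3 : ∀ᶠ y in 𝓝 (γ t), dir (𝓡 (m + 2)) N f' y = a := by
      filter_upwards [hNn, hff.eventually_nhds, 𝓑.U_open.mem_nhds hU] with y h4 h5 h6
      rw [dir_congr_vec f' h4, dir_congr_fun _ h5, ha y h6]
    filter_upwards [mvfderiv_zero_iff hN (integralCurve_congr hc hNn) hf' h3,
      hc.continuousAt.eventually hff.eventually_nhds] with t' h4 h5
    rw [← mvfderiv_congr h5, h4, mvfderiv_congr hff]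

lemma mvfderiv_comp_horizon {f : M → ℝ} (hf : ContMDiffOn (𝓡 (m + 2)) 𝓘(ℝ, ℝ) ∞ f 𝓑.U)
    (p : B × ℝ) (w : TangentSpace (modelH m) p) :
    mvfderiv (modelH m) (fun p => f (Δ.e p)) p w =
      mvfderiv (𝓡 (m + 2)) f (Δ.e p) (Δ.push p w) :=
  mvfderiv_comp_map Δ.e_smooth p (((hf _ (𝓑.horizon_subset p)).contMDiffAt
    (𝓑.U_open.mem_nhds (𝓑.horizon_subset p))).mdifferentiableAt (by simp)) w

/-- ζ(r) is constant along n, and on the horizon ζ is tangent while r vanishes. -/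
lemma dir_ζ_r {x : M} (hx : x ∈ 𝓑.U) : dir (𝓡 (m + 2)) 𝓑.ζ 𝓑.r x = 0 := by
  obtain ⟨p, -, h, -⟩ := 𝓑.exists_transport hx
  rw [h 𝓑.ζ 𝓑.r (-1) 𝓑.ζ_smooth 𝓑.ζ_dragged 𝓑.r_smooth 𝓑.r_n, dir, 𝓑.ζ_horizon,
    ← 𝓑.mvfderiv_comp_horizon 𝓑.r_smooth, funext 𝓑.r_horizon]
  exact dir_const ℓ 0 p

/-- A nonzero covector annihilating the image is df for some f on B. Then x is critical for f∘proj;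
this propagates along n to the horizon, where proj is a submersion to the same base point, so df = 0
there. -/
lemma mfderiv_proj_surjective {x : M} (hx : x ∈ 𝓑.U) :
    Function.Surjective (mfderiv (𝓡 (m + 2)) (𝓡 m) 𝓑.proj x) := by
  set P : TangentSpace (𝓡 (m + 2)) x →ₗ[ℝ] TangentSpace (𝓡 m) (𝓑.proj x) :=
    (mfderiv (𝓡 (m + 2)) (𝓡 m) 𝓑.proj x).toLinearMap with hP
  change Function.Surjective P
  rw [← LinearMap.range_eq_top]
  by_contra hne
  obtain ⟨L, hL0, hL⟩ := Submodule.exists_le_ker_of_lt_top _ (lt_top_iff_ne_top.2 hne)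
  obtain ⟨f, hf, hfL⟩ := exists_smoothFn_mvfderiv_eq (I := 𝓡 m) L
  obtain ⟨p, hp, -, h⟩ := 𝓑.exists_transport hx
  have h1 := h _ 0 (𝓑.comp_proj_smooth hf) (fun y hy => 𝓑.dir_n_comp_proj hy hf) (by
    ext w
    rw [𝓑.mvfderiv_comp_proj hx hf, hfL]
    exact hL ⟨w, rfl⟩)
  have h2 : mvfderiv (𝓡 m) f p.1 = 0 := by
    ext w
    have h3 := 𝓑.mvfderiv_comp_horizon (𝓑.comp_proj_smooth hf) p (Horizon.horiz p w)
    rw [h1] at h3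
    simp only [𝓑.proj_horizon] at h3
    rw [mvfderiv_comp_map Horizon.smooth_fst p (hf.mdiff _)] at h3
    change mvfderiv (𝓡 m) f p.1 (Horizon.dfst p (Horizon.horiz p w)) = 0 at h3
    rwa [Horizon.dfst_horiz] at h3
  rw [← hp] at h2
  refine hL0 (LinearMap.ext fun w => ?_)
  rw [← hfL, h2]
  rfl

/-- The differentials of `proj`, `r` and `v` separate tangent vectors. -/
lemma eq_of_coord {x : M} (hx : x ∈ 𝓑.U) {w w' : TangentSpace (𝓡 (m + 2)) x}
    (h1 : mfderiv (𝓡 (m + 2)) (𝓡 m) 𝓑.proj x w = mfderiv (𝓡 (m + 2)) (𝓡 m) 𝓑.proj x w')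
    (h2 : mvfderiv (𝓡 (m + 2)) 𝓑.r x w = mvfderiv (𝓡 (m + 2)) 𝓑.r x w')
    (h3 : mvfderiv (𝓡 (m + 2)) 𝓑.v x w = mvfderiv (𝓡 (m + 2)) 𝓑.v x w') : w = w' := by
  let P : EuclideanSpace ℝ (Fin (m + 2)) →L[ℝ] EuclideanSpace ℝ (Fin m) :=
    mfderiv (𝓡 (m + 2)) (𝓡 m) 𝓑.proj x
  let R : EuclideanSpace ℝ (Fin (m + 2)) →L[ℝ] ℝ := mvfderiv (𝓡 (m + 2)) 𝓑.r x
  let V : EuclideanSpace ℝ (Fin (m + 2)) →L[ℝ] ℝ := mvfderiv (𝓡 (m + 2)) 𝓑.v x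
  let D := (P.prod (R.prod V)).toLinearMap
  -- n and ζ project to zero and take the values (-1, 0) and (0, 1) on (r, v), so they adjust the
  -- last two components freely. Equality of dimensions then gives injectivity.
  have hD : Function.Surjective D := by
    rintro ⟨u, a, b⟩
    obtain ⟨w₀, hw₀⟩ := 𝓑.mfderiv_proj_surjective hx u
    have e1 := 𝓑.r_n x hx
    have e2 := 𝓑.v_n x hx
    have e3 := 𝓑.dir_ζ_r hx
    have e4 := 𝓑.v_ζ x hx
    rw [dir] at e1 e2 e3 e4
    refine ⟨w₀ + (mvfderiv (𝓡 (m + 2)) 𝓑.r x w₀ - a) • 𝓑.n x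
      + (b - mvfderiv (𝓡 (m + 2)) 𝓑.v x w₀) • 𝓑.ζ x, ?_⟩
    refine Prod.ext ?_ (Prod.ext ?_ ?_)
    · change mfderiv (𝓡 (m + 2)) (𝓡 m) 𝓑.proj x (w₀ + (_ : ℝ) • 𝓑.n x + (_ : ℝ) • 𝓑.ζ x) = u
      rw [map_add, map_add, map_smul, map_smul, 𝓑.proj_n x hx, 𝓑.proj_ζ x hx, hw₀, smul_zero, smul_zero]
      exact (add_zero _).trans (add_zero u)
    · change mvfderiv (𝓡 (m + 2)) 𝓑.r x (w₀ + (_ : ℝ) • 𝓑.n x + (_ : ℝ) • 𝓑.ζ x) = a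
      rw [map_add, map_add, map_smul, map_smul, e1, e3]
      simp
    · change mvfderiv (𝓡 (m + 2)) 𝓑.v x (w₀ + (_ : ℝ) • 𝓑.n x + (_ : ℝ) • 𝓑.ζ x) = b
      rw [map_add, map_add, map_smul, map_smul, e2, e4]
      simp
  have hDi : Function.Injective D :=
    (LinearMap.injective_iff_surjective_of_finrank_eq_finrank (by simp)).2 hD
  exact hDi (Prod.ext h1 (Prod.ext h2 h3))

end BondiNeighbourhood

end NEH

/-! ### Components of the Killing field in the invariant coordinates. -/

namespace NEH

open VectorField Filter Set

/-- L stands for the differential of the coordinate map. W is ℝ on the horizon and ℝ × ℝ in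
spacetime, so one statement serves both expansions. -/
lemma eq_add_sum_of_map {m : ℕ} {V W : Type*} [NormedAddCommGroup V] [NormedSpace ℝ V]
    [NormedAddCommGroup W] [NormedSpace ℝ W] {L : V →L[ℝ] EuclideanSpace ℝ (Fin m) × W}
    (hL : Function.Injective L) {w z : V} {D : Fin m → V} {c : EuclideanSpace ℝ (Fin m)} {a : ℝ}
    {u : W} (h1 : L w = (c, a • u)) (h2 : L z = (0, u))
    (h3 : ∀ A, L (D A) = (EuclideanSpace.single A 1, 0)) : w = a • z + ∑ A, c A • D A := by
  apply hL
  rw [map_add, map_sum, map_smul, h1, h2]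
  simp only [map_smul, h3]
  refine Prod.ext ?_ ?_
  · simp only [Prod.fst_add, Prod.smul_fst, smul_zero, zero_add, Prod.fst_sum]
    ext j
    simp [Pi.single_apply]
  · simp [Prod.snd_sum]

/-- The target carries the vector space model of V × W, as in the coordinate maps, and not the
product of the two models. -/
lemma hasMFDerivAt_prodMk_space {E : Type*} [NormedAddCommGroup E] [NormedSpace ℝ E] {H : Type*}
    [TopologicalSpace H] {I : ModelWithCorners ℝ E H} {M : Type*} [TopologicalSpace M]
    [ChartedSpace H M] {V W : Type*} [NormedAddCommGroup V] [NormedSpace ℝ V]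
    [NormedAddCommGroup W] [NormedSpace ℝ W] {f : M → V} {h : M → W} {x : M}
    {df : E →L[ℝ] V} {dh : E →L[ℝ] W} (hf : HasMFDerivAt I 𝓘(ℝ, V) f x df)
    (hh : HasMFDerivAt I 𝓘(ℝ, W) h x dh) :
    HasMFDerivAt I 𝓘(ℝ, V × W) (fun x => (f x, h x)) x (df.prod dh) :=
  ⟨hf.1.prodMk hh.1, hf.2.prodMk hh.2⟩

variable {m : ℕ} {M : Type*} [TopologicalSpace M] [T2Space M]
  [ChartedSpace (EuclideanSpace ℝ (Fin (m + 2))) M] [IsManifold (𝓡 (m + 2)) ∞ M]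
  {B : Type*} [TopologicalSpace B] [T2Space B]
  [ChartedSpace (EuclideanSpace ℝ (Fin m)) B] [IsManifold (𝓡 m) ∞ B]
  {S : Spacetime (m + 2) M} {Δ : Horizon S B} {ℓ : VF (modelH m) (B × ℝ)}
  {v₀ : B × ℝ → ℝ} (𝓑 : BondiNeighbourhood Δ ℓ v₀)
  {φ : OpenPartialHomeomorph B (EuclideanSpace ℝ (Fin m))}
  (hφ : φ ∈ IsManifold.maximalAtlas (𝓡 m) ∞ B)

section Charts

include hφ

lemma chart_mdiff {b : B} (hb : b ∈ φ.source) :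
    MDifferentiableAt (𝓡 m) 𝓘(ℝ, EuclideanSpace ℝ (Fin m)) φ b :=
  (contMDiffAt_of_mem_maximalAtlas hφ hb).mdifferentiableAt (by simp)

lemma mfderiv_chart_injective {b : B} (hb : b ∈ φ.source) :
    Function.Injective (mfderiv (𝓡 m) 𝓘(ℝ, EuclideanSpace ℝ (Fin m)) φ b) := by
  have h : φ.MDifferentiable (𝓡 m) 𝓘(ℝ, EuclideanSpace ℝ (Fin m)) :=
    ⟨(contMDiffOn_of_mem_maximalAtlas hφ).mdifferentiableOn (by simp),
      (contMDiffOn_symm_of_mem_maximalAtlas hφ).mdifferentiableOn (by simp)⟩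
  exact Function.LeftInverse.injective fun w => DFunLike.congr_fun (h.symm_comp_deriv hb) w

/-- The component with index A is X applied to the coordinate function φ^A, which is replaced near
each point by a global smooth function. -/
lemma chart_pushforward_smooth {X : VF (𝓡 m) B} (hX : SmoothVF (𝓡 m) X) :
    ContDiffOn ℝ ∞ (fun y => (mfderiv (𝓡 m) 𝓘(ℝ, EuclideanSpace ℝ (Fin m)) φ (φ.symm y)
      (X (φ.symm y)) : EuclideanSpace ℝ (Fin m))) φ.target := by
  intro y hy
  apply ContDiffAt.contDiffWithinAt
  refine contDiffAt_euclidean.2 fun A => ?_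
  let pr : EuclideanSpace ℝ (Fin m) →L[ℝ] ℝ := EuclideanSpace.proj A
  have hs : ContMDiffOn (𝓡 m) 𝓘(ℝ, ℝ) ∞ (fun b => pr (φ b)) φ.source :=
    pr.contMDiff.comp_contMDiffOn (contMDiffOn_of_mem_maximalAtlas hφ)
  obtain ⟨f, hf, hfe⟩ := exists_smoothFn_eventuallyEq φ.open_source hs (φ.map_target hy)
  have h1 : ContMDiffAt 𝓘(ℝ, EuclideanSpace ℝ (Fin m)) 𝓘(ℝ, ℝ) ∞
      (fun y => dir (𝓡 m) X f (φ.symm y)) y :=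
    ((hX.dir hf) _).comp y (contMDiffAt_symm_of_mem_maximalAtlas hφ hy)
  refine h1.contDiffAt.congr_of_eventuallyEq ?_
  filter_upwards [φ.open_target.mem_nhds hy,
    (φ.continuousAt_symm hy).eventually hfe.eventually_nhds] with z hz hz'
  rw [dir_congr_fun X hz', dir]
  have h2 := mvfderiv_comp_apply (φ.symm z) (g := pr) (I' := 𝓡 m)
    (I := 𝓘(ℝ, EuclideanSpace ℝ (Fin m))) pr.differentiableAt.mdifferentiableAt
    (chart_mdiff hφ (φ.map_target hz)) (X (φ.symm z))
  refine Eq.trans ?_ h2.symm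
  simp only [mvfderiv, mfderiv_eq_fderiv, ContinuousLinearMap.fderiv]
  rfl

lemma mfderiv_horizonCoord (hvs : SmoothFn (modelH m) v₀) {p : B × ℝ} (hp : p.1 ∈ φ.source)
    (w : TangentSpace (modelH m) p) :
    mfderiv (modelH m) 𝓘(ℝ, EuclideanSpace ℝ (Fin m) × ℝ) (horizonCoord φ v₀) p w =
      ((mfderiv (𝓡 m) 𝓘(ℝ, EuclideanSpace ℝ (Fin m)) φ p.1 (Horizon.dfst p w),
        mvfderiv (modelH m) v₀ p w) : EuclideanSpace ℝ (Fin m) × ℝ) := by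
  have h1 := (chart_mdiff hφ hp).hasMFDerivAt.comp p
    ((Horizon.smooth_fst (B := B) p).mdifferentiableAt (by simp)).hasMFDerivAt
  have h2 := (hvs.mdiff p).hasMFDerivAt
  have h3 := (hasMFDerivAt_prodMk_space h1 h2).mfderiv
  exact DFunLike.congr_fun h3 w

lemma mfderiv_coord {x : M} (hx : x ∈ 𝓑.U) (hxφ : 𝓑.proj x ∈ φ.source)
    (w : TangentSpace (𝓡 (m + 2)) x) :
    mfderiv (𝓡 (m + 2)) 𝓘(ℝ, EuclideanSpace ℝ (Fin m) × ℝ × ℝ) (𝓑.coord φ) x w =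
      ((mfderiv (𝓡 m) 𝓘(ℝ, EuclideanSpace ℝ (Fin m)) φ (𝓑.proj x)
        (mfderiv (𝓡 (m + 2)) (𝓡 m) 𝓑.proj x w), mvfderiv (𝓡 (m + 2)) 𝓑.r x w,
        mvfderiv (𝓡 (m + 2)) 𝓑.v x w) : EuclideanSpace ℝ (Fin m) × ℝ × ℝ) := by
  have hU := 𝓑.U_open.mem_nhds hx
  have h1 := (chart_mdiff hφ hxφ).hasMFDerivAt.comp x (𝓑.proj_mdiff hx).hasMFDerivAt
  have h2 := (((𝓑.r_smooth x hx).contMDiffAt hU).mdifferentiableAt (by simp)).hasMFDerivAt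
  have h3 := (((𝓑.v_smooth x hx).contMDiffAt hU).mdifferentiableAt (by simp)).hasMFDerivAt
  have h4 := (hasMFDerivAt_prodMk_space h1 (hasMFDerivAt_prodMk_space h2 h3)).mfderiv
  exact DFunLike.congr_fun h4 w

/-- A tangent vector of the horizon is determined by its components. -/
lemma eq_add_sum_horizonPartial (hnull : Δ.IsNull ℓ) (hℓ0 : ∀ p, ℓ p ≠ 0)
    (hvs : SmoothFn (modelH m) v₀) (hv : ∀ p, dir (modelH m) ℓ v₀ p = 1) {p : B × ℝ}
    (hp : p.1 ∈ φ.source) {a₀ : ℝ} {w : TangentSpace (modelH m) p}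
    (ha : mvfderiv (modelH m) v₀ p w = a₀) {c : EuclideanSpace ℝ (Fin m)}
    (hc : mfderiv (𝓡 m) 𝓘(ℝ, EuclideanSpace ℝ (Fin m)) φ p.1 (Horizon.dfst p w) = c) :
    w = a₀ • ℓ p + ∑ A, c A • horizonPartial φ v₀ A p := by
  let L : EuclideanSpace ℝ (Fin m) × ℝ →L[ℝ] EuclideanSpace ℝ (Fin m) × ℝ :=
    mfderiv (modelH m) 𝓘(ℝ, EuclideanSpace ℝ (Fin m) × ℝ) (horizonCoord φ v₀) p
  have hL : Function.Injective L := by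
    rw [injective_iff_map_eq_zero]
    intro u hu
    have hu' := (mfderiv_horizonCoord hφ hvs hp u).symm.trans hu
    have h1 : Horizon.dfst p u = 0 := mfderiv_chart_injective hφ hp
      ((congrArg Prod.fst hu').trans (map_zero _).symm)
    obtain ⟨s, hs⟩ := Horizon.eq_smul_vert_of_dfst h1
    have h2 : mvfderiv (modelH m) v₀ p u = 0 := congrArg Prod.snd hu'
    rw [hs, map_smul, smul_eq_zero] at h2
    rcases h2 with h2 | h2
    · rw [hs, h2, zero_smul]
      rfl
    · exact absurd h2 (Δ.mvfderiv_vert_ne hnull hℓ0 hv p)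
  have h1 : L w = (c, a₀) := (mfderiv_horizonCoord hφ hvs hp w).trans (Prod.ext hc ha)
  have h2 : L (ℓ p) = (0, 1) := by
    refine (mfderiv_horizonCoord hφ hvs hp (ℓ p)).trans (Prod.ext ?_ (hv p))
    have h3 : Horizon.dfst p (ℓ p) = 0 := Δ.dfst_null hnull p
    rw [h3]
    exact map_zero _
  have h3 : ∀ A, L (horizonPartial φ v₀ A p) = (EuclideanSpace.single A 1, 0) := fun A =>
    apply_inverse_of_injective hL rfl _
  exact eq_add_sum_of_map hL (h1.trans (by simp)) h2 h3

/-- A tangent vector of the spacetime is determined by its Bondi-like components. -/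
lemma eq_add_sum_partialA {x : M} (hx : x ∈ 𝓑.U) (hxφ : 𝓑.proj x ∈ φ.source) {a₀ : ℝ}
    {w : TangentSpace (𝓡 (m + 2)) x} (hr : mvfderiv (𝓡 (m + 2)) 𝓑.r x w = 0)
    (hv : mvfderiv (𝓡 (m + 2)) 𝓑.v x w = a₀) {c : EuclideanSpace ℝ (Fin m)}
    (hc : mfderiv (𝓡 m) 𝓘(ℝ, EuclideanSpace ℝ (Fin m)) φ (𝓑.proj x)
      (mfderiv (𝓡 (m + 2)) (𝓡 m) 𝓑.proj x w) = c) :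
    w = a₀ • 𝓑.ζ x + ∑ A, c A • 𝓑.partialA φ A x := by
  let L : EuclideanSpace ℝ (Fin (m + 2)) →L[ℝ] EuclideanSpace ℝ (Fin m) × ℝ × ℝ :=
    mfderiv (𝓡 (m + 2)) 𝓘(ℝ, EuclideanSpace ℝ (Fin m) × ℝ × ℝ) (𝓑.coord φ) x
  have hLa := mfderiv_coord 𝓑 hφ hx hxφ
  have hL : Function.Injective L := by
    intro u u' huu
    have hu' := ((hLa u).symm.trans huu).trans (hLa u')
    exact 𝓑.eq_of_coord hx (mfderiv_chart_injective hφ hxφ (congrArg Prod.fst hu'))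
      (congrArg (fun z => z.2.1) hu') (congrArg (fun z => z.2.2) hu')
  have h1 : L w = (c, 0, a₀) := (hLa w).trans (Prod.ext hc (Prod.ext hr hv))
  have h2 : L (𝓑.ζ x) = (0, 0, 1) := by
    refine (hLa (𝓑.ζ x)).trans (Prod.ext ?_ (Prod.ext (𝓑.dir_ζ_r hx) (𝓑.v_ζ x hx)))
    rw [𝓑.proj_ζ x hx]
    exact map_zero _
  have h3 : ∀ A, L (𝓑.partialA φ A x) = (EuclideanSpace.single A 1, 0, 0) := fun A =>
    apply_inverse_of_injective hL (by simp) _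
  exact eq_add_sum_of_map hL (h1.trans (by simp)) h2 h3

end Charts

/-- The components of a Killing field are constant along `n`. -/
lemma BondiNeighbourhood.killing_coord {K : VF (𝓡 (m + 2)) M} (hK : S.IsKilling K)
    {k : VF (modelH m) (B × ℝ)} (hkK : ∀ p, Δ.push p (k p) = K (Δ.e p))
    (hnK : ∀ x ∈ 𝓑.U, mlieBracket (𝓡 (m + 2)) 𝓑.n K x = 0)
    {a₀ : ℝ} (ha₀ : ∀ p, dir (modelH m) k v₀ p = a₀)
    (hproj : ∀ p, Horizon.dfst p (k p) = Horizon.projVF k p.1) {x : M} (hx : x ∈ 𝓑.U) :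
    mfderiv (𝓡 (m + 2)) (𝓡 m) 𝓑.proj x (K x) = Horizon.projVF k (𝓑.proj x) ∧
      mvfderiv (𝓡 (m + 2)) 𝓑.r x (K x) = 0 ∧ mvfderiv (𝓡 (m + 2)) 𝓑.v x (K x) = a₀ := by
  obtain ⟨p, hp, h, -⟩ := 𝓑.exists_transport hx
  have hKU : SmoothVFOn (𝓡 (m + 2)) K 𝓑.U := ContMDiff.contMDiffOn hK.1
  -- Since K commutes with n, K(f) at x equals its value at the foot of the curve on the horizon,
  -- where K is k.
  have hhor : ∀ (f : M → ℝ) (a : ℝ), ContMDiffOn (𝓡 (m + 2)) 𝓘(ℝ, ℝ) ∞ f 𝓑.U →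
      (∀ y ∈ 𝓑.U, dir (𝓡 (m + 2)) 𝓑.n f y = a) →
      mvfderiv (𝓡 (m + 2)) f x (K x) = dir (modelH m) k (fun p => f (Δ.e p)) p := by
    intro f a hf ha
    rw [dir, 𝓑.mvfderiv_comp_horizon hf, hkK]
    exact h K f a hKU hnK hf ha
  refine ⟨?_, ?_, ?_⟩
  · apply eq_of_forall_mvfderiv_eq
    intro f hf
    rw [← 𝓑.mvfderiv_comp_proj hx hf,
      hhor _ 0 (𝓑.comp_proj_smooth hf) fun y hy => 𝓑.dir_n_comp_proj hy hf]
    simp only [𝓑.proj_horizon]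
    rw [dir, mvfderiv_comp_map Horizon.smooth_fst p (hf.mdiff _)]
    change mvfderiv (𝓡 m) f p.1 (Horizon.dfst p (k p)) = dir (𝓡 m) (Horizon.projVF k) f (𝓑.proj x)
    rw [hproj, hp]
    rfl
  · rw [hhor 𝓑.r (-1) 𝓑.r_smooth 𝓑.r_n, funext 𝓑.r_horizon]
    exact dir_const k 0 p
  · rw [hhor 𝓑.v 0 𝓑.v_smooth 𝓑.v_n, funext 𝓑.v_horizon]
    exact ha₀ p

end NEH

/-! ### The two cases of the theorem. -/

theorem mainTheorem3 {m : ℕ}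
    {M : Type*} [TopologicalSpace M] [T2Space M] [SecondCountableTopology M]
    [ChartedSpace (EuclideanSpace ℝ (Fin (m + 2))) M] [IsManifold (𝓡 (m + 2)) ∞ M]
    {B : Type*} [TopologicalSpace B] [T2Space B] [CompactSpace B] [ConnectedSpace B]
    [ChartedSpace (EuclideanSpace ℝ (Fin m)) B] [IsManifold (𝓡 m) ∞ B]
    (S : NEH.Spacetime (m + 2) M) (Δ : NEH.Horizon S B)
    (hE : Δ.StrongerEnergyCondition) (hT : Δ.MatterLieDragged)
    (hgen : Δ.InvariantGeneric)
    -- the invariant vector field, the function `v` of its good cuts, and the invariant structures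
    -- of a neighbourhood
    (ℓ : NEH.VF (NEH.modelH m) (B × ℝ)) (hℓ : Δ.IsNatural ℓ) (hℓ0 : ∀ p, ℓ p ≠ 0)
    (v₀ : B × ℝ → ℝ) (hv₀ : Δ.IsGoodCutFunction ℓ v₀)
    (𝓑 : NEH.BondiNeighbourhood Δ ℓ v₀)
    -- a Killing field tangent to the horizon
    (K : NEH.VF (𝓡 (m + 2)) M) (hK : S.IsKilling K)
    (hKtan : ∀ p, ∃ w, Δ.push p w = K (Δ.e p)) :
    ((∀ p, S.g (Δ.e p) (K (Δ.e p)) (K (Δ.e p)) = 0) →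
      ∃ a₀ : ℝ, ∀ x ∈ 𝓑.U, K x = a₀ • 𝓑.ζ x) ∧
    ((¬ ∀ p, S.g (Δ.e p) (K (Δ.e p)) (K (Δ.e p)) = 0) →
      ∃ (a₀ : ℝ) (k : NEH.VF (NEH.modelH m) (B × ℝ)),
        (∀ p, Δ.push p (k p) = K (Δ.e p)) ∧
        Δ.IsInfinitesimalSymmetry k ∧
        ∀ φ ∈ IsManifold.maximalAtlas (𝓡 m) ∞ B,
          ∃ Φ : EuclideanSpace ℝ (Fin m) → EuclideanSpace ℝ (Fin m),
            ContDiffOn ℝ ∞ Φ φ.target ∧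
            (∀ x ∈ 𝓑.U, 𝓑.proj x ∈ φ.source →
              K x = a₀ • 𝓑.ζ x + ∑ A, Φ (φ (𝓑.proj x)) A • 𝓑.partialA φ A x) ∧
            (∀ p : B × ℝ, p.1 ∈ φ.source →
              k p = a₀ • ℓ p + ∑ A, Φ (φ p.1) A • NEH.horizonPartial φ v₀ A p)) := by
  have hv := hv₀.normalized
  have hvs := hv₀.smooth
  choose k hkK using hKtan
  have hks := Δ.smooth_of_push hK hkK
  have htg := Δ.totallyGeodesic hℓ.smooth hℓ.null hℓ.surface_gravity hv 𝓑 hE hℓ0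
  have hq := fun X Y hX hY => Δ.lie_q_eq_zero hℓ.smooth hℓ.null hℓ.surface_gravity hv 𝓑 hE hℓ0
    (X := X) (Y := Y) hX hY
  have hkℓ := Δ.bracket_killing_natural htg hK hkK hℓ hℓ0 hvs hv hgen
  obtain ⟨a₀, ha₀⟩ := Δ.dir_killing_const hgen hℓ hℓ0 hv₀ htg hq hK hkK
  have hnK := fun x hx => 𝓑.bracket_killing_n hK hkK hℓ.null hvs hv ha₀ (x := x) hx
  have hproj := Δ.dfst_eq_projVF hℓ.smooth hℓ.null hℓ0 hks hkℓ
  have hcoord := fun x hx => 𝓑.killing_coord hK hkK hnK ha₀ hproj (x := x) hx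
  refine ⟨fun hnull => ⟨a₀, fun x hx => ?_⟩, fun hnull => ⟨a₀, k, hkK, ?_, fun φ hφ => ?_⟩⟩
  · have hk0 : Δ.IsNull k := fun p => by
      have h := hnull p
      rw [← hkK] at h
      exact h
    obtain ⟨h1, h2, h3⟩ := hcoord x hx
    -- Both sides have vanishing r-component and v-component a₀. The projections to B agree because
    -- the null field k projects to zero.
    refine 𝓑.eq_of_coord hx ?_ ?_ ?_
    · rw [h1, map_smul, 𝓑.proj_ζ x hx, smul_zero]
      exact Δ.dfst_null hk0 _
    · rw [h2, map_smul]
      have h4 := 𝓑.dir_ζ_r hx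
      rw [NEH.dir] at h4
      rw [h4, smul_zero]
    · rw [h3, map_smul]
      have h4 := 𝓑.v_ζ x hx
      rw [NEH.dir] at h4
      rw [h4, smul_eq_mul, mul_one]
  · refine ⟨hks, ?_, fun Y Z hY hZ => Δ.lie_q_killing hK hkK hY hZ,
      fun Y Z hY hZ => Δ.lieD_killing htg hK hkK hY hZ⟩
    -- A field k that vanishes identically would make K null along the whole horizon.
    by_contra hzero
    push Not at hzero
    refine hnull fun p => ?_
    rw [← hkK, hzero, map_zero, map_zero]
  -- Φ is the coordinate expression of the projected field k̂, so one Φ serves both the horizon and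
  -- its neighbourhood.
  · refine ⟨fun y => mfderiv (𝓡 m) 𝓘(ℝ, EuclideanSpace ℝ (Fin m)) φ (φ.symm y)
      (NEH.Horizon.projVF k (φ.symm y)),
      NEH.chart_pushforward_smooth hφ (NEH.Horizon.projVF_smooth hks), fun x hx hxφ => ?_,
      fun p hp => ?_⟩
    · obtain ⟨h1, h2, h3⟩ := hcoord x hx
      refine NEH.eq_add_sum_partialA 𝓑 hφ hx hxφ h2 h3 ?_
      rw [h1]
      exact congrArg (fun b => (mfderiv (𝓡 m) 𝓘(ℝ, EuclideanSpace ℝ (Fin m)) φ b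
        (NEH.Horizon.projVF k b) : EuclideanSpace ℝ (Fin m))) (φ.left_inv hxφ).symm
    · refine NEH.eq_add_sum_horizonPartial hφ hℓ.null hℓ0 hvs hv hp (ha₀ p) ?_
      rw [hproj]
      exact congrArg (fun b => (mfderiv (𝓡 m) 𝓘(ℝ, EuclideanSpace ℝ (Fin m)) φ b
        (NEH.Horizon.projVF k b) : EuclideanSpace ℝ (Fin m))) (φ.left_inv hp).symm
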